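/- **Grid diagrams and branched covers.** A grid diagram of size $N$ of a knot is a torus with horizontal circles $\alpha_i$ and vertical circles $\beta_j$ ($i,j\in\mathbb Z/N$) that cut it into $N^2$ squares, with one marking $X$ and one marking $O$ in each row and in each column, never in the same square, such that the vertical segments between the markings of each column and the horizontal segments between the markings of each row form a single closed curve. For a grid diagram $D$ and $m\ge 1$, let $\widetilde D$ be the $m$-fold cyclic cover of the torus branched at the markings, with the vertical segments as branch cuts (passing a cut changes the sheet by $\pm1$, according to the direction of the segment). Each $\alpha_i$ and each $\beta_j$ has $m$ lifts. A generator is a set of intersection points with exactly one point on each lift of each $\alpha_i$ and of each $\beta_j$. $C(\widetilde D)$ is the free abelian group on the generators. The Alexander grading of a generator is the average of the Alexander gradings $\mathcal J\big(\mathbf x-\tfrac12(X+O),\,X-O\big)-\tfrac{N-1}2$ of the $m$ generators of $D$ into which its projection decomposes; here $\mathcal J$ is bilinear, and $\mathcal J(P,Q)$ is half of the number of pairs of a point of $P$ and a point of $Q$ one of which is above and to the right of the other. **Signs.** A formal generator is a bijection $\sigma$ between the set of $\alpha$-curves and the set of $\beta$-curves with a sign $\varepsilon_i$ for each pair. Formal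 flows are formal bigons and formal rectangles, with orientations of their edges, considered up to orientation preserving homeomorphisms of the plane; the boundary of a flow from $\mathbf x$ to $\mathbf y$ runs along its $\alpha$-edges from $\mathbf x$ to $\mathbf y$. A sign assignment $\mathcal S$ gives each formal flow a value $\pm1$ such that $\mathcal S(\phi_1)\mathcal S(\phi_2)=1$ for the two flows of a boundary degeneration of type $\alpha$, $\mathcal S(\phi_1)\mathcal S(\phi_2)=-1$ for those of a boundary degeneration of type $\beta$, and $\mathcal S(\phi_1)\mathcal S(\phi_2)+\mathcal S(\phi_3)\mathcal S(\phi_4)=0$ whenever $(\phi_1,\phi_2)$ and $(\phi_3,\phi_4)$ form a square, i.e. are the two decompositions of one planar configuration of oriented arcs into consecutive flows. Fix orientations of all lifted curves and a sign assignment $\mathcal S$ for the curves of the cover $\widetilde H$ below. The coefficient of $\mathbf y$ in $\partial\mathbf x$ is the sum of the signs of the formal rectangles of all empty rectangles from $\mathbf x$ to $\mathbf y$ (no marking inside, no component of $\mathbf x$ in the interior). **Stabilization.** Let $H$ be a grid diagram of a knot with a column whose markings $O_1$, $X_1$ lie in consecutive rows, $O_1$ directly above $X_1$. Let $\alpha_1$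 be the circle between $O_1$ and $X_1$, $\beta_1$ and $\beta_2$ the circles to the left and to the right of $O_1$, and $w=\alpha_1\cap\beta_1$. Assume that the $X$-marking $X_2$ in the row of $O_1$ is in the square next to $O_1$ on its left or right (on the torus). $G$ is obtained from $H$ by deleting $\alpha_1,\beta_1,O_1,X_1$. Let $w_k$ ($k\in\mathbb Z/m$) be the lifts of $w$, $w_k$ on the lift $\widetilde\beta_1^k$ of $\beta_1$ in sheet $k$, and $\widetilde\beta_2^k$ the lift of $\beta_2$ in the same sheet. The generators of $\widetilde H$ that contain all $w_k$ are identified with the generators of $\widetilde G$ by forgetting the $w_k$. The curves of $\widetilde G$ inherit their orientations from $\widetilde H$; the sign of a rectangle for $\widetilde G$ is the sign of the formal rectangle in $\widetilde H$ between the generators completed by the $w_k$. **Pseudo-domains.** Let $\lambda$ be a circle around the segment $O_1X_1$, with lifts $\lambda_k$. A pseudo-domain from $\mathbf x$ to $\mathbf y$ is an integral two-chain in the cover, cut along the lifted curves and the $\lambda_k$, such that the boundary of the part of its boundary on the lifts of the $\alpha$-circles is $\mathbf y-\mathbf x$, and the part of its boundary outside of the lifted curves is an integral combination of the $\lambda_k$.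 It is $\mathcal Q$-fine if its multiplicity is $0$ at all markings except possibly at $X_1$. * A *punctured rectangle* at $k$ from $\mathbf x$ to $\mathbf y$ is a rectangle from $\mathbf x$ to $\mathbf y$ with left edge on $\widetilde\beta_1^k$, right edge on $\widetilde\beta_2^k$, containing $\lambda_k$, with the disk bounded by $\lambda_k$ removed. Its sign is the sign of the formal rectangle. * A *punctured hexagon* at $k$ consists of a punctured rectangle at $k$ from $\mathbf x$ to $\mathbf z$ and an empty rectangle from $\mathbf z$ to $\mathbf y$ to the left of it, with right edge on $\widetilde\beta_1^k$, upper edge on the $\alpha$-curve of the upper edge of the punctured rectangle, and lower edge meeting the interior of the left edge of the punctured rectangle in the obtuse corner. Its sign is the product of the two signs. * A *$4m$-gon* from $\mathbf x$ to $\mathbf y$ is an embedded disk containing $X_1$ as a branch point, with the $4m$ corners alternately in $\mathbf x$ and $\mathbf y$: it has one part for each $k$, with left edge on $\widetilde\beta_1^k$ from the lower left corner in $\mathbf x$ up to $w_k\in\mathbf y$, upper right corner the component of $\mathbf x$ on the lift of $\alpha_1$ through $w_{k+1}$, and lower right corner in $\mathbf y$. It contains no component of $\mathbf x$ in its interior and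 no marking other than $X_1$. Its sign: let $a_1$ be its $\alpha$-edge at the component of $\mathbf x$ on $\widetilde\beta_1^1$ and $a_2,\dots,a_{2m}$ its other $\alpha$-edges, in the order against the boundary orientation; after a finger move of $a_1$ across the polygon, $\mathbf x$ is connected with $\mathbf y$ by the flows $R_1,-B_1,R_2,-B_2,\dots,-B_{2m-2},R_{2m-1}$, where $R_i$ is the rectangle with $\alpha$-edges on $a_1$ and $a_{i+1}$ and the $-B_j$ are reversed bigons on $a_1$; the sign is the product of the signs of their formal flows. Let $\mathbf y$ contain all $w_k$. A pseudo-domain from $\mathbf x$ to $\mathbf y$ is of *Type L* if it is the union of consecutive punctured hexagons, exactly one with obtuse corner at $w_k$ for each $k$ with $w_k\notin\mathbf x$ (the zero domain if $\mathbf x=\mathbf y$). It is of *Type R* if it is the union of consecutive punctured hexagons (possibly none) whose obtuse corners are not any of the $w_k$, followed by a $4m$-gon. Its sign $\mu(p)$ is the product of the signs of the pieces. Define $$F=(F^R,F^L):C(\widetilde H)\to C(\widetilde G)[1]\oplus C(\widetilde G),\qquad F^{R}(\mathbf x)=\sum_{\mathbf y}\sum_{p\text{ of Type }R}\mu(p)\,\mathbf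 y,\quad F^{L}(\mathbf x)=\sum_{\mathbf y}\sum_{p\text{ of Type }L}\mu(p)\,\mathbf y,$$ where the target has the differential $(a,b)\mapsto(-\partial a,\partial b)$. **The $\mathcal Q$-filtration.** Put one point in each square of $H$ outside of the row and the column of $O_1$. $\mathcal Q$ is an integer-valued function on the generators of $\widetilde H$ such that, for each $\mathcal Q$-fine pseudo-domain $p$ from $\mathbf x$ to $\mathbf y$, $\mathcal Q(\mathbf x)-\mathcal Q(\mathbf y)$ is the total multiplicity of the projection of $p$ to the torus at these points. The generators of $\widetilde G$ get the value of $\mathcal Q$ of their completions by the $w_k$; on $C(\widetilde G)[1]\oplus C(\widetilde G)$ the filtration level is the maximum over the terms. **Proposition.** In this situation: 1. $C(\widetilde H)$ and $C(\widetilde G)$ are chain complexes ($\partial^2=0$), and $\partial$ preserves the Alexander grading. 2. $F$ is a chain map over $\mathbb Z$. It is homogeneous for the Alexander gradings: $F^R$ preserves the grading, and $F^L$ raises it by $1$. 3. A function $\mathcal Q$ exists. For each such $\mathcal Q$ the differentials and $F$ preserve the $\mathcal Q$-filtration, and $F$ induces an isomorphism on the homology of the associated graded complexes, in each filtration level. 4.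 $F$ is a quasi-isomorphism. 5. $H(C(\widetilde H))\cong H(C(\widetilde G))\otimes(\mathbb Z\oplus\mathbb Z)$ as graded groups, with the two copies of $\mathbb Z$ in gradings $0$ and $-1$. So the stable homology, i.e. the class of the pair $(H(C(\widetilde H)),N)$ with $N$ the size of $H$ under the equivalence $(V,N)\sim(W,M)$ iff $V\cong W\otimes(\mathbb Z\oplus\mathbb Z)^{\otimes(N-M)}$ ($N\ge M$), does not change under stabilization. -/

import Mathlib

open scoped TensorProduct

noncomputable section

namespace GridCover

/-! ### Formal generators, formal flows, sign assignments -/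

/-- A formal generator: a pairing of the set `A` of alpha curves with the set `B` of beta curves and
a sign for each intersection point. -/
structure FormalGen (A B : Type) where
  pairing : A ≃ B
  eps : A → ℤˣ

/-- The formal flows that start at a given formal generator.  The boundary of a bigon or of a
rectangle from `x` to `y` (boundary orientation, region on the left) runs along the alpha arcs from
the components of `x` to the components of `y`.  The sign `a` attached to a moving alpha curve `i` is
`1` if this path follows the orientation of the curve and `-1` otherwise.  Together with the signs of
`x` this determines the orientations of all edges.  In `rect i j a b` the components of `x` on `i` and
on `j` are the SW and the NE corner, so that the south edge points to the east iff `a = 1`, and the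
north edge points to the east iff `b = -1`.  (Symbols `rect i i a b` play no role.) -/
inductive FormalMove (A : Type) where
  | bigon (i : A) (a : ℤˣ)
  | rect (i j : A) (a b : ℤˣ)

namespace FormalMove

variable {A A' B : Type}

/-- The terminal generator of the formal flow `f` that starts at `x`. -/
def apply [DecidableEq A] (x : FormalGen A B) : FormalMove A → FormalGen A B
  | bigon i _ => ⟨x.pairing, fun k => if k = i then -x.eps k else x.eps k⟩
  | rect i j a b => ⟨(Equiv.swap i j).trans x.pairing,
      fun k => if k = i then -(a * b * x.eps j) else if k = j then -(a * b * x.eps i) else x.eps k⟩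

/-- Renaming of the alpha curves. -/
def map (φ : A' → A) : FormalMove A' → FormalMove A
  | bigon i a => bigon (φ i) a
  | rect i j a b => rect (φ i) (φ j) a b

/-- Boundary degenerations of Type alpha: the alpha arcs of the two flows close up to full circles
(one circle cut by a beta arc for two bigons, an annulus cut by two beta arcs for two rectangles). -/
inductive AlphaDeg : FormalMove A → FormalMove A → Prop
  | bigon (i : A) (a : ℤˣ) : AlphaDeg (bigon i a) (bigon i a)
  | rect (i j : A) (a b : ℤˣ) (hij : i ≠ j) : AlphaDeg (rect i j a b) (rect i j a b)

/-- Boundary degenerations of Type beta: the beta arcs of the two flows close up to full circles,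
and the alpha arcs are traversed back. -/
inductive BetaDeg : FormalMove A → FormalMove A → Prop
  | bigon (i : A) (a : ℤˣ) : BetaDeg (bigon i a) (bigon i (-a))
  | rect (i j : A) (a b : ℤˣ) (hij : i ≠ j) : BetaDeg (rect i j a b) (rect i j (-a) (-b))

/-- Squares: `Square f₁ f₂ f₃ f₄` says that the compositions `(f₁, f₂)` and `(f₃, f₄)` are the two
decompositions of one planar configuration of oriented arcs: two flows with no moving curve in common
that are used in the two orders; a bigon and a rectangle that meet at a corner, cut along the alpha or
along the beta curve through the concave corner; two rectangles with the same moving curves (an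
annulus with two concave corners); two rectangles with one common moving alpha curve (an L-shaped
hexagon or two rectangles adjacent along part of an edge), cut in either way at the concave
corner. -/
inductive Square : FormalMove A → FormalMove A → FormalMove A → FormalMove A → Prop
  | bigon_bigon (i j : A) (a b : ℤˣ) (hij : i ≠ j) :
      Square (bigon i a) (bigon j b) (bigon j b) (bigon i a)
  | bigon_rect (i j k : A) (a b c : ℤˣ) (hij : i ≠ j) (hik : i ≠ k) (hjk : j ≠ k) :
      Square (bigon i a) (rect j k b c) (rect j k b c) (bigon i a)
  | rect_rect (i j k l : A) (a b c d : ℤˣ) (hij : i ≠ j) (hik : i ≠ k) (hil : i ≠ l) (hjk : j ≠ k)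
      (hjl : j ≠ l) (hkl : k ≠ l) :
      Square (rect i j a b) (rect k l c d) (rect k l c d) (rect i j a b)
  | pentagon_same (i j : A) (a b c : ℤˣ) (hij : i ≠ j) :
      Square (bigon i c) (rect i j a b) (rect i j (-a) b) (bigon i c)
  | pentagon_other (i j : A) (a b c : ℤˣ) (hij : i ≠ j) :
      Square (bigon i c) (rect i j a b) (rect i j a b) (bigon j (-(a * b * c)))
  | annulus (i j : A) (a b : ℤˣ) (hij : i ≠ j) :
      Square (rect i j a b) (rect i j a (-b)) (rect i j a (-b)) (rect i j a b)
  | hexagon_first (i j k : A) (a a' b c : ℤˣ) (hij : i ≠ j) (hik : i ≠ k) (hjk : j ≠ k) :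
      Square (rect i j a b) (rect i k a' c) (rect i k a' c) (rect k j (-(a * a' * c)) b)
  | hexagon_second (i j k : A) (a a' b c : ℤˣ) (hij : i ≠ j) (hik : i ≠ k) (hjk : j ≠ k) :
      Square (rect i j a b) (rect i k a' c) (rect j k (-(a * a' * b)) c) (rect i j a b)

end FormalMove

open FormalMove

/-- A sign assignment on the formal flows with alpha curves `A` and beta curves `B`.  The field
`rot` says that the value depends only on the formal rectangle, which is unchanged if it is rotated
by 180 degrees. -/
structure SignAssignment (A B : Type) [DecidableEq A] where
  sign : FormalGen A B → FormalMove A → ℤˣ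
  rot : ∀ x i j a b, i ≠ j → sign x (rect i j a b) = sign x (rect j i b a)
  alphaDeg : ∀ x f g, AlphaDeg f g → sign x f * sign (apply x f) g = 1
  betaDeg : ∀ x f g, BetaDeg f g → sign x f * sign (apply x f) g = -1
  square : ∀ x f₁ f₂ f₃ f₄, Square f₁ f₂ f₃ f₄ →
    ((sign x f₁ * sign (apply x f₁) f₂ : ℤˣ) : ℤ) + (sign x f₃ * sign (apply x f₃) f₄ : ℤˣ) = 0

/-- The product of the signs of consecutive flows. -/
def SignAssignment.path {A B : Type} [DecidableEq A] (S : SignAssignment A B) :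
    FormalGen A B → List (FormalMove A) → ℤˣ
  | _, [] => 1
  | x, f :: l => S.sign x f * S.path (apply x f) l

section Extend

variable {A A' B B' W : Type}

/-- Adding the pairs `(w, w)`, `w ∈ W`, with signs `ε`, to a formal generator. -/
def FormalGen.extend (eA : A' ⊕ W ≃ A) (eB : B' ⊕ W ≃ B) (ε : W → ℤˣ) (x : FormalGen A' B') :
    FormalGen A B where
  pairing := eA.symm.trans ((Equiv.sumCongr x.pairing (Equiv.refl W)).trans eB)
  eps k := Sum.elim x.eps ε (eA.symm k)

theorem FormalGen.extend_apply [DecidableEq A] [DecidableEq A'] (eA : A' ⊕ W ≃ A) (eB : B' ⊕ W ≃ B)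
    (ε : W → ℤˣ) (x : FormalGen A' B') (f : FormalMove A') :
    (apply x f).extend eA eB ε = apply (x.extend eA eB ε) (f.map (fun i => eA (Sum.inl i))) := by
  cases f with
  | bigon i a =>
    simp only [FormalMove.map, apply, FormalGen.extend, FormalGen.mk.injEq, true_and]
    funext k
    obtain ⟨k, rfl⟩ := eA.surjective k
    rcases k with k | k <;> simp
  | rect i j a b =>
    simp only [FormalMove.map, apply, FormalGen.extend, FormalGen.mk.injEq]
    constructor
    · ext k
      obtain ⟨k, rfl⟩ := eA.surjective k
      rcases k with k | k
      · by_cases hi : k = i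
        · subst hi; simp
        · by_cases hj : k = j
          · subst hj; simp
          · simp [Equiv.swap_apply_of_ne_of_ne, hi, hj]
      · simp [Equiv.swap_apply_of_ne_of_ne]
    · funext k
      obtain ⟨k, rfl⟩ := eA.surjective k
      rcases k with k | k <;> simp

/-- The sign assignment on a smaller set of curves that is induced by adding fixed pairs. -/
def SignAssignment.restrict [DecidableEq A] [DecidableEq A'] (S : SignAssignment A B)
    (eA : A' ⊕ W ≃ A) (eB : B' ⊕ W ≃ B) (ε : W → ℤˣ) : SignAssignment A' B' where
  sign x f := S.sign (x.extend eA eB ε) (f.map (fun i => eA (Sum.inl i)))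
  rot x i j a b hij := S.rot _ _ _ _ _ (by simpa using hij)
  alphaDeg x f g h := by
    rw [FormalGen.extend_apply]
    refine S.alphaDeg _ _ _ ?_
    cases h with
    | bigon i a => exact .bigon _ _
    | rect i j a b hij => exact .rect _ _ _ _ (by simpa using hij)
  betaDeg x f g h := by
    rw [FormalGen.extend_apply]
    refine S.betaDeg _ _ _ ?_
    cases h with
    | bigon i a => exact .bigon _ _
    | rect i j a b hij => exact .rect _ _ _ _ (by simpa using hij)
  square x f₁ f₂ f₃ f₄ h := by
    rw [FormalGen.extend_apply, FormalGen.extend_apply]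
    refine S.square _ _ _ _ _ ?_
    cases h with
    | bigon_bigon i j a b h => exact .bigon_bigon _ _ _ _ (by simpa using h)
    | bigon_rect i j k a b c h1 h2 h3 =>
      exact .bigon_rect _ _ _ _ _ _ (by simpa using h1) (by simpa using h2) (by simpa using h3)
    | rect_rect i j k l a b c d h1 h2 h3 h4 h5 h6 =>
      exact .rect_rect _ _ _ _ _ _ _ _ (by simpa using h1) (by simpa using h2)
        (by simpa using h3) (by simpa using h4) (by simpa using h5) (by simpa using h6)
    | pentagon_same i j a b c h => exact .pentagon_same _ _ _ _ _ (by simpa using h)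
    | pentagon_other i j a b c h => exact .pentagon_other _ _ _ _ _ (by simpa using h)
    | annulus i j a b h => exact .annulus _ _ _ _ (by simpa using h)
    | hexagon_first i j k a a' b c h1 h2 h3 =>
      exact .hexagon_first _ _ _ _ _ _ _ (by simpa using h1) (by simpa using h2)
        (by simpa using h3)
    | hexagon_second i j k a a' b c h1 h2 h3 =>
      exact .hexagon_second _ _ _ _ _ _ _ (by simpa using h1) (by simpa using h2)
        (by simpa using h3)

end Extend

/-! ### Grid diagrams and their branched covers

Columns are numbered from left to right and rows from bottom to top.  The circle `alpha_i` is the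
lower edge of row `i` and the circle `beta_j` is the left edge of column `j`; the square `(i, j)` lies
in row `i` and column `j`. -/

/-- A grid diagram of a knot: `X j` and `O j` are the rows of the markings in column `j`. -/
structure Grid (N : ℕ) where
  X : Equiv.Perm (Fin N)
  O : Equiv.Perm (Fin N)
  disjoint : ∀ j, X j ≠ O j
  knot : ∀ j k, (O⁻¹ * X).SameCycle j k

/-- Lifts of curves.  The beta curve `(j, a)` is the lift of `beta_j` in the sheet `a`, and the alpha
curve `(i, a)` is the lift of `alpha_i` that meets the lift of `beta_0` in the sheet `a`. -/
abbrev Curve (N m : ℕ) : Type := Fin N × ZMod m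

/-- `k` lies in the cyclic interval `[a, b)`. -/
def cycIco {N : ℕ} (a b k : Fin N) : Prop := ((k - a : Fin N) : ℕ) < ((b - a : Fin N) : ℕ)

/-- `k` lies in the cyclic interval `(a, b)`. -/
def cycIoo {N : ℕ} (a b k : Fin N) : Prop := k ≠ a ∧ cycIco a b k

namespace Grid

variable {N m : ℕ} (D : Grid N)

/-- The change of the sheet when `alpha_i` is followed to the right through column `j`: the branch cut
of the column is the vertical segment between its two markings. -/
def cross (i j : Fin N) : ℤ :=
  if D.O j < i ∧ i ≤ D.X j then 1 else if D.X j < i ∧ i ≤ D.O j then -1 else 0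

/-- The change of the sheet when column `j` is passed to the right inside row `i`, for a square
without marking. -/
def rowCross (i j : Fin N) : ℤ :=
  if D.O j < i ∧ i < D.X j then 1 else if D.X j < i ∧ i < D.O j then -1 else 0

/-- The change of the sheet when `alpha_i` is followed to the right from `beta_0` to `beta_j`. -/
def shift (i j : Fin N) : ℤ := ∑ k : Fin N, if k < j then D.cross i k else 0

/-- The lift `p` of an alpha circle and the lift `q` of a beta circle intersect (in one point). -/
def Meets (p q : Curve N m) : Prop := q.2 = p.2 + (D.shift p.1 q.1 : ZMod m)

variable (m) in
/-- Generators of the `m`-fold branched cover: one intersection point on each lift of an alpha circle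
and on each lift of a beta circle. -/
def Gen : Type := {σ : Curve N m ≃ Curve N m // ∀ p, D.Meets p (σ p)}

instance [NeZero m] : Finite (D.Gen m) := by unfold Gen; infer_instance

instance [NeZero m] : Fintype (D.Gen m) := Fintype.ofFinite _

variable (m) in
/-- The free abelian group on the generators. -/
abbrev Chain : Type := D.Gen m →₀ ℤ

/-- The squares in rows `[i₀, i₁)` and columns `[j₀, j₁)` contain no marking. -/
def NoMarking (i₀ i₁ j₀ j₁ : Fin N) : Prop :=
  ∀ j, cycIco j₀ j₁ j → ¬ cycIco i₀ i₁ (D.X j) ∧ ¬ cycIco i₀ i₁ (D.O j)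

/-- No component of `x` lies in the interior of the lifted rectangle with left edge on the beta curve
`q`, right edge over `beta_{j₁}`, and lower and upper edges over `alpha_{i₀}` and `alpha_{i₁}`. -/
def NoPoint (x : D.Gen m) (i₀ i₁ : Fin N) (q : Curve N m) (j₁ : Fin N) : Prop :=
  ∀ p : Curve N m, cycIoo i₀ i₁ p.1 → cycIoo q.1 j₁ (x.1 p).1 → ¬ D.Meets p q

/-- There is an empty rectangle from `x` to `y` whose lower left corner is the component of `x` on the
alpha curve `s` and whose upper right corner is the component of `x` on `t`. -/
def IsRect (x y : D.Gen m) (s t : Curve N m) : Prop :=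
  s.1 ≠ t.1 ∧ (x.1 s).1 ≠ (x.1 t).1 ∧ y.1 = (Equiv.swap s t).trans x.1 ∧
    D.NoMarking s.1 t.1 (x.1 s).1 (x.1 t).1 ∧ D.NoPoint x s.1 t.1 (x.1 s) (x.1 t).1

/-- The number of pairs of a point of `P` and a point of `Q`, one of which is above and to the right of
the other. -/
def pairCount (P Q : Multiset (ℚ × ℚ)) : ℚ :=
  ((P ×ˢ Q).filter (fun z => 0 < (z.2.1 - z.1.1) * (z.2.2 - z.1.2))).card

/-- The markings `X` as points of the plane. -/
def pointsX : Multiset (ℚ × ℚ) :=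
  (Finset.univ : Finset (Fin N)).val.map fun j : Fin N =>
    (((j : ℕ) : ℚ) + 1 / 2, ((D.X j : ℕ) : ℚ) + 1 / 2)

/-- The markings `O` as points of the plane. -/
def pointsO : Multiset (ℚ × ℚ) :=
  (Finset.univ : Finset (Fin N)).val.map fun j : Fin N =>
    (((j : ℕ) : ℚ) + 1 / 2, ((D.O j : ℕ) : ℚ) + 1 / 2)

/-- The projections of the components of `x` as points of the plane. -/
def points [NeZero m] (x : D.Gen m) : Multiset (ℚ × ℚ) :=
  (Finset.univ : Finset (Curve N m)).val.map fun p : Curve N m =>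
    ((((x.1 p).1 : ℕ) : ℚ), ((p.1 : ℕ) : ℚ))

/-- The Alexander grading.  The Alexander grading of a generator `x` of the grid,
`J(x - (X + O) / 2, X - O) / 2 - (N - 1) / 2` with `J = pairCount` extended bilinearly, is affine in
the sum of the points of `x`, so the average of the gradings of the `m` generators into which the
projection of a generator of the cover decomposes is given by the following formula. -/
def alexander [NeZero m] (x : D.Gen m) : ℚ :=
  1 / 2 * ((pairCount (D.points x) D.pointsX - pairCount (D.points x) D.pointsO) / m
    - 1 / 2 * (pairCount D.pointsX D.pointsX - pairCount D.pointsX D.pointsO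
      + pairCount D.pointsO D.pointsX - pairCount D.pointsO D.pointsO)) - ((N : ℚ) - 1) / 2

end Grid

/-- Orientations of the lifted curves; `1` means to the right for an alpha curve and upwards for a
beta curve. -/
structure Orientation (N m : ℕ) where
  alpha : Curve N m → ℤˣ
  beta : Curve N m → ℤˣ

namespace Grid

variable {N m : ℕ} (D : Grid N)

/-- The formal generator of a generator. -/
def formal (o : Orientation N m) (x : D.Gen m) : FormalGen (Curve N m) (Curve N m) where
  pairing := x.1
  eps p := o.alpha p * o.beta (x.1 p)

end Grid

/-- The formal flow of a rectangle with lower left corner on `s` and upper right corner on `t`: its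
boundary follows `s` to the right and `t` to the left. -/
def rectMove {N m : ℕ} (o : Orientation N m) (s t : Curve N m) : FormalMove (Curve N m) :=
  rect s t (o.alpha s) (-o.alpha t)

namespace Grid

variable {N m : ℕ} (D : Grid N)

open Classical in
/-- The coefficient of `y` in the boundary of `x`. -/
def coeff [NeZero m] (S : SignAssignment (Curve N m) (Curve N m)) (o : Orientation N m)
    (x y : D.Gen m) : ℤ :=
  ∑ s : Curve N m, ∑ t : Curve N m,
    if D.IsRect x y s t then ((S.sign (D.formal o x) (rectMove o s t) : ℤˣ) : ℤ) else 0

/-- The boundary operator. -/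
def boundary [NeZero m] (S : SignAssignment (Curve N m) (Curve N m)) (o : Orientation N m) :
    D.Chain m →ₗ[ℤ] D.Chain m :=
  Finsupp.linearCombination ℤ fun x => ∑ y, Finsupp.single y (D.coeff S o x y)

end Grid

/-! ### Stabilization -/

/-- `H` is a stabilization of `G`: `H` has a new column `c` whose markings `O_1` and `X_1` lie in the
rows `ρ.succ` and `ρ.castSucc`, `O_1` directly above `X_1`; the marking `X` in the row of `O_1` lies in
the column next to `c` on the right or on the left (on the torus); `G` is obtained by deleting
`alpha_{ρ.succ}` (which separates `O_1` and `X_1`) and `beta_c` (to the left of `O_1`) with the two new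
markings. -/
structure IsStabilization {n : ℕ} (G : Grid n) (H : Grid (n + 1)) (ρ : Fin n) (c : Fin (n + 1)) :
    Prop where
  O_new : H.O c = ρ.succ
  X_new : H.X c = ρ.castSucc
  X_old : ∀ j, G.X j = ρ.predAbove (H.X (c.succAbove j))
  O_old : ∀ j, G.O j = ρ.predAbove (H.O (c.succAbove j))
  adjacent : H.X (c + 1) = ρ.succ ∨ H.X (c - 1) = ρ.succ

theorem le_predAbove {n : ℕ} (ρ i : Fin n) (k : Fin (n + 1)) :
    i ≤ ρ.predAbove k ↔ ρ.succ.succAbove i ≤ k := by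
  unfold Fin.predAbove Fin.succAbove
  split_ifs with h1 h2 h2 <;>
    (have h3 := h1
     have h4 := h2
     clear h2
     simp only [Fin.lt_def, Fin.le_def, Fin.val_castSucc, Fin.val_succ, Fin.val_pred,
      Fin.coe_castPred] at h3 h4 ⊢
     try omega)

theorem IsStabilization.shift_eq {n : ℕ} {G : Grid n} {H : Grid (n + 1)} {ρ : Fin n}
    {c : Fin (n + 1)} (h : IsStabilization G H ρ c) (i j : Fin n) :
    H.shift (ρ.succ.succAbove i) (c.succAbove j) = G.shift i j := by
  unfold Grid.shift
  rw [Fin.sum_univ_succAbove _ c]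
  have h0 : H.cross (ρ.succ.succAbove i) c = 0 := by
    have hne := Fin.succAbove_ne ρ.succ i
    have h1 : ¬ (ρ.castSucc < ρ.succ.succAbove i ∧ ρ.succ.succAbove i ≤ ρ.succ) := by
      rintro ⟨h1, h2⟩
      apply hne
      rw [Fin.lt_def] at h1
      rw [Fin.le_def] at h2
      ext
      simp only [Fin.val_castSucc, Fin.val_succ] at *
      omega
    have h2 : ¬ (ρ.succ < ρ.succ.succAbove i ∧ ρ.succ.succAbove i ≤ ρ.castSucc) := by
      rintro ⟨h1, h2⟩
      have := h1.trans_le h2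
      rw [Fin.lt_def] at this
      simp only [Fin.val_castSucc, Fin.val_succ] at this
      omega
    simp [Grid.cross, h.O_new, h.X_new, h1, h2]
  rw [h0, ite_self, zero_add]
  refine Finset.sum_congr rfl fun k _ => ?_
  simp only [Fin.succAbove_lt_succAbove_iff]
  have hc : H.cross (ρ.succ.succAbove i) (c.succAbove k) = G.cross i k := by
    simp only [Grid.cross, h.X_old, h.O_old, le_predAbove, ← not_le]
  rw [hc]

/-- The curves `(k', a)` of the smaller grid, where `k'` numbers the circles other than number `k`, and
the curves `(k, a + e)`, together are the curves of the larger grid. -/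
def insertCurve {n m : ℕ} (k : Fin (n + 1)) (e : ZMod m) :
    Curve n m ⊕ ZMod m ≃ Curve (n + 1) m :=
  Equiv.ofBijective (Sum.elim (fun p => (k.succAbove p.1, p.2)) (fun a => (k, a + e))) <| by
    constructor
    · rintro (⟨i, a⟩ | a) (⟨j, b⟩ | b) hab
      · simpa using hab
      · exact absurd (congrArg Prod.fst hab) (Fin.succAbove_ne k i)
      · exact absurd (congrArg Prod.fst hab).symm (Fin.succAbove_ne k j)
      · simpa using hab
    · rintro ⟨i, a⟩
      by_cases hi : i = k
      · exact ⟨Sum.inr (a - e), by simp [hi]⟩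
      · obtain ⟨j, rfl⟩ := Fin.exists_succAbove_eq hi
        exact ⟨Sum.inl (j, a), rfl⟩

@[simp]
theorem insertCurve_inl {n m : ℕ} (k : Fin (n + 1)) (e : ZMod m) (p : Curve n m) :
    insertCurve k e (Sum.inl p) = (k.succAbove p.1, p.2) := rfl

@[simp]
theorem insertCurve_inr {n m : ℕ} (k : Fin (n + 1)) (e : ZMod m) (a : ZMod m) :
    insertCurve k e (Sum.inr a) = (k, a + e) := rfl

section Stab

variable {n m : ℕ} {G : Grid n} {H : Grid (n + 1)} {ρ : Fin n} {c : Fin (n + 1)}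

/-- The inverse of the map `ψ` that forgets the components at the lifts of
`w = alpha_{ρ.succ} ∩ beta_c`: a generator of the cover of `G` is completed by all these lifts. -/
def IsStabilization.lift (h : IsStabilization G H ρ c) (g : G.Gen m) : H.Gen m :=
  ⟨(insertCurve ρ.succ (0 : ZMod m)).symm.trans
    ((Equiv.sumCongr g.1 (Equiv.refl (ZMod m))).trans (insertCurve c (H.shift ρ.succ c : ZMod m))), by
    intro p
    obtain ⟨p, rfl⟩ := (insertCurve ρ.succ (0 : ZMod m)).surjective p
    simp only [Equiv.trans_apply, Equiv.symm_apply_apply, Equiv.sumCongr_apply]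
    rcases p with p | a
    · have hp := g.2 p
      simpa [Grid.Meets, h.shift_eq] using hp
    · simp [Grid.Meets]⟩

variable (H ρ c)

/-- The sign assignment for the cover of `G`: a rectangle gets the sign of the rectangle with the same
edges in the cover of `H`, the components at the lifts of `w` being added to both generators. -/
def signG (S : SignAssignment (Curve (n + 1) m) (Curve (n + 1) m)) (o : Orientation (n + 1) m) :
    SignAssignment (Curve n m) (Curve n m) :=
  S.restrict (insertCurve ρ.succ (0 : ZMod m)) (insertCurve c (H.shift ρ.succ c : ZMod m))
    (fun a => o.alpha (ρ.succ, a) * o.beta (c, a + (H.shift ρ.succ c : ZMod m)))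

/-- The orientations of the curves of the cover of `G`. -/
def orientationG (ρ : Fin n) (c : Fin (n + 1)) (o : Orientation (n + 1) m) : Orientation n m where
  alpha p := o.alpha (ρ.succ.succAbove p.1, p.2)
  beta q := o.beta (c.succAbove q.1, q.2)

/-- The lift of `alpha_{ρ.succ}` through `w_k`, the lift of `w` to the sheet `k`. -/
def alphaThrough (k : ZMod m) : Curve (n + 1) m := (ρ.succ, k - (H.shift ρ.succ c : ZMod m))

/-! ### Pseudo-domains

Let `λ` be a circle around the segment from `O_1` to `X_1`; it has one lift `λ_k` in each sheet.  A
two-chain on the complement of the lifted curves and of the `λ_k` is given by its multiplicities at the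
lifts of the squares (for the squares of `O_1` and `X_1`: at the parts outside of the `λ_k`) and by the
multiplicities at `O_1` and at `X_1`.  A lifted square is labelled by the sheet of its left edge.
The lifts of a square with another marking form one region, so the multiplicity there must not depend
on the sheet. -/

/-- `p.1 i j a` is the multiplicity at the lift of the square in row `i` and column `j` whose left edge
lies in the sheet `a`; `p.2.1` and `p.2.2` are the multiplicities at `O_1` and `X_1`. -/
abbrev TwoChain (N m : ℕ) : Type := (Fin N → Fin N → ZMod m → ℤ) × ℤ × ℤ

open Classical in
/-- The multiplicity of the intersection point of `alpha_i` and `beta_j` in the sheet `a` in `x`. -/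
def pointCount {N m : ℕ} (D : Grid N) (x : D.Gen m) (i j : Fin N) (a : ZMod m) : ℤ :=
  if (x.1.symm (j, a)).1 = i then 1 else 0

/-- `p` is a pseudo-domain from `x` to `y`: along the part of its boundary on the lifted curves, the
boundary of the alpha part is `y - x`, and the rest of the boundary is a combination of the `λ_k`. -/
structure IsPseudoDomain (x y : H.Gen m) (p : TwoChain (n + 1) m) : Prop where
  marked : ∀ j, j ≠ c → ∀ a b, p.1 (H.X j) j a = p.1 (H.X j) j b ∧ p.1 (H.O j) j a = p.1 (H.O j) j b
  puncture : ∀ k, p.1 ρ.succ c k - p.1 ρ.castSucc c k = p.2.1 - p.2.2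
  corner : ∀ i j a,
    p.1 i j a - p.1 (i - 1) j a - p.1 i (j - 1) (a - (H.rowCross i (j - 1) : ZMod m))
      + p.1 (i - 1) (j - 1) (a - (H.rowCross (i - 1) (j - 1) : ZMod m))
      = pointCount H x i j a - pointCount H y i j a

/-- The multiplicity is zero at each base point except possibly at `X_1`. -/
def QFine (p : TwoChain (n + 1) m) : Prop :=
  (∀ j, j ≠ c → ∀ a, p.1 (H.X j) j a = 0 ∧ p.1 (H.O j) j a = 0) ∧ p.2.1 = 0

/-- The multiplicity of the projection of `p` at the set `Q` that has one point in each square outside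
of the row and the column of `O_1`. -/
def qCount [NeZero m] (p : TwoChain (n + 1) m) : ℤ :=
  ∑ i ∈ Finset.univ.filter (· ≠ ρ.succ), ∑ j ∈ Finset.univ.filter (· ≠ c), ∑ a : ZMod m, p.1 i j a

/-- The defining property of the function that gives the `Q`-filtration. -/
def IsQFunction [NeZero m] (Q : H.Gen m → ℤ) : Prop :=
  ∀ (x y : H.Gen m) (p : TwoChain (n + 1) m),
    IsPseudoDomain H ρ c x y p → QFine H c p → Q x - Q y = qCount ρ c p

open Classical in
/-- The lifted squares in the rows `[s.1, i₁)` and the columns `[j₀, j₁)`, for the lift of this rectangle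
with lower edge on the alpha curve `s`. -/
def squares (s : Curve (n + 1) m) (i₁ j₀ j₁ : Fin (n + 1)) : Fin (n + 1) → Fin (n + 1) → ZMod m → ℤ :=
  fun i j a => if cycIco s.1 i₁ i ∧ cycIco j₀ j₁ j ∧ H.Meets s (j, a) then 1 else 0

/-- There is a punctured rectangle from `x` to `y` around `λ_k`, with the lower left corner at the
component of `x` on `s` and the upper right corner at the component of `x` on `t`. -/
def IsPuncturedRect (x y : H.Gen m) (k : ZMod m) (s t : Curve (n + 1) m) : Prop :=
  x.1 s = (c, k) ∧ x.1 t = (c + 1, k) ∧ y.1 = (Equiv.swap s t).trans x.1 ∧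
    cycIco s.1 t.1 ρ.succ ∧ cycIco s.1 t.1 ρ.castSucc

/-- `HexChain H ρ c S o P ks x y p μ`: the two-chain `p` is the union of consecutive punctured hexagons
that lead from `x` to `y`, the hexagons lie at the `λ_k` for the successive entries `k` of the list `ks`,
and `μ` is the product of their signs.  A punctured hexagon consists of a punctured rectangle from `x`
to `z`, with corners on `s` and `t`, and an empty rectangle from `z` to `z'` to the left of it, with the
upper edge on the same alpha curve `t` and lower edge on `u`; the obtuse corner is the intersection point
of `u` and the left edge of the punctured rectangle.  The curve `u` has to satisfy `P`. -/
inductive HexChain (S : SignAssignment (Curve (n + 1) m) (Curve (n + 1) m))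
    (o : Orientation (n + 1) m) (P : Curve (n + 1) m → Prop) :
    List (ZMod m) → H.Gen m → H.Gen m → TwoChain (n + 1) m → ℤˣ → Prop
  | nil (x : H.Gen m) : HexChain S o P [] x x 0 1
  | cons (x z z' y : H.Gen m) (k : ZMod m) (s t u : Curve (n + 1) m) (ks : List (ZMod m))
      (p : TwoChain (n + 1) m) (μ : ℤˣ)
      (punctured : IsPuncturedRect H ρ c x z k s t)
      (rectangle : H.IsRect z z' u t)
      (obtuse : cycIoo s.1 t.1 u.1)
      (corner : P u)
      (rest : HexChain S o P ks z' y p μ) :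
      HexChain S o P (k :: ks) x y
        ((squares H s t.1 c (c + 1) + squares H u t.1 (x.1 u).1 c, 0, 0) + p)
        (S.sign (H.formal o x) (rectMove o s t) * S.sign (H.formal o z) (rectMove o u t) * μ)

/-- All the `w_k` are components of `y`. -/
def AllI (y : H.Gen m) : Prop := ∀ a : ZMod m, (y.1 (ρ.succ, a)).1 = c

/-- `p` is a pseudo-domain of Type L from `x` to `y` with sign `μ`: one punctured hexagon with obtuse corner
at `w_k` for each `w_k` that is not a component of `x`. -/
def TypeL (S : SignAssignment (Curve (n + 1) m) (Curve (n + 1) m)) (o : Orientation (n + 1) m)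
    (x y : H.Gen m) (p : TwoChain (n + 1) m) (μ : ℤˣ) : Prop :=
  IsPseudoDomain H ρ c x y p ∧ AllI H ρ c y ∧
    ∃ ks : List (ZMod m), ks.Nodup ∧ (∀ k, k ∈ ks ↔ (x.1.symm (c, k)).1 ≠ ρ.succ) ∧
      HexChain H ρ c S o (fun u => u.1 = ρ.succ) ks x y p μ

/-- There is a `4m`-gon around `X_1` from `x` to `y`.  Its part that starts at the lift of `beta_c` in the
sheet `k` has its upper left corner at `w_k`, the lower left corner at the component of `x` on this
lift of `beta_c`, the upper right corner at the component of `x` on the lift of `alpha_{ρ.succ}` through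
`w_{k+1}` (this lift passes to the sheet `k + 1` at the branch cut, going to the left), and the
lower right corner at a component of `y`. -/
structure IsPolygon (x y : H.Gen m) : Prop where
  row_ne : ∀ k, (x.1.symm (c, k)).1 ≠ ρ.succ
  col_ne : ∀ k, (x.1 (alphaThrough H ρ c (k + 1))).1 ≠ c
  meets : ∀ k, H.Meets (x.1.symm (c, k)) (x.1 (alphaThrough H ρ c (k + 1)))
  noMarking : ∀ k j, cycIco c (x.1 (alphaThrough H ρ c (k + 1))).1 j →
    (j ≠ c → ¬ cycIco (x.1.symm (c, k)).1 ρ.succ (H.X j)) ∧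
      ¬ cycIco (x.1.symm (c, k)).1 ρ.succ (H.O j)
  noPoint : ∀ k, H.NoPoint x (x.1.symm (c, k)).1 ρ.succ (c, k)
    (x.1 (alphaThrough H ρ c (k + 1))).1
  upper_left : ∀ k, y.1 (alphaThrough H ρ c k) = (c, k)
  lower_right : ∀ k, y.1 (x.1.symm (c, k)) = x.1 (alphaThrough H ρ c (k + 1))
  other : ∀ p, (∀ k, p ≠ alphaThrough H ρ c k) → (∀ k, p ≠ x.1.symm (c, k)) → y.1 p = x.1 p

/-- The two-chain of the `4m`-gon that starts at `x`. -/
def polygonChain [NeZero m] (x : H.Gen m) : TwoChain (n + 1) m :=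
  (∑ k : ZMod m, squares H (x.1.symm (c, k)) ρ.succ c (x.1 (alphaThrough H ρ c (k + 1))).1, 0, 1)

/-- The alpha edges `a_2, ..., a_{2m}` of the `4m`-gon, in the order in which they follow the edge `a_1` that
ends at the component of `x` on the lift of `beta_c` in the sheet `1`, with `1` if the boundary of the
polygon follows the orientation of the curve and `-1` otherwise. -/
def polygonEdges (o : Orientation (n + 1) m) (x : H.Gen m) : List (Curve (n + 1) m × ℤˣ) :=
  ((List.range m).flatMap fun t =>
    [(alphaThrough H ρ c (1 - (t : ZMod m)), -o.alpha (alphaThrough H ρ c (1 - (t : ZMod m)))),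
      (x.1.symm (c, -(t : ZMod m)), o.alpha (x.1.symm (c, -(t : ZMod m))))]).dropLast

/-- The sign of the `4m`-gon that starts at `x`: after a finger move of the edge `a_1`, the polygon is
decomposed into the rectangles `R_i` with edges on `a_1` and `a_{i+1}`, which alternate with the reversed
bigons `-B_i` on `a_1`. -/
def polygonSign (S : SignAssignment (Curve (n + 1) m) (Curve (n + 1) m)) (o : Orientation (n + 1) m)
    (x : H.Gen m) : ℤˣ :=
  let a₁ := x.1.symm (c, 1)
  S.path (H.formal o x)
    (((polygonEdges H ρ c o x).map fun e => rect a₁ e.1 (o.alpha a₁) e.2).intersperse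
      (bigon a₁ (o.alpha a₁)))

/-- `p` is a pseudo-domain of Type R from `x` to `y` with sign `μ`: punctured hexagons with obtuse corners
different from the `w_k`, followed by a `4m`-gon. -/
def TypeR [NeZero m] (S : SignAssignment (Curve (n + 1) m) (Curve (n + 1) m))
    (o : Orientation (n + 1) m) (x y : H.Gen m) (p : TwoChain (n + 1) m) (μ : ℤˣ) : Prop :=
  IsPseudoDomain H ρ c x y p ∧ AllI H ρ c y ∧
    ∃ (ks : List (ZMod m)) (z : H.Gen m) (p' : TwoChain (n + 1) m) (μ' : ℤˣ),
      HexChain H ρ c S o (fun u => u.1 ≠ ρ.succ) ks x z p' μ' ∧ IsPolygon H ρ c z y ∧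
        p = p' + polygonChain H ρ c z ∧ μ = μ' * polygonSign H ρ c S o z

/-- The sum of the signs of the pseudo-domains of Type L from `x` to `y`. -/
def coeffL (S : SignAssignment (Curve (n + 1) m) (Curve (n + 1) m)) (o : Orientation (n + 1) m)
    (x y : H.Gen m) : ℤ :=
  ∑ᶠ q ∈ {q : TwoChain (n + 1) m × ℤˣ | TypeL H ρ c S o x y q.1 q.2}, (q.2 : ℤ)

/-- The sum of the signs of the pseudo-domains of Type R from `x` to `y`. -/
def coeffR [NeZero m] (S : SignAssignment (Curve (n + 1) m) (Curve (n + 1) m))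
    (o : Orientation (n + 1) m) (x y : H.Gen m) : ℤ :=
  ∑ᶠ q ∈ {q : TwoChain (n + 1) m × ℤˣ | TypeR H ρ c S o x y q.1 q.2}, (q.2 : ℤ)

variable {H ρ c}

/-- The stabilization map `F = (F^R, F^L)`. -/
def IsStabilization.stabMap [NeZero m] (h : IsStabilization G H ρ c)
    (S : SignAssignment (Curve (n + 1) m) (Curve (n + 1) m)) (o : Orientation (n + 1) m) :
    H.Chain m →ₗ[ℤ] G.Chain m × G.Chain m :=
  Finsupp.linearCombination ℤ fun x =>
    (∑ g, Finsupp.single g (coeffR H ρ c S o x (h.lift g)),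
      ∑ g, Finsupp.single g (coeffL H ρ c S o x (h.lift g)))

end Stab

/-! ### Filtered differential groups and homology -/

section Algebra

variable {M M' : Type} [AddCommGroup M] [AddCommGroup M']

/-- The homology of a differential. -/
abbrev Homology (d : M →ₗ[ℤ] M) : Type :=
  LinearMap.ker d ⧸ (LinearMap.range d).submoduleOf (LinearMap.ker d)

/-- The map in homology induced by a chain map. -/
def homologyMap (d : M →ₗ[ℤ] M) (d' : M' →ₗ[ℤ] M') (f : M →ₗ[ℤ] M')
    (hf : d' ∘ₗ f = f ∘ₗ d) : Homology d →ₗ[ℤ] Homology d' :=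
  Submodule.mapQ _ _
    (f.restrict (p := LinearMap.ker d) (q := LinearMap.ker d') fun v hv => by
      have h := LinearMap.congr_fun hf v
      simp only [LinearMap.comp_apply, LinearMap.mem_ker] at h hv ⊢
      rw [h, hv, map_zero]) <| by
    rintro ⟨v, hv⟩ ⟨w, hw⟩
    refine ⟨f w, ?_⟩
    have h := LinearMap.congr_fun hf w
    simp only [LinearMap.comp_apply] at h
    change d w = v at hw
    change d' (f w) = f v
    rw [h, hw]

/-- `f` is a chain map that induces an isomorphism in homology. -/
def IsQuasiIso (d : M →ₗ[ℤ] M) (d' : M' →ₗ[ℤ] M') (f : M →ₗ[ℤ] M') : Prop :=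
  ∃ hf : d' ∘ₗ f = f ∘ₗ d, Function.Bijective (homologyMap d d' f hf)

/-- `f` preserves the filtrations. -/
def IsFiltered (Fil : ℤ → Submodule ℤ M) (Fil' : ℤ → Submodule ℤ M') (f : M →ₗ[ℤ] M') : Prop :=
  ∀ k, ∀ v ∈ Fil k, f v ∈ Fil' k

/-- The associated graded group in degree `k`. -/
abbrev Gr (Fil : ℤ → Submodule ℤ M) (k : ℤ) : Type :=
  Fil k ⧸ (Fil (k - 1)).submoduleOf (Fil k)

/-- The map of associated graded groups. -/
def grMap {Fil : ℤ → Submodule ℤ M} {Fil' : ℤ → Submodule ℤ M'} {f : M →ₗ[ℤ] M'}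
    (hf : IsFiltered Fil Fil' f) (k : ℤ) : Gr Fil k →ₗ[ℤ] Gr Fil' k :=
  Submodule.mapQ _ _ (f.restrict (hf k)) fun v hv => hf (k - 1) v hv

/-- The classes in homology that are represented by cycles in `V`. -/
def homologyPart (d : M →ₗ[ℤ] M) (V : Submodule ℤ M) : Submodule ℤ (Homology d) :=
  (V.submoduleOf (LinearMap.ker d)).map (Submodule.mkQ _)

end Algebra

/-- The subgroup of the chains of filtration level at most `k`. -/
def levelLE {N m : ℕ} (D : Grid N) (Q : D.Gen m → ℤ) (k : ℤ) : Submodule ℤ (D.Chain m) :=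
  Finsupp.supported ℤ ℤ {x | Q x ≤ k}

/-- The chains of Alexander grading `a`. -/
def degreePart {N m : ℕ} [NeZero m] (D : Grid N) (a : ℚ) : Submodule ℤ (D.Chain m) :=
  Finsupp.supported ℤ ℤ {x | D.alexander x = a}

end GridCover

end

noncomputable section

namespace GridCover

open FormalMove
open Equiv (swap swap_apply_def swap_apply_eq_iff swap_apply_left swap_apply_of_ne_of_ne swap_apply_right
  swap_apply_self swap_comm)

/-! ### Cyclic intervals -/

@[grind =]
theorem cycIco_iff {N : ℕ} {a b k : Fin N} :
    cycIco a b k ↔ ((a : ℕ) ≤ k ∧ (k : ℕ) < b) ∨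
      ((b : ℕ) < a ∧ ((a : ℕ) ≤ k ∨ (k : ℕ) < b)) := by
  unfold cycIco
  rw [Fin.val_sub, Fin.val_sub]
  have h : ∀ x : Fin N, (N - (a : ℕ) + x) % N =
      if (a : ℕ) ≤ x then (x : ℕ) - a else N - a + x := by
    intro x
    split_ifs with h
    · rw [show N - (a : ℕ) + x = (x - a) + N by omega, Nat.add_mod_right, Nat.mod_eq_of_lt (by omega)]
    · exact Nat.mod_eq_of_lt (by omega)
  rw [h, h]
  split_ifs <;> omega

@[grind =]
theorem cycIoo_iff {N : ℕ} {a b k : Fin N} :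
    cycIoo a b k ↔ ((a : ℕ) < k ∧ (k : ℕ) < b) ∨
      ((b : ℕ) ≤ a ∧ ((a : ℕ) < k ∨ (k : ℕ) < b)) ∧ a ≠ b := by
  rw [cycIoo, cycIco_iff, ne_eq, Fin.ext_iff, ne_eq, Fin.ext_iff]
  omega

theorem fin_ne_iff {N : ℕ} {a b : Fin N} : a ≠ b ↔ (a : ℕ) ≠ b := by rw [ne_eq, Fin.ext_iff]

/-- The closed cyclic interval from `a` to `b`. -/
def cycIcc {N : ℕ} (a b k : Fin N) : Prop := cycIco a b k ∨ k = b

@[grind =]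
theorem cycIcc_iff {N : ℕ} {a b k : Fin N} :
    cycIcc a b k ↔ ((a : ℕ) ≤ k ∧ (k : ℕ) ≤ b) ∨
      ((b : ℕ) < a ∧ ((a : ℕ) ≤ k ∨ (k : ℕ) ≤ b)) ∨ (k : ℕ) = b := by
  rw [cycIcc, cycIco_iff, Fin.ext_iff]
  omega

theorem cycIcc_left {N : ℕ} (a b : Fin N) : cycIcc a b a := by rw [cycIcc_iff]; omega

theorem cycIcc_right {N : ℕ} (a b : Fin N) : cycIcc a b b := Or.inr rfl

theorem cycIoo.icc {N : ℕ} {a b k : Fin N} (h : cycIoo a b k) : cycIcc a b k := Or.inl h.2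

theorem cycIco_left {N : ℕ} {a b : Fin N} (h : a ≠ b) : cycIco a b a := by rw [cycIco_iff]; omega

theorem not_cycIco_right {N : ℕ} (a b : Fin N) : ¬ cycIco a b b := by rw [cycIco_iff]; omega

theorem cycIco_or {N : ℕ} {a b : Fin N} (h : a ≠ b) (k : Fin N) :
    cycIco a b k ∨ cycIco b a k := by
  rw [cycIco_iff, cycIco_iff]; omega

theorem cycIco_split {N : ℕ} {a b d : Fin N} (h : cycIco a d b) (k : Fin N) :
    cycIco a d k ↔ cycIco a b k ∨ cycIco b d k := by
  rw [cycIco_iff] at *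
  rw [cycIco_iff, cycIco_iff]; omega

theorem cycIoo_cases {N : ℕ} {s t u : Fin N} (hst : s ≠ t) (hsu : s ≠ u) (htu : t ≠ u) :
    cycIoo s u t ∨ cycIoo s t u := by
  rw [cycIoo_iff, cycIoo_iff, fin_ne_iff]; omega

/-! ### Rectangles in a branched cover -/

/-- Bijections from the lifts of the alpha circles to the lifts of the beta circles. -/
abbrev State (N m : ℕ) : Type := Curve N m ≃ Curve N m

/-- The components on `s` and `t` are replaced by the other two corners of a rectangle. -/
def mv {N m : ℕ} (σ : State N m) (s t : Curve N m) : State N m := (swap s t).trans σ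

section mv

variable {N m : ℕ} (σ : State N m) (s t : Curve N m)

@[simp] theorem mv_left : mv σ s t s = σ t := by simp [mv]

@[simp] theorem mv_right : mv σ s t t = σ s := by simp [mv]

variable {s t} in
theorem mv_of_ne {p : Curve N m} (hs : p ≠ s) (ht : p ≠ t) : mv σ s t p = σ p := by
  simp [mv, swap_apply_of_ne_of_ne hs ht]

theorem mv_symm_apply (q : Curve N m) : (mv σ s t).symm q = swap s t (σ.symm q) := by
  simp [mv]

end mv

namespace Grid

variable {N m : ℕ} (D : Grid N)

/-- Every component of `σ` is an intersection point. -/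
def IsGen (σ : State N m) : Prop := ∀ p, D.Meets p (σ p)

/-- No component of `σ` lies in the interior of the lifted rectangle. -/
def Clear (σ : State N m) (i₀ i₁ : Fin N) (q : Curve N m) (j₁ : Fin N) : Prop :=
  ∀ p : Curve N m, cycIoo i₀ i₁ p.1 → cycIoo q.1 j₁ (σ p).1 → ¬ D.Meets p q

/-- There is an empty rectangle that starts at `σ` with lower left corner on `s` and upper right
corner on `t`. -/
structure Rect (σ : State N m) (s t : Curve N m) : Prop where
  row : s.1 ≠ t.1
  col : (σ s).1 ≠ (σ t).1
  ms : D.Meets s (σ t)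
  mt : D.Meets t (σ s)
  noMarking : D.NoMarking s.1 t.1 (σ s).1 (σ t).1
  clear : D.Clear σ s.1 t.1 (σ s) (σ t).1

variable {D}

theorem Meets.left_unique {p p' q : Curve N m} (h : D.Meets p q) (h' : D.Meets p' q)
    (hp : p.1 = p'.1) : p = p' := by
  unfold Meets at h h'
  refine Prod.ext hp ?_
  rw [hp] at h
  exact add_right_cancel (h.symm.trans h')

theorem Meets.right_unique {p q q' : Curve N m} (h : D.Meets p q) (h' : D.Meets p q')
    (hq : q.1 = q'.1) : q = q' := by
  unfold Meets at h h'
  refine Prod.ext hq ?_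
  rw [h, h', hq]

theorem cross_eq (i j : Fin N) :
    D.cross i j = (if D.O j < i then 1 else 0) - (if D.X j < i then 1 else 0) := by
  have h1 := D.disjoint j
  unfold cross
  simp only [Fin.lt_def, Fin.le_def]
  split_ifs <;> omega

theorem sum_cross (i : Fin N) : ∑ j, D.cross i j = 0 := by
  simp only [cross_eq, Finset.sum_sub_distrib]
  rw [Equiv.sum_comp D.O (fun r => if r < i then (1 : ℤ) else 0),
    Equiv.sum_comp D.X (fun r => if r < i then (1 : ℤ) else 0), sub_self]

open Classical in
theorem shift_sub_shift (i j₀ j : Fin N) :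
    D.shift i j - D.shift i j₀ = ∑ k, if cycIco j₀ j k then D.cross i k else 0 := by
  unfold shift
  by_cases h : j₀ ≤ j
  · rw [← Finset.sum_sub_distrib]
    refine Finset.sum_congr rfl fun k _ => ?_
    rw [Fin.le_def] at h
    simp only [cycIco_iff, Fin.lt_def]
    split_ifs <;> omega
  · have h0 := D.sum_cross i
    rw [← sub_eq_zero, ← h0, ← Finset.sum_sub_distrib, ← Finset.sum_sub_distrib, h0,
      ← neg_eq_zero, ← h0, ← Finset.sum_neg_distrib]
    refine Finset.sum_congr rfl fun k _ => ?_
    rw [not_le, Fin.lt_def] at h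
    simp only [cycIco_iff, Fin.lt_def]
    split_ifs <;> omega

theorem cross_congr {i₀ i₁ i i' j : Fin N} (hX : ¬ cycIco i₀ i₁ (D.X j))
    (hO : ¬ cycIco i₀ i₁ (D.O j)) (hi : cycIcc i₀ i₁ i) (hi' : cycIcc i₀ i₁ i') :
    D.cross i j = D.cross i' j := by
  rw [cross_eq, cross_eq]
  rw [cycIco_iff] at hX hO
  rw [cycIcc_iff] at hi hi'
  simp only [Fin.lt_def]
  split_ifs <;> omega

theorem Meets.transport' {i₀ i₁ j₀ j₁ : Fin N}
    (hflat : ∀ j, cycIco j₀ j₁ j → ∀ i i', cycIcc i₀ i₁ i → cycIcc i₀ i₁ i' →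
      D.cross i j = D.cross i' j)
    {p p' q q' : Curve N m} (hp : cycIcc i₀ i₁ p.1) (hp' : cycIcc i₀ i₁ p'.1)
    (hq : cycIcc j₀ j₁ q.1) (hq' : cycIcc j₀ j₁ q'.1)
    (h1 : D.Meets p q) (h2 : D.Meets p q') (h3 : D.Meets p' q) : D.Meets p' q' := by
  classical
  have key : ∀ j, cycIcc j₀ j₁ j →
      D.shift p.1 j - D.shift p.1 j₀ = D.shift p'.1 j - D.shift p'.1 j₀ := by
    intro j hj
    rw [shift_sub_shift, shift_sub_shift]
    refine Finset.sum_congr rfl fun k _ => ?_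
    split_ifs with hk
    · refine hflat k ?_ _ _ hp hp'
      rw [cycIcc_iff] at hj
      rw [cycIco_iff] at *
      omega
    · rfl
  have e : D.shift p.1 q'.1 - D.shift p.1 q.1 = D.shift p'.1 q'.1 - D.shift p'.1 q.1 := by
    have := key _ hq
    have := key _ hq'
    omega
  have e' := congrArg (Int.cast : ℤ → ZMod m) e
  push_cast at e'
  unfold Meets at *
  linear_combination h2 - h1 + h3 + e'

theorem NoMarking.flat {i₀ i₁ j₀ j₁ : Fin N} (h : D.NoMarking i₀ i₁ j₀ j₁) :
    ∀ j, cycIco j₀ j₁ j → ∀ i i', cycIcc i₀ i₁ i → cycIcc i₀ i₁ i' →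
      D.cross i j = D.cross i' j :=
  fun j hj _ _ hi hi' => cross_congr (h j hj).1 (h j hj).2 hi hi'

theorem NoMarking.transport {i₀ i₁ j₀ j₁ : Fin N} (h : D.NoMarking i₀ i₁ j₀ j₁)
    {p p' q q' : Curve N m} (hp : cycIcc i₀ i₁ p.1) (hp' : cycIcc i₀ i₁ p'.1)
    (hq : cycIcc j₀ j₁ q.1) (hq' : cycIcc j₀ j₁ q'.1)
    (h1 : D.Meets p q) (h2 : D.Meets p q') (h3 : D.Meets p' q) : D.Meets p' q' :=
  Meets.transport' h.flat hp hp' hq hq' h1 h2 h3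

theorem NoMarking.mono {i₀ i₁ j₀ j₁ i₀' i₁' j₀' j₁' : Fin N} (h : D.NoMarking i₀ i₁ j₀ j₁)
    (hi : ∀ i, cycIco i₀' i₁' i → cycIco i₀ i₁ i) (hj : ∀ j, cycIco j₀' j₁' j → cycIco j₀ j₁ j) :
    D.NoMarking i₀' i₁' j₀' j₁' :=
  fun j hj' => ⟨fun h' => (h j (hj j hj')).1 (hi _ h'), fun h' => (h j (hj j hj')).2 (hi _ h')⟩

theorem NoMarking.not_cover_row {i₀ i₁ j₀ j₁ i₀' i₁' j₀' j₁' i : Fin N}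
    (h : D.NoMarking i₀ i₁ j₀ j₁) (h' : D.NoMarking i₀' i₁' j₀' j₁')
    (hi : cycIco i₀ i₁ i) (hi' : cycIco i₀' i₁' i)
    (hc : ∀ j, cycIco j₀ j₁ j ∨ cycIco j₀' j₁' j) : False := by
  rcases hc (D.X.symm i) with hj | hj
  · exact (h _ hj).1 (by simpa using hi)
  · exact (h' _ hj).1 (by simpa using hi')

theorem NoMarking.not_cover_col {i₀ i₁ j₀ j₁ i₀' i₁' j₀' j₁' j : Fin N}
    (h : D.NoMarking i₀ i₁ j₀ j₁) (h' : D.NoMarking i₀' i₁' j₀' j₁')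
    (hj : cycIco j₀ j₁ j) (hj' : cycIco j₀' j₁' j)
    (hc : ∀ i, cycIco i₀ i₁ i ∨ cycIco i₀' i₁' i) : False := by
  rcases hc (D.X j) with hi | hi
  · exact (h _ hj).1 hi
  · exact (h' _ hj').1 hi

theorem IsGen.mv {σ : State N m} (hσ : D.IsGen σ) {s t : Curve N m} (ms : D.Meets s (σ t))
    (mt : D.Meets t (σ s)) : D.IsGen (mv σ s t) := by
  intro p
  by_cases hs : p = s
  · subst hs; simpa using ms
  · by_cases ht : p = t
    · subst ht; simpa using mt
    · rw [mv_of_ne σ hs ht]; exact hσ p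

theorem Rect.isGen {σ : State N m} (hσ : D.IsGen σ) {s t : Curve N m} (h : D.Rect σ s t) :
    D.IsGen (GridCover.mv σ s t) := hσ.mv h.ms h.mt

theorem Rect.ne {σ : State N m} {s t : Curve N m} (h : D.Rect σ s t) : s ≠ t :=
  fun e => h.row (congrArg Prod.fst e)

theorem isRect_iff {x y : D.Gen m} {s t : Curve N m} :
    D.IsRect x y s t ↔ D.Rect x.1 s t ∧ y.1 = GridCover.mv x.1 s t := by
  constructor
  · rintro ⟨h1, h2, h3, h4, h5⟩
    have hs := y.2 s
    have ht := y.2 t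
    rw [h3] at hs ht
    exact ⟨⟨h1, h2, by simpa using hs, by simpa using ht, h4, h5⟩, h3⟩
  · rintro ⟨h, h3⟩
    exact ⟨h.row, h.col, h3, h.noMarking, h.clear⟩

end Grid

namespace Grid

variable {N m : ℕ} {D : Grid N} {σ : State N m} {s t u : Curve N m}

/-! ### L-shaped hexagons -/

theorem Rect.hexagon₁ (hσ : D.IsGen σ) (hsu : s ≠ u) (htu : t ≠ u)
    (h1 : D.Rect σ s t) (h2 : D.Rect (mv σ s t) s u) (ht : cycIoo s.1 u.1 t.1) :
    D.Rect σ t u ∧ D.Rect (mv σ t u) s t ∧ cycIoo (σ s).1 (σ u).1 (σ t).1 := by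
  have hst := h1.ne
  obtain ⟨r1, c1, ms1, mt1, n1, k1⟩ := h1
  obtain ⟨r2, c2, ms2, mt2, n2, k2⟩ := h2
  rw [mv_left, mv_of_ne σ hsu.symm htu.symm] at c2 n2 k2
  rw [mv_of_ne σ hsu.symm htu.symm] at ms2
  rw [mv_left] at mt2
  have hc : cycIoo (σ s).1 (σ u).1 (σ t).1 := by
    by_contra hc
    refine n1.not_cover_row n2 (cycIco_left r1) (cycIco_left r2) fun j => ?_
    grind
  have hrow : t.1 ≠ u.1 := by grind
  have mtu : D.Meets t (σ u) := n2.transport (cycIcc_left _ _) ht.icc (cycIcc_left _ _)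
    (cycIcc_right _ _) ms1 ms2 (hσ t)
  refine ⟨⟨hrow, c2, mtu, mt2, ?_, ?_⟩, ⟨r1, ?_, ?_, ?_, ?_, ?_⟩, hc⟩
  · refine n2.mono (fun i hi => ?_) (fun j hj => hj)
    grind
  · intro p hp hq
    have hps : p ≠ s := by grind
    have hpt : p ≠ t := by rintro rfl; exact hp.1 rfl
    refine k2 p ?_ (by rwa [mv_of_ne σ hps hpt])
    grind
  · rw [mv_of_ne σ hst hsu, mv_left]
    grind
  · rwa [mv_left]
  · rwa [mv_of_ne σ hst hsu]
  · rw [mv_of_ne σ hst hsu, mv_left]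
    intro j hj
    rw [cycIco_split hc.2] at hj
    rcases hj with hj | hj
    · exact n1 j hj
    · refine (n2.mono (fun i hi => ?_) (fun j hj => hj)) j hj
      grind
  · rw [mv_of_ne σ hst hsu, mv_left]
    intro p hp hq hm
    have hps : p ≠ s := by rintro rfl; exact hp.1 rfl
    have hpt : p ≠ t := by grind
    have hpu : p ≠ u := by grind
    rw [mv_of_ne σ hpt hpu] at hq
    have hmt : D.Meets p (σ t) := n1.transport (cycIcc_left _ _) hp.icc (cycIcc_left _ _)
      (cycIcc_right _ _) (hσ s) ms1 hm
    have hcol : (σ p).1 ≠ (σ t).1 := fun e =>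
      hpt (σ.injective ((hσ p).right_unique hmt e))
    by_cases hl : cycIoo (σ s).1 (σ t).1 (σ p).1
    · exact k1 p hp hl hm
    · refine k2 p ?_ ?_ ?_
      · grind
      · rw [mv_of_ne σ hps hpt]
        grind
      · exact hmt

theorem Rect.hexagon₁' (hσ : D.IsGen σ) (hsu : s ≠ u)
    (h1 : D.Rect σ t u) (h2 : D.Rect (mv σ t u) s t) (hc : cycIoo (σ s).1 (σ u).1 (σ t).1) :
    D.Rect σ s t ∧ D.Rect (mv σ s t) s u ∧ cycIoo s.1 u.1 t.1 := by
  have htu := h1.ne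
  have hst := h2.ne
  obtain ⟨r1, c1, ms1, mt1, n1, k1⟩ := h1
  obtain ⟨r2, c2, ms2, mt2, n2, k2⟩ := h2
  rw [mv_left, mv_of_ne σ hst hsu] at c2 n2 k2
  rw [mv_of_ne σ hst hsu] at mt2
  rw [mv_left] at ms2
  have ht : cycIoo s.1 u.1 t.1 := by
    by_contra hc'
    refine n1.not_cover_col n2 (cycIco_left c1) hc.2 fun j => ?_
    grind
  have mst : D.Meets s (σ t) := n2.transport (cycIcc_right _ _) (cycIcc_left _ _) (cycIcc_left _ _)
    hc.icc mt2 (hσ t) (hσ s)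
  have hrow : s.1 ≠ u.1 := by grind
  refine ⟨⟨r2, ?_, mst, mt2, ?_, ?_⟩, ⟨hrow, ?_, ?_, ?_, ?_, ?_⟩, ht⟩
  · exact fun e => hc.1 e.symm
  · refine n2.mono (fun i hi => hi) (fun j hj => ?_)
    grind
  · intro p hp hq hm
    have hpt : p ≠ t := by grind
    have hpu : p ≠ u := by grind
    refine k2 p hp ?_ hm
    rw [mv_of_ne σ hpt hpu]
    grind
  · rwa [mv_left, mv_of_ne σ hsu.symm htu.symm]
  · rwa [mv_of_ne σ hsu.symm htu.symm]
  · rwa [mv_left]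
  · rw [mv_left, mv_of_ne σ hsu.symm htu.symm]
    intro j hj
    rw [cycIco_split ht.2, cycIco_split ht.2]
    have a := n1 j hj
    have b := n2 j (by rw [cycIco_split hc.2]; exact Or.inr hj)
    tauto
  · rw [mv_left, mv_of_ne σ hsu.symm htu.symm]
    intro p hp hq hm
    have hps : p ≠ s := by rintro rfl; exact hp.1 rfl
    have hpu : p ≠ u := by grind
    by_cases hpt : p.1 = t.1
    · have : p = t := hm.left_unique (hσ t) hpt
      subst this
      rw [mv_right] at hq
      grind
    · have hpt' : p ≠ t := fun e => hpt (congrArg Prod.fst e)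
      rw [mv_of_ne σ hps hpt'] at hq
      by_cases hl : cycIoo s.1 t.1 p.1
      · refine k2 p hl ?_ ?_
        · rw [mv_of_ne σ hpt' hpu]
          grind
        · exact n2.transport (cycIcc_left _ _) hl.icc hc.icc (cycIcc_left _ _) mst (hσ s) hm
      · refine k1 p ?_ hq hm
        grind

theorem Rect.hexagon₂ (hσ : D.IsGen σ) (hsu : s ≠ u) (htu : t ≠ u)
    (h1 : D.Rect σ s t) (h2 : D.Rect (mv σ s t) s u) (ht : cycIoo s.1 t.1 u.1) :
    D.Rect σ s u ∧ D.Rect (mv σ s u) u t ∧ cycIoo (σ s).1 (σ u).1 (σ t).1 := by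
  have hst := h1.ne
  obtain ⟨r1, c1, ms1, mt1, n1, k1⟩ := h1
  obtain ⟨r2, c2, ms2, mt2, n2, k2⟩ := h2
  rw [mv_left, mv_of_ne σ hsu.symm htu.symm] at c2 n2 k2
  rw [mv_of_ne σ hsu.symm htu.symm] at ms2
  rw [mv_left] at mt2
  have hc : cycIoo (σ s).1 (σ u).1 (σ t).1 := by
    by_contra hc
    refine n1.not_cover_row n2 (cycIco_left r1) (cycIco_left r2) fun j => ?_
    grind
  have mus : D.Meets u (σ s) := n1.transport (cycIcc_left _ _) ht.icc (cycIcc_right _ _)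
    (cycIcc_left _ _) ms1 (hσ s) mt2
  have hrow : u.1 ≠ t.1 := by grind
  refine ⟨⟨r2, ?_, ms2, mus, ?_, ?_⟩, ⟨hrow, ?_, ?_, ?_, ?_, ?_⟩, hc⟩
  · grind
  · intro j hj
    rw [cycIco_split hc.2] at hj
    rcases hj with hj | hj
    · refine (n1.mono (fun i hi => ?_) (fun j hj => hj)) j hj
      grind
    · exact n2 j hj
  · intro p hp hq hm
    have hps : p ≠ s := by rintro rfl; exact hp.1 rfl
    have hpt : p ≠ t := by grind
    have hmt : D.Meets p (σ t) := n1.transport (cycIcc_left _ _)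
      (by grind) (cycIcc_left _ _)
      (cycIcc_right _ _) (hσ s) ms1 hm
    have hcol : (σ p).1 ≠ (σ t).1 := fun e =>
      hpt (σ.injective ((hσ p).right_unique hmt e))
    by_cases hl : cycIoo (σ s).1 (σ t).1 (σ p).1
    · refine k1 p ?_ hl hm
      grind
    · refine k2 p hp ?_ hmt
      rw [mv_of_ne σ hps hpt]
      grind
  · rwa [mv_right, mv_of_ne σ hst.symm htu]
  · rwa [mv_of_ne σ hst.symm htu]
  · rwa [mv_right]
  · rw [mv_right, mv_of_ne σ hst.symm htu]
    refine n1.mono (fun i hi => ?_) (fun j hj => hj)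
    grind
  · rw [mv_right, mv_of_ne σ hst.symm htu]
    intro p hp hq hm
    have hps : p ≠ s := by grind
    have hpu : p ≠ u := by rintro rfl; exact hp.1 rfl
    rw [mv_of_ne σ hps hpu] at hq
    refine k1 p ?_ hq hm
    grind

theorem Rect.hexagon₂' (hσ : D.IsGen σ) (hst : s ≠ t)
    (h1 : D.Rect σ s u) (h2 : D.Rect (mv σ s u) u t) (hc : cycIoo (σ s).1 (σ u).1 (σ t).1) :
    D.Rect σ s t ∧ D.Rect (mv σ s t) s u ∧ cycIoo s.1 t.1 u.1 := by
  have hsu := h1.ne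
  have htu := h2.ne.symm
  obtain ⟨r1, c1, ms1, mt1, n1, k1⟩ := h1
  obtain ⟨r2, c2, ms2, mt2, n2, k2⟩ := h2
  rw [mv_right, mv_of_ne σ hst.symm htu] at c2 n2 k2
  rw [mv_of_ne σ hst.symm htu] at ms2
  rw [mv_right] at mt2
  have ht : cycIoo s.1 t.1 u.1 := by
    by_contra hc'
    refine n1.not_cover_col n2 (cycIco_left c1) (cycIco_left c2) fun j => ?_
    grind
  have mst : D.Meets s (σ t) := n1.transport (cycIcc_right _ _) (cycIcc_left _ _) (cycIcc_left _ _)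
    hc.icc mt1 ms2 (hσ s)
  have hrow : s.1 ≠ t.1 := by grind
  refine ⟨⟨hrow, c2, mst, mt2, ?_, ?_⟩, ⟨r1, ?_, ?_, ?_, ?_, ?_⟩, ht⟩
  · intro j hj
    rw [cycIco_split ht.2, cycIco_split ht.2]
    have a := n1 j (by rw [cycIco_split hc.2]; exact Or.inl hj)
    have b := n2 j hj
    tauto
  · intro p hp hq hm
    have hps : p ≠ s := by rintro rfl; exact hp.1 rfl
    by_cases hpu : p.1 = u.1
    · have : p = u := hm.left_unique mt1 hpu
      subst this
      grind
    · have hpu' : p ≠ u := fun e => hpu (congrArg Prod.fst e)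
      by_cases hl : cycIoo s.1 u.1 p.1
      · refine k1 p hl ?_ hm
        grind
      · refine k2 p ?_ ?_ hm
        · rw [← ne_eq] at hpu
          grind
        · rwa [mv_of_ne σ hps hpu']
  · rw [mv_left, mv_of_ne σ hsu.symm htu.symm]
    grind
  · rwa [mv_of_ne σ hsu.symm htu.symm]
  · rwa [mv_left]
  · rw [mv_left, mv_of_ne σ hsu.symm htu.symm]
    refine n1.mono (fun i hi => hi) (fun j hj => ?_)
    grind
  · rw [mv_left, mv_of_ne σ hsu.symm htu.symm]
    intro p hp hq hm
    have hps : p ≠ s := by rintro rfl; exact hp.1 rfl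
    have hpt : p ≠ t := by grind
    rw [mv_of_ne σ hps hpt] at hq
    refine k1 p hp ?_ ?_
    · clear hp ht
      grind
    · exact n1.transport (cycIcc_left _ _) hp.icc hc.icc (cycIcc_left _ _) mst (hσ s) hm

theorem Rect.hexagon₃ (hσ : D.IsGen σ) (hsu : s ≠ u) (htu : t ≠ u)
    (h1 : D.Rect σ s t) (h2 : D.Rect (mv σ s t) u t) (ht : cycIoo s.1 t.1 u.1) :
    D.Rect σ u t ∧ D.Rect (mv σ u t) s u ∧ cycIoo (σ u).1 (σ t).1 (σ s).1 := by
  have hst := h1.ne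
  obtain ⟨r1, c1, ms1, mt1, n1, k1⟩ := h1
  obtain ⟨r2, c2, ms2, mt2, n2, k2⟩ := h2
  rw [mv_right, mv_of_ne σ hsu.symm htu.symm] at c2 n2 k2
  rw [mv_of_ne σ hsu.symm htu.symm] at mt2
  rw [mv_right] at ms2
  have hc : cycIoo (σ u).1 (σ t).1 (σ s).1 := by
    by_contra hc
    refine n1.not_cover_row n2 ht.2 (cycIco_left r2) fun j => ?_
    grind
  have hut : D.Meets u (σ t) := n1.transport (cycIcc_left _ _) ht.icc (cycIcc_left _ _)
    (cycIcc_right _ _) (hσ s) ms1 ms2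
  have hcol : (σ u).1 ≠ (σ t).1 := by grind
  have hrow : s.1 ≠ u.1 := by grind
  refine ⟨⟨r2, hcol, hut, mt2, ?_, ?_⟩, ⟨hrow, ?_, ?_, ?_, ?_, ?_⟩, hc⟩
  · intro j hj
    rw [cycIco_split hc.2] at hj
    rcases hj with hj | hj
    · exact n2 j hj
    · refine (n1.mono (fun i hi => ?_) (fun j hj => hj)) j hj
      grind
  · intro p hp hq hm
    have hps : p ≠ s := by grind
    have hpt : p ≠ t := by grind
    have hms : D.Meets p (σ s) := n2.transport (cycIcc_left _ _) hp.icc (cycIcc_left _ _)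
      (cycIcc_right _ _) (hσ u) ms2 hm
    have hcs : (σ p).1 ≠ (σ s).1 := fun e =>
      hps (σ.injective ((hσ p).right_unique hms e))
    by_cases hl : cycIoo (σ u).1 (σ s).1 (σ p).1
    · exact k2 p hp (by rwa [mv_of_ne σ hps hpt]) hm
    · refine k1 p ?_ ?_ hms
      · clear hl hq hc
        grind
      · rw [fin_ne_iff] at hcs
        grind
  · rwa [mv_left, mv_of_ne σ hsu hst]
  · rwa [mv_left]
  · rwa [mv_of_ne σ hsu hst]
  · rw [mv_left, mv_of_ne σ hsu hst]
    refine n1.mono (fun i hi => ?_) (fun j hj => hj)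
    grind
  · rw [mv_left, mv_of_ne σ hsu hst]
    intro p hp hq hm
    have hpu : p ≠ u := by grind
    have hpt : p ≠ t := by grind
    rw [mv_of_ne σ hpu hpt] at hq
    refine k1 p ?_ hq hm
    grind

theorem Rect.hexagon₃' (hσ : D.IsGen σ) (hst : s ≠ t)
    (h1 : D.Rect σ u t) (h2 : D.Rect (mv σ u t) s u) (hc : cycIoo (σ u).1 (σ t).1 (σ s).1) :
    D.Rect σ s t ∧ D.Rect (mv σ s t) u t ∧ cycIoo s.1 t.1 u.1 := by
  have hut := h1.ne
  have hsu := h2.ne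
  obtain ⟨r1, c1, ms1, mt1, n1, k1⟩ := h1
  obtain ⟨r2, c2, ms2, mt2, n2, k2⟩ := h2
  rw [mv_left, mv_of_ne σ hsu hst] at c2 n2 k2
  rw [mv_of_ne σ hsu hst] at mt2
  rw [mv_left] at ms2
  have ht : cycIoo s.1 t.1 u.1 := by
    by_contra hc'
    refine n1.not_cover_col n2 hc.2 (cycIco_left c2) fun j => ?_
    grind
  have mts : D.Meets t (σ s) := n1.transport (cycIcc_left _ _) (cycIcc_right _ _) (cycIcc_left _ _)
    hc.icc (hσ u) mt2 mt1
  have hrow : s.1 ≠ t.1 := by grind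
  refine ⟨⟨hrow, c2, ms2, mts, ?_, ?_⟩, ⟨r1, ?_, ?_, ?_, ?_, ?_⟩, ht⟩
  · intro j hj
    rw [cycIco_split ht.2, cycIco_split ht.2]
    have a := n1 j (by rw [cycIco_split hc.2]; exact Or.inr hj)
    have b := n2 j hj
    tauto
  · intro p hp hq hm
    have hpt : p ≠ t := by grind
    by_cases hpu : p.1 = u.1
    · have : p = u := hm.left_unique mt2 hpu
      subst this
      grind
    · have hpu' : p ≠ u := fun e => hpu (congrArg Prod.fst e)
      by_cases hl : cycIoo s.1 u.1 p.1
      · exact k2 p hl (by rwa [mv_of_ne σ hpu' hpt]) hm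
      · have hp' : cycIoo u.1 t.1 p.1 := by
          grind
        refine k1 p hp' ?_ ?_
        · clear hl hp ht hp'
          grind
        · exact n1.transport (cycIcc_left _ _) hp'.icc hc.icc (cycIcc_left _ _) mt2 (hσ u) hm
  · rw [mv_right, mv_of_ne σ hsu.symm hut]
    grind
  · rwa [mv_right]
  · rwa [mv_of_ne σ hsu.symm hut]
  · rw [mv_right, mv_of_ne σ hsu.symm hut]
    refine n1.mono (fun i hi => hi) (fun j hj => ?_)
    grind
  · rw [mv_right, mv_of_ne σ hsu.symm hut]
    intro p hp hq hm
    have hpt : p ≠ t := by grind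
    have hps : p ≠ s := by grind
    rw [mv_of_ne σ hps hpt] at hq
    refine k1 p hp ?_ hm
    grind

theorem Rect.hexagon₄ (hσ : D.IsGen σ) (hsu : s ≠ u) (htu : t ≠ u)
    (h1 : D.Rect σ s t) (h2 : D.Rect (mv σ s t) u t) (ht : cycIoo u.1 t.1 s.1) :
    D.Rect σ u s ∧ D.Rect (mv σ u s) s t ∧ cycIoo (σ u).1 (σ t).1 (σ s).1 := by
  have hst := h1.ne
  obtain ⟨r1, c1, ms1, mt1, n1, k1⟩ := h1
  obtain ⟨r2, c2, ms2, mt2, n2, k2⟩ := h2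
  rw [mv_right, mv_of_ne σ hsu.symm htu.symm] at c2 n2 k2
  rw [mv_of_ne σ hsu.symm htu.symm] at mt2
  rw [mv_right] at ms2
  have hc : cycIoo (σ u).1 (σ t).1 (σ s).1 := by
    by_contra hc
    refine n1.not_cover_row n2 (cycIco_left r1) ht.2 fun j => ?_
    grind
  have msu : D.Meets s (σ u) := n2.transport (cycIcc_left _ _) ht.icc (cycIcc_right _ _)
    (cycIcc_left _ _) ms2 (hσ u) (hσ s)
  have hcol : (σ u).1 ≠ (σ t).1 := by grind
  have hrow : u.1 ≠ s.1 := by grind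
  refine ⟨⟨hrow, c2, ms2, msu, ?_, ?_⟩, ⟨r1, ?_, ?_, ?_, ?_, ?_⟩, hc⟩
  · refine n2.mono (fun i hi => ?_) (fun j hj => hj)
    grind
  · intro p hp hq hm
    have hps : p ≠ s := by grind
    have hpt : p ≠ t := by grind
    refine k2 p ?_ (by rwa [mv_of_ne σ hps hpt]) hm
    grind
  · rwa [mv_right, mv_of_ne σ htu hst.symm]
  · rwa [mv_of_ne σ htu hst.symm]
  · rwa [mv_right]
  · rw [mv_right, mv_of_ne σ htu hst.symm]
    intro j hj
    rw [cycIco_split hc.2] at hj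
    rcases hj with hj | hj
    · refine (n2.mono (fun i hi => ?_) (fun j hj => hj)) j hj
      grind
    · exact n1 j hj
  · rw [mv_right, mv_of_ne σ htu hst.symm]
    intro p hp hq hm
    have hps : p ≠ s := by rintro rfl; exact hp.1 rfl
    have hpt : p ≠ t := by grind
    have hpu : p ≠ u := by grind
    rw [mv_of_ne σ hpu hps] at hq
    have hp' : cycIoo u.1 t.1 p.1 := by grind
    have hms : D.Meets p (σ s) := n2.transport (cycIcc_left _ _) hp'.icc (cycIcc_left _ _)
      (cycIcc_right _ _) (hσ u) ms2 hm
    have hcs : (σ p).1 ≠ (σ s).1 := fun e =>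
      hps (σ.injective ((hσ p).right_unique hms e))
    by_cases hl : cycIoo (σ u).1 (σ s).1 (σ p).1
    · exact k2 p hp' (by rwa [mv_of_ne σ hps hpt]) hm
    · refine k1 p hp ?_ hms
      grind

theorem Rect.hexagon₄' (hσ : D.IsGen σ) (hut : u ≠ t)
    (h1 : D.Rect σ u s) (h2 : D.Rect (mv σ u s) s t) (hc : cycIoo (σ u).1 (σ t).1 (σ s).1) :
    D.Rect σ s t ∧ D.Rect (mv σ s t) u t ∧ cycIoo u.1 t.1 s.1 := by
  have hus := h1.ne
  have hst := h2.ne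
  obtain ⟨r1, c1, ms1, mt1, n1, k1⟩ := h1
  obtain ⟨r2, c2, ms2, mt2, n2, k2⟩ := h2
  rw [mv_right, mv_of_ne σ hut.symm hst.symm] at c2 n2 k2
  rw [mv_of_ne σ hut.symm hst.symm] at ms2
  rw [mv_right] at mt2
  have ht : cycIoo u.1 t.1 s.1 := by
    by_contra hc'
    refine n1.not_cover_col n2 (cycIco_left c1) (cycIco_left c2) fun j => ?_
    grind
  have mts : D.Meets t (σ s) := n2.transport (cycIcc_left _ _) (cycIcc_right _ _) (cycIcc_left _ _)
    hc.icc mt1 (hσ s) mt2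
  have hrow : u.1 ≠ t.1 := by grind
  refine ⟨⟨r2, ?_, ms2, mts, ?_, ?_⟩, ⟨hrow, ?_, ?_, ?_, ?_, ?_⟩, ht⟩
  · grind
  · refine n2.mono (fun i hi => hi) (fun j hj => ?_)
    grind
  · intro p hp hq hm
    have hps : p ≠ s := by rintro rfl; exact hp.1 rfl
    have hpu : p ≠ u := by grind
    refine k2 p hp ?_ ?_
    · rw [mv_of_ne σ hpu hps]
      grind
    · exact n2.transport (cycIcc_left _ _) hp.icc hc.icc (cycIcc_left _ _) (hσ s) mt1 hm
  · rwa [mv_right, mv_of_ne σ hus hut]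
  · rwa [mv_right]
  · rwa [mv_of_ne σ hus hut]
  · rw [mv_right, mv_of_ne σ hus hut]
    intro j hj
    rw [cycIco_split ht.2, cycIco_split ht.2]
    have a := n1 j hj
    have b := n2 j (by rw [cycIco_split hc.2]; exact Or.inl hj)
    tauto
  · rw [mv_right, mv_of_ne σ hus hut]
    intro p hp hq hm
    have hpu : p ≠ u := by rintro rfl; exact hp.1 rfl
    have hpt : p ≠ t := by grind
    by_cases hps : p.1 = s.1
    · have : p = s := hm.left_unique mt1 hps
      subst this
      rw [mv_left] at hq
      grind
    · have hps' : p ≠ s := fun e => hps (congrArg Prod.fst e)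
      rw [mv_of_ne σ hps' hpt] at hq
      by_cases hl : cycIoo u.1 s.1 p.1
      · exact k1 p hl hq hm
      · refine k2 p ?_ ?_ hm
        · rw [← ne_eq] at hps
          grind
        · rw [mv_of_ne σ hpu hps']
          grind

/-! ### Rectangles without common corner -/

set_option maxHeartbeats 400000 in
theorem Rect.comm {s' t' : Curve N m} (hσ : D.IsGen σ) (hss : s ≠ s') (hst : s ≠ t') (hts : t ≠ s')
    (htt : t ≠ t') (h1 : D.Rect σ s t) (h2 : D.Rect (mv σ s t) s' t') :
    D.Rect σ s' t' ∧ D.Rect (mv σ s' t') s t := by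
  obtain ⟨r1, c1, ms1, mt1, n1, k1⟩ := h1
  obtain ⟨r2, c2, ms2, mt2, n2, k2⟩ := h2
  rw [mv_of_ne σ hss.symm hts.symm, mv_of_ne σ hst.symm htt.symm] at c2 n2 k2
  rw [mv_of_ne σ hst.symm htt.symm] at ms2
  rw [mv_of_ne σ hss.symm hts.symm] at mt2
  have inj : ∀ {p p' : Curve N m}, D.Meets p (σ p') → D.Meets p (σ p) →
      (σ p).1 = (σ p').1 → p = p' := fun h h' e => σ.injective (h'.right_unique h e)
  have k2s := k2 s
  have k2t := k2 t
  rw [mv_left] at k2s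
  rw [mv_right] at k2t
  refine ⟨⟨r2, c2, ms2, mt2, n2, ?_⟩, ⟨r1, ?_, ?_, ?_, ?_, ?_⟩⟩
  · intro p hp hq hm
    by_cases hps : p = s
    · subst hps
      have e1 : D.Meets t' (σ p) := n2.transport hp.icc (cycIcc_right _ _) (cycIcc_left _ _)
        hq.icc hm (hσ p) mt2
      have e2 : t.1 ≠ t'.1 := fun e => htt (mt1.left_unique e1 e)
      have e3 : (σ t).1 ≠ (σ t').1 := by
        intro e
        have : D.Meets p (σ t') := n2.transport (cycIcc_left _ _) hp.icc (cycIcc_left _ _)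
          (cycIcc_right _ _) (hσ s') ms2 hm
        exact htt (σ.injective (ms1.right_unique this e))
      have e4 : ¬ cycIoo (σ s').1 (σ t').1 (σ t).1 := fun h => k2s hp h hm
      have e5 : ¬ cycIoo s'.1 t'.1 t.1 := by
        intro h
        refine k2t h hq ?_
        exact n2.transport hp.icc h.icc hq.icc (cycIcc_left _ _) (hσ p) hm mt1
      refine k1 t' ?_ ?_ e1
      · rw [fin_ne_iff] at e2
        grind
      · rw [fin_ne_iff] at e3
        grind
    · by_cases hpt : p = t
      · subst hpt
        have hms : D.Meets p (σ s') := hm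
        have e1 : D.Meets s' (σ p) := n2.transport hp.icc (cycIcc_left _ _) (cycIcc_left _ _)
          hq.icc hm (hσ p) (hσ s')
        have e2 : s.1 ≠ s'.1 := fun e => hss (ms1.left_unique e1 e)
        have e3 : (σ s).1 ≠ (σ s').1 := fun e => hss (σ.injective (mt1.right_unique hm e))
        have e4 : ¬ cycIoo (σ s').1 (σ t').1 (σ s).1 := fun h => k2t hp h hm
        have e5 : ¬ cycIoo s'.1 t'.1 s.1 := by
          intro h
          refine k2s h hq ?_
          exact n2.transport hp.icc h.icc hq.icc (cycIcc_left _ _) (hσ p) hm ms1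
        have e6 : cycIoo s.1 p.1 s'.1 := by grind
        have e7 : cycIoo (σ s).1 (σ p).1 (σ s').1 := by grind
        refine k1 s' e6 e7 ?_
        exact n1.transport (cycIcc_left _ _) e6.icc (cycIcc_right _ _) (cycIcc_left _ _) ms1
          (hσ s) e1
      · exact k2 p hp (by rwa [mv_of_ne σ hps hpt]) hm
  · rwa [mv_of_ne σ hss hst, mv_of_ne σ hts htt]
  · rwa [mv_of_ne σ hts htt]
  · rwa [mv_of_ne σ hss hst]
  · rwa [mv_of_ne σ hss hst, mv_of_ne σ hts htt]
  · rw [mv_of_ne σ hss hst, mv_of_ne σ hts htt]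
    intro p hp hq hm
    by_cases hps : p = s'
    · subst hps
      rw [mv_left] at hq
      have e0 : ¬ cycIoo (σ s).1 (σ t).1 (σ p).1 := fun h => k1 p hp h hm
      have e1 : (σ p).1 ≠ (σ s).1 := fun e => hss (inj hm (hσ p) e).symm
      have e2 : cycIoo (σ p).1 (σ t').1 (σ s).1 := by grind
      have e3 : D.Meets t' (σ s) := n2.transport (cycIcc_left _ _) (cycIcc_right _ _)
        (cycIcc_left _ _) e2.icc (hσ p) hm mt2
      have e4 : ¬ cycIoo s.1 t.1 t'.1 := fun h => k1 t' h hq e3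
      have e5 : t'.1 ≠ t.1 := fun e => htt (mt1.left_unique e3 e.symm)
      have e6 : cycIoo p.1 t'.1 t.1 := by grind
      exact k2t e6 e2 (n2.transport (cycIcc_left _ _) e6.icc e2.icc (cycIcc_left _ _) hm (hσ p) mt1)
    · by_cases hpt : p = t'
      · subst hpt
        rw [mv_right] at hq
        have e0 : ¬ cycIoo (σ s).1 (σ t).1 (σ p).1 := fun h => k1 p hp h hm
        have e1 : D.Meets p (σ t) := n1.transport (cycIcc_left _ _) hp.icc (cycIcc_left _ _)
          (cycIcc_right _ _) (hσ s) ms1 hm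
        have e2 : (σ p).1 ≠ (σ t).1 := fun e => htt (inj e1 (hσ p) e).symm
        have e3 : cycIoo (σ s').1 (σ p).1 (σ t).1 := by grind
        have e4 : cycIcc s.1 t.1 s'.1 → D.Meets s' (σ s) := fun h => n1.transport hp.icc h
          hq.icc (cycIcc_left _ _) mt2 hm (hσ s')
        have e5 : ¬ cycIoo s.1 t.1 s'.1 := fun h => k1 s' h hq (e4 h.icc)
        have e6 : s'.1 ≠ s.1 := by
          intro e
          exact hss ((hσ s).left_unique (e4 (e ▸ cycIcc_left _ _)) e.symm)
        have e7 : cycIoo s'.1 p.1 s.1 := by grind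
        exact k2s e7 e3 (n1.transport hp.icc (cycIcc_left _ _) (cycIcc_left _ _) hq.icc hm mt2
          (hσ s))
      · rw [mv_of_ne σ hps hpt] at hq
        exact k1 p hp hq hm

theorem Rect.not_same {σ : State N m} {s t : Curve N m} (h1 : D.Rect σ s t) :
    ¬ D.Rect (mv σ s t) s t := by
  intro h2
  have n2 := h2.noMarking
  rw [mv_left, mv_right] at n2
  exact h1.noMarking.not_cover_row n2 (cycIco_left h1.row) (cycIco_left h1.row)
    (cycIco_or h1.col)

theorem Rect.not_opposite {σ : State N m} {s t : Curve N m} (h1 : D.Rect σ s t) :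
    ¬ D.Rect (mv σ s t) t s := by
  intro h2
  have n2 := h2.noMarking
  rw [mv_left, mv_right] at n2
  exact h1.noMarking.not_cover_col n2 (cycIco_left h1.col) (cycIco_left h1.col)
    (cycIco_or h1.row)

end Grid

/-! ### The action of formal flows -/

section Op

variable {A B : Type}

theorem op_ext {a b : Module.End ℤ (FormalGen A B →₀ ℤ)}
    (h : ∀ x, a (Finsupp.single x 1) = b (Finsupp.single x 1)) : a = b :=
  Finsupp.lhom_ext' fun x => LinearMap.ext_ring (h x)

variable [DecidableEq A]

theorem apply_apply_rect (x : FormalGen A B) {i j : A} (_ : i ≠ j) (a b : ℤˣ) :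
    apply (apply x (rect i j a b)) (rect i j a b) = x := by
  obtain ⟨p, e⟩ := x
  simp only [apply, FormalGen.mk.injEq]
  refine ⟨by ext k; simp, ?_⟩
  funext k
  rcases Int.units_eq_one_or a with rfl | rfl <;> rcases Int.units_eq_one_or b with rfl | rfl <;>
    by_cases hi : k = i <;> by_cases hj : k = j <;> simp_all

theorem apply_apply_bigon (x : FormalGen A B) (i : A) (a : ℤˣ) :
    apply (apply x (bigon i a)) (bigon i a) = x := by
  obtain ⟨p, e⟩ := x
  simp only [apply, FormalGen.mk.injEq, true_and]
  funext k
  by_cases hi : k = i <;> simp_all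

theorem apply_pentagon (x : FormalGen A B) {i j : A} (hij : i ≠ j) (a b c : ℤˣ) :
    apply (apply x (bigon i c)) (rect i j a b) = apply (apply x (rect i j (-a) b)) (bigon i c) := by
  obtain ⟨p, e⟩ := x
  simp only [apply, FormalGen.mk.injEq, true_and]
  funext k
  have hij' := hij.symm
  by_cases hi : k = i <;> by_cases hj : k = j <;> simp_all

theorem apply_disjoint (x : FormalGen A B) {i j k l : A} (hik : i ≠ k) (hil : i ≠ l)
    (hjk : j ≠ k) (hjl : j ≠ l) (a b c d : ℤˣ) :
    apply (apply x (rect i j a b)) (rect k l c d) =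
      apply (apply x (rect k l c d)) (rect i j a b) := by
  obtain ⟨p, e⟩ := x
  simp only [apply, FormalGen.mk.injEq]
  constructor
  · ext q
    simp only [Equiv.trans_apply, swap_apply_def]
    congr 1
    split_ifs <;> simp_all
  · funext q
    split_ifs <;> simp_all

theorem apply_hexagon (x : FormalGen A B) {i j k : A} (hij : i ≠ j) (hik : i ≠ k) (hjk : j ≠ k)
    (a a' b c : ℤˣ) :
    apply (apply x (rect i j a b)) (rect i k a' c) =
      apply (apply x (rect i k a' c)) (rect k j (-(a * a' * c)) b) := by
  obtain ⟨p, e⟩ := x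
  simp only [apply, FormalGen.mk.injEq]
  constructor
  · ext q
    simp only [Equiv.trans_apply, swap_apply_def]
    congr 1
    split_ifs <;> simp_all
  · funext q
    rcases Int.units_eq_one_or a with rfl | rfl <;> rcases Int.units_eq_one_or a' with rfl | rfl <;>
      rcases Int.units_eq_one_or c with rfl | rfl <;> split_ifs <;> simp_all

variable (S : SignAssignment A B)

/-- The operator of a formal flow on the free abelian group of the formal generators. -/
def op (f : FormalMove A) : Module.End ℤ (FormalGen A B →₀ ℤ) :=
  Finsupp.linearCombination ℤ fun x => Finsupp.single (apply x f) ((S.sign x f : ℤˣ) : ℤ)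

theorem op_single (f : FormalMove A) (x : FormalGen A B) :
    op S f (Finsupp.single x 1) = ((S.sign x f : ℤˣ) : ℤ) • Finsupp.single (apply x f) 1 := by
  simp [op]

theorem op_mul_single (f g : FormalMove A) (x : FormalGen A B) :
    (op S g * op S f) (Finsupp.single x 1) =
      ((S.sign x f * S.sign (apply x f) g : ℤˣ) : ℤ) •
        Finsupp.single (apply (apply x f) g) 1 := by
  rw [Module.End.mul_apply, op_single, map_smul, op_single, smul_smul, Units.val_mul]

theorem op_square {f₁ f₂ f₃ f₄ : FormalMove A} (h : Square f₁ f₂ f₃ f₄)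
    (e : ∀ x : FormalGen A B, apply (apply x f₁) f₂ = apply (apply x f₃) f₄) :
    op S f₂ * op S f₁ = -(op S f₄ * op S f₃) := by
  refine op_ext fun x => ?_
  rw [LinearMap.neg_apply, op_mul_single, op_mul_single, e, ← neg_smul,
    eq_neg_of_add_eq_zero_left (S.square x _ _ _ _ h)]

theorem op_bigon_sq (i : A) (a : ℤˣ) : op S (bigon i a) * op S (bigon i a) = 1 := by
  refine op_ext fun x => ?_
  rw [op_mul_single, apply_apply_bigon, S.alphaDeg _ _ _ (.bigon i a)]
  simp

theorem op_rect_sq {i j : A} (hij : i ≠ j) (a b : ℤˣ) :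
    op S (rect i j a b) * op S (rect i j a b) = 1 := by
  refine op_ext fun x => ?_
  rw [op_mul_single, apply_apply_rect x hij, S.alphaDeg _ _ _ (.rect i j a b hij)]
  simp

theorem op_rect_neg {i j : A} (hij : i ≠ j) (a b : ℤˣ) :
    op S (rect i j (-a) (-b)) = -op S (rect i j a b) := by
  refine op_ext fun y => ?_
  obtain ⟨x, rfl⟩ : ∃ x, y = apply x (rect i j a b) := ⟨_, (apply_apply_rect y hij a b).symm⟩
  have h1 := S.alphaDeg x _ _ (.rect i j a b hij)
  have h2 := S.betaDeg x _ _ (.rect i j a b hij)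
  have h3 : S.sign (apply x (rect i j a b)) (rect i j (-a) (-b)) =
      -S.sign (apply x (rect i j a b)) (rect i j a b) := by
    refine mul_left_cancel (a := S.sign x (rect i j a b)) ?_
    rw [h2, mul_neg, h1]
  rw [LinearMap.neg_apply, op_single, op_single, h3]
  simp [apply]

theorem op_rect_comm {i j : A} (hij : i ≠ j) (a b : ℤˣ) :
    op S (rect i j a b) = op S (rect j i b a) := by
  refine op_ext fun x => ?_
  rw [op_single, op_single, S.rot _ _ _ _ _ hij]
  congr 2
  simp only [apply, FormalGen.mk.injEq]
  refine ⟨by rw [swap_comm], ?_⟩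
  funext k
  rw [mul_comm b a]
  by_cases hi : k = i <;> by_cases hj : k = j <;> simp_all

end Op

section Tau

/-- The group in which the operators of formal flows act. -/
abbrev FormalChain (N m : ℕ) : Type := FormalGen (Curve N m) (Curve N m) →₀ ℤ

/-- The operators on formal generators. -/
abbrev Operator (N m : ℕ) : Type := Module.End ℤ (FormalChain N m)

variable {N m : ℕ} (S : SignAssignment (Curve N m) (Curve N m)) (o : Orientation N m)

/-- The operator of a rectangle with the given lower left and upper right corners. -/
def tau (s t : Curve N m) :
    Operator N m := op S (rectMove o s t)

variable {s t i j k l : Curve N m}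

theorem tau_sq (h : s ≠ t) : tau S o s t * tau S o s t = 1 := op_rect_sq S h _ _

theorem tau_symm (h : s ≠ t) : tau S o t s = -tau S o s t := by
  unfold tau rectMove
  rw [op_rect_comm S h.symm, ← op_rect_neg S h, neg_neg]

theorem tau_disjoint (hij : i ≠ j) (hkl : k ≠ l) (hik : i ≠ k) (hil : i ≠ l) (hjk : j ≠ k)
    (hjl : j ≠ l) : tau S o k l * tau S o i j = -(tau S o i j * tau S o k l) :=
  op_square S (.rect_rect _ _ _ _ _ _ _ _ hij hik hil hjk hjl hkl)
    fun x => apply_disjoint x hik hil hjk hjl _ _ _ _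

theorem tau_hexagon (hij : i ≠ j) (hik : i ≠ k) (hjk : j ≠ k) :
    tau S o i k * tau S o i j = -(tau S o k j * tau S o i k) := by
  have h := op_square S (.hexagon_first i j k (o.alpha i) (o.alpha i) (-o.alpha j) (-o.alpha k)
    hij hik hjk) (fun x => apply_hexagon x hij hik hjk _ _ _ _)
  rw [Int.units_mul_self, one_mul, neg_neg] at h
  exact h

theorem tau_mul_tau (hij : i ≠ j) (hik : i ≠ k) (hjk : j ≠ k) :
    tau S o i j * tau S o i k = -(tau S o i k * tau S o k j) := by
  have h := tau_hexagon S o hij hik hjk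
  have e1 := tau_sq S o hij
  have e2 := tau_sq S o hik
  have e3 := tau_sq S o hjk.symm
  have h1 : tau S o k j = -(tau S o i k * tau S o i j * tau S o i k) := by
    rw [h, neg_mul, neg_neg, mul_assoc, e2, mul_one]
  rw [h1, mul_neg, neg_neg, ← mul_assoc, ← mul_assoc, e2, one_mul]

theorem tau_hexagon₃ (hij : i ≠ j) (hik : i ≠ k) (hjk : j ≠ k) :
    tau S o k j * tau S o i j = -(tau S o i k * tau S o k j) := by
  have h := tau_hexagon S o hij.symm hjk hik
  rw [tau_symm S o hij, tau_symm S o hjk.symm, neg_mul_neg, tau_symm S o hik, neg_mul_neg] at h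
  exact h

theorem tau_hexagon₄ (hij : i ≠ j) (hik : i ≠ k) (hjk : j ≠ k) :
    tau S o k j * tau S o i j = -(tau S o i j * tau S o k i) := by
  have h := tau_mul_tau S o hjk hij.symm hik.symm
  rw [tau_symm S o hij, tau_symm S o hjk.symm, neg_mul_neg, tau_symm S o hik.symm, neg_mul_neg] at h
  exact h

/-- The tautological vector of a state. -/
def formalState (σ : State N m) : FormalGen (Curve N m) (Curve N m) where
  pairing := σ
  eps p := o.alpha p * o.beta (σ p)

/-- The basis vector of a state. -/
def vec (σ : State N m) : FormalGen (Curve N m) (Curve N m) →₀ ℤ :=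
  Finsupp.single (formalState o σ) 1

theorem apply_formalState (σ : State N m) (h : s ≠ t) :
    apply (formalState o σ) (rectMove o s t) = formalState o (mv σ s t) := by
  simp only [formalState, rectMove, apply, FormalGen.mk.injEq]
  refine ⟨rfl, ?_⟩
  funext k
  have e : ∀ a : ℤˣ, a * a = 1 := Int.units_mul_self
  by_cases hs : k = s
  · subst hs
    simp only [if_true, mv_left]
    rw [mul_neg, neg_mul, neg_neg]
    calc _ = o.alpha k * (o.alpha t * o.alpha t) * o.beta (σ t) := by ac_rfl
      _ = _ := by rw [e, mul_one]
  · by_cases ht : k = t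
    · subst ht
      simp only [if_neg hs, if_true, mv_right]
      rw [mul_neg, neg_mul, neg_neg]
      calc _ = o.alpha k * (o.alpha s * o.alpha s) * o.beta (σ s) := by ac_rfl
        _ = _ := by rw [e, mul_one]
    · simp [hs, ht, mv_of_ne σ hs ht]

theorem tau_vec (σ : State N m) (h : s ≠ t) :
    tau S o s t (vec o σ) =
      ((S.sign (formalState o σ) (rectMove o s t) : ℤˣ) : ℤ) • vec o (mv σ s t) := by
  rw [tau, vec, op_single, apply_formalState o σ h, vec]

theorem vec_injective : Function.Injective (vec o : State N m → _) := by
  intro σ σ' h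
  have := Finsupp.single_left_injective (one_ne_zero) h
  exact congrArg FormalGen.pairing this

end Tau

/-! ### The square of the differential -/

section Sums

theorem sum_split_pair {A M : Type*} [Fintype A] [DecidableEq A] [AddCommMonoid M] {a b : A}
    (hab : a ≠ b) (f : A → M) :
    ∑ x, f x = f a + f b + ∑ x, if x = a ∨ x = b then 0 else f x := by
  have h : ∀ x, f x = (if x = a then f a else 0) + (if x = b then f b else 0) +
      (if x = a ∨ x = b then 0 else f x) := by
    intro x
    by_cases h1 : x = a
    · subst h1; simp [hab]
    · by_cases h2 : x = b
      · subst h2; simp [h1]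
      · simp [h1, h2]
  rw [Finset.sum_congr rfl fun x _ => h x, Finset.sum_add_distrib, Finset.sum_add_distrib]
  simp

end Sums

namespace Grid

variable {N m : ℕ} [NeZero m] (D : Grid N)
variable (S : SignAssignment (Curve N m) (Curve N m)) (o : Orientation N m)

open Classical in
/-- The signed sum over the empty rectangles that start at `σ`. -/
def dOp (σ : State N m) : Operator N m :=
  ∑ s, ∑ t, if D.Rect σ s t then tau S o s t else 0

variable {D}

theorem sum_rotate {A M : Type*} [Fintype A] [AddCommMonoid M] (f : A → A → A → M) :
    ∑ a, ∑ b, ∑ c, f c a b = ∑ a, ∑ b, ∑ c, f a b c := by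
  rw [Finset.sum_congr rfl fun a _ => Finset.sum_comm, Finset.sum_comm]

theorem sum_comm₄ {A M : Type*} [Fintype A] [AddCommMonoid M] (f : A → A → A → A → M) :
    ∑ a, ∑ b, ∑ c, ∑ d, f a b c d = ∑ a, ∑ b, ∑ c, ∑ d, f c d a b := by
  have h := Finset.sum_comm (s := (Finset.univ : Finset (A × A)))
    (t := (Finset.univ : Finset (A × A))) (f := fun x y => f x.1 x.2 y.1 y.2)
  simpa only [Fintype.sum_prod_type] using h

open Classical in
theorem dOp_comp {σ : State N m} (hσ : D.IsGen σ) :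
    (∑ s, ∑ t, if D.Rect σ s t then D.dOp S o (mv σ s t) * tau S o s t else 0) = 0 := by
  let T := tau S o
  let f (a b c d : Curve N m) : Operator N m :=
    if D.Rect σ a b ∧ D.Rect (mv σ a b) c d then T c d * T a b else 0
  let g (a b c d : Curve N m) : Operator N m :=
    if c = a ∨ c = b ∨ d = a ∨ d = b then 0 else f a b c d
  let p (a b u : Curve N m) : Operator N m :=
    if u = a ∨ u = b then 0 else f a b a u + f a b u b + f a b b u + f a b u a
  let e₁ (s t u : Curve N m) : Operator N m :=
    if s ≠ u ∧ t ≠ u ∧ D.Rect σ s t ∧ D.Rect (mv σ s t) s u ∧ cycIoo s.1 u.1 t.1 then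
      T s u * T s t else 0
  let e₂ (s t u : Curve N m) : Operator N m :=
    if s ≠ u ∧ t ≠ u ∧ D.Rect σ s t ∧ D.Rect (mv σ s t) s u ∧ cycIoo s.1 t.1 u.1 then
      T s u * T s t else 0
  let e₃ (s t u : Curve N m) : Operator N m :=
    if s ≠ u ∧ t ≠ u ∧ D.Rect σ s t ∧ D.Rect (mv σ s t) u t ∧ cycIoo s.1 t.1 u.1 then
      T u t * T s t else 0
  let e₄ (s t u : Curve N m) : Operator N m :=
    if s ≠ u ∧ t ≠ u ∧ D.Rect σ s t ∧ D.Rect (mv σ s t) u t ∧ cycIoo u.1 t.1 s.1 then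
      T u t * T s t else 0
  have f0 : ∀ a c d, f a a c d = 0 := fun a c d => if_neg fun h => h.1.ne rfl
  have f1 : ∀ a b c, f a b c c = 0 := fun a b c => if_neg fun h => h.2.ne rfl
  have f2 : ∀ a b, f a b a b = 0 := fun a b => if_neg fun h => h.1.not_same h.2
  have f3 : ∀ a b, f a b b a = 0 := fun a b => if_neg fun h => h.1.not_opposite h.2
  have hsplit : ∀ a b, ∑ c, ∑ d, f a b c d = (∑ c, ∑ d, g a b c d) + ∑ u, p a b u := by
    intro a b
    by_cases hab : a = b
    · subst hab
      simp [g, p, f0]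
    · have h1 : ∀ c, ∑ d, f a b c d = f a b c a + f a b c b +
          ∑ d, if d = a ∨ d = b then 0 else f a b c d := fun c => sum_split_pair hab _
      simp only [h1, Finset.sum_add_distrib]
      rw [sum_split_pair hab (fun c => f a b c a), sum_split_pair hab (fun c => f a b c b),
        sum_split_pair hab (fun c => ∑ d, if d = a ∨ d = b then 0 else f a b c d)]
      simp only [f1, f2, f3, zero_add]
      have h2 : (∑ c, if c = a ∨ c = b then (0 : Module.End ℤ _) else
          ∑ d, if d = a ∨ d = b then 0 else f a b c d) = ∑ c, ∑ d, g a b c d := by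
        refine Finset.sum_congr rfl fun c _ => ?_
        by_cases hc : c = a ∨ c = b
        · rw [if_pos hc]
          refine (Finset.sum_eq_zero fun d _ => if_pos ?_).symm
          tauto
        · rw [if_neg hc]
          refine Finset.sum_congr rfl fun d _ => ?_
          simp only [g]
          refine if_congr ?_ rfl rfl
          tauto
      have h3 : ∑ u, p a b u = (∑ u, if u = a ∨ u = b then 0 else f a b a u) +
          (∑ u, if u = a ∨ u = b then 0 else f a b u b) +
          (∑ u, if u = a ∨ u = b then 0 else f a b b u) +
          (∑ u, if u = a ∨ u = b then 0 else f a b u a) := by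
        simp only [← Finset.sum_add_distrib]
        refine Finset.sum_congr rfl fun u _ => ?_
        simp only [p]
        split_ifs <;> simp
      rw [h2, h3]
      abel
  have hg : ∑ a, ∑ b, ∑ c, ∑ d, g a b c d = 0 := by
    have hanti : ∀ a b c d, g a b c d = -g c d a b := by
      intro a b c d
      simp only [g]
      by_cases h : c = a ∨ c = b ∨ d = a ∨ d = b
      · rw [if_pos h, if_pos (by tauto), neg_zero]
      · rw [if_neg h, if_neg (by tauto)]
        push Not at h
        obtain ⟨h1, h2, h3, h4⟩ := h
        simp only [f]
        by_cases hr : D.Rect σ a b ∧ D.Rect (mv σ a b) c d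
        · rw [if_pos hr, if_pos (hr.1.comm hσ h1.symm h3.symm h2.symm h4.symm hr.2)]
          exact tau_disjoint S o hr.1.ne hr.2.ne h1.symm h3.symm h2.symm h4.symm
        · rw [if_neg hr, if_neg, neg_zero]
          exact fun h' => hr (h'.1.comm hσ h1 h2 h3 h4 h'.2)
    have hneg : ∑ a, ∑ b, ∑ c, ∑ d, g a b c d = -∑ a, ∑ b, ∑ c, ∑ d, g a b c d := by
      conv_lhs => rw [sum_comm₄]
      simp only [← Finset.sum_neg_distrib]
      exact Finset.sum_congr rfl fun a _ => Finset.sum_congr rfl fun b _ =>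
        Finset.sum_congr rfl fun c _ => Finset.sum_congr rfl fun d _ => hanti c d a b
    refine LinearMap.ext fun v => Finsupp.ext fun x => ?_
    have := congrArg (fun φ => φ v x) hneg
    simp only [LinearMap.neg_apply, Finsupp.neg_apply] at this
    rw [LinearMap.zero_apply, Finsupp.zero_apply]
    omega
  have hp : ∀ a b c, p a b c = (e₁ a b c + e₂ a b c) + (e₃ a b c + e₄ a b c) +
      (-e₂ a c b - e₄ b c a) + (-e₁ c a b - e₃ c b a) := by
    intro a b c
    by_cases hac : c = a
    · have : ∀ x, ¬ D.Rect σ x x := fun x h => h.ne rfl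
      simp [p, e₁, e₂, e₃, e₄, hac, this]
    by_cases hbc : c = b
    · have : ∀ x, ¬ D.Rect σ x x := fun x h => h.ne rfl
      simp [p, e₁, e₂, e₃, e₄, hbc, this]
    by_cases hab : a = b
    · have : ∀ x, ¬ D.Rect σ x x := fun x h => h.ne rfl
      simp [p, e₁, e₂, e₃, e₄, hab, f0, this]
    have excl : ∀ x y z : Fin N, cycIoo x y z → ¬ cycIoo x z y := by
      intro x y z h h'
      grind
    have q1 : f a b a c = e₁ a b c + e₂ a b c := by
      simp only [f, e₁, e₂]
      by_cases h : D.Rect σ a b ∧ D.Rect (mv σ a b) a c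
      · have htu : b.1 ≠ c.1 := by
          intro e
          have h2 := h.2.mt
          rw [mv_left] at h2
          exact hbc (h2.left_unique (hσ b) e.symm)
        rw [if_pos h]
        rcases cycIoo_cases h.1.row h.2.row htu with h' | h'
        · rw [if_pos ⟨Ne.symm hac, Ne.symm hbc, h.1, h.2, h'⟩, if_neg, add_zero]
          exact fun h'' => excl _ _ _ h' h''.2.2.2.2
        · rw [if_neg, if_pos ⟨Ne.symm hac, Ne.symm hbc, h.1, h.2, h'⟩, zero_add]
          exact fun h'' => excl _ _ _ h' h''.2.2.2.2
      · rw [if_neg h, if_neg, if_neg, add_zero] <;> tauto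
    have q2 : f a b c b = e₃ a b c + e₄ a b c := by
      simp only [f, e₃, e₄]
      by_cases h : D.Rect σ a b ∧ D.Rect (mv σ a b) c b
      · have hsu : a.1 ≠ c.1 := by
          intro e
          have h2 := h.2.ms
          rw [mv_right] at h2
          exact hac (h2.left_unique (hσ a) e.symm)
        rw [if_pos h]
        have hc : cycIoo a.1 b.1 c.1 ∨ cycIoo c.1 b.1 a.1 := by
          have h1 := h.1.row
          have h2 := h.2.row
          grind
        rcases hc with h' | h'
        · rw [if_pos ⟨Ne.symm hac, Ne.symm hbc, h.1, h.2, h'⟩, if_neg, add_zero]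
          intro h''
          have := h''.2.2.2.2
          grind
        · rw [if_neg, if_pos ⟨Ne.symm hac, Ne.symm hbc, h.1, h.2, h'⟩, zero_add]
          intro h''
          have := h''.2.2.2.2
          grind
      · rw [if_neg h, if_neg, if_neg, add_zero] <;> tauto
    have q3 : f a b b c = -e₂ a c b - e₄ b c a := by
      simp only [f, e₂, e₄]
      have hr2 : D.Rect σ a b ∧ D.Rect (mv σ a b) b c ∧ cycIoo (σ a).1 (σ b).1 (σ c).1 ↔
          D.Rect σ a c ∧ D.Rect (mv σ a c) a b ∧ cycIoo a.1 c.1 b.1 :=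
        ⟨fun h => h.1.hexagon₂' hσ (Ne.symm hac) h.2.1 h.2.2,
          fun h => h.1.hexagon₂ hσ hab hbc h.2.1 h.2.2⟩
      have hr4 : D.Rect σ a b ∧ D.Rect (mv σ a b) b c ∧ cycIoo (σ a).1 (σ c).1 (σ b).1 ↔
          D.Rect σ b c ∧ D.Rect (mv σ b c) a c ∧ cycIoo a.1 c.1 b.1 :=
        ⟨fun h => h.1.hexagon₄' hσ (Ne.symm hac) h.2.1 h.2.2,
          fun h => h.1.hexagon₄ hσ (Ne.symm hab) hac h.2.1 h.2.2⟩
      have i2 : T b c * T a b = -(T a b * T a c) := by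
        rw [tau_hexagon S o (Ne.symm hac) hab hbc, neg_neg]
      have i4 : T b c * T a b = -(T a c * T b c) := by
        rw [tau_hexagon₄ S o (Ne.symm hbc) (Ne.symm hab) hac, neg_neg]
      by_cases h : D.Rect σ a b ∧ D.Rect (mv σ a b) b c
      · have hc := h.2.col
        rw [mv_right, mv_of_ne σ hac hbc] at hc
        have hc' : (σ b).1 ≠ (σ c).1 := by
          intro e
          have h2 := h.2.ms
          rw [mv_of_ne σ hac hbc] at h2
          exact hbc (σ.injective ((hσ b).right_unique h2 e)).symm
        have h0 := h.1.col
        rw [if_pos h]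
        by_cases h' : cycIoo (σ a).1 (σ b).1 (σ c).1
        · rw [if_pos ⟨hab, hbc, hr2.1 ⟨h.1, h.2, h'⟩⟩, if_neg, sub_zero, i2]
          intro h''
          exact excl _ _ _ h' (hr4.2 h''.2.2).2.2
        · have h'' : cycIoo (σ a).1 (σ c).1 (σ b).1 := by
            rw [cycIoo_iff] at *; omega
          rw [if_neg, if_pos ⟨Ne.symm hab, hac, hr4.1 ⟨h.1, h.2, h''⟩⟩, neg_zero, zero_sub, i4]
          intro h3
          exact h' (hr2.2 h3.2.2).2.2
      · rw [if_neg h, if_neg, if_neg, neg_zero, sub_zero]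
        · exact fun h' => h ⟨(hr4.2 h'.2.2).1, (hr4.2 h'.2.2).2.1⟩
        · exact fun h' => h ⟨(hr2.2 h'.2.2).1, (hr2.2 h'.2.2).2.1⟩
    have q4 : f a b c a = -e₁ c a b - e₃ c b a := by
      simp only [f, e₁, e₃]
      have hr1 : D.Rect σ a b ∧ D.Rect (mv σ a b) c a ∧ cycIoo (σ c).1 (σ b).1 (σ a).1 ↔
          D.Rect σ c a ∧ D.Rect (mv σ c a) c b ∧ cycIoo c.1 b.1 a.1 :=
        ⟨fun h => h.1.hexagon₁' hσ hbc h.2.1 h.2.2,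
          fun h => h.1.hexagon₁ hσ hbc hab h.2.1 h.2.2⟩
      have hr3 : D.Rect σ a b ∧ D.Rect (mv σ a b) c a ∧ cycIoo (σ a).1 (σ b).1 (σ c).1 ↔
          D.Rect σ c b ∧ D.Rect (mv σ c b) a b ∧ cycIoo c.1 b.1 a.1 :=
        ⟨fun h => h.1.hexagon₃' hσ hbc h.2.1 h.2.2,
          fun h => h.1.hexagon₃ hσ hac (Ne.symm hab) h.2.1 h.2.2⟩
      have i1 : T c a * T a b = -(T c b * T c a) := by
        rw [tau_mul_tau S o hbc hac (Ne.symm hab), neg_neg]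
      have i3 : T c a * T a b = -(T a b * T c b) := by
        rw [tau_hexagon₃ S o hbc hac (Ne.symm hab), neg_neg]
      by_cases h : D.Rect σ a b ∧ D.Rect (mv σ a b) c a
      · have hc := h.2.col
        rw [mv_left, mv_of_ne σ hac hbc] at hc
        have hc' : (σ a).1 ≠ (σ c).1 := by
          intro e
          have h2 := h.2.mt
          rw [mv_of_ne σ hac hbc] at h2
          exact hac (σ.injective ((hσ a).right_unique h2 e)).symm
        have h0 := h.1.col
        rw [if_pos h]
        by_cases h' : cycIoo (σ c).1 (σ b).1 (σ a).1
        · rw [if_pos ⟨hbc, hab, hr1.1 ⟨h.1, h.2, h'⟩⟩, if_neg, sub_zero, i1]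
          intro h''
          have := (hr3.2 h''.2.2).2.2
          rw [cycIoo_iff] at *; omega
        · have h'' : cycIoo (σ a).1 (σ b).1 (σ c).1 := by
            rw [cycIoo_iff] at *; omega
          rw [if_neg, if_pos ⟨hac, Ne.symm hab, hr3.1 ⟨h.1, h.2, h''⟩⟩, neg_zero, zero_sub, i3]
          intro h3
          exact h' (hr1.2 h3.2.2).2.2
      · rw [if_neg h, if_neg, if_neg, neg_zero, sub_zero]
        · exact fun h' => h ⟨(hr3.2 h'.2.2).1, (hr3.2 h'.2.2).2.1⟩
        · exact fun h' => h ⟨(hr1.2 h'.2.2).1, (hr1.2 h'.2.2).2.1⟩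
    simp only [p, if_neg (show ¬ (c = a ∨ c = b) by tauto), q1, q2, q3, q4]
  have hp0 : ∑ a, ∑ b, ∑ c, p a b c = 0 := by
    have r1 := sum_rotate e₁
    have r2 : ∑ a, ∑ b, ∑ c, e₂ a c b = ∑ a, ∑ b, ∑ c, e₂ a b c :=
      Finset.sum_congr rfl fun a _ => Finset.sum_comm
    have r3 : ∑ a, ∑ b, ∑ c, e₃ c b a = ∑ a, ∑ b, ∑ c, e₃ a b c := by
      rw [← sum_rotate e₃, Finset.sum_comm]
    have r4 : ∑ a, ∑ b, ∑ c, e₄ b c a = ∑ a, ∑ b, ∑ c, e₄ a b c := by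
      rw [Finset.sum_comm, Finset.sum_congr rfl fun a _ => Finset.sum_comm]
    simp only [hp, Finset.sum_add_distrib, Finset.sum_sub_distrib, Finset.sum_neg_distrib, r1, r2,
      r3, r4]
    abel
  have hf : (∑ s, ∑ t, if D.Rect σ s t then D.dOp S o (mv σ s t) * tau S o s t else 0) =
      ∑ a, ∑ b, ∑ c, ∑ d, f a b c d := by
    refine Finset.sum_congr rfl fun a _ => Finset.sum_congr rfl fun b _ => ?_
    by_cases h : D.Rect σ a b
    · simp only [dOp, Finset.sum_mul, f, h, true_and, ite_mul, zero_mul, T, if_true]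
    · simp [f, h]
  rw [hf]
  simp only [hsplit, Finset.sum_add_distrib, hg, hp0, add_zero]

end Grid

namespace Grid

variable {N m : ℕ} {D : Grid N}
variable (S : SignAssignment (Curve N m) (Curve N m)) (o : Orientation N m)

variable (D) in
/-- The linear map that applies to each generator an operator that depends on the generator. -/
def ev (Φ : State N m → Operator N m) : D.Chain m →ₗ[ℤ] FormalChain N m :=
  Finsupp.linearCombination ℤ fun x => Φ x.1 (vec o x.1)

theorem ev_single (Φ : State N m → Operator N m) (x : D.Gen m) :
    D.ev o Φ (Finsupp.single x 1) = Φ x.1 (vec o x.1) := by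
  simp [ev]

theorem ev_one_injective : Function.Injective (D.ev (m := m) o fun _ => 1) := by
  have h : LinearIndependent ℤ (fun f : FormalGen (Curve N m) (Curve N m) =>
      (Finsupp.single f 1 : FormalChain N m)) := by
    simpa using Finsupp.basisSingleOne.linearIndependent
  have h2 : LinearIndependent ℤ (fun x : D.Gen m => (vec o x.1 : FormalChain N m)) :=
    h.comp (fun x : D.Gen m => formalState o x.1) fun x y hxy =>
      Subtype.ext (congrArg FormalGen.pairing hxy)
  exact h2

variable (D) in
/-- A state all of whose components are intersection points, as a generator. -/
def toGen (σ : State N m) (hσ : D.IsGen σ) : D.Gen m := ⟨σ, hσ⟩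

@[simp] theorem toGen_val (σ : State N m) (hσ : D.IsGen σ) : (D.toGen σ hσ).1 = σ := rfl

variable [NeZero m]

theorem boundary_single (x : D.Gen m) :
    D.boundary S o (Finsupp.single x 1) = ∑ y, Finsupp.single y (D.coeff S o x y) := by
  simp [boundary]

open Classical in
theorem ev_boundary (Φ : State N m → Operator N m) (x : D.Gen m) :
    D.ev o Φ (D.boundary S o (Finsupp.single x 1)) =
      (∑ s, ∑ t, if D.Rect x.1 s t then Φ (mv x.1 s t) * tau S o s t else 0) (vec o x.1) := by
  rw [boundary_single, map_sum]
  have h1 : ∀ y, D.ev o Φ (Finsupp.single y (D.coeff S o x y)) =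
      ∑ s, ∑ t, if D.IsRect x y s t then
        ((S.sign (D.formal o x) (rectMove o s t) : ℤˣ) : ℤ) • Φ y.1 (vec o y.1) else 0 := by
    intro y
    rw [ev, Finsupp.linearCombination_single, coeff, Finset.sum_smul]
    refine Finset.sum_congr rfl fun s _ => ?_
    rw [Finset.sum_smul]
    refine Finset.sum_congr rfl fun t _ => ?_
    rw [ite_smul, zero_smul]
  rw [Finset.sum_congr rfl fun y _ => h1 y, Finset.sum_comm, LinearMap.sum_apply]
  refine Finset.sum_congr rfl fun s _ => ?_
  rw [Finset.sum_comm, LinearMap.sum_apply]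
  refine Finset.sum_congr rfl fun t _ => ?_
  by_cases h : D.Rect x.1 s t
  · rw [Finset.sum_eq_single (D.toGen (mv x.1 s t) (h.isGen x.2))]
    · rw [if_pos (isRect_iff.2 ⟨h, toGen_val _ _⟩), if_pos h, Module.End.mul_apply,
        tau_vec S o _ h.ne, map_smul]
      rfl
    · intro y _ hy
      exact if_neg fun h' => hy (Subtype.ext (isRect_iff.1 h').2)
    · intro h'; exact absurd (Finset.mem_univ _) h'
  · rw [if_neg h, LinearMap.zero_apply]
    exact Finset.sum_eq_zero fun y _ => if_neg fun h' => h (isRect_iff.1 h').1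

theorem boundary_comp_boundary : D.boundary S o ∘ₗ D.boundary S o = 0 := by
  have h1 : D.ev o (fun _ => 1) ∘ₗ D.boundary S o = D.ev o (D.dOp S o) := by
    refine Finsupp.lhom_ext' fun x => LinearMap.ext_ring ?_
    simp only [LinearMap.comp_apply, Finsupp.lsingle_apply, ev_boundary, ev_single, one_mul]
    rfl
  have h2 : D.ev o (D.dOp S o) ∘ₗ D.boundary S o = 0 := by
    refine Finsupp.lhom_ext' fun x => LinearMap.ext_ring ?_
    simp only [LinearMap.comp_apply, Finsupp.lsingle_apply, ev_boundary, LinearMap.zero_apply]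
    rw [dOp_comp S o x.2, LinearMap.zero_apply]
  refine LinearMap.ext fun v => ev_one_injective o ?_
  have := LinearMap.congr_fun h2 v
  rw [← h1] at this
  simpa using this

end Grid

/-! ### The cover of the destabilized grid -/

variable {n m : ℕ} {G : Grid n} {H : Grid (n + 1)} {ρ : Fin n} {c : Fin (n + 1)}

variable (H ρ c) in
/-- The rectangles of the destabilized grid, described in terms of the curves of the large grid. -/
structure GRect (σ : State (n + 1) m) (s t : Curve (n + 1) m) : Prop where
  rs : s.1 ≠ ρ.succ
  rt : t.1 ≠ ρ.succ
  row : s.1 ≠ t.1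
  col : (σ s).1 ≠ (σ t).1
  ms : H.Meets s (σ t)
  mt : H.Meets t (σ s)
  noMarking : ∀ j, j ≠ c → cycIco (σ s).1 (σ t).1 j →
    ¬ cycIco s.1 t.1 (H.X j) ∧ ¬ cycIco s.1 t.1 (H.O j)
  clear : ∀ p : Curve (n + 1) m, p.1 ≠ ρ.succ → cycIoo s.1 t.1 p.1 →
    cycIoo (σ s).1 (σ t).1 (σ p).1 → ¬ H.Meets p (σ s)

/-- The curve of the large grid that corresponds to a curve of the small one. -/
def curveUp (k : Fin (n + 1)) (p : Curve n m) : Curve (n + 1) m := (k.succAbove p.1, p.2)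

theorem curveUp_injective (k : Fin (n + 1)) : Function.Injective (curveUp (m := m) k) := by
  rintro ⟨i, a⟩ ⟨j, b⟩ h
  simpa [curveUp] using h

theorem exists_curveUp {k : Fin (n + 1)} {p : Curve (n + 1) m} (h : p.1 ≠ k) :
    ∃ p', p = curveUp k p' := by
  obtain ⟨j, hj⟩ := Fin.exists_succAbove_eq h
  exact ⟨(j, p.2), Prod.ext hj.symm rfl⟩

theorem cycIco_succAbove (k : Fin (n + 1)) {a b i : Fin n} :
    cycIco (k.succAbove a) (k.succAbove b) (k.succAbove i) ↔ cycIco a b i := by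
  have h : ∀ x y : Fin n, ((k.succAbove x : ℕ) ≤ k.succAbove y ↔ (x : ℕ) ≤ y) ∧
      ((k.succAbove x : ℕ) < k.succAbove y ↔ (x : ℕ) < y) := fun x y =>
    ⟨by simpa only [Fin.le_def] using Fin.succAbove_le_succAbove_iff (p := k) (i := x) (j := y),
      by simpa only [Fin.lt_def] using Fin.succAbove_lt_succAbove_iff (p := k) (i := x) (j := y)⟩
  rw [cycIco_iff, cycIco_iff, (h _ _).1, (h _ _).2, (h _ _).2]

theorem cycIoo_succAbove (k : Fin (n + 1)) {a b i : Fin n} :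
    cycIoo (k.succAbove a) (k.succAbove b) (k.succAbove i) ↔ cycIoo a b i := by
  rw [cycIoo, cycIoo, cycIco_succAbove, (Fin.succAbove_right_injective (p := k)).ne_iff]

theorem cycIco_predAbove {a b : Fin n} {r : Fin (n + 1)} :
    cycIco a b (ρ.predAbove r) ↔ cycIco (ρ.succ.succAbove a) (ρ.succ.succAbove b) r := by
  have h : ∀ x : Fin n, (x : ℕ) ≤ ρ.predAbove r ↔ ((ρ.succ.succAbove x : ℕ) ≤ r) := fun x => by
    simpa only [Fin.le_def] using le_predAbove ρ x r
  have h2 : (b : ℕ) < a ↔ (ρ.succ.succAbove b : ℕ) < ρ.succ.succAbove a := by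
    simpa only [Fin.lt_def] using (Fin.succAbove_lt_succAbove_iff (p := ρ.succ) (i := b) (j := a)).symm
  have ha := h a
  have hb := h b
  grind

section lift

variable (h : IsStabilization G H ρ c)

theorem meets_curveUp (h : IsStabilization G H ρ c) {p q : Curve n m} :
    H.Meets (curveUp ρ.succ p) (curveUp c q) ↔ G.Meets p q := by
  unfold Grid.Meets curveUp
  rw [h.shift_eq]

theorem lift_curveUp (g : G.Gen m) (p : Curve n m) :
    (h.lift g).1 (curveUp ρ.succ p) = curveUp c (g.1 p) := by
  have e : curveUp ρ.succ p = insertCurve ρ.succ (0 : ZMod m) (Sum.inl p) := rfl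
  simp only [e, IsStabilization.lift, Equiv.trans_apply, Equiv.symm_apply_apply]
  rfl

theorem lift_new (g : G.Gen m) (a : ZMod m) :
    (h.lift g).1 (ρ.succ, a) = (c, a + (H.shift ρ.succ c : ZMod m)) := by
  have e : ((ρ.succ, a) : Curve (n + 1) m) = insertCurve ρ.succ (0 : ZMod m) (Sum.inr a) := by simp
  simp only [e, IsStabilization.lift, Equiv.trans_apply, Equiv.symm_apply_apply]
  rfl

theorem lift_injective : Function.Injective (h.lift (m := m)) := by
  intro g g' e
  refine Subtype.ext (Equiv.ext fun p => ?_)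
  have h1 := lift_curveUp h g p
  rw [e, lift_curveUp h g' p] at h1
  exact (curveUp_injective c h1).symm

theorem allI_lift (g : G.Gen m) : AllI H ρ c (h.lift g) := fun a => by rw [lift_new]

theorem exists_lift {y : H.Gen m} (hy : AllI H ρ c y) : ∃ g, h.lift g = y := by
  have hnew : ∀ a, y.1 (ρ.succ, a) = (c, a + (H.shift ρ.succ c : ZMod m)) := by
    intro a
    have h1 := y.2 (ρ.succ, a)
    unfold Grid.Meets at h1
    rw [hy a] at h1
    exact Prod.ext (hy a) h1
  have hne : ∀ p : Curve n m, (y.1 (curveUp ρ.succ p)).1 ≠ c := by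
    intro p hp
    have h1 : y.1 (curveUp ρ.succ p) =
        y.1 (ρ.succ, (y.1 (curveUp ρ.succ p)).2 - (H.shift ρ.succ c : ZMod m)) := by
      rw [hnew, sub_add_cancel]; exact Prod.ext hp rfl
    exact Fin.succAbove_ne ρ.succ p.1 (congrArg Prod.fst (y.1.injective h1))
  choose f hf using fun p => exists_curveUp (hne p)
  have hinj : Function.Injective f := fun p p' e =>
    curveUp_injective _ (y.1.injective (by rw [hf, hf, e]))
  have hsurj : Function.Surjective f := by
    intro q
    have h1 : (y.1.symm (curveUp c q)).1 ≠ ρ.succ := by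
      intro e
      have h2 : y.1 (y.1.symm (curveUp c q)) = curveUp c q := by simp
      rw [show y.1.symm (curveUp c q) = (ρ.succ, (y.1.symm (curveUp c q)).2) from Prod.ext e rfl,
        hnew] at h2
      exact Fin.succAbove_ne c q.1 (congrArg Prod.fst h2).symm
    obtain ⟨p, hp⟩ := exists_curveUp h1
    refine ⟨p, curveUp_injective c ?_⟩
    rw [← hf, ← hp, Equiv.apply_symm_apply]
  have hgen : G.IsGen (Equiv.ofBijective f ⟨hinj, hsurj⟩) := by
    intro p
    have := y.2 (curveUp ρ.succ p)
    rw [hf, meets_curveUp h] at this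
    exact this
  refine ⟨G.toGen _ hgen, ?_⟩
  · refine Subtype.ext (Equiv.ext fun p => ?_)
    by_cases hp : p.1 = ρ.succ
    · rw [show p = (ρ.succ, p.2) from Prod.ext hp rfl, lift_new, hnew]
    · obtain ⟨p, rfl⟩ := exists_curveUp hp
      rw [lift_curveUp, hf]; rfl

theorem isRect_lift_iff {g g' : G.Gen m} {s t : Curve n m} :
    G.IsRect g g' s t ↔ GRect H ρ c (h.lift g).1 (curveUp ρ.succ s) (curveUp ρ.succ t) ∧
      (h.lift g').1 = mv (h.lift g).1 (curveUp ρ.succ s) (curveUp ρ.succ t) := by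
  have hne : ∀ p : Curve n m, (curveUp ρ.succ p).1 ≠ ρ.succ := fun p => Fin.succAbove_ne _ _
  have hswap : (h.lift g').1 = mv (h.lift g).1 (curveUp ρ.succ s) (curveUp ρ.succ t) ↔
      g'.1 = mv g.1 s t := by
    have hs : ∀ p : Curve n m, swap (curveUp ρ.succ s) (curveUp ρ.succ t) (curveUp ρ.succ p) =
        curveUp ρ.succ (swap s t p) := fun p =>
      (curveUp_injective (m := m) ρ.succ).swap_apply s t p
    constructor
    · intro e
      refine Equiv.ext fun p => curveUp_injective c ?_
      have := Equiv.congr_fun e (curveUp ρ.succ p)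
      rw [lift_curveUp] at this
      rw [this]
      simp only [mv, Equiv.trans_apply]
      rw [hs, lift_curveUp]
    · intro e
      refine Equiv.ext fun p => ?_
      by_cases hp : p.1 = ρ.succ
      · rw [mv_of_ne _ (by rintro rfl; exact hne s hp) (by rintro rfl; exact hne t hp),
          show p = (ρ.succ, p.2) from Prod.ext hp rfl, lift_new, lift_new]
      · obtain ⟨p, rfl⟩ := exists_curveUp hp
        rw [lift_curveUp, e]
        simp only [mv, Equiv.trans_apply]
        rw [hs, lift_curveUp]
  rw [hswap, Grid.isRect_iff]
  refine and_congr_left fun _ => ⟨fun hr => ⟨hne s, hne t, ?_, ?_, ?_, ?_, ?_, ?_⟩,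
    fun hr => ⟨?_, ?_, ?_, ?_, ?_, ?_⟩⟩
  · exact fun e => hr.row (Fin.succAbove_right_injective e)
  · rw [lift_curveUp, lift_curveUp]
    exact fun e => hr.col (Fin.succAbove_right_injective e)
  · rw [lift_curveUp, meets_curveUp h]; exact hr.ms
  · rw [lift_curveUp, meets_curveUp h]; exact hr.mt
  · intro j hj hj'
    obtain ⟨j, rfl⟩ := Fin.exists_succAbove_eq hj
    rw [lift_curveUp, lift_curveUp] at hj'
    have h1 := hr.noMarking j ((cycIco_succAbove c).1 hj')
    rw [h.X_old, h.O_old, cycIco_predAbove, cycIco_predAbove] at h1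
    exact h1
  · intro p hp hp' hq hm
    obtain ⟨p, rfl⟩ := exists_curveUp hp
    rw [lift_curveUp, lift_curveUp, lift_curveUp] at hq
    rw [lift_curveUp, meets_curveUp h] at hm
    exact hr.clear p ((cycIoo_succAbove _).1 hp') ((cycIoo_succAbove _).1 hq) hm
  · exact fun e => hr.row (congrArg ρ.succ.succAbove e)
  · have := hr.col
    rw [lift_curveUp, lift_curveUp] at this
    exact fun e => this (congrArg c.succAbove e)
  · have := hr.ms
    rwa [lift_curveUp, meets_curveUp h] at this
  · have := hr.mt
    rwa [lift_curveUp, meets_curveUp h] at this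
  · intro j hj
    rw [h.X_old, h.O_old, cycIco_predAbove, cycIco_predAbove]
    refine hr.noMarking _ (Fin.succAbove_ne c j) ?_
    rw [lift_curveUp, lift_curveUp]
    exact (cycIco_succAbove c).2 hj
  · intro p hp hq hm
    refine hr.clear (curveUp ρ.succ p) (hne p) ((cycIoo_succAbove _).2 hp) ?_ ?_
    · rw [lift_curveUp, lift_curveUp, lift_curveUp]
      exact (cycIoo_succAbove _).2 hq
    · rw [lift_curveUp, meets_curveUp h]; exact hm

theorem extend_formal (o : Orientation (n + 1) m) (g : G.Gen m) :
    (G.formal (orientationG ρ c o) g).extend (insertCurve ρ.succ (0 : ZMod m))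
        (insertCurve c (H.shift ρ.succ c : ZMod m))
        (fun a => o.alpha (ρ.succ, a) * o.beta (c, a + (H.shift ρ.succ c : ZMod m))) =
      formalState o (h.lift g).1 := by
  simp only [FormalGen.extend, formalState, FormalGen.mk.injEq]
  refine ⟨rfl, ?_⟩
  funext k
  by_cases hk : k.1 = ρ.succ
  · obtain ⟨i, a⟩ := k
    obtain rfl : i = ρ.succ := hk
    have e : ((ρ.succ, a) : Curve (n + 1) m) = insertCurve ρ.succ (0 : ZMod m) (Sum.inr a) := by simp
    rw [lift_new, e, Equiv.symm_apply_apply]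
    simp
  · obtain ⟨k, rfl⟩ := exists_curveUp hk
    rw [lift_curveUp]
    have e : curveUp ρ.succ k = insertCurve ρ.succ (0 : ZMod m) (Sum.inl k) := rfl
    rw [e, Equiv.symm_apply_apply]
    rfl

variable (H ρ c) in
open Classical in
/-- The signed sum over the empty rectangles of the small grid. -/
def gOp [NeZero m] (S : SignAssignment (Curve (n + 1) m) (Curve (n + 1) m))
    (o : Orientation (n + 1) m) (σ : State (n + 1) m) : Operator (n + 1) m :=
  ∑ s, ∑ t, if GRect H ρ c σ s t then tau S o s t else 0

/-- Chains of the small grid, as elements of the group of formal chains of the large grid. -/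
def evLift (o : Orientation (n + 1) m) : G.Chain m →ₗ[ℤ] FormalChain (n + 1) m :=
  Finsupp.linearCombination ℤ fun g => vec o (h.lift g).1

theorem evLift_single (o : Orientation (n + 1) m) (g : G.Gen m) (a : ℤ) :
    evLift h o (Finsupp.single g a) = a • vec o (h.lift g).1 := by
  simp [evLift]

theorem evLift_injective (o : Orientation (n + 1) m) : Function.Injective (evLift (m := m) h o) := by
  have hl : LinearIndependent ℤ (fun f : FormalGen (Curve (n + 1) m) (Curve (n + 1) m) =>
      (Finsupp.single f 1 : FormalChain (n + 1) m)) := by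
    simpa using Finsupp.basisSingleOne.linearIndependent
  have h2 : LinearIndependent ℤ (fun g : G.Gen m => (vec o (h.lift g).1 : FormalChain (n + 1) m)) :=
    hl.comp (fun g : G.Gen m => formalState o (h.lift g).1) fun x y hxy =>
      lift_injective h (Subtype.ext (congrArg FormalGen.pairing hxy))
  exact h2

theorem sum_curveUp {M : Type*} [AddCommMonoid M] [NeZero m] (k : Fin (n + 1))
    (f : Curve (n + 1) m → M) (hf : ∀ a, f (k, a) = 0) : ∑ s, f s = ∑ s : Curve n m, f (curveUp k s) := by
  rw [Fintype.sum_prod_type, Fin.sum_univ_succAbove _ k, Finset.sum_eq_zero fun a _ => hf a, zero_add,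
    Fintype.sum_prod_type]
  rfl

open Classical in
theorem evLift_boundary [NeZero m] (S : SignAssignment (Curve (n + 1) m) (Curve (n + 1) m))
    (o : Orientation (n + 1) m) (g : G.Gen m) :
    evLift h o (G.boundary (signG H ρ c S o) (orientationG ρ c o) (Finsupp.single g 1)) =
      gOp H ρ c S o (h.lift g).1 (vec o (h.lift g).1) := by
  rw [Grid.boundary_single, map_sum]
  have h1 : ∀ y, evLift h o
        (Finsupp.single y (G.coeff (signG H ρ c S o) (orientationG ρ c o) g y)) =
      ∑ s, ∑ t, if G.IsRect g y s t then
        ((S.sign (formalState o (h.lift g).1)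
          (rectMove o (curveUp ρ.succ s) (curveUp ρ.succ t)) : ℤˣ) : ℤ) •
            vec o (h.lift y).1 else 0 := by
    intro y
    rw [evLift_single, Grid.coeff, Finset.sum_smul]
    refine Finset.sum_congr rfl fun s _ => ?_
    rw [Finset.sum_smul]
    refine Finset.sum_congr rfl fun t _ => ?_
    rw [ite_smul, zero_smul, ← extend_formal h]
    rfl
  rw [Finset.sum_congr rfl fun y _ => h1 y, Finset.sum_comm, gOp, LinearMap.sum_apply,
    sum_curveUp ρ.succ]
  swap
  · intro a
    rw [LinearMap.sum_apply]
    exact Finset.sum_eq_zero fun t _ => by rw [if_neg fun h' => h'.rs rfl]; rfl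
  refine Finset.sum_congr rfl fun s _ => ?_
  rw [Finset.sum_comm, LinearMap.sum_apply, sum_curveUp ρ.succ]
  swap
  · intro a
    rw [if_neg fun h' => h'.rt rfl]; rfl
  refine Finset.sum_congr rfl fun t _ => ?_
  by_cases hr : GRect H ρ c (h.lift g).1 (curveUp ρ.succ s) (curveUp ρ.succ t)
  · have hI : AllI H ρ c (H.toGen (mv (h.lift g).1 (curveUp ρ.succ s) (curveUp ρ.succ t))
        (Grid.IsGen.mv (D := H) (h.lift g).2 hr.ms hr.mt)) := by
      intro a
      rw [Grid.toGen_val, mv_of_ne, lift_new]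
      · exact fun e => hr.rs (congrArg Prod.fst e).symm
      · exact fun e => hr.rt (congrArg Prod.fst e).symm
    obtain ⟨g', hg'⟩ := exists_lift h hI
    have hg'' := congrArg Subtype.val hg'
    rw [Grid.toGen_val] at hg''
    rw [Finset.sum_eq_single g']
    · rw [if_pos ((isRect_lift_iff h).2 ⟨hr, hg''⟩), if_pos hr, tau_vec S o _
        (fun e => hr.row (congrArg Prod.fst e)), hg'']
    · intro y _ hy
      refine if_neg fun h' => hy (lift_injective h (Subtype.ext ?_))
      rw [((isRect_lift_iff h).1 h').2, hg'']
    · intro h'; exact absurd (Finset.mem_univ _) h'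
  · rw [if_neg hr, LinearMap.zero_apply]
    exact Finset.sum_eq_zero fun y _ => if_neg fun h' => hr ((isRect_lift_iff h).1 h').1

end lift

/-! ### The sign of the polygon -/

section Star

variable {N m : ℕ} (S : SignAssignment (Curve N m) (Curve N m)) (o : Orientation N m)

theorem tau_conj {a b s t : Curve N m} (hab : a ≠ b) (hst : s ≠ t) :
    tau S o a b * tau S o s t =
      -(tau S o s t * tau S o (swap s t a) (swap s t b)) := by
  by_cases has : a = s
  · subst has
    by_cases hbt : b = t
    · subst hbt
      rw [swap_apply_left, swap_apply_right, tau_symm S o hst, mul_neg, neg_neg]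
    · rw [swap_apply_left, swap_apply_of_ne_of_ne hab.symm hbt]
      rw [tau_mul_tau S o hab hst hbt]
  · by_cases hat : a = t
    · subst hat
      by_cases hbs : b = s
      · subst hbs
        rw [swap_apply_left, swap_apply_right, tau_symm S o hst, neg_mul]
      · rw [swap_apply_right, swap_apply_of_ne_of_ne hbs hab.symm]
        rw [tau_symm S o hst.symm, mul_neg, neg_mul, neg_neg, tau_mul_tau S o hab has hbs]
        exact neg_neg _
    · by_cases hbs : b = s
      · subst hbs
        rw [swap_apply_left, swap_apply_of_ne_of_ne has hat]
        rw [tau_symm S o hab.symm, tau_symm S o (Ne.symm hat), neg_mul, mul_neg, neg_neg,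
          tau_mul_tau S o hab.symm hst hat, neg_neg]
      · by_cases hbt : b = t
        · subst hbt
          rw [swap_apply_right, swap_apply_of_ne_of_ne has hat]
          rw [tau_symm S o hab.symm, tau_symm S o hst.symm, tau_symm S o (Ne.symm has), neg_mul_neg,
            tau_mul_tau S o hab.symm hst.symm has, neg_mul_neg]
        · rw [swap_apply_of_ne_of_ne has hat, swap_apply_of_ne_of_ne hbs hbt]
          exact tau_disjoint S o hst hab (Ne.symm has) (Ne.symm hbs) (Ne.symm hat) (Ne.symm hbt)

/-- The successive exchanges of the component on `a` with the components on the curves of a list. -/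
def star (a : Curve N m) : List (Curve N m) → Operator N m
  | [] => 1
  | b :: L => star a L * tau S o a b

/-- The cyclic exchange of the components on the curves of a list. -/
def cyc : List (Curve N m) → Operator N m
  | [] => 1
  | a :: L => star S o a L

theorem star_append (a : Curve N m) (L L' : List (Curve N m)) :
    star S o a (L ++ L') = star S o a L' * star S o a L := by
  induction L with
  | nil => simp [star]
  | cons b L ih => rw [List.cons_append, star, ih, star, mul_assoc]

theorem star_conj {a s t : Curve N m} (hst : s ≠ t) (L : List (Curve N m)) (ha : a ∉ L) :
    star S o a L * tau S o s t = (-1) ^ L.length *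
      (tau S o s t * star S o (swap s t a) (L.map (swap s t))) := by
  induction L with
  | nil => simp [star]
  | cons b L ih =>
    rw [List.mem_cons, not_or] at ha
    rw [star, mul_assoc, tau_conj S o ha.1 hst, mul_neg, ← mul_assoc, ih ha.2, List.map_cons, star,
      List.length_cons, pow_succ]
    simp only [mul_assoc, neg_mul, mul_neg, mul_one]

theorem star_rotate {a b : Curve N m} (hab : a ≠ b) (L : List (Curve N m)) (ha : a ∉ L) (hb : b ∉ L) :
    star S o a L * tau S o a b = (-1) ^ L.length * (tau S o a b * star S o b L) := by
  rw [star_conj S o hab L ha, swap_apply_left]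
  congr 3
  refine (List.map_congr_left fun x hx => ?_).trans (List.map_id L)
  exact swap_apply_of_ne_of_ne (fun e => ha (e ▸ hx)) (fun e => hb (e ▸ hx))

theorem cyc_rotate {a b : Curve N m} {L : List (Curve N m)} (h : (a :: b :: L).Nodup) :
    cyc S o (a :: b :: L) = (-1) ^ (L.length + 1) * cyc S o (b :: (L ++ [a])) := by
  simp only [List.nodup_cons, List.mem_cons, not_or] at h
  obtain ⟨⟨hab, ha⟩, hb, -⟩ := h
  rw [cyc, cyc, star, star_append, star_rotate S o hab L ha hb, star, star, one_mul,
    tau_symm S o hab, pow_succ]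
  simp

theorem cyc_rotate_two {a b : Curve N m} {L : List (Curve N m)} (h : (a :: b :: L).Nodup)
    (hL : Even L.length) : cyc S o (a :: b :: L) = cyc S o (L ++ [a, b]) := by
  rw [cyc_rotate S o h]
  have h' : (b :: (L ++ [a])).Nodup := by
    have h2 := (List.perm_append_comm (l₁ := [a]) (l₂ := b :: L)).nodup_iff.1 (by simpa using h)
    simpa using h2
  cases L with
  | nil => rw [List.nil_append, cyc_rotate S o h']; simp
  | cons c L =>
    rw [List.cons_append, cyc_rotate S o (by simpa using h'), List.length_append, List.length_cons,
      List.length_cons, List.length_nil, ← mul_assoc, ← pow_add]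
    have : Even (L.length + 1 + 1 + (L.length + (0 + 1) + 1)) := ⟨L.length + 2, by omega⟩
    rw [this.neg_one_pow, one_mul]
    simp

/-- The curves `r b, A b, r (b - 1), A (b - 1), ...`. -/
def zig (r A : ZMod m → Curve N m) : ZMod m → ℕ → List (Curve N m)
  | _, 0 => []
  | b, k + 1 => r b :: A b :: zig r A (b - 1) k

variable (r A : ZMod m → Curve N m)

theorem zig_succ (b : ZMod m) (k : ℕ) :
    zig r A b (k + 1) = zig r A b k ++ [r (b - k), A (b - k)] := by
  induction k generalizing b with
  | zero => simp [zig]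
  | succ k ih =>
    rw [zig, ih, zig, List.cons_append, List.cons_append, Nat.cast_add, Nat.cast_one,
      add_comm (k : ZMod m) 1, sub_sub]

theorem length_zig (b : ZMod m) (k : ℕ) : (zig r A b k).length = 2 * k := by
  induction k generalizing b with
  | zero => rfl
  | succ k ih => rw [zig, List.length_cons, List.length_cons, ih]; omega

theorem mem_zig {b : ZMod m} {k : ℕ} {p : Curve N m} (h : p ∈ zig r A b k) :
    ∃ i < k, p = r (b - (i : ℕ)) ∨ p = A (b - (i : ℕ)) := by
  induction k with
  | zero => simp [zig] at h
  | succ k ih =>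
    rw [zig_succ, List.mem_append] at h
    rcases h with h | h
    · obtain ⟨i, hi, h⟩ := ih h
      exact ⟨i, by omega, h⟩
    · refine ⟨k, by omega, by simpa using h⟩

variable {r A}

theorem nodup_zig (hr : Function.Injective r) (hA : Function.Injective A) (hrA : ∀ i j, r i ≠ A j)
    (b : ZMod m) {k : ℕ} (hk : k ≤ m) : (zig r A b k).Nodup := by
  have hne : ∀ i j : ℕ, i < j → j < m → (b - (i : ZMod m)) ≠ b - (j : ZMod m) := by
    intro i j hij hj e
    have h1 : (i : ZMod m) = j := sub_right_injective e
    rw [ZMod.natCast_eq_natCast_iff', Nat.mod_eq_of_lt (by omega), Nat.mod_eq_of_lt hj] at h1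
    omega
  induction k with
  | zero => simp [zig]
  | succ k ih =>
    rw [zig_succ, List.nodup_append]
    refine ⟨ih (by omega), by simp [hrA], ?_⟩
    rintro p hp q hq rfl
    obtain ⟨i, hi, h⟩ := mem_zig r A hp
    have h' : p = r (b - (k : ℕ)) ∨ p = A (b - (k : ℕ)) := by simpa using hq
    have hik := hne i k hi (by omega)
    rcases h with rfl | rfl <;> rcases h' with h' | h'
    · exact hik (hr h')
    · exact hrA _ _ h'
    · exact hrA _ _ h'.symm
    · exact hik (hA h')

theorem map_zig (f : Curve N m → Curve N m) (b : ZMod m) (k : ℕ) :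
    (zig r A b k).map f = zig (f ∘ r) (f ∘ A) b k := by
  induction k generalizing b with
  | zero => rfl
  | succ k ih => simp only [zig, List.map_cons, ih, Function.comp]

theorem cyc_conj {s t : Curve N m} (hst : s ≠ t) {L : List (Curve N m)} (hL : L.Nodup)
    (he : Even L.length) (h0 : L ≠ []) :
    cyc S o L * tau S o s t = -(tau S o s t * cyc S o (L.map (swap s t))) := by
  cases L with
  | nil => exact absurd rfl h0
  | cons a L =>
    rw [cyc, star_conj S o hst L (List.nodup_cons.1 hL).1, List.map_cons, cyc]
    rw [List.length_cons, Nat.even_add_one, Nat.not_even_iff_odd] at he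
    rw [he.neg_one_pow, neg_one_mul]

/-- The composition of the operators of a list of flows. -/
def opList (S : SignAssignment (Curve N m) (Curve N m)) :
    List (FormalMove (Curve N m)) → Operator N m
  | [] => 1
  | f :: l => opList S l * op S f

/-- The terminal generator of a list of flows. -/
def applyList : FormalGen (Curve N m) (Curve N m) → List (FormalMove (Curve N m)) →
    FormalGen (Curve N m) (Curve N m)
  | x, [] => x
  | x, f :: l => applyList (apply x f) l

theorem opList_single (l : List (FormalMove (Curve N m))) (x : FormalGen (Curve N m) (Curve N m)) :
    opList S l (Finsupp.single x 1) =
      ((S.path x l : ℤˣ) : ℤ) • Finsupp.single (applyList x l) 1 := by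
  induction l generalizing x with
  | nil => simp [opList, SignAssignment.path, applyList]
  | cons f l ih =>
    rw [opList, Module.End.mul_apply, op_single, map_smul, ih, smul_smul, applyList,
      SignAssignment.path, Units.val_mul]

theorem op_bigon_rect_bigon {a b : Curve N m} (hab : a ≠ b) :
    op S (bigon a (o.alpha a)) * op S (rect a b (o.alpha a) (o.alpha b)) *
      op S (bigon a (o.alpha a)) = tau S o a b := by
  rw [mul_assoc, op_square S (.pentagon_same a b (o.alpha a) (o.alpha b) (o.alpha a) hab)
    (fun x => apply_pentagon x hab _ _ _), mul_neg, ← mul_assoc, op_bigon_sq, one_mul,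
    ← op_rect_neg S hab, neg_neg]
  rfl

/-- The curves `A b, r (b - 1), A (b - 1), ..., A (b - k)` with the signs of the edges of a
polygon. -/
def signedZig (o : Orientation N m) (r A : ZMod m → Curve N m) :
    ZMod m → ℕ → List (Curve N m × ℤˣ)
  | b, 0 => [(A b, -o.alpha (A b))]
  | b, k + 1 => (A b, -o.alpha (A b)) :: (r (b - 1), o.alpha (r (b - 1))) ::
      signedZig o r A (b - 1) k

theorem signedZig_map_fst (b : ZMod m) (k : ℕ) :
    r b :: (signedZig o r A b k).map Prod.fst = zig r A b (k + 1) := by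
  induction k generalizing b with
  | zero => rfl
  | succ k ih =>
    rw [signedZig, List.map_cons, List.map_cons, ih]
    rfl

theorem signedZig_eq (b : ZMod m) (k : ℕ) :
    ((List.range (k + 1)).flatMap fun t : ℕ =>
      [(A (b - (t : ZMod m)), -o.alpha (A (b - (t : ZMod m)))),
        (r (b - 1 - (t : ZMod m)), o.alpha (r (b - 1 - (t : ZMod m))))]).dropLast =
      signedZig o r A b k := by
  induction k generalizing b with
  | zero => simp [signedZig]
  | succ k ih =>
    rw [List.range_succ_eq_map, List.flatMap_cons, List.flatMap_map, signedZig, ← ih,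
      List.dropLast_append_of_ne_nil]
    · simp only [Nat.cast_zero, sub_zero, List.cons_append, List.nil_append, Nat.succ_eq_add_one,
        Nat.cast_add, Nat.cast_one, sub_sub, add_comm, add_left_comm]
    · rw [List.range_succ_eq_map]; simp

theorem opList_signedZig {a : Curve N m} (b : ZMod m) (k : ℕ)
    (ha : a ∉ (signedZig o r A b k).map Prod.fst) :
    opList S (((signedZig o r A b k).map fun e => rect a e.1 (o.alpha a) e.2).intersperse
      (bigon a (o.alpha a))) = star S o a ((signedZig o r A b k).map Prod.fst) := by
  induction k generalizing b with
  | zero => rfl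
  | succ k ih =>
    simp only [signedZig, List.map_cons, List.mem_cons, not_or] at ha ⊢
    have hne : ∀ (x : FormalMove (Curve N m)) (l : List (FormalMove (Curve N m))), l ≠ [] →
        (x :: l).intersperse (bigon a (o.alpha a)) =
          x :: bigon a (o.alpha a) :: l.intersperse (bigon a (o.alpha a)) := by
      intro x l hl
      obtain ⟨y, l, rfl⟩ := List.exists_cons_of_ne_nil hl
      rfl
    rw [hne _ _ (by simp), hne _ _ (by cases k <;> simp [signedZig]), opList, opList, opList, opList,
      ih _ ha.2.2, star, star, ← op_bigon_rect_bigon S o ha.2.1]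
    simp only [mul_assoc]
    rfl

variable [NeZero m]

theorem cyc_zig (hr : Function.Injective r) (hA : Function.Injective A) (hrA : ∀ i j, r i ≠ A j)
    (b b' : ZMod m) : cyc S o (zig r A b m) = cyc S o (zig r A b' m) := by
  have hstep : ∀ b : ZMod m, cyc S o (zig r A b m) = cyc S o (zig r A (b - 1) m) := by
    intro b
    obtain ⟨k, hk⟩ := Nat.exists_eq_succ_of_ne_zero (NeZero.ne m)
    have hn := nodup_zig hr hA hrA b le_rfl
    have h1 : zig r A b m = r b :: A b :: zig r A (b - 1) k := congrArg (zig r A b) hk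
    have h2 : zig r A (b - 1) m = zig r A (b - 1) k ++ [r b, A b] := by
      refine (congrArg (zig r A (b - 1)) hk).trans ?_
      rw [Nat.succ_eq_add_one, zig_succ]
      have : b - 1 - (k : ZMod m) = b := by
        have : ((k + 1 : ℕ) : ZMod m) = 0 := by rw [← Nat.succ_eq_add_one, ← hk]; simp
        push_cast at this
        linear_combination -this
      rw [this]
    rw [h1] at hn ⊢
    rw [h2]
    exact cyc_rotate_two S o hn (by rw [length_zig]; exact even_two_mul k)
  have h3 : ∀ k : ℕ, cyc S o (zig r A (b - k) m) = cyc S o (zig r A b m) := by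
    intro k
    induction k with
    | zero => simp
    | succ k ih => rw [← ih, hstep (b - k)]; congr 2; push_cast; ring
  have := h3 (b - b').val
  rw [ZMod.natCast_zmod_val] at this
  rw [← this]
  congr 2
  ring

/-- The sign operator of a polygon with the curves `r` and `A`. -/
def polyOp (r A : ZMod m → Curve N m) : Operator N m := cyc S o (zig r A 1 m)

theorem polyOp_conj (hr : Function.Injective r) (hA : Function.Injective A)
    (hrA : ∀ i j, r i ≠ A j) {s t : Curve N m} (hst : s ≠ t) :
    polyOp S o r A * tau S o s t =
      -(tau S o s t * polyOp S o (swap s t ∘ r) (swap s t ∘ A)) := by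
  rw [polyOp, cyc_conj S o hst (nodup_zig hr hA hrA 1 le_rfl), map_zig]
  · rfl
  · rw [length_zig]; exact even_two_mul m
  · intro h
    have := congrArg List.length h
    rw [length_zig, List.length_nil] at this
    have := NeZero.ne m
    omega

theorem polyOp_mul_tau (hr : Function.Injective r) (hA : Function.Injective A)
    (hrA : ∀ i j, r i ≠ A j) {t : Curve N m} (htr : ∀ i, t ≠ r i) (htA : ∀ i, t ≠ A i) (k : ZMod m) :
    polyOp S o r A * tau S o t (A (k + 1)) = tau S o (r k) t * polyOp S o r A := by
  obtain ⟨l, hl⟩ := Nat.exists_eq_succ_of_ne_zero (NeZero.ne m)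
  have hcast : k - (l : ZMod m) = k + 1 := by
    have : ((l + 1 : ℕ) : ZMod m) = 0 := by rw [← Nat.succ_eq_add_one, ← hl]; simp
    push_cast at this
    linear_combination -this
  obtain ⟨L, hL⟩ : ∃ L, zig r A k m = r k :: (L ++ [A (k + 1)]) := by
    cases l with
    | zero =>
      refine ⟨[], ?_⟩
      have : k = k + 1 := by simpa using hcast
      rw [← this]
      exact congrArg (zig r A k) hl
    | succ l =>
      refine ⟨A k :: (zig r A (k - 1) l ++ [r (k + 1)]), ?_⟩
      refine (congrArg (zig r A k) hl).trans ?_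
      change r k :: A k :: zig r A (k - 1) (l + 1) = _
      rw [zig_succ]
      have : k - 1 - (l : ZMod m) = k + 1 := by rw [← hcast]; push_cast; ring
      rw [this]; simp
  have hn := nodup_zig hr hA hrA k le_rfl
  have heven := length_zig r A k m
  have ht : t ∉ zig r A k m := fun h => by
    obtain ⟨i, -, h⟩ := mem_zig r A h
    rcases h with h | h
    · exact htr _ h
    · exact htA _ h
  rw [polyOp, cyc_zig S o hr hA hrA 1 k]
  rw [hL] at hn heven ht ⊢
  rw [cyc_conj S o (htA _) hn (by rw [heven]; exact even_two_mul m) (by simp)]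
  simp only [List.nodup_cons, List.mem_append, List.nodup_append, List.mem_cons,
    List.not_mem_nil, not_or] at hn ht
  have hmapL : L.map (swap t (A (k + 1))) = L := by
    refine (List.map_congr_left fun x hx => ?_).trans (List.map_id L)
    exact swap_apply_of_ne_of_ne (fun e => ht.2.1 (e ▸ hx))
      (fun e => hn.2.2.2 x hx (A (k + 1)) (Or.inl rfl) e)
  rw [List.map_cons, List.map_append, hmapL, swap_apply_of_ne_of_ne (htr k).symm (hrA _ _),
    List.map_cons, swap_apply_right, List.map_nil, cyc, star_append, cyc, star_append,
    star, star, star, star, one_mul, one_mul, ← mul_assoc, ← mul_assoc,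
    tau_hexagon S o (hrA _ _) (htr k).symm (htA _).symm, neg_mul]

/-- The sign of a polygon, expressed by the sign operator. -/
theorem polyOp_vec {n : ℕ} {H : Grid (n + 1)} {ρ : Fin n} {c : Fin (n + 1)}
    {S : SignAssignment (Curve (n + 1) m) (Curve (n + 1) m)} {o : Orientation (n + 1) m}
    (x : H.Gen m) (hne : ∀ k, (x.1.symm (c, k)).1 ≠ ρ.succ) :
    ∃ f, polyOp S o (fun k => x.1.symm (c, k)) (alphaThrough H ρ c) (vec o x.1) =
      ((polygonSign H ρ c S o x : ℤˣ) : ℤ) • Finsupp.single f 1 := by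
  have hr : Function.Injective fun k : ZMod m => x.1.symm (c, k) := fun i j h => by simpa using h
  have hA : Function.Injective (alphaThrough H ρ c (m := m)) := fun i j h => by
    simpa [alphaThrough] using h
  have hrA : ∀ i j, x.1.symm (c, i) ≠ alphaThrough H ρ c j := fun i j h =>
    hne i (congrArg Prod.fst h)
  obtain ⟨k, hk⟩ := Nat.exists_eq_succ_of_ne_zero (NeZero.ne m)
  set r : ZMod m → Curve (n + 1) m := fun k => x.1.symm (c, k) with hrdef
  have hz : zig r (alphaThrough H ρ c) 1 m = zig r (alphaThrough H ρ c) 1 (k + 1) :=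
    congrArg (zig r (alphaThrough H ρ c) 1) hk
  have hn := nodup_zig hr hA hrA 1 le_rfl
  have hE : polygonEdges H ρ c o x = signedZig o r (alphaThrough H ρ c) 1 k := by
    rw [← signedZig_eq, polygonEdges]
    congr 1
    have h1 : List.range m = List.range (k + 1) := congrArg List.range hk
    rw [h1]
    simp [hrdef, List.flatMap_assoc]
  rw [hz, ← signedZig_map_fst o] at hn
  refine ⟨applyList (formalState o x.1) ((List.map (fun e => rect (r 1) e.1 (o.alpha (r 1)) e.2)
    (polygonEdges H ρ c o x)).intersperse (bigon (r 1) (o.alpha (r 1)))), ?_⟩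
  rw [polyOp, hz, ← signedZig_map_fst o, cyc, ← opList_signedZig S o _ _ (List.nodup_cons.1 hn).1,
    vec, opList_single, polygonSign, hE]
  rfl

end Star

variable (S : SignAssignment (Curve (n + 1) m) (Curve (n + 1) m)) (o : Orientation (n + 1) m)

/-! ### Local coordinates near a branch cut -/

theorem val_rows {n : ℕ} (ρ : Fin n) : (ρ.succ : ℕ) = ρ + 1 ∧ (ρ.castSucc : ℕ) = ρ :=
  ⟨Fin.val_succ ρ, Fin.val_castSucc ρ⟩

theorem val_add_one_cases {n : ℕ} (ρ : Fin n) (c : Fin (n + 1)) :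
    ((c : ℕ) < n ∧ ((c + 1 : Fin (n + 1)) : ℕ) = c + 1) ∨
      ((c : ℕ) = n ∧ ((c + 1 : Fin (n + 1)) : ℕ) = 0) := by
  have hρ := ρ.2
  have hc := c.2
  by_cases h : (c : ℕ) = n
  · right
    refine ⟨h, ?_⟩
    rw [Fin.val_add, Fin.val_one', h, Nat.mod_eq_of_lt (a := 1) (by omega), Nat.mod_self]
  · left
    refine ⟨by omega, ?_⟩
    rw [Fin.val_add, Fin.val_one', Nat.mod_eq_of_lt (a := 1) (by omega), Nat.mod_eq_of_lt (by omega)]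

theorem val_sub_one_cases {n : ℕ} (ρ : Fin n) (c : Fin (n + 1)) :
    (((c - 1 : Fin (n + 1)) : ℕ) + 1 = c) ∨
      ((c : ℕ) = 0 ∧ ((c - 1 : Fin (n + 1)) : ℕ) = n) := by
  have h := val_add_one_cases ρ (c - 1)
  rw [sub_add_cancel] at h
  omega

theorem cycIco_add_one {n : ℕ} (ρ : Fin n) {c j : Fin (n + 1)} : cycIco c (c + 1) j ↔ j = c := by
  have := val_add_one_cases ρ c
  have := j.2
  have := ρ.2
  grind

theorem not_cycIoo_add_one {n : ℕ} (ρ : Fin n) {c j : Fin (n + 1)} : ¬ cycIoo c (c + 1) j := by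
  have := val_add_one_cases ρ c
  have := j.2
  grind

section Local

theorem IsStabilization.cross_new (h : IsStabilization G H ρ c) (i : Fin (n + 1)) :
    H.cross i c = if i = ρ.succ then -1 else 0 := by
  rw [Grid.cross_eq, h.O_new, h.X_new]
  have h1 : (ρ.succ : ℕ) = ρ + 1 := Fin.val_succ ρ
  have h2 : (ρ.castSucc : ℕ) = ρ := Fin.val_castSucc ρ
  simp only [Fin.lt_def, Fin.ext_iff, h1, h2]
  split_ifs <;> omega

theorem IsStabilization.shift_new (h : IsStabilization G H ρ c) (i : Fin (n + 1)) :
    H.shift i (c + 1) - H.shift i c = if i = ρ.succ then -1 else 0 := by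
  classical
  rw [Grid.shift_sub_shift, ← h.cross_new]
  simp [cycIco_add_one ρ]

theorem IsStabilization.meets_add_one (h : IsStabilization G H ρ c) {p : Curve (n + 1) m}
    (hp : p.1 ≠ ρ.succ) {k : ZMod m} : H.Meets p (c + 1, k) ↔ H.Meets p (c, k) := by
  have h1 := h.shift_new p.1
  rw [if_neg hp, sub_eq_zero] at h1
  unfold Grid.Meets
  rw [h1]

variable (H ρ c) in
theorem meets_alphaThrough (k : ZMod m) : H.Meets (alphaThrough H ρ c k) (c, k) := by
  simp [Grid.Meets, alphaThrough]

theorem IsStabilization.meets_alphaThrough_add_one (h : IsStabilization G H ρ c) (k : ZMod m) :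
    H.Meets (alphaThrough H ρ c (k + 1)) (c + 1, k) := by
  have h1 := h.shift_new ρ.succ
  rw [if_pos rfl] at h1
  have h2 := congrArg (Int.cast : ℤ → ZMod m) h1
  push_cast at h2
  simp only [Grid.Meets, alphaThrough]
  linear_combination -h2

variable (H c) in
/-- The lift of `beta_j` that meets the lift of `alpha_e` through the point of `beta_c` in the sheet
`k`. -/
def colAt (e : Fin (n + 1)) (k : ZMod m) (j : Fin (n + 1)) : Curve (n + 1) m :=
  (j, k + ((H.shift e j : ZMod m) - (H.shift e c : ZMod m)))

variable {e : Fin (n + 1)} {k : ZMod m}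

@[simp] theorem colAt_fst (j : Fin (n + 1)) : (colAt H c e k j).1 = j := rfl

theorem colAt_self : colAt H c e k c = (c, k) := by simp [colAt]

theorem IsStabilization.colAt_add_one (h : IsStabilization G H ρ c) (he : e ≠ ρ.succ) :
    colAt H c e k (c + 1) = (c + 1, k) := by
  have h1 := h.shift_new e
  rw [if_neg he, sub_eq_zero] at h1
  simp [colAt, h1]

theorem meets_colAt (j : Fin (n + 1)) :
    H.Meets (e, k - (H.shift e c : ZMod m)) (colAt H c e k j) := by
  simp only [Grid.Meets, colAt]; ring

theorem colAt_inj {k' : ZMod m} {j j' : Fin (n + 1)} :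
    colAt H c e k j = colAt H c e k' j' ↔ k = k' ∧ j = j' := by
  constructor
  · intro h
    have h1 : j = j' := congrArg Prod.fst h
    subst h1
    exact ⟨add_right_cancel (congrArg Prod.snd h), rfl⟩
  · rintro ⟨rfl, rfl⟩; rfl

variable (H c) in
/-- The components of a state on the lifts of the beta circles near the branch cut in sheet `k`. -/
def loc (σ : State (n + 1) m) (e : Fin (n + 1)) (k : ZMod m) (j : Fin (n + 1)) :
    Curve (n + 1) m := σ.symm (colAt H c e k j)

variable {σ : State (n + 1) m}

@[simp] theorem apply_loc (j : Fin (n + 1)) : σ (loc H c σ e k j) = colAt H c e k j := by simp [loc]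

theorem loc_inj {k' : ZMod m} {j j' : Fin (n + 1)} :
    loc H c σ e k j = loc H c σ e k' j' ↔ k = k' ∧ j = j' := by
  rw [loc, loc, σ.symm.injective.eq_iff, colAt_inj]

theorem loc_injective : Function.Injective (loc H c σ e k) := fun _ _ h => (loc_inj.1 h).2

theorem eq_loc {p : Curve (n + 1) m} {j : Fin (n + 1)} (h : σ p = colAt H c e k j) :
    p = loc H c σ e k j := by rw [loc, ← h, Equiv.symm_apply_apply]

theorem loc_mv (s t : Curve (n + 1) m) (j : Fin (n + 1)) :
    loc H c (mv σ s t) e k j = swap s t (loc H c σ e k j) := by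
  rw [loc, mv_symm_apply, loc]

theorem loc_mv_loc (a b : Fin (n + 1)) :
    loc H c (mv σ (loc H c σ e k a) (loc H c σ e k b)) e k =
      loc H c σ e k ∘ swap a b := by
  funext j
  rw [loc_mv, Function.comp, loc_injective.swap_apply]

theorem loc_mv_of_ne {k' : ZMod m} (hk : k' ≠ k) (a b : Fin (n + 1)) :
    loc H c (mv σ (loc H c σ e k a) (loc H c σ e k b)) e k' = loc H c σ e k' := by
  funext j
  rw [loc_mv, swap_apply_of_ne_of_ne] <;> exact fun h => hk (loc_inj.1 h).1

variable (hσ : H.IsGen σ)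

theorem rect_loc_iff (hσ : H.IsGen σ) {a b : Fin (n + 1)}
    (he : cycIcc (loc H c σ e k a).1 (loc H c σ e k b).1 e) :
    H.Rect σ (loc H c σ e k a) (loc H c σ e k b) ↔
      (loc H c σ e k a).1 ≠ (loc H c σ e k b).1 ∧ a ≠ b ∧
        H.NoMarking (loc H c σ e k a).1 (loc H c σ e k b).1 a b ∧
        ∀ j, cycIoo a b j → ¬ cycIoo (loc H c σ e k a).1 (loc H c σ e k b).1 (loc H c σ e k j).1 := by
  have hloc : ∀ j, H.Meets (loc H c σ e k j) (colAt H c e k j) := fun j => by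
    have := hσ (loc H c σ e k j)
    rwa [apply_loc] at this
  constructor
  · intro hr
    have hm := hr.noMarking
    have hcol := hr.col
    simp only [apply_loc, colAt_fst] at hm hcol
    refine ⟨hr.row, hcol, hm, fun j hj hj' => ?_⟩
    refine hr.clear (loc H c σ e k j) hj' (by simpa using hj) ?_
    rw [apply_loc]
    exact hm.transport (p := (e, k - (H.shift e c : ZMod m))) he hj'.icc hj.icc (cycIcc_left _ _)
      (meets_colAt j) (meets_colAt a) (hloc j)
  · rintro ⟨hrow, hcol, hm, hcl⟩
    refine ⟨hrow, by simpa using hcol, ?_, ?_, by simpa using hm, ?_⟩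
    · rw [apply_loc]
      exact hm.transport (p := (e, k - (H.shift e c : ZMod m))) he (cycIcc_left _ _)
        (cycIcc_left _ _) (cycIcc_right _ _) (meets_colAt a) (meets_colAt b) (hloc a)
    · rw [apply_loc]
      exact hm.transport (p := (e, k - (H.shift e c : ZMod m))) he (cycIcc_right _ _)
        (cycIcc_right _ _) (cycIcc_left _ _) (meets_colAt b) (meets_colAt a) (hloc b)
    · intro p hp hq hmeet
      simp only [apply_loc, colAt_fst] at hp hq hmeet
      have h1 : H.Meets p (colAt H c e k (σ p).1) :=
        hm.transport (p := (e, k - (H.shift e c : ZMod m))) he hp.icc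
          (cycIcc_left _ _) hq.icc (meets_colAt a) (meets_colAt _) hmeet
      have h2 := eq_loc ((hσ p).right_unique h1 rfl)
      rw [h2] at hp
      exact hcl _ hq hp

theorem Grid.Rect.exists_loc_right (hσ : H.IsGen σ) {a : Fin (n + 1)} {t : Curve (n + 1) m}
    (hr : H.Rect σ (loc H c σ e k a) t) (he : cycIcc (loc H c σ e k a).1 t.1 e) :
    ∃ b, t = loc H c σ e k b := by
  have hm := hr.noMarking
  have hms := hr.ms
  have hloc := hσ (loc H c σ e k a)
  simp only [apply_loc, colAt_fst] at hm hloc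
  refine ⟨(σ t).1, eq_loc (Grid.Meets.right_unique (D := H)
    (p := (e, k - (H.shift e c : ZMod m))) ?_ (meets_colAt (σ t).1) rfl)⟩
  exact hm.transport (cycIcc_left _ _) he (cycIcc_left _ _) (cycIcc_right _ _) hloc hms (meets_colAt a)

theorem Grid.Rect.exists_loc_left (hσ : H.IsGen σ) {b : Fin (n + 1)} {s : Curve (n + 1) m}
    (hr : H.Rect σ s (loc H c σ e k b)) (he : cycIcc s.1 (loc H c σ e k b).1 e) :
    ∃ a, s = loc H c σ e k a := by
  have hm := hr.noMarking
  have hmt := hr.mt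
  have hloc := hσ (loc H c σ e k b)
  simp only [apply_loc, colAt_fst] at hm hloc
  refine ⟨(σ s).1, eq_loc (Grid.Meets.right_unique (D := H)
    (p := (e, k - (H.shift e c : ZMod m))) ?_ (meets_colAt (σ s).1) rfl)⟩
  exact hm.transport (cycIcc_right _ _) he (cycIcc_right _ _) (cycIcc_left _ _) hloc hmt
    (meets_colAt b)

/-! ### Local operators -/

variable (H ρ c) in
/-- The part of a polygon with lower edge on `u` and upper edge on `A`. -/
def Poly (A : Curve (n + 1) m) (f : Fin (n + 1) → Curve (n + 1) m) (u : Curve (n + 1) m) : Prop :=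
  u.1 ≠ ρ.succ ∧ ∃ j, j ≠ c ∧ f j = A ∧
    (∀ i, cycIco c j i → (i ≠ c → ¬ cycIco u.1 ρ.succ (H.X i)) ∧ ¬ cycIco u.1 ρ.succ (H.O i)) ∧
    ∀ i, cycIoo c j i → ¬ cycIoo u.1 ρ.succ (f i).1

variable (H ρ c) in
/-- A punctured hexagon, the obtuse corner lies on the curve `f j`. -/
structure HexAt (f : Fin (n + 1) → Curve (n + 1) m) (j : Fin (n + 1)) : Prop where
  punctured : cycIoo (f c).1 (f (c + 1)).1 ρ.succ
  obtuse : cycIoo (f c).1 (f (c + 1)).1 (f j).1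
  noMarking : H.NoMarking (f j).1 (f (c + 1)).1 j c
  clear : ∀ i, cycIoo j c i → ¬ cycIoo (f j).1 (f (c + 1)).1 (f i).1

variable (c) in
/-- The operator of a punctured hexagon. -/
def hexOp (f : Fin (n + 1) → Curve (n + 1) m) (j : Fin (n + 1)) :
    Operator (n + 1) m :=
  tau S o (f j) (f (c + 1)) * tau S o (f c) (f (c + 1))

variable (H ρ c) in
open Classical in
/-- The contribution of one sheet to the map `F^R`. -/
def locR (A : Curve (n + 1) m) (f : Fin (n + 1) → Curve (n + 1) m) :
    Operator (n + 1) m :=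
  (if Poly H ρ c A f (f c) then 1 else 0) +
    ∑ j, if HexAt H ρ c f j ∧ cycIoo (f c).1 ρ.succ (f j).1 ∧ Poly H ρ c A f (f j) then
      hexOp c S o f j else 0

variable (H ρ c) in
open Classical in
/-- The contribution of one sheet to the map `F^L`. -/
def locL (A : Curve (n + 1) m) (f : Fin (n + 1) → Curve (n + 1) m) :
    Operator (n + 1) m :=
  (if f c = A then 1 else 0) +
    ∑ j, if HexAt H ρ c f j ∧ f j = A then hexOp c S o f j else 0

variable (ρ c) in
/-- In the columns of `beta_c` and `beta_{c + 1}` the components lie on the lower left and the upper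
right corner of a rectangle that does not cross the new row. -/
def NPlus (f : Fin (n + 1) → Curve (n + 1) m) : Prop := cycIoo ρ.succ (f (c + 1)).1 (f c).1

variable {f : Fin (n + 1) → Curve (n + 1) m} {A : Curve (n + 1) m}

theorem not_poly_of_blocked (hA : A.1 = ρ.succ) {u : Curve (n + 1) m}
    (ht : cycIoo u.1 ρ.succ (f (c + 1)).1) : ¬ Poly H ρ c A f u := by
  rintro ⟨-, j, hj, hjA, -, hcl⟩
  have h1 := val_add_one_cases ρ c
  by_cases hj1 : j = c + 1
  · subst hj1
    rw [hjA, hA] at ht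
    exact not_cycIco_right _ _ ht.2
  · refine hcl (c + 1) ?_ ht
    grind

theorem HexAt.not_nPlus {j : Fin (n + 1)} (h : HexAt H ρ c f j) : ¬ NPlus ρ c f := by
  intro h'
  have := h.punctured
  unfold NPlus at h'
  grind

theorem locR_eq_zero_of_nPlus (hA : A.1 = ρ.succ) (hf : NPlus ρ c f) :
    locR H ρ c S o A f = 0 := by
  rw [locR, if_neg, zero_add]
  · exact Finset.sum_eq_zero fun j _ => if_neg fun h => h.1.not_nPlus hf
  · refine not_poly_of_blocked hA ?_
    unfold NPlus at hf
    grind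

theorem locL_eq_zero_of_nPlus (hA : A.1 = ρ.succ) (hf : NPlus ρ c f) :
    locL H ρ c S o A f = 0 := by
  rw [locL, if_neg, zero_add]
  · exact Finset.sum_eq_zero fun j _ => if_neg fun h => h.1.not_nPlus hf
  · rintro h
    unfold NPlus at hf
    rw [h, hA] at hf
    exact hf.1 rfl

end Local

section Local

variable {e : Fin (n + 1)} {k : ZMod m} {σ : State (n + 1) m}

theorem IsStabilization.not_wide (h : IsStabilization G H ρ c) {i₀ i₁ j₀ j₁ : Fin (n + 1)}
    (hm : H.NoMarking i₀ i₁ j₀ j₁) (hi : cycIco i₀ i₁ ρ.succ) (h1 : cycIco j₀ j₁ (c + 1))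
    (h2 : cycIco j₀ j₁ (c - 1)) : False := by
  rcases h.adjacent with h' | h'
  · exact (hm _ h1).1 (by rwa [h'])
  · exact (hm _ h2).1 (by rwa [h'])

set_option maxHeartbeats 400000 in
/-- The rectangles that start at a state with two components on the corners of a thin rectangle. -/
theorem NPlus.cases (h : IsStabilization G H ρ c) (hσ : H.IsGen σ)
    (he : e = ρ.castSucc ∨ e = ρ.succ + 1) (hes : e ≠ ρ.succ)
    (hN : NPlus ρ c (loc H c σ e k)) {s t : Curve (n + 1) m} (hr : H.Rect σ s t) :
    NPlus ρ c (fun j => swap s t (loc H c σ e k j)) ∨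
    (s = loc H c σ e k c ∧ t = loc H c σ e k (c + 1)) ∨
    (∃ j, s = loc H c σ e k j ∧ t = loc H c σ e k c ∧
      cycIoo (loc H c σ e k (c + 1)).1 ρ.succ (loc H c σ e k j).1) ∨
    (t = loc H c σ e k c ∧ s.1 = ρ.succ) ∨
    (s = loc H c σ e k (c + 1) ∧ t.1 = ρ.succ) ∨
    ∃ j, s = loc H c σ e k (c + 1) ∧ t = loc H c σ e k j ∧
      cycIoo ρ.succ (loc H c σ e k c).1 (loc H c σ e k j).1 ∧ H.X (c - 1) = ρ.succ := by
  have hc1 := val_add_one_cases ρ c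
  have hc2 := val_sub_one_cases ρ c
  have hsu := val_add_one_cases ρ ρ.succ
  have hsv : (ρ.succ : ℕ) = ρ + 1 := Fin.val_succ ρ
  have hcv : (ρ.castSucc : ℕ) = ρ := Fin.val_castSucc ρ
  have hrc : σ (loc H c σ e k c) = (c, k) := by rw [apply_loc, colAt_self]
  have htc : σ (loc H c σ e k (c + 1)) = (c + 1, k) := by rw [apply_loc, h.colAt_add_one hes]
  have hNt : (loc H c σ e k (c + 1)).1 ≠ ρ.succ := by
    intro e'
    have := hN.2
    unfold cycIco at this
    rw [e', sub_self] at this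
    exact absurd this (by simp)
  have hNr : (loc H c σ e k c).1 ≠ ρ.succ := hN.1
  have mr : H.Meets (loc H c σ e k c) (c, k) := hrc ▸ hσ _
  have mt1 : H.Meets (loc H c σ e k (c + 1)) (c + 1, k) := htc ▸ hσ _
  have mt : H.Meets (loc H c σ e k (c + 1)) (c, k) := (h.meets_add_one hNt).1 mt1
  have mr1 : H.Meets (loc H c σ e k c) (c + 1, k) := (h.meets_add_one hNr).2 mr
  have hrt : loc H c σ e k c ≠ loc H c σ e k (c + 1) := fun e' => by
    have := congrArg Prod.fst (hrc.symm.trans ((congrArg σ e').trans htc))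
    simp only [Fin.ext_iff] at this
    have := ρ.2
    omega
  have hee : (e : ℕ) = ρ ∨ (e : ℕ) = ((ρ.succ + 1 : Fin (n + 1)) : ℕ) := by
    rcases he with rfl | rfl
    · exact Or.inl hcv
    · exact Or.inr rfl
  set r := loc H c σ e k c with hrdef
  set t0 := loc H c σ e k (c + 1) with htdef
  have hNN : NPlus ρ c (fun j => swap s t (loc H c σ e k j)) ↔
      cycIoo ρ.succ (swap s t t0).1 (swap s t r).1 := Iff.rfl
  rw [hNN]
  have hN' : cycIoo ρ.succ t0.1 r.1 := hN
  by_cases hsr : s = r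
  · subst hsr
    by_cases htt : t = t0
    · exact Or.inr (Or.inl ⟨rfl, htt⟩)
    · left
      have m1 : H.Meets t (c, k) := hrc ▸ hr.mt
      have m2 := hr.ms
      have h1 : t.1 ≠ t0.1 := fun e' => htt (m1.left_unique mt e')
      have h2 : (σ t).1 ≠ c + 1 := fun e' =>
        htt (σ.injective ((m2.right_unique mr1 e').trans htc.symm))
      have h3 := hr.col
      have h4 := hr.row
      have hcl := hr.clear t0
      rw [htc, hrc] at hcl
      rw [hrc] at h3
      rw [swap_apply_left, swap_apply_of_ne_of_ne (Ne.symm hrt) (Ne.symm htt)]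
      have h5 : ¬ cycIoo r.1 t.1 t0.1 := by
        intro h5
        refine hcl h5 ?_ mt
        have := (σ t).1.2
        have := ρ.2
        rw [cycIoo_iff]; dsimp only at *; omega
      grind
  · by_cases htr : t = r
    · subst htr
      by_cases hst : s = t0
      · exfalso
        subst hst
        refine h.not_wide hr.noMarking ?_ ?_ ?_
        · rw [cycIoo_iff] at hN'
          grind
        · rw [htc]
          refine cycIco_left ?_
          rw [fin_ne_iff, hrc]
          have := ρ.2
          dsimp only
          omega
        · rw [htc, hrc]
          have := ρ.2
          have := c.2
          rw [cycIco_iff]; dsimp only; omega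
      · have m1 : H.Meets s (c, k) := hrc ▸ hr.ms
        by_cases hs : s.1 = ρ.succ
        · exact Or.inr (Or.inr (Or.inr (Or.inl ⟨rfl, hs⟩)))
        · have h1 : s.1 ≠ t0.1 := fun e' => hst (m1.left_unique mt e')
          have h4 := hr.row
          by_cases h2 : cycIoo ρ.succ t0.1 s.1
          · left
            rwa [swap_apply_right, swap_apply_of_ne_of_ne (Ne.symm hst) (Ne.symm hrt)]
          · right; right; left
            have h3 : cycIoo t0.1 ρ.succ s.1 := by grind
            obtain ⟨j, hj⟩ := hr.exists_loc_left hσ (by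
              rw [← hrdef]
              have := ρ.2
              have := s.1.2
              grind)
            exact ⟨j, hj, rfl, hj ▸ h3⟩
    · by_cases hst : s = t0
      · subst hst
        have m1 : H.Meets t (c + 1, k) := htc ▸ hr.mt
        by_cases hts : t.1 = ρ.succ
        · exact Or.inr (Or.inr (Or.inr (Or.inr (Or.inl ⟨rfl, hts⟩))))
        · have h1 : t.1 ≠ r.1 := fun e' => htr (m1.left_unique mr1 e')
          have h4 := hr.row
          by_cases h2 : cycIoo t0.1 ρ.succ t.1
          · left
            rw [swap_apply_left, swap_apply_of_ne_of_ne hrt (Ne.symm htr)]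
            grind
          · by_cases h3 : cycIoo r.1 t0.1 t.1
            · left
              rw [swap_apply_left, swap_apply_of_ne_of_ne hrt (Ne.symm htr)]
              grind
            · right; right; right; right; right
              have h5 : cycIoo ρ.succ r.1 t.1 := by grind
              obtain ⟨j, hj⟩ := hr.exists_loc_right hσ (by
                rw [← htdef]
                have := ρ.2
                have := t.1.2
                have := r.1.2
                grind)
              refine ⟨j, rfl, hj, hj ▸ h5, ?_⟩
              refine h.adjacent.resolve_left fun hX => ?_
              have hcol := hr.col
              refine (hr.noMarking (c + 1) ?_).1 ?_
              · rw [htc] at hcol ⊢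
                exact cycIco_left hcol
              · rw [hX]
                grind
      · left
        by_cases htt : t = t0
        · subst htt
          have m1 : H.Meets s (c + 1, k) := htc ▸ hr.ms
          have m2 := hr.mt
          have h1 : s.1 ≠ r.1 := fun e' => hsr (m1.left_unique mr1 e')
          have h2 : (σ s).1 ≠ c := fun e' =>
            hsr (σ.injective ((m2.right_unique mt e').trans hrc.symm))
          have h3 := hr.col
          have h4 := hr.row
          have hcl := hr.clear r
          rw [htc, hrc] at hcl
          rw [htc] at h3
          rw [swap_apply_right, swap_apply_of_ne_of_ne (Ne.symm hsr) hrt]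
          have h5 : ¬ cycIoo s.1 t0.1 r.1 := by
            intro h5
            have h6 : cycIoo (σ s).1 (c + 1) c := by
              have := (σ s).1.2
              have := ρ.2
              have := c.2
              rw [cycIoo_iff]; dsimp only at *; omega
            refine hcl h5 h6 ?_
            have hm := hr.noMarking
            rw [htc] at hm
            exact hm.transport (p := t0) (cycIcc_right _ _) h5.icc h6.icc (cycIcc_left _ _) mt m2 mr
          grind
        · rwa [swap_apply_of_ne_of_ne (Ne.symm hst) (Ne.symm htt),
            swap_apply_of_ne_of_ne (Ne.symm hsr) (Ne.symm htr)]

end Local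

section Local

variable {e : Fin (n + 1)} {k : ZMod m} {σ : State (n + 1) m}
variable {f f' : Fin (n + 1) → Curve (n + 1) m} {A : Curve (n + 1) m}

theorem Poly.congr {u : Curve (n + 1) m} (h1 : ∀ i, f i = A ↔ f' i = A)
    (h2 : ∀ i, i ≠ c → (cycIoo u.1 ρ.succ (f i).1 ↔ cycIoo u.1 ρ.succ (f' i).1)) :
    Poly H ρ c A f u ↔ Poly H ρ c A f' u := by
  unfold Poly
  refine and_congr_right fun _ => exists_congr fun j => and_congr_right fun _ => and_congr (h1 j)
    (and_congr_right fun _ => forall_congr' fun i => imp_congr_right fun hi => ?_)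
  exact not_congr (h2 i hi.1)

theorem locR_eq_zero_of_row (hf : (f c).1 = ρ.succ) : locR H ρ c S o A f = 0 := by
  rw [locR, if_neg fun h => h.1 hf, zero_add]
  exact Finset.sum_eq_zero fun j _ => if_neg fun h => h.1.punctured.1 hf.symm

theorem HexAt.row_ne {j : Fin (n + 1)} (h : HexAt H ρ c f j) : (f (c + 1)).1 ≠ ρ.succ := fun e' => by
  have := h.punctured
  rw [e'] at this
  exact not_cycIco_right _ _ this.2

theorem swap_loc_eq {a b : Fin (n + 1)} :
    (fun j => swap (loc H c σ e k a) (loc H c σ e k b) (loc H c σ e k j)) =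
      loc H c σ e k ∘ swap a b := by
  rw [← loc_mv_loc]; funext j; rw [loc_mv]

theorem locR_thin (h : IsStabilization G H ρ c) (hfc : (f c).1 ≠ ρ.succ) (hA : f (c + 1) = A)
    (hArow : A.1 = ρ.succ) : locR H ρ c S o A f = 1 := by
  rw [locR, if_pos, Finset.sum_eq_zero, add_zero]
  · exact fun j _ => if_neg fun h' => h'.1.row_ne (hA ▸ hArow)
  · refine ⟨hfc, c + 1, ?_, hA, fun i hi => ?_, fun i hi => absurd hi (not_cycIoo_add_one ρ)⟩
    · have := val_add_one_cases ρ c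
      have := ρ.2
      omega
    · rw [cycIco_add_one ρ] at hi
      subst hi
      rw [h.O_new]
      exact ⟨fun h' => absurd rfl h', not_cycIco_right _ _⟩

open Classical in
theorem locR_low (hσ : H.IsGen σ) (hes : e = ρ.castSucc)
    (hN : NPlus ρ c (loc H c σ e k)) {j : Fin (n + 1)}
    (hj : cycIoo (loc H c σ e k (c + 1)).1 ρ.succ (loc H c σ e k j).1)
    (hr : H.Rect σ (loc H c σ e k j) (loc H c σ e k c)) :
    locR H ρ c S o A (loc H c σ e k ∘ swap j c) =
      if Poly H ρ c A (loc H c σ e k ∘ swap j c) (loc H c σ e k j) then 1 else 0 := by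
  have hc1 := val_add_one_cases ρ c
  have hv := val_rows ρ
  have hN' : cycIoo ρ.succ (loc H c σ e k (c + 1)).1 (loc H c σ e k c).1 := hN
  have hrow := hr.row
  have he : cycIcc (loc H c σ e k j).1 (loc H c σ e k c).1 e := by
    subst hes
    grind
  obtain ⟨-, hjc, hm, hcl⟩ := (rect_loc_iff hσ he).1 hr
  set f := loc H c σ e k with hf
  have hj1 : j ≠ c + 1 := by
    rintro rfl
    grind
  have h1 : (f ∘ swap j c) c = f j := by simp
  have hcc : c + 1 ≠ c := by omega
  have h2 : (f ∘ swap j c) (c + 1) = f (c + 1) := by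
    simp [swap_apply_of_ne_of_ne hj1.symm hcc]
  have h3 : (f ∘ swap j c) j = f c := by simp
  rw [locR, h1]
  refine (congrArg _ (Finset.sum_eq_zero fun i _ => ?_)).trans (add_zero _)
  refine if_neg ?_
  rintro ⟨hx, hi, -⟩
  by_cases hij : i = j
  · subst hij
    rw [h3] at hi
    grind
  by_cases hic : i = c
  · subst hic
    rw [h1] at hi
    exact hi.1 rfl
  have h4 : (f ∘ swap j c) i = f i := by simp [swap_apply_of_ne_of_ne hij hic]
  rw [h4] at hi
  by_cases hji : cycIoo i c j
  · have := hx.clear j hji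
    rw [h4, h2, h3] at this
    grind
  · have := hcl i (by
      rw [← ne_eq] at hij hic
      rw [cycIoo_iff] at hji ⊢
      omega)
    grind

theorem locR_high (h : IsStabilization G H ρ c) (hσ : H.IsGen σ) (hes : e = ρ.castSucc)
    (hArow : A.1 = ρ.succ)
    (hN : NPlus ρ c (loc H c σ e k)) {j : Fin (n + 1)}
    (hj : cycIoo ρ.succ (loc H c σ e k c).1 (loc H c σ e k j).1)
    (hr : H.Rect σ (loc H c σ e k (c + 1)) (loc H c σ e k j)) (hX : H.X (c - 1) = ρ.succ) :
    locR H ρ c S o A (loc H c σ e k ∘ swap (c + 1) j) = 0 := by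
  classical
  have hc1 := val_add_one_cases ρ c
  have hc2 := val_sub_one_cases ρ c
  have hv := val_rows ρ
  have hN' : cycIoo ρ.succ (loc H c σ e k (c + 1)).1 (loc H c σ e k c).1 := hN
  have hrow := hr.row
  have he : cycIcc (loc H c σ e k (c + 1)).1 (loc H c σ e k j).1 e := by
    subst hes
    grind
  obtain ⟨-, hjc, hm, hcl⟩ := (rect_loc_iff hσ he).1 hr
  set f := loc H c σ e k with hf
  have hj1 : j ≠ c := by
    rintro rfl
    grind
  have h1 : (f ∘ swap (c + 1) j) (c + 1) = f j := by simp
  have hcc : c ≠ c + 1 := by omega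
  have h2 : (f ∘ swap (c + 1) j) c = f c := by
    simp [swap_apply_of_ne_of_ne hcc hj1.symm]
  have h3 : (f ∘ swap (c + 1) j) j = f (c + 1) := by simp
  rw [locR, h2, if_neg, zero_add]
  · refine Finset.sum_eq_zero fun i _ => if_neg ?_
    rintro ⟨hx, hi, -⟩
    have hm' := hx.noMarking
    rw [h1] at hm'
    have hic : i ≠ c := by
      rintro rfl
      rw [h2] at hi
      exact hi.1 rfl
    refine (hm' (c - 1) ?_).1 ?_
    · have := i.2
      grind
    · rw [hX]
      grind
  · rintro ⟨-, a, hac, haA, -, hacl⟩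
    have haj : a ≠ j := by
      rintro rfl
      rw [h3] at haA
      rw [haA, hArow] at hN'
      have := hN'.2
      unfold cycIco at this
      rw [sub_self] at this
      exact absurd this (by simp)
    have ha1 : a ≠ c + 1 := by
      rintro rfl
      rw [h1] at haA
      rw [haA, hArow] at hj
      grind
    have h4 : (f ∘ swap (c + 1) j) a = f a := by simp [swap_apply_of_ne_of_ne ha1 haj]
    rw [h4] at haA
    by_cases hin : cycIoo (c + 1) j a
    · refine hcl a hin ?_
      rw [haA, hArow]
      grind
    · refine hacl j ?_ ?_
      · have := a.2
        have := j.2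
        grind
      · rw [h3]
        grind

theorem locL_low (hσ : H.IsGen σ) (hArow : A.1 = ρ.succ)
    (hes : e = ρ.succ + 1)
    (hN : NPlus ρ c (loc H c σ e k)) {j : Fin (n + 1)}
    (hj : cycIoo (loc H c σ e k (c + 1)).1 ρ.succ (loc H c σ e k j).1)
    (hr : H.Rect σ (loc H c σ e k j) (loc H c σ e k c)) :
    locL H ρ c S o A (loc H c σ e k ∘ swap j c) = 0 := by
  classical
  have hc1 := val_add_one_cases ρ c
  have hsu := val_add_one_cases ρ ρ.succ
  have hN' : cycIoo ρ.succ (loc H c σ e k (c + 1)).1 (loc H c σ e k c).1 := hN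
  have hrow := hr.row
  have he : cycIcc (loc H c σ e k j).1 (loc H c σ e k c).1 e := by
    subst hes
    grind
  obtain ⟨-, hjc, hm, hcl⟩ := (rect_loc_iff hσ he).1 hr
  set f := loc H c σ e k with hf
  have hj1 : j ≠ c + 1 := by
    rintro rfl
    grind
  have h1 : (f ∘ swap j c) c = f j := by simp
  have hcc : c + 1 ≠ c := by omega
  have h2 : (f ∘ swap j c) (c + 1) = f (c + 1) := by
    simp [swap_apply_of_ne_of_ne hj1.symm hcc]
  have h3 : (f ∘ swap j c) j = f c := by simp
  have hjA : f j ≠ A := fun h' => by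
    rw [h', hArow] at hj
    grind
  rw [locL, h1, if_neg hjA, zero_add]
  refine Finset.sum_eq_zero fun i _ => if_neg ?_
  rintro ⟨hx, hi⟩
  by_cases hij : i = j
  · subst hij
    rw [h3] at hi
    rw [hi, hArow] at hN'
    exact hN'.1 rfl
  by_cases hic : i = c
  · subst hic
    exact hjA (h1 ▸ hi)
  have h4 : (f ∘ swap j c) i = f i := by simp [swap_apply_of_ne_of_ne hij hic]
  by_cases hji : cycIoo i c j
  · have := hx.clear j hji
    rw [hi, hArow, h2, h3] at this
    grind
  · have := hcl i (by
      rw [← ne_eq] at hij hic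
      rw [cycIoo_iff] at hji ⊢
      omega)
    rw [h4] at hi
    rw [hi, hArow] at this
    grind

theorem locL_high (hArow : A.1 = ρ.succ)
    (hN : NPlus ρ c f) {j : Fin (n + 1)}
    (hj : cycIoo ρ.succ (f c).1 (f j).1) (hX : H.X (c - 1) = ρ.succ) :
    locL H ρ c S o A (f ∘ swap (c + 1) j) = 0 := by
  classical
  have hc1 := val_add_one_cases ρ c
  have hc2 := val_sub_one_cases ρ c
  have hj1 : j ≠ c := by
    rintro rfl
    grind
  have h1 : (f ∘ swap (c + 1) j) (c + 1) = f j := by simp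
  have hcc : c ≠ c + 1 := by omega
  have h2 : (f ∘ swap (c + 1) j) c = f c := by
    simp [swap_apply_of_ne_of_ne hcc hj1.symm]
  have hcA : f c ≠ A := fun h' => hN.1 (h' ▸ hArow)
  rw [locL, h2, if_neg hcA, zero_add]
  refine Finset.sum_eq_zero fun i _ => if_neg ?_
  rintro ⟨hx, hi⟩
  have hm' := hx.noMarking
  rw [h1, hi] at hm'
  have hic : i ≠ c := by
    rintro rfl
    exact hcA (h2 ▸ hi)
  refine (hm' (c - 1) ?_).1 ?_
  · have := i.2
    grind
  · rw [hX, hArow]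
    grind

theorem locL_eq_zero_of_row (hfc : f c ≠ A) (hft : (f (c + 1)).1 = ρ.succ) :
    locL H ρ c S o A f = 0 := by
  rw [locL, if_neg hfc, zero_add]
  exact Finset.sum_eq_zero fun j _ => if_neg fun h' => h'.1.row_ne hft

theorem locL_of_eq (hfc : f c = A) (hArow : A.1 = ρ.succ) : locL H ρ c S o A f = 1 := by
  rw [locL, if_pos hfc, Finset.sum_eq_zero, add_zero]
  exact fun j _ => if_neg fun h' => h'.1.punctured.1 (by rw [hfc, hArow])

end Local

section Local

variable {e : Fin (n + 1)} {k : ZMod m} {σ : State (n + 1) m}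
variable {f f' : Fin (n + 1) → Curve (n + 1) m} {A : Curve (n + 1) m}

theorem NPlus.row_ne (hN : NPlus ρ c f) : (f (c + 1)).1 ≠ ρ.succ := fun e' => by
  have := hN.2
  unfold cycIco at this
  rw [e', sub_self] at this
  exact absurd this (by simp)

theorem add_one_ne (ρ : Fin n) (c : Fin (n + 1)) : c + 1 ≠ c := by
  have hc1 := val_add_one_cases ρ c
  have hρ := ρ.2
  omega

theorem poly_thin_iff (h : IsStabilization G H ρ c) (hσ : H.IsGen σ) (hes : e = ρ.castSucc)
    (hArow : A.1 = ρ.succ) (hN : NPlus ρ c (loc H c σ e k)) :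
    Poly H ρ c A (loc H c σ e k ∘ swap c (c + 1)) (loc H c σ e k (c + 1)) ↔
      H.Rect σ (loc H c σ e k (c + 1)) A := by
  have hc1 := val_add_one_cases ρ c
  have hv := val_rows ρ
  have hN' : cycIoo ρ.succ (loc H c σ e k (c + 1)).1 (loc H c σ e k c).1 := hN
  have ht := hN.row_ne
  have he : cycIcc (loc H c σ e k (c + 1)).1 A.1 e := by
    subst hes
    rw [hArow]
    grind
  have hcc := add_one_ne ρ c
  have hgen : ∀ j, loc H c σ e k j = A →
      (Poly H ρ c A (loc H c σ e k ∘ swap c (c + 1)) (loc H c σ e k (c + 1)) ↔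
        H.Rect σ (loc H c σ e k (c + 1)) A) := by
    intro j hj
    have hjc : j ≠ c := by
      rintro rfl
      rw [hj, hArow] at hN'
      exact hN'.1 rfl
    have hj1 : j ≠ c + 1 := by
      rintro rfl
      exact ht (hj ▸ hArow)
    have hswap : ∀ i, i ≠ c → i ≠ c + 1 →
        (loc H c σ e k ∘ swap c (c + 1)) i = loc H c σ e k i := fun i h1 h2 => by
      simp [swap_apply_of_ne_of_ne h1 h2]
    have hswap1 : (loc H c σ e k ∘ swap c (c + 1)) (c + 1) = loc H c σ e k c := by simp
    have hfj : (loc H c σ e k ∘ swap c (c + 1)) j = A := (hswap j hjc hj1).trans hj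
    have hinj : Function.Injective (loc H c σ e k ∘ swap c (c + 1)) :=
      loc_injective.comp (Equiv.injective _)
    rw [← hj, rect_loc_iff hσ (by rwa [hj]), hj, hArow]
    constructor
    · rintro ⟨h1, j', -, h2, h3, h4⟩
      obtain rfl : j' = j := hinj (h2.trans hfj.symm)
      refine ⟨h1, hj1.symm, fun i hi => ?_, fun i hi hi' => ?_⟩
      · have h5 : i ≠ c := by
          grind
        have := h3 i (by
          rw [cycIco_iff] at hi ⊢
          omega)
        exact ⟨this.1 h5, this.2⟩
      · have h5 : i ≠ c ∧ i ≠ c + 1 := by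
          grind
        refine h4 i (by
          rw [cycIoo_iff] at hi ⊢
          omega) ?_
        rwa [hswap i h5.1 h5.2]
    · rintro ⟨h1, -, h2, h3⟩
      refine ⟨h1, j, hjc, hfj, fun i hi => ?_, fun i hi hi' => ?_⟩
      · by_cases hic : i = c
        · subst hic
          rw [h.O_new]
          exact ⟨fun h' => absurd rfl h', not_cycIco_right _ _⟩
        · have := h2 i (by
            rw [← ne_eq] at hic
            rw [cycIco_iff] at hi ⊢
            omega)
          exact ⟨fun _ => this.1, this.2⟩
      · by_cases hi1 : i = c + 1
        · subst hi1
          rw [hswap1] at hi'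
          grind
        · rw [hswap i hi.1 hi1] at hi'
          refine h3 i ?_ hi'
          grind
  constructor
  · intro hp
    obtain ⟨-, j, -, hj, -⟩ := id hp
    have hj' : loc H c σ e k (swap c (c + 1) j) = A := hj
    exact (hgen _ hj').1 hp
  · intro hr
    obtain ⟨j, hj⟩ := hr.exists_loc_right hσ he
    exact (hgen j hj.symm).2 hr

theorem hexAt_thin_iff (hσ : H.IsGen σ) (hN : NPlus ρ c (loc H c σ e k)) {j : Fin (n + 1)}
    (hj : cycIoo (loc H c σ e k (c + 1)).1 (loc H c σ e k c).1 (loc H c σ e k j).1)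
    (hjs : cycIco (loc H c σ e k j).1 (loc H c σ e k c).1 ρ.succ)
    (he : cycIcc (loc H c σ e k j).1 (loc H c σ e k c).1 e) :
    HexAt H ρ c (loc H c σ e k ∘ swap c (c + 1)) j ↔
      H.Rect σ (loc H c σ e k j) (loc H c σ e k c) := by
  have hcc := add_one_ne ρ c
  have hN' : cycIoo ρ.succ (loc H c σ e k (c + 1)).1 (loc H c σ e k c).1 := hN
  have hjc : j ≠ c := by
    rintro rfl
    exact not_cycIco_right _ _ hj.2
  have hj1 : j ≠ c + 1 := by
    rintro rfl
    exact hj.1 rfl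
  have hswap : ∀ i, i ≠ c → i ≠ c + 1 →
      (loc H c σ e k ∘ swap c (c + 1)) i = loc H c σ e k i := fun i h1 h2 => by
    simp [swap_apply_of_ne_of_ne h1 h2]
  have hswap1 : (loc H c σ e k ∘ swap c (c + 1)) (c + 1) = loc H c σ e k c := by simp
  have hswap2 : (loc H c σ e k ∘ swap c (c + 1)) c = loc H c σ e k (c + 1) := by simp
  have hswapj := hswap j hjc hj1
  rw [rect_loc_iff hσ he]
  constructor
  · intro hx
    have h1 := hx.noMarking
    rw [hswapj, hswap1] at h1
    refine ⟨?_, hjc, h1, fun i hi hi' => ?_⟩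
    · rw [cycIoo_iff] at hj
      omega
    · have h2 := hx.clear i hi
      rw [hswapj, hswap1] at h2
      by_cases hi1 : i = c + 1
      · subst hi1
        grind
      · have hic : i ≠ c := by
          rintro rfl
          exact not_cycIco_right _ _ hi.2
        rw [hswap i hic hi1] at h2
        exact h2 hi'
  · rintro ⟨h1, -, h2, h3⟩
    refine ⟨?_, ?_, ?_, fun i hi hi' => ?_⟩
    · rw [hswap2, hswap1]
      grind
    · rwa [hswap2, hswap1, hswapj]
    · rwa [hswap1, hswapj]
    · rw [hswap1, hswapj] at hi'
      by_cases hi1 : i = c + 1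
      · subst hi1
        rw [hswap1] at hi'
        exact not_cycIco_right _ _ hi'.2
      · have hic : i ≠ c := by
          rintro rfl
          exact not_cycIco_right _ _ hi.2
        rw [hswap i hic hi1] at hi'
        exact h3 i hi hi'

open Classical in
theorem locR_thin_state (h : IsStabilization G H ρ c) (hσ : H.IsGen σ) (hes : e = ρ.castSucc)
    (hArow : A.1 = ρ.succ) (hN : NPlus ρ c (loc H c σ e k)) :
    locR H ρ c S o A (loc H c σ e k ∘ swap c (c + 1)) =
      (if H.Rect σ (loc H c σ e k (c + 1)) A then 1 else 0) +
      ∑ j, if H.Rect σ (loc H c σ e k j) (loc H c σ e k c) ∧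
          cycIoo (loc H c σ e k (c + 1)).1 ρ.succ (loc H c σ e k j).1 ∧
          Poly H ρ c A (loc H c σ e k ∘ swap j c) (loc H c σ e k j) then
        tau S o (loc H c σ e k j) (loc H c σ e k c) *
          tau S o (loc H c σ e k (c + 1)) (loc H c σ e k c) else 0 := by
  have hcc := add_one_ne ρ c
  have hv := val_rows ρ
  have hN' : cycIoo ρ.succ (loc H c σ e k (c + 1)).1 (loc H c σ e k c).1 := hN
  have hswap : ∀ i, i ≠ c → i ≠ c + 1 →
      (loc H c σ e k ∘ swap c (c + 1)) i = loc H c σ e k i := fun i h1 h2 => by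
    simp [swap_apply_of_ne_of_ne h1 h2]
  have hswap1 : (loc H c σ e k ∘ swap c (c + 1)) (c + 1) = loc H c σ e k c := by simp
  have hswap2 : (loc H c σ e k ∘ swap c (c + 1)) c = loc H c σ e k (c + 1) := by simp
  unfold locR
  rw [hswap2]
  congr 1
  · exact if_congr (poly_thin_iff h hσ hes hArow hN) rfl rfl
  refine Finset.sum_congr rfl fun j _ => ?_
  by_cases hj : cycIoo (loc H c σ e k (c + 1)).1 ρ.succ (loc H c σ e k j).1
  · have hjc : j ≠ c := by
      rintro rfl
      grind
    have hj1 : j ≠ c + 1 := by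
      rintro rfl
      exact hj.1 rfl
    have hswapj := hswap j hjc hj1
    have hswapj1 : (loc H c σ e k ∘ swap j c) j = loc H c σ e k c := by simp
    have hswapj2 : (loc H c σ e k ∘ swap j c) c = loc H c σ e k j := by simp
    have hx := hexAt_thin_iff hσ hN (j := j) (by
      grind) (by
      grind) (by
      subst hes
      grind)
    have hp : Poly H ρ c A (loc H c σ e k ∘ swap c (c + 1)) (loc H c σ e k j) ↔
        Poly H ρ c A (loc H c σ e k ∘ swap j c) (loc H c σ e k j) := by
      have hrA : loc H c σ e k c ≠ A := fun h' => by
        rw [h', hArow] at hN'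
        exact hN'.1 rfl
      have htA : loc H c σ e k (c + 1) ≠ A := fun h' => hN.row_ne (h' ▸ hArow)
      have hjA : loc H c σ e k j ≠ A := fun h' => by
        rw [h', hArow] at hj
        exact not_cycIco_right _ _ hj.2
      have hr1 : ¬ cycIoo (loc H c σ e k j).1 ρ.succ (loc H c σ e k c).1 := by grind
      have ht1 : ¬ cycIoo (loc H c σ e k j).1 ρ.succ (loc H c σ e k (c + 1)).1 := by grind
      have hj2 : ¬ cycIoo (loc H c σ e k j).1 ρ.succ (loc H c σ e k j).1 := fun h' => h'.1 rfl
      have hsj1 : (loc H c σ e k ∘ swap j c) (c + 1) = loc H c σ e k (c + 1) := by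
        simp [swap_apply_of_ne_of_ne hj1.symm hcc]
      have hsj : ∀ i, i ≠ c → i ≠ j → (loc H c σ e k ∘ swap j c) i = loc H c σ e k i :=
        fun i h1 h2 => by simp [swap_apply_of_ne_of_ne h2 h1]
      refine Poly.congr (fun i => ?_) (fun i hic => ?_)
      · by_cases h1 : i = c
        · subst h1
          rw [hswap2, hswapj2]
          exact iff_of_false htA hjA
        by_cases h2 : i = c + 1
        · subst h2
          rw [hswap1, hsj1]
          exact iff_of_false hrA htA
        by_cases h3 : i = j
        · subst h3
          rw [hswapj, hswapj1]
          exact iff_of_false hjA hrA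
        rw [hswap i h1 h2, hsj i h1 h3]
      · by_cases h2 : i = c + 1
        · subst h2
          rw [hswap1, hsj1]
          exact iff_of_false hr1 ht1
        by_cases h3 : i = j
        · subst h3
          rw [hswapj, hswapj1]
          exact iff_of_false hj2 hr1
        rw [hswap i hic h2, hsj i hic h3]
    rw [hexOp, hswap1, hswap2, hswapj, hx, hp]
  · rw [if_neg, if_neg]
    · tauto
    · rintro ⟨hx, h1, -⟩
      by_cases hjc : j = c
      · subst hjc
        exact h1.1 (congrArg Prod.fst hswap2)
      by_cases hj1 : j = c + 1
      · subst hj1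
        have := hx.obtuse
        rw [hswap1] at this
        exact not_cycIco_right _ _ this.2
      · rw [hswap j hjc hj1] at h1
        exact hj h1

open Classical in
theorem locL_thin_state (hσ : H.IsGen σ) (hes : e = ρ.succ + 1)
    (hArow : A.1 = ρ.succ) (hN : NPlus ρ c (loc H c σ e k)) :
    locL H ρ c S o A (loc H c σ e k ∘ swap c (c + 1)) =
      ∑ j, if H.Rect σ (loc H c σ e k j) (loc H c σ e k c) ∧ loc H c σ e k j = A then
        tau S o (loc H c σ e k j) (loc H c σ e k c) *
          tau S o (loc H c σ e k (c + 1)) (loc H c σ e k c) else 0 := by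
  have hcc := add_one_ne ρ c
  have hsu := val_add_one_cases ρ ρ.succ
  have hN' : cycIoo ρ.succ (loc H c σ e k (c + 1)).1 (loc H c σ e k c).1 := hN
  have hswap : ∀ i, i ≠ c → i ≠ c + 1 →
      (loc H c σ e k ∘ swap c (c + 1)) i = loc H c σ e k i := fun i h1 h2 => by
    simp [swap_apply_of_ne_of_ne h1 h2]
  have hswap1 : (loc H c σ e k ∘ swap c (c + 1)) (c + 1) = loc H c σ e k c := by simp
  have hswap2 : (loc H c σ e k ∘ swap c (c + 1)) c = loc H c σ e k (c + 1) := by simp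
  have hrA : loc H c σ e k c ≠ A := fun h' => by
    rw [h', hArow] at hN'
    exact hN'.1 rfl
  have htA : loc H c σ e k (c + 1) ≠ A := fun h' => hN.row_ne (h' ▸ hArow)
  unfold locL
  rw [hswap2, if_neg htA, zero_add]
  refine Finset.sum_congr rfl fun j _ => ?_
  by_cases hj : loc H c σ e k j = A
  · have hjc : j ≠ c := by
      rintro rfl
      exact hrA hj
    have hj1 : j ≠ c + 1 := by
      rintro rfl
      exact htA hj
    have ht := hN.row_ne
    have hx := hexAt_thin_iff hσ hN (j := j) (by
      rw [hj, hArow]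
      grind) (by
      rw [hj, hArow]
      exact cycIco_left hN'.1.symm) (by
      rw [hj, hArow]
      subst hes
      grind)
    rw [hexOp, hswap1, hswap2, hswap j hjc hj1, hx]
  · rw [if_neg, if_neg]
    · tauto
    · rintro ⟨-, h1⟩
      by_cases hjc : j = c
      · subst hjc
        exact htA (hswap2 ▸ h1)
      by_cases hj1 : j = c + 1
      · subst hj1
        exact hrA (hswap1 ▸ h1)
      · exact hj (hswap j hjc hj1 ▸ h1)

end Local

/-! ### Products over the sheets -/

theorem list_prod_eq_update_mul {K M : Type*} [DecidableEq K] [Monoid M] (g : K → M) (k : K)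
    {l : List K} (hl : l.Nodup) (hk : k ∈ l) (hc : ∀ k', k' ≠ k → Commute (g k) (g k')) :
    (l.map g).prod = (l.map (Function.update g k 1)).prod * g k := by
  induction l with
  | nil => simp at hk
  | cons a l ih =>
    rw [List.nodup_cons] at hl
    rw [List.map_cons, List.map_cons, List.prod_cons, List.prod_cons]
    by_cases ha : a = k
    · subst ha
      have h1 : l.map (Function.update g a 1) = l.map g :=
        List.map_congr_left fun x hx => Function.update_of_ne (fun e => hl.1 (by rwa [← e])) _ _
      rw [h1, Function.update_self, one_mul]
      refine Commute.list_prod_right (l.map g) _ fun x hx => ?_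
      obtain ⟨k', hk', rfl⟩ := List.mem_map.1 hx
      exact hc k' fun e => hl.1 (e ▸ hk')
    · rw [Function.update_of_ne ha, ih hl.2 ((List.mem_cons.1 hk).resolve_left (Ne.symm ha)),
        mul_assoc]

section SheetProd

variable {m : ℕ} [NeZero m] {M : Type*} [Monoid M]

/-- The sheets in a fixed order. -/
def sheetList (m : ℕ) [NeZero m] : List (ZMod m) := (List.finRange m).map (ZMod.finEquiv m)

theorem nodup_sheetList : (sheetList m).Nodup :=
  (List.nodup_finRange m).map (ZMod.finEquiv m).injective

theorem mem_sheetList (k : ZMod m) : k ∈ sheetList m :=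
  List.mem_map.2 ⟨(ZMod.finEquiv m).symm k, List.mem_finRange _, by simp⟩

/-- The product over the sheets in a fixed order. -/
def sheetProd (g : ZMod m → M) : M := ((sheetList m).map g).prod

theorem sheetProd_eq_mul (g : ZMod m → M) (k : ZMod m)
    (hc : ∀ k', k' ≠ k → Commute (g k) (g k')) :
    sheetProd g = sheetProd (Function.update g k 1) * g k :=
  list_prod_eq_update_mul g k nodup_sheetList (mem_sheetList k) hc

theorem sheetProd_eq_zero {R : Type*} [MonoidWithZero R] {g : ZMod m → R} (k : ZMod m)
    (hk : g k = 0) : sheetProd g = 0 :=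
  List.prod_eq_zero (List.mem_map.2 ⟨k, mem_sheetList k, hk⟩)

theorem sheetProd_one {g : ZMod m → M} (hg : ∀ k, g k = 1) : sheetProd g = 1 :=
  List.prod_eq_one fun x hx => by
    obtain ⟨k, -, rfl⟩ := List.mem_map.1 hx
    exact hg k

end SheetProd

section Maps

variable {e : Fin (n + 1)} {k : ZMod m} {σ : State (n + 1) m}
variable {f f' : Fin (n + 1) → Curve (n + 1) m} {A A' : Curve (n + 1) m}

theorem HexAt.ne_add_one {j : Fin (n + 1)} (h : HexAt H ρ c f j) : f j ≠ f (c + 1) := fun e' => by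
  have := h.obtuse
  rw [e'] at this
  exact not_cycIco_right _ _ this.2

theorem HexAt.ne_add_one' {j : Fin (n + 1)} (h : HexAt H ρ c f j) : f c ≠ f (c + 1) := fun e' => by
  have h1 := h.punctured
  have h2 := h.obtuse
  have h3 := h.row_ne
  have h4 := h.clear
  by_cases hj : f j = f (c + 1)
  · exact h.ne_add_one hj
  · have h5 : cycIoo (f c).1 (f c).1 ρ.succ := by rwa [← e'] at h1
    unfold cycIoo cycIco at h5
    rw [sub_self] at h5
    exact absurd h5.2 (by simp)

theorem hexOp_commute (hd : ∀ i j, f i ≠ f' j) {i j : Fin (n + 1)} (hi : HexAt H ρ c f i)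
    (hj : HexAt H ρ c f' j) : Commute (hexOp c S o f i) (hexOp c S o f' j) := by
  have key : ∀ a b a' b' : Fin (n + 1), f a ≠ f b → f' a' ≠ f' b' →
      tau S o (f a) (f b) * tau S o (f' a') (f' b') =
        -(tau S o (f' a') (f' b') * tau S o (f a) (f b)) := fun a b a' b' h1 h2 =>
    tau_disjoint S o h2 h1 (hd _ _).symm (hd _ _).symm (hd _ _).symm (hd _ _).symm
  have k1 := key i (c + 1) j (c + 1) hi.ne_add_one hj.ne_add_one
  have k2 := key i (c + 1) c (c + 1) hi.ne_add_one hj.ne_add_one'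
  have k3 := key c (c + 1) j (c + 1) hi.ne_add_one' hj.ne_add_one
  have k4 := key c (c + 1) c (c + 1) hi.ne_add_one' hj.ne_add_one'
  unfold hexOp Commute SemiconjBy
  rw [mul_assoc, ← mul_assoc (tau S o (f c) (f (c + 1))), k3, neg_mul, mul_assoc, k4, mul_neg,
    mul_neg, mul_neg, neg_neg, ← mul_assoc, k1, neg_mul, mul_assoc,
    ← mul_assoc (tau S o (f i) (f (c + 1))), k2, neg_mul, mul_neg, neg_neg]
  simp only [mul_assoc]

theorem commute_ite {R : Type*} [MonoidWithZero R] {a b : R} (p : Prop) [Decidable p]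
    (h : p → Commute a b) : Commute a (if p then b else 0) := by
  split_ifs with hp
  · exact h hp
  · exact Commute.zero_right a

theorem locR_commute (hd : ∀ i j, f i ≠ f' j) :
    Commute (locR H ρ c S o A f) (locR H ρ c S o A' f') := by
  classical
  refine Commute.add_left (commute_ite _ fun _ => Commute.one_right _).symm
    (Commute.sum_left _ _ _ fun i _ => (commute_ite _ fun hi => ?_).symm)
  refine Commute.add_left (commute_ite _ fun _ => Commute.one_right _).symm
    (Commute.sum_left _ _ _ fun j _ => (commute_ite _ fun hj => ?_).symm)
  exact hexOp_commute S o hd hi.1 hj.1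

theorem locL_commute (hd : ∀ i j, f i ≠ f' j) :
    Commute (locL H ρ c S o A f) (locL H ρ c S o A' f') := by
  classical
  refine Commute.add_left (commute_ite _ fun _ => Commute.one_right _).symm
    (Commute.sum_left _ _ _ fun i _ => (commute_ite _ fun hi => ?_).symm)
  refine Commute.add_left (commute_ite _ fun _ => Commute.one_right _).symm
    (Commute.sum_left _ _ _ fun j _ => (commute_ite _ fun hj => ?_).symm)
  exact hexOp_commute S o hd hi.1 hj.1

theorem NPlus.rect (h : IsStabilization G H ρ c) (hσ : H.IsGen σ) (hes : e ≠ ρ.succ)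
    (hN : NPlus ρ c (loc H c σ e k)) : H.Rect σ (loc H c σ e k c) (loc H c σ e k (c + 1)) := by
  have hrc : σ (loc H c σ e k c) = (c, k) := by rw [apply_loc, colAt_self]
  have htc : σ (loc H c σ e k (c + 1)) = (c + 1, k) := by rw [apply_loc, h.colAt_add_one hes]
  have mr : H.Meets (loc H c σ e k c) (c, k) := hrc ▸ hσ _
  have mt1 : H.Meets (loc H c σ e k (c + 1)) (c + 1, k) := htc ▸ hσ _
  have hN' : cycIoo ρ.succ (loc H c σ e k (c + 1)).1 (loc H c σ e k c).1 := hN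
  refine ⟨fun e' => ?_, ?_, ?_, ?_, ?_, ?_⟩
  · rw [e'] at hN'
    exact not_cycIco_right _ _ hN'.2
  · rw [hrc, htc]; exact (add_one_ne ρ c).symm
  · rw [htc]; exact (h.meets_add_one hN.1).2 mr
  · rw [hrc]; exact (h.meets_add_one hN.row_ne).1 mt1
  · rw [hrc, htc]
    intro j hj
    rw [cycIco_add_one ρ] at hj
    subst hj
    rw [h.X_new, h.O_new]
    have hv := val_rows ρ
    have := hN.row_ne
    grind
  · rw [hrc, htc]
    intro p _ hp
    exact absurd hp (not_cycIoo_add_one ρ)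

theorem eq_alphaThrough (h : IsStabilization G H ρ c) {k : ZMod m} {p : Curve (n + 1) m}
    (hp : p.1 = ρ.succ) (hm : H.Meets p (c + 1, k)) : p = alphaThrough H ρ c (k + 1) :=
  hm.left_unique (h.meets_alphaThrough_add_one k) hp

theorem eq_alphaThrough' {k : ZMod m} {p : Curve (n + 1) m}
    (hp : p.1 = ρ.succ) (hm : H.Meets p (c, k)) : p = alphaThrough H ρ c k :=
  hm.left_unique (meets_alphaThrough H ρ c k) hp

variable [NeZero m]

variable (H ρ c) in
/-- The product over the sheets of the contributions to `F^R`. -/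
def prodR (σ : State (n + 1) m) : Operator (n + 1) m :=
  sheetProd fun k => locR H ρ c S o (alphaThrough H ρ c (k + 1)) (loc H c σ ρ.castSucc k)

variable (H ρ c) in
/-- The operator whose value on a state is the value of `F^R`. -/
def opR (σ : State (n + 1) m) : Operator (n + 1) m :=
  prodR H ρ c S o σ * polyOp S o (fun k => σ.symm (c, k)) (alphaThrough H ρ c)

variable (H ρ c) in
/-- The operator whose value on a state is the value of `F^L`. -/
def opL (σ : State (n + 1) m) : Operator (n + 1) m :=
  sheetProd fun k => locL H ρ c S o (alphaThrough H ρ c k) (loc H c σ (ρ.succ + 1) k)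

theorem prodR_split (k : ZMod m) (a b : Fin (n + 1)) :
    prodR H ρ c S o (mv σ (loc H c σ ρ.castSucc k a) (loc H c σ ρ.castSucc k b)) =
      sheetProd (Function.update
        (fun k => locR H ρ c S o (alphaThrough H ρ c (k + 1)) (loc H c σ ρ.castSucc k)) k 1) *
      locR H ρ c S o (alphaThrough H ρ c (k + 1)) (loc H c σ ρ.castSucc k ∘ swap a b) := by
  unfold prodR
  rw [sheetProd_eq_mul _ k, loc_mv_loc]
  · congr 2
    funext k'
    by_cases hk : k' = k
    · subst hk; simp
    · rw [Function.update_of_ne hk, Function.update_of_ne hk, loc_mv_of_ne hk]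
  · exact fun k' hk => locR_commute S o fun i j h => hk (loc_inj.1 h).1.symm

theorem opL_split (k : ZMod m) (a b : Fin (n + 1)) :
    opL H ρ c S o (mv σ (loc H c σ (ρ.succ + 1) k a) (loc H c σ (ρ.succ + 1) k b)) =
      sheetProd (Function.update
        (fun k => locL H ρ c S o (alphaThrough H ρ c k) (loc H c σ (ρ.succ + 1) k)) k 1) *
      locL H ρ c S o (alphaThrough H ρ c k) (loc H c σ (ρ.succ + 1) k ∘ swap a b) := by
  unfold opL
  rw [sheetProd_eq_mul _ k, loc_mv_loc]
  · congr 2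
    funext k'
    by_cases hk : k' = k
    · subst hk; simp
    · rw [Function.update_of_ne hk, Function.update_of_ne hk, loc_mv_of_ne hk]
  · exact fun k' hk => locL_commute S o fun i j h => hk (loc_inj.1 h).1.symm

theorem opR_eq_zero {σ : State (n + 1) m} (k : ZMod m)
    (h : locR H ρ c S o (alphaThrough H ρ c (k + 1)) (loc H c σ ρ.castSucc k) = 0) :
    opR H ρ c S o σ = 0 := by
  rw [opR, prodR, sheetProd_eq_zero k h, zero_mul]

theorem opL_eq_zero {σ : State (n + 1) m} (k : ZMod m)
    (h : locL H ρ c S o (alphaThrough H ρ c k) (loc H c σ (ρ.succ + 1) k) = 0) :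
    opL H ρ c S o σ = 0 := sheetProd_eq_zero k h

theorem castSucc_ne_succ (ρ : Fin n) : ρ.castSucc ≠ ρ.succ := by
  rw [fin_ne_iff, Fin.val_castSucc, Fin.val_succ]; omega

theorem succ_add_one_ne_succ (ρ : Fin n) : ρ.succ + 1 ≠ ρ.succ := add_one_ne ρ ρ.succ

open Classical in
/-- The differential of a state with two components on the corners of a thin rectangle is annihilated
by `F^L`. -/
theorem sum_opL_of_nPlus (h : IsStabilization G H ρ c) (hσ : H.IsGen σ)
    (hN : NPlus ρ c (loc H c σ (ρ.succ + 1) k)) :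
    (∑ s, ∑ t, if H.Rect σ s t then opL H ρ c S o (mv σ s t) * tau S o s t else 0) = 0 := by
  set f := loc H c σ (ρ.succ + 1) k with hf
  set A := alphaThrough H ρ c k with hA
  set X := sheetProd (Function.update
        (fun k => locL H ρ c S o (alphaThrough H ρ c k) (loc H c σ (ρ.succ + 1) k)) k 1) with hX
  have hcc := add_one_ne ρ c
  have hrt : f c ≠ f (c + 1) := fun e' => hcc.symm (loc_injective e')
  have hrc : σ (f c) = (c, k) := by rw [hf, apply_loc, colAt_self]
  have htc : σ (f (c + 1)) = (c + 1, k) := by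
    rw [hf, apply_loc, h.colAt_add_one (succ_add_one_ne_succ ρ)]
  have hArow : A.1 = ρ.succ := rfl
  have hrA : f c ≠ A := fun h' => hN.1 (h' ▸ hArow)
  have htA : f (c + 1) ≠ A := fun h' => hN.row_ne (h' ▸ hArow)
  have hthin : H.Rect σ (f c) (f (c + 1)) := hN.rect h hσ (succ_add_one_ne_succ ρ)
  let T (s t : Curve (n + 1) m) : Operator (n + 1) m :=
    if H.Rect σ s t then opL H ρ c S o (mv σ s t) * tau S o s t else 0
  have hT : ∀ s t, T s t = (if s = f c ∧ t = f (c + 1) then T (f c) (f (c + 1)) else 0) +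
      (if t = f c then T s (f c) else 0) := by
    intro s t
    by_cases h1 : s = f c ∧ t = f (c + 1)
    · rw [if_pos h1, if_neg, add_zero, h1.1, h1.2]
      rw [h1.2]; exact hrt.symm
    · rw [if_neg h1, zero_add]
      by_cases h2 : t = f c
      · rw [if_pos h2, h2]
      · rw [if_neg h2]
        by_cases hr : H.Rect σ s t
        · refine (if_pos hr).trans ?_
          rw [opL_eq_zero S o k, zero_mul]
          rw [show loc H c (mv σ s t) (ρ.succ + 1) k = fun j => swap s t (f j) from
            funext fun j => loc_mv s t j]
          rcases hN.cases h hσ (Or.inr rfl) (succ_add_one_ne_succ ρ) hr with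
            h3 | h3 | ⟨j, -, h3, -⟩ | h3 | h3 | ⟨j, h3, h4, h5, h6⟩
          · exact locL_eq_zero_of_nPlus S o hArow h3
          · exact absurd h3 h1
          · exact absurd h3 h2
          · exact absurd h3.1 h2
          · refine locL_eq_zero_of_row S o ?_ ?_
            · rw [h3.1]
              rw [swap_apply_of_ne_of_ne hrt (Ne.symm h2)]
              exact hrA
            · rw [h3.1, swap_apply_left]
              exact h3.2
          · rw [h3, h4, swap_loc_eq]
            exact locL_high S o hArow hN h5 h6
        · exact if_neg hr
  have hT1 : T (f c) (f (c + 1)) = -(X * ∑ j, if H.Rect σ (f j) (f c) ∧ f j = A then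
        tau S o (f j) (f c) else 0) := by
    refine (if_pos hthin).trans ?_
    rw [opL_split, ← hX, ← hf, locL_thin_state S o hσ rfl hArow hN, mul_assoc, Finset.sum_mul,
      ← mul_neg, ← Finset.sum_neg_distrib]
    congr 1
    refine Finset.sum_congr rfl fun j _ => ?_
    split_ifs with hj
    · rw [mul_assoc, tau_symm S o hrt, neg_mul]
      erw [tau_sq S o hrt]
      rw [mul_neg, mul_one]
    · simp
  have hT2 : ∀ j, T (f j) (f c) = X * if H.Rect σ (f j) (f c) ∧ f j = A then
        tau S o (f j) (f c) else 0 := by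
    intro j
    by_cases hr : H.Rect σ (f j) (f c)
    · refine (if_pos hr).trans ?_
      rw [opL_split, ← hX, ← hf]
      by_cases hj : f j = A
      · rw [if_pos ⟨hr, hj⟩, locL_of_eq S o (by simpa using hj) hArow, mul_one]
      · rw [if_neg fun h' => hj h'.2, mul_zero]
        have hjrow : (f j).1 ≠ ρ.succ := fun e' => hj (eq_alphaThrough' e' (hrc ▸ hr.ms))
        rcases hN.cases h hσ (Or.inr rfl) (succ_add_one_ne_succ ρ) hr with
            h3 | h3 | ⟨j', h3, -, h4⟩ | h3 | h3 | ⟨j', h3, h4, h5, h6⟩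
        · rw [swap_loc_eq] at h3
          rw [locL_eq_zero_of_nPlus S o hArow h3, mul_zero, zero_mul]
        · exact absurd h3.2 hrt
        · rw [← h3] at h4
          rw [locL_low S o hσ hArow rfl hN h4 hr, mul_zero, zero_mul]
        · exact absurd h3.2 hjrow
        · exact absurd h3.2 hN.1
        · rw [← h4] at h5
          exact absurd h5 fun h5 => not_cycIco_right _ _ h5.2
    · rw [if_neg fun h' => hr h'.1, mul_zero]
      exact if_neg hr
  have hT3 : ∑ s, T s (f c) = ∑ j, T (f j) (f c) := by
    refine (Fintype.sum_of_injective f loc_injective _ _ (fun s hs => ?_) fun j => rfl).symm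
    by_cases hr : H.Rect σ s (f c)
    · refine (if_pos hr).trans ?_
      rcases hN.cases h hσ (Or.inr rfl) (succ_add_one_ne_succ ρ) hr with
          h3 | h3 | ⟨j, h3, -⟩ | h3 | h3 | ⟨j', h3, h4, h5, h6⟩
      · rw [opL_eq_zero S o k, zero_mul]
        rw [show loc H c (mv σ s (f c)) (ρ.succ + 1) k = fun j => swap s (f c) (f j) from
          funext fun j => loc_mv s (f c) j]
        exact locL_eq_zero_of_nPlus S o hArow h3
      · exact absurd h3.2 hrt
      · exact absurd ⟨j, h3.symm⟩ hs
      · obtain ⟨j, hj⟩ := hr.exists_loc_left hσ (by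
          change cycIcc s.1 (f c).1 _
          have h1 := val_add_one_cases ρ ρ.succ
          have h4 := hr.row
          rw [h3.2] at h4 ⊢
          grind)
        exact absurd ⟨j, hj.symm⟩ hs
      · exact absurd h3.2 hN.1
      · rw [← h4] at h5
        exact absurd h5 fun h5 => not_cycIco_right _ _ h5.2
    · exact if_neg hr
  calc _ = ∑ s, ∑ t, T s t := rfl
    _ = T (f c) (f (c + 1)) + ∑ s, T s (f c) := by
      rw [Finset.sum_congr rfl fun s _ => Finset.sum_congr rfl fun t _ => hT s t]
      simp [Finset.sum_add_distrib, ite_and]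
    _ = 0 := by
      rw [hT3, Finset.sum_congr rfl fun j _ => hT2 j, ← Finset.mul_sum, hT1]
      exact neg_add_cancel _

end Maps

section Maps

variable {k : ZMod m} {σ : State (n + 1) m}
variable (H ρ c) in
theorem alphaThrough_injective : Function.Injective (alphaThrough H ρ c (m := m)) := fun i j h => by
  simpa [alphaThrough] using h

theorem symm_col_injective (σ : State (n + 1) m) :
    Function.Injective fun k : ZMod m => σ.symm (c, k) := fun i j h => by
  simpa using h

variable [NeZero m]

open Classical in
/-- The differential of a state with two components on the corners of a thin rectangle is annihilated
by `F^R`. -/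
theorem sum_opR_of_nPlus (h : IsStabilization G H ρ c) (hσ : H.IsGen σ)
    (hN : NPlus ρ c (loc H c σ ρ.castSucc k)) :
    (∑ s, ∑ t, if H.Rect σ s t then opR H ρ c S o (mv σ s t) * tau S o s t else 0) = 0 := by
  set f := loc H c σ ρ.castSucc k with hf
  set A := alphaThrough H ρ c (k + 1) with hA
  set X := sheetProd (Function.update
        (fun k => locR H ρ c S o (alphaThrough H ρ c (k + 1)) (loc H c σ ρ.castSucc k)) k 1) with hX
  set W := polyOp S o (fun k => σ.symm (c, k)) (alphaThrough H ρ c) with hW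
  have hcc := add_one_ne ρ c
  have hrt : f c ≠ f (c + 1) := fun e' => hcc.symm (loc_injective e')
  have hrc : σ (f c) = (c, k) := by rw [hf, apply_loc, colAt_self]
  have htc : σ (f (c + 1)) = (c + 1, k) := by rw [hf, apply_loc, h.colAt_add_one (castSucc_ne_succ ρ)]
  have hArow : A.1 = ρ.succ := rfl
  have hrA : f c ≠ A := fun h' => hN.1 (h' ▸ hArow)
  have htA : f (c + 1) ≠ A := fun h' => hN.row_ne (h' ▸ hArow)
  have hthin : H.Rect σ (f c) (f (c + 1)) := hN.rect h hσ (castSucc_ne_succ ρ)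
  let T (s t : Curve (n + 1) m) : Operator (n + 1) m :=
    if H.Rect σ s t then opR H ρ c S o (mv σ s t) * tau S o s t else 0
  have hzero : ∀ s t, H.Rect σ s t →
      ¬ (s = f c ∧ t = f (c + 1)) → ¬ (s = f (c + 1) ∧ t = A) →
      ¬ (∃ j, s = f j ∧ t = f c ∧ cycIoo (f (c + 1)).1 ρ.succ (f j).1) → T s t = 0 := by
    intro s t hr h1 h2 h3
    refine (if_pos hr).trans ?_
    rw [opR_eq_zero S o k, zero_mul]
    rw [show loc H c (mv σ s t) ρ.castSucc k = fun j => swap s t (f j) from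
      funext fun j => loc_mv s t j]
    rcases hN.cases h hσ (Or.inl rfl) (castSucc_ne_succ ρ) hr with
      h4 | h4 | h4 | h4 | h4 | ⟨j, h4, h5, h6, h7⟩
    · exact locR_eq_zero_of_nPlus S o hArow h4
    · exact absurd h4 h1
    · exact absurd h4 h3
    · refine locR_eq_zero_of_row S o ?_
      rw [h4.1]
      change (swap s (f c) (f c)).1 = _
      rw [swap_apply_right]
      exact h4.2
    · refine absurd ⟨h4.1, eq_alphaThrough h h4.2 ?_⟩ h2
      have := hr.mt
      rwa [h4.1, ← hf, htc] at this
    · rw [h4, h5, swap_loc_eq]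
      rw [h4, h5] at hr
      exact locR_high S o h hσ rfl hArow hN h6 hr h7
  have hT : ∀ s t, T s t = (if s = f c ∧ t = f (c + 1) then T (f c) (f (c + 1)) else 0) +
      ((if t = f c then T s (f c) else 0) +
        if s = f (c + 1) ∧ t = A then T (f (c + 1)) A else 0) := by
    intro s t
    by_cases h1 : s = f c ∧ t = f (c + 1)
    · rw [if_pos h1, if_neg, if_neg, add_zero, add_zero, h1.1, h1.2]
      · rw [h1.2]; exact fun h' => htA h'.2
      · rw [h1.2]; exact hrt.symm
    · rw [if_neg h1, zero_add]
      by_cases h2 : t = f c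
      · rw [if_pos h2, if_neg, add_zero, h2]
        rw [h2]; exact fun h' => hrA h'.2
      · rw [if_neg h2, zero_add]
        by_cases h3 : s = f (c + 1) ∧ t = A
        · rw [if_pos h3, h3.1, h3.2]
        · rw [if_neg h3]
          by_cases hr : H.Rect σ s t
          · exact hzero s t hr h1 h3 fun ⟨j, _, h4, _⟩ => h2 h4
          · exact if_neg hr
  have hT3 : ∑ s, T s (f c) = ∑ j, T (f j) (f c) := by
    refine (Fintype.sum_of_injective f loc_injective _ _ (fun s hs => ?_) fun j => rfl).symm
    by_cases hr : H.Rect σ s (f c)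
    · exact hzero s _ hr (fun h' => hrt h'.2) (fun h' => hrA h'.2)
        fun ⟨j, h4, _⟩ => hs ⟨j, h4.symm⟩
    · exact if_neg hr
  have hsum : (∑ s, ∑ t, T s t) = T (f c) (f (c + 1)) + (∑ j, T (f j) (f c) + T (f (c + 1)) A) := by
    rw [Finset.sum_congr rfl fun s _ => Finset.sum_congr rfl fun t _ => hT s t, ← hT3]
    simp [Finset.sum_add_distrib, ite_and]
  refine hsum.trans ?_
  by_cases hrow : ∀ k', (σ.symm (c, k')).1 ≠ ρ.succ
  · have hrinj := symm_col_injective (c := c) σ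
    have hAinj := alphaThrough_injective H ρ c (m := m)
    have hrA' : ∀ i j, σ.symm (c, i) ≠ alphaThrough H ρ c j := fun i j h' =>
      hrow i (congrArg Prod.fst h')
    have hconj : ∀ s t, s ≠ t → s.1 ≠ ρ.succ → t.1 ≠ ρ.succ →
        polyOp S o (fun k => (mv σ s t).symm (c, k)) (alphaThrough H ρ c) * tau S o s t =
          -(tau S o s t * W) := by
      intro s t hst hs ht
      have h1 : (swap s t ∘ alphaThrough H ρ c) = alphaThrough H ρ c (m := m) := funext fun i =>
        swap_apply_of_ne_of_ne (fun e' => hs (congrArg Prod.fst e').symm)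
          (fun e' => ht (congrArg Prod.fst e').symm)
      rw [polyOp_conj S o (symm_col_injective _) hAinj _ hst, h1]
      · congr 3
        funext i
        simp [mv_symm_apply]
      · intro i j h'
        rw [mv_symm_apply, swap_apply_eq_iff, ← Function.comp_apply (f := swap s t),
          h1] at h'
        exact hrA' _ _ h'
    have hT1 : T (f c) (f (c + 1)) = (X * ((∑ j, if H.Rect σ (f j) (f c) ∧
        cycIoo (f (c + 1)).1 ρ.succ (f j).1 ∧ Poly H ρ c A (f ∘ swap j c) (f j) then
          tau S o (f j) (f c) else 0) -
        if H.Rect σ (f (c + 1)) A then tau S o (f c) (f (c + 1)) else 0)) * W := by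
      refine (if_pos hthin).trans ?_
      rw [opR, prodR_split, ← hX, ← hf, locR_thin_state S o h hσ rfl hArow hN, mul_assoc,
        hconj _ _ hrt hN.1 hN.row_ne, mul_neg, ← neg_mul, ← mul_assoc, ← mul_neg, mul_assoc X]
      congr 2
      rw [neg_add, add_mul, ← Finset.sum_neg_distrib, Finset.sum_mul, sub_eq_add_neg]
      refine (add_comm _ _).trans ?_
      congr 1
      · refine Finset.sum_congr rfl fun j _ => ?_
        split_ifs with hj
        · rw [neg_mul, mul_assoc, tau_symm S o hrt, neg_mul]
          erw [tau_sq S o hrt]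
          rw [mul_neg, mul_one, neg_neg]
        · simp
      · split_ifs <;> simp
    have hT2 : ∀ j, T (f j) (f c) = -(X * if H.Rect σ (f j) (f c) ∧
        cycIoo (f (c + 1)).1 ρ.succ (f j).1 ∧ Poly H ρ c A (f ∘ swap j c) (f j) then
          tau S o (f j) (f c) else 0) * W := by
      intro j
      by_cases hr : H.Rect σ (f j) (f c)
      · by_cases hj : cycIoo (f (c + 1)).1 ρ.succ (f j).1
        · refine (if_pos hr).trans ?_
          have hjrow : (f j).1 ≠ ρ.succ := fun e' => by
            rw [e'] at hj
            exact not_cycIco_right _ _ hj.2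
          rw [opR, prodR_split, ← hX, ← hf, locR_low S o hσ rfl hN hj hr, mul_assoc,
            hconj _ _ hr.ne hjrow hN.1, mul_neg, ← mul_assoc, ← neg_mul, mul_assoc X, ite_mul,
            one_mul, zero_mul]
          by_cases hp : Poly H ρ c A (f ∘ swap j c) (f j)
          · rw [if_pos hp, if_pos ⟨hr, hj, hp⟩]
          · rw [if_neg hp, if_neg fun h' => hp h'.2.2]
        · rw [if_neg fun h' => hj h'.2.1, mul_zero, neg_zero, zero_mul]
          exact hzero _ _ hr (fun h' => hrt h'.2) (fun h' => hrA h'.2)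
            fun ⟨j', h4, _, h5⟩ => hj (by rwa [h4])
      · rw [if_neg fun h' => hr h'.1, mul_zero, neg_zero, zero_mul]
        exact if_neg hr
    have hT4 : T (f (c + 1)) A = (X * if H.Rect σ (f (c + 1)) A then
        tau S o (f c) (f (c + 1)) else 0) * W := by
      by_cases hr : H.Rect σ (f (c + 1)) A
      · obtain ⟨j, hj⟩ := hr.exists_loc_right hσ (by
          have hv := val_rows ρ
          have h2 := hN.row_ne
          change cycIcc (f (c + 1)).1 A.1 _
          rw [hArow]
          grind)
        have hjc : j ≠ c := fun e' => hrA (by rw [hj, e'])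
        rw [if_pos hr]
        refine (if_pos hr).trans ?_
        have h1 : (fun k' => (mv σ (f (c + 1)) A).symm (c, k')) = fun k' => σ.symm (c, k') := by
          funext k'
          rw [mv_symm_apply, swap_apply_of_ne_of_ne]
          · intro e'
            have := congrArg σ e'
            rw [Equiv.apply_symm_apply, htc] at this
            exact hcc (congrArg Prod.fst this).symm
          · exact hrA' _ _
        have h2 : prodR H ρ c S o (mv σ (f (c + 1)) A) = X := by
          rw [hj, prodR_split, ← hX, ← hf, locR_thin S o h, mul_one]
          · rw [Function.comp, swap_apply_of_ne_of_ne hcc.symm hjc.symm]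
            exact hN.1
          · rw [Function.comp, swap_apply_left]
            exact hj.symm
          · rfl
        rw [opR, h1, h2, ← hW, mul_assoc, mul_assoc, hA,
          polyOp_mul_tau S o hrinj hAinj hrA' (t := f (c + 1)) _ _ k]
        · congr 3
          rw [hf, loc, colAt_self]
        · intro i e'
          have := congrArg σ e'
          rw [Equiv.apply_symm_apply, htc] at this
          exact hcc (congrArg Prod.fst this)
        · exact fun i e' => hN.row_ne (congrArg Prod.fst e')
      · rw [if_neg hr, mul_zero, zero_mul]
        exact if_neg hr
    rw [hT1, Finset.sum_congr rfl fun j _ => hT2 j, hT4, ← Finset.sum_mul, Finset.sum_neg_distrib,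
      ← Finset.mul_sum, ← add_mul, ← add_mul, mul_sub]
    rw [show ∀ a b : Operator (n + 1) m, a - b + (-a + b) = 0 from
      fun a b => by abel, zero_mul]
  · push Not at hrow
    obtain ⟨k', hk'⟩ := hrow
    have hkk : k' ≠ k := by
      rintro rfl
      refine hN.1 ?_
      rwa [hf, loc, colAt_self]
    have hX0 : X = 0 := sheetProd_eq_zero k' (by
      rw [Function.update_of_ne hkk]
      refine locR_eq_zero_of_row S o ?_
      rwa [loc, colAt_self])
    have hz : ∀ a b, T (f a) (f b) = 0 := by
      intro a b
      by_cases hr : H.Rect σ (f a) (f b)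
      · refine (if_pos hr).trans ?_
        rw [opR, prodR_split, ← hX, hX0]
        simp
      · exact if_neg hr
    have hzA : T (f (c + 1)) A = 0 := by
      by_cases hr : H.Rect σ (f (c + 1)) A
      · obtain ⟨j, hj⟩ := hr.exists_loc_right hσ (by
          have hv := val_rows ρ
          have h2 := hN.row_ne
          change cycIcc (f (c + 1)).1 A.1 _
          rw [hArow]
          grind)
        rw [hj]
        exact hz _ _
      · exact if_neg hr
    rw [hz, hzA, Finset.sum_congr rfl fun j _ => hz j c]
    simp

end Maps

section Maps

variable {k : ZMod m} {σ : State (n + 1) m} {s t u : Curve (n + 1) m}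
variable (H c) in
theorem exists_eq_alphaThrough {p : Curve (n + 1) m} (hp : p.1 = ρ.succ) :
    ∃ k, p = alphaThrough H ρ c k :=
  ⟨p.2 + (H.shift ρ.succ c : ZMod m), Prod.ext hp (by simp [alphaThrough])⟩

variable (H ρ c) in
/-- All lifts of `w` are components of `σ`. -/
def StateI (σ : State (n + 1) m) : Prop := ∀ k, σ (alphaThrough H ρ c k) = (c, k)

theorem StateI.col (hI : StateI H ρ c σ) {p : Curve (n + 1) m} (hp : p.1 = ρ.succ) :
    (σ p).1 = c := by
  obtain ⟨k, rfl⟩ := exists_eq_alphaThrough H c hp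
  rw [hI]

theorem StateI.row (hI : StateI H ρ c σ) {p : Curve (n + 1) m} (hp : (σ p).1 = c) :
    p.1 = ρ.succ := by
  have : σ p = σ (alphaThrough H ρ c (σ p).2) := by rw [hI]; exact Prod.ext hp rfl
  rw [σ.injective this]
  rfl

theorem StateI.not_rect (h : IsStabilization G H ρ c) (hI : StateI H ρ c σ) (hs : s.1 = ρ.succ) :
    ¬ H.Rect σ s t := fun hr => by
  have h1 := hr.noMarking c (by rw [hI.col hs]; exact cycIco_left (hI.col hs ▸ hr.col))
  rw [h.O_new, ← hs] at h1
  exact h1.2 (cycIco_left hr.row)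

theorem StateI.rect_iff (h : IsStabilization G H ρ c) (hI : StateI H ρ c σ) (hs : s.1 ≠ ρ.succ)
    (ht : t.1 ≠ ρ.succ) : H.Rect σ s t ↔ GRect H ρ c σ s t ∧
      ¬ (cycIoo s.1 t.1 ρ.succ ∧ cycIoo (σ s).1 (σ t).1 c) := by
  have hcs : c ≠ (σ s).1 := fun e => hs (hI.row e.symm)
  constructor
  · intro hr
    refine ⟨⟨hs, ht, hr.row, hr.col, hr.ms, hr.mt, fun j _ hj => hr.noMarking j hj,
      fun p _ => hr.clear p⟩, fun ⟨h1, h2⟩ => ?_⟩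
    have := (hr.noMarking c h2.2).2
    rw [h.O_new] at this
    exact this h1.2
  · rintro ⟨hr, hn⟩
    refine ⟨hr.row, hr.col, hr.ms, hr.mt, fun j hj => ?_, fun p hp hq => ?_⟩
    · by_cases hjc : j = c
      · subst hjc
        have h1 : ¬ cycIoo s.1 t.1 ρ.succ := fun h' => hn ⟨h', hcs, hj⟩
        rw [h.O_new, h.X_new]
        have hv := val_rows ρ
        grind
      · exact hr.noMarking j hjc hj
    · by_cases hps : p.1 = ρ.succ
      · rw [hps] at hp
        rw [hI.col hps] at hq
        exact absurd ⟨hp, hq⟩ hn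
      · exact hr.clear p hps hp hq

theorem GRect.crossing (h : IsStabilization G H ρ c) (hr : GRect H ρ c σ s t)
    (h1 : cycIoo s.1 t.1 ρ.succ) (h2 : cycIoo (σ s).1 (σ t).1 c) : (σ t).1 = c + 1 := by
  by_contra hne
  have hc1 := val_add_one_cases ρ c
  have hc2 := val_sub_one_cases ρ c
  have hadd : c + 1 ≠ c := add_one_ne ρ c
  have hsub : c - 1 ≠ c := by omega
  rw [← ne_eq] at hne
  rcases h.adjacent with h' | h'
  · refine (hr.noMarking _ hadd ?_).1 (by rw [h']; exact h1.2)
    grind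
  · refine (hr.noMarking _ hsub ?_).1 (by rw [h']; exact h1.2)
    grind

/-- A rectangle of the small grid that is not a rectangle of the large one corresponds to a
rectangle followed by a punctured hexagon. -/
theorem StateI.gRect_iff (h : IsStabilization G H ρ c) (hσ : H.IsGen σ) (hI : StateI H ρ c σ) :
    (GRect H ρ c σ u (σ.symm (c + 1, k)) ∧ cycIoo u.1 (σ.symm (c + 1, k)).1 ρ.succ) ↔
      H.Rect σ u (alphaThrough H ρ c k) ∧
        HexAt H ρ c (loc H c (mv σ u (alphaThrough H ρ c k)) (ρ.succ + 1) k) (σ u).1 ∧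
        loc H c (mv σ u (alphaThrough H ρ c k)) (ρ.succ + 1) k (σ u).1 = alphaThrough H ρ c k := by
  set A := alphaThrough H ρ c k with hA
  set t := σ.symm (c + 1, k) with ht
  set f := loc H c (mv σ u A) (ρ.succ + 1) k with hf
  have hAr : A.1 = ρ.succ := rfl
  have hσA : σ A = (c, k) := hI k
  have hσt : σ t = (c + 1, k) := by simp [ht]
  have hc1 := val_add_one_cases ρ c
  have hsu := val_add_one_cases ρ ρ.succ
  have hcc := add_one_ne ρ c
  have htr : t.1 ≠ ρ.succ := fun e => hcc (by have h' := hI.col e; rwa [hσt] at h')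
  have htA : t ≠ A := fun e => htr (by rw [e]; rfl)
  have hmt1 : H.Meets t (c + 1, k) := hσt ▸ hσ t
  have hmt : H.Meets t (c, k) := (h.meets_add_one htr).1 hmt1
  have hfc : f c = u := by
    rw [hf, loc_mv, loc, colAt_self, ← hσA, Equiv.symm_apply_apply, swap_apply_right]
  have hft : u ≠ t → f (c + 1) = t := fun hut => by
    rw [hf, loc_mv, loc, h.colAt_add_one (succ_add_one_ne_succ ρ), ← ht,
      swap_apply_of_ne_of_ne hut.symm htA]
  have key : H.NoMarking u.1 t.1 (σ u).1 c → cycIoo u.1 t.1 ρ.succ → H.Meets u (c, k) →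
      ∀ p, cycIcc u.1 t.1 p.1 → cycIcc (σ u).1 c (σ p).1 →
        (H.Meets p (σ u) ↔ σ p = colAt H c (ρ.succ + 1) k (σ p).1) := by
    intro hm hsut hmu p hp hq
    have he : cycIcc u.1 t.1 (ρ.succ + 1) := by grind
    have hBc := meets_colAt (H := H) (c := c) (e := ρ.succ + 1) (k := k) c
    rw [colAt_self] at hBc
    have hB : ∀ j, cycIcc (σ u).1 c j → H.Meets u (colAt H c (ρ.succ + 1) k j) := fun j hj =>
      hm.transport he (cycIcc_left _ _) (cycIcc_right _ _) hj
        hBc (meets_colAt j) hmu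
    constructor
    · intro hpu
      refine (hσ p).right_unique (q' := colAt H c (ρ.succ + 1) k (σ p).1) ?_ rfl
      exact hm.transport (p := u) (q' := colAt H c (ρ.succ + 1) k (σ p).1) (cycIcc_left _ _) hp
        (cycIcc_left _ _) hq (hσ u) (hB _ hq) hpu
    · intro e
      have h1 : H.Meets p (colAt H c (ρ.succ + 1) k (σ p).1) := by rw [← e]; exact hσ p
      exact hm.transport (p := u) (q := colAt H c (ρ.succ + 1) k (σ p).1) (cycIcc_left _ _) hp hq
        (cycIcc_left _ _) (hB _ hq) (hσ u) h1
  constructor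
  · rintro ⟨hg, hsut⟩
    have hut : u ≠ t := fun e => hg.row (by rw [e])
    have huc : (σ u).1 ≠ c := fun e => hg.rs (hI.row e)
    have hcol : ∀ j, cycIco (σ u).1 c j → cycIco (σ u).1 (σ t).1 j ∧ j ≠ c := by
      intro j hj
      have h2 := hg.col
      rw [hσt] at h2 ⊢
      rw [cycIco_iff] at *
      dsimp only at h2 ⊢
      omega
    have hm : H.NoMarking u.1 t.1 (σ u).1 c := fun j hj =>
      hg.noMarking j (hcol j hj).2 (hcol j hj).1
    have hcolo : ∀ j, cycIoo (σ u).1 c j → cycIoo (σ u).1 (σ t).1 j := fun j hj =>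
      ⟨hj.1, (hcol j hj.2).1⟩
    have hmu1 : H.Meets u (c + 1, k) := hσt ▸ hg.ms
    have hmu : H.Meets u (c, k) := (h.meets_add_one hg.rs).1 hmu1
    have hAu : H.Meets A (σ u) := by
      refine hm.transport (p := t) (cycIcc_right _ _) hsut.icc (cycIcc_right _ _) (cycIcc_left _ _)
        hmt hg.mt ?_
      rw [← hσA]; exact hσ A
    have hr1 : H.Rect σ u A := by
      refine ⟨hg.rs, by rw [hσA]; exact huc, by rw [hσA]; exact hmu, hAu, ?_, ?_⟩
      · rw [hσA]
        exact hm.mono (fun i hi => (cycIco_split hsut.2 i).2 (Or.inl hi)) fun j hj => hj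
      · intro p hp hq
        rw [hσA] at hq
        refine hg.clear p (fun e => ?_) ⟨hp.1, (cycIco_split hsut.2 _).2 (Or.inl hp.2)⟩ (hcolo _ hq)
        rw [e, hAr] at hp
        exact not_cycIco_right _ _ hp.2
    have hfA : f (σ u).1 = A := by
      rw [hf, loc_mv, swap_apply_eq_iff, swap_apply_right, loc,
        ← (key hm hsut hmu u (cycIcc_left _ _) (cycIcc_left _ _)).1 (hσ u), Equiv.symm_apply_apply]
    refine ⟨hr1, ⟨?_, ?_, ?_, ?_⟩, hfA⟩
    · rw [hfc, hft hut]; exact hsut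
    · rw [hfc, hft hut, hfA]; exact hsut
    · rw [hfA, hft hut]
      exact hm.mono (fun i hi => (cycIco_split hsut.2 i).2 (Or.inr hi)) fun j hj => hj
    · intro i hi hi'
      rw [hfA, hft hut] at hi'
      have hp : σ (σ.symm (colAt H c (ρ.succ + 1) k i)) = colAt H c (ρ.succ + 1) k i := by simp
      have hne1 : σ.symm (colAt H c (ρ.succ + 1) k i) ≠ u := fun e => hi.1 (by rw [← e, hp]; rfl)
      have hne2 : σ.symm (colAt H c (ρ.succ + 1) k i) ≠ A := fun e => by
        have := hσA.symm.trans ((congrArg σ e).symm.trans hp)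
        have h1 := congrArg Prod.fst this
        simp only [colAt_fst] at h1
        rw [← h1] at hi
        exact not_cycIco_right _ _ hi.2
      rw [hf, loc_mv, loc, swap_apply_of_ne_of_ne hne1 hne2] at hi'
      have h2 : cycIoo u.1 t.1 (σ.symm (colAt H c (ρ.succ + 1) k i)).1 := by
        have h0 := hi'
        have h00 := hsut
        rw [cycIoo_iff] at h0 h00
        rw [cycIoo_iff]; dsimp only [A, alphaThrough] at h0; omega
      refine hg.clear _ hi'.1 h2 (by rw [hp]; exact hcolo _ hi) ?_
      exact (key hm hsut hmu _ h2.icc (by rw [hp]; exact hi.icc)).2 (by rw [hp]; rfl)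
  · rintro ⟨hr, hx, hfA⟩
    have hut : u ≠ t := fun e => by
      have h1 := hx.row_ne
      rw [hf, loc_mv, loc, h.colAt_add_one (succ_add_one_ne_succ ρ), ← ht, e,
        swap_apply_left] at h1
      exact h1 rfl
    have hus : u.1 ≠ ρ.succ := hr.row
    have huc : (σ u).1 ≠ c := fun e => hus (hI.row e)
    have hsut : cycIoo u.1 t.1 ρ.succ := by
      have := hx.punctured
      rwa [hfc, hft hut] at this
    have hm1 := hr.noMarking
    rw [hσA] at hm1
    have hm2 := hx.noMarking
    rw [hfA, hft hut] at hm2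
    have hm : H.NoMarking u.1 t.1 (σ u).1 c := by
      intro j hj
      have h1 := hm1 j hj
      have h2 := hm2 j hj
      rw [cycIco_split hsut.2, cycIco_split hsut.2]
      exact ⟨fun h' => h'.elim h1.1 h2.1, fun h' => h'.elim h1.2 h2.2⟩
    have hmu : H.Meets u (c, k) := hσA ▸ hr.ms
    have hmu1 : H.Meets u (c + 1, k) := (h.meets_add_one hus).2 hmu
    have huc1 : (σ u).1 ≠ c + 1 := by
      intro e
      refine hut (σ.injective ?_)
      rw [hσt]
      exact (hσ u).right_unique hmu1 e
    have hcol : ∀ j, j ≠ c → cycIco (σ u).1 (c + 1) j → cycIco (σ u).1 c j := by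
      intro j hj hj'
      grind
    refine ⟨⟨hus, htr, ?_, ?_, ?_, ?_, ?_, ?_⟩, hsut⟩
    · intro e
      rw [e] at hsut
      unfold cycIoo cycIco at hsut
      rw [sub_self] at hsut
      exact absurd hsut.2 (by simp)
    · rw [hσt]; exact huc1
    · rw [hσt]; exact hmu1
    · exact hm.transport (p := u) (cycIcc_left _ _) (cycIcc_right _ _) (cycIcc_right _ _)
        (cycIcc_left _ _) hmu (hσ u) hmt
    · intro j hj hj'
      rw [hσt] at hj'
      exact hm j (hcol j hj hj')
    · intro p hps hp hq hmp
      rw [hσt] at hq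
      have hpc : (σ p).1 ≠ c := fun e => hps (hI.row e)
      have hq' : cycIoo (σ u).1 c (σ p).1 := ⟨hq.1, hcol _ hpc hq.2⟩
      have h1 := (key hm hsut hmu p hp.icc hq'.icc).1 hmp
      rcases (cycIco_split hsut.2 _).1 hp.2 with h2 | h2
      · exact hr.clear p ⟨hp.1, h2⟩ (by rw [hσA]; exact hq') hmp
      · refine hx.clear (σ p).1 hq' ?_
        have h3 : f (σ p).1 = p := by
          rw [hf, loc_mv, loc, ← h1, Equiv.symm_apply_apply, swap_apply_of_ne_of_ne]
          · exact fun e => hp.1 (by rw [e])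
          · exact fun e => hps (by rw [e]; rfl)
        rw [hfA, hft hut, h3]
        exact ⟨hps, h2⟩

variable [NeZero m]

theorem StateI.opL_eq (hI : StateI H ρ c σ) : opL H ρ c S o σ = 1 :=
  sheetProd_one fun k => locL_of_eq S o (by rw [loc, colAt_self, ← hI k, Equiv.symm_apply_apply]) rfl

open Classical in
theorem StateI.opL_mv (hI : StateI H ρ c σ) (hus : u.1 ≠ ρ.succ) :
    opL H ρ c S o (mv σ u (alphaThrough H ρ c k)) =
      if HexAt H ρ c (loc H c (mv σ u (alphaThrough H ρ c k)) (ρ.succ + 1) k) (σ u).1 ∧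
        loc H c (mv σ u (alphaThrough H ρ c k)) (ρ.succ + 1) k (σ u).1 = alphaThrough H ρ c k then
      hexOp c S o (loc H c (mv σ u (alphaThrough H ρ c k)) (ρ.succ + 1) k) (σ u).1 else 0 := by
  set A := alphaThrough H ρ c k with hA
  set f := loc H c (mv σ u A) (ρ.succ + 1) k with hf
  have hfc : f c = u := by
    rw [hf, loc_mv, loc, colAt_self, ← hI k, Equiv.symm_apply_apply, swap_apply_right]
  have h1 : ∀ k', k' ≠ k →
      locL H ρ c S o (alphaThrough H ρ c k') (loc H c (mv σ u A) (ρ.succ + 1) k') = 1 := by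
    intro k' hk
    refine locL_of_eq S o ?_ rfl
    rw [loc_mv, loc, colAt_self, ← hI k', Equiv.symm_apply_apply, swap_apply_of_ne_of_ne]
    · exact fun e => hus (congrArg Prod.fst e).symm
    · exact fun e => hk (alphaThrough_injective H ρ c e)
  have h2 : opL H ρ c S o (mv σ u A) = locL H ρ c S o A f := by
    rw [opL, sheetProd_eq_mul _ k, sheetProd_one, one_mul]
    rotate_left
    · exact fun k' hk => locL_commute S o fun i j e => hk (loc_inj.1 e).1.symm
    intro k'
    by_cases hk : k' = k
    · rw [hk, Function.update_self]
    · rw [Function.update_of_ne hk, h1 k' hk]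
  have h3 : ∀ j, f j = A → j = (σ u).1 := by
    intro j hj
    have h4 : mv σ u A (f j) = σ u := by rw [hj, mv_right]
    rw [hf, apply_loc] at h4
    rw [← h4]; rfl
  have h5 : f c ≠ A := by
    rw [hfc]
    exact fun e => hus (congrArg Prod.fst e)
  rw [h2, locL, if_neg h5, zero_add]
  exact Finset.sum_eq_single _ (fun j _ hj => if_neg fun h' => hj (h3 j h'.2))
    fun h' => absurd (Finset.mem_univ _) h'

open Classical in
/-- On the states that contain all lifts of `w`, the map `F^L` commutes with the differentials. -/
theorem StateI.sum_opL (h : IsStabilization G H ρ c) (hσ : H.IsGen σ) (hI : StateI H ρ c σ) :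
    (∑ s, ∑ t, if H.Rect σ s t then opL H ρ c S o (mv σ s t) * tau S o s t else 0) =
      gOp H ρ c S o σ := by
  have hz : ∀ k, σ.symm (c, k) = alphaThrough H ρ c k := fun k => by
    rw [← hI k, Equiv.symm_apply_apply]
  let T (s t : Curve (n + 1) m) : Operator (n + 1) m :=
    if GRect H ρ c σ s t ∧ ¬ (cycIoo s.1 t.1 ρ.succ ∧ cycIoo (σ s).1 (σ t).1 c) then tau S o s t else 0
  let V : Curve (n + 1) m → Curve (n + 1) m → Operator (n + 1) m := fun s t =>
    if GRect H ρ c σ s t ∧ (cycIoo s.1 t.1 ρ.succ ∧ cycIoo (σ s).1 (σ t).1 c) then tau S o s t else 0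
  let V' : Curve (n + 1) m → ZMod m → Operator (n + 1) m := fun s k =>
    if GRect H ρ c σ s (σ.symm (c + 1, k)) ∧ cycIoo s.1 (σ.symm (c + 1, k)).1 ρ.succ then
      tau S o s (σ.symm (c + 1, k)) else 0
  have h1 : gOp H ρ c S o σ = ∑ s, ((∑ t, T s t) + ∑ t, V s t) := by
    rw [gOp]
    refine Finset.sum_congr rfl fun s _ => ?_
    rw [← Finset.sum_add_distrib]
    refine Finset.sum_congr rfl fun t _ => ?_
    by_cases h1 : GRect H ρ c σ s t <;>
      by_cases h2 : (cycIoo s.1 t.1 ρ.succ ∧ cycIoo (σ s).1 (σ t).1 c) <;> simp [T, V, h1, h2]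
  have h2 : ∀ s, ∑ t, V s t = ∑ k, V' s k := by
    intro s
    refine (Fintype.sum_of_injective (fun k => σ.symm (c + 1, k)) (fun i j e => by simpa using e)
      (V' s) (V s) (fun t ht => if_neg fun h' => ?_) fun k => if_congr (and_congr_right fun hg =>
        ⟨fun h' => ⟨h', ?_⟩, fun h' => h'.1⟩) rfl rfl).symm
    · refine ht ⟨(σ t).2, ?_⟩
      change σ.symm (c + 1, (σ t).2) = t
      rw [← h'.1.crossing h h'.2.1 h'.2.2]
      simp
    · have h3 := hg.col
      have h4 : (σ s).1 ≠ c := fun e => hg.rs (hI.row e)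
      rw [Equiv.apply_symm_apply] at h3 ⊢
      have h5 := val_add_one_cases ρ c
      rw [cycIoo_iff]
      dsimp only at h3 ⊢
      omega
  rw [h1]
  refine Finset.sum_congr rfl fun s _ => ?_
  rw [h2]
  by_cases hs : s.1 = ρ.succ
  · rw [Finset.sum_eq_zero fun t _ => if_neg (hI.not_rect h hs),
      Finset.sum_eq_zero fun t _ => if_neg fun h' => h'.1.rs hs,
      Finset.sum_eq_zero fun t _ => if_neg fun h' => h'.1.rs hs, add_zero]
  have h3 : ∀ k, (if H.Rect σ s (alphaThrough H ρ c k) then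
      opL H ρ c S o (mv σ s (alphaThrough H ρ c k)) * tau S o s (alphaThrough H ρ c k) else 0) =
      V' s k := by
    intro k
    have hiff := hI.gRect_iff h hσ (u := s) (k := k)
    rw [hI.opL_mv S o hs]
    by_cases hr : H.Rect σ s (alphaThrough H ρ c k) ∧
        HexAt H ρ c (loc H c (mv σ s (alphaThrough H ρ c k)) (ρ.succ + 1) k) (σ s).1 ∧
        loc H c (mv σ s (alphaThrough H ρ c k)) (ρ.succ + 1) k (σ s).1 = alphaThrough H ρ c k
    · rw [if_pos hr.1, if_pos hr.2]
      refine Eq.trans ?_ (if_pos (hiff.2 hr)).symm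
      obtain ⟨hg, -⟩ := hiff.2 hr
      have hst : s ≠ σ.symm (c + 1, k) := fun e => hg.row (congrArg Prod.fst e)
      have hsA : s ≠ alphaThrough H ρ c k := fun e => hs (congrArg Prod.fst e)
      have htA : σ.symm (c + 1, k) ≠ alphaThrough H ρ c k := fun e => hg.rt (congrArg Prod.fst e)
      have e1 : loc H c (mv σ s (alphaThrough H ρ c k)) (ρ.succ + 1) k c = s := by
        rw [loc_mv, loc, colAt_self, hz, swap_apply_right]
      have e2 : loc H c (mv σ s (alphaThrough H ρ c k)) (ρ.succ + 1) k (c + 1) =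
          σ.symm (c + 1, k) := by
        rw [loc_mv, loc, h.colAt_add_one (succ_add_one_ne_succ ρ), swap_apply_of_ne_of_ne
          hst.symm htA]
      rw [hexOp, hr.2.2, e1, e2, mul_assoc, tau_hexagon S o hsA hst htA.symm, tau_symm S o htA.symm,
        neg_mul, neg_neg, ← mul_assoc]
      erw [tau_sq S o htA.symm, one_mul]
    · have h4 : V' s k = 0 := if_neg fun h' => hr (hiff.1 h')
      rw [h4]
      split_ifs with h5 h6
      · exact absurd ⟨h5, h6⟩ hr
      · exact zero_mul _
      · rfl
  let Q : Curve (n + 1) m → Operator (n + 1) m := fun t =>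
    if t.1 = ρ.succ ∧ H.Rect σ s t then opL H ρ c S o (mv σ s t) * tau S o s t else 0
  have h4 : ∀ t, (if H.Rect σ s t then opL H ρ c S o (mv σ s t) * tau S o s t else 0) =
      T s t + Q t := by
    intro t
    by_cases ht : t.1 = ρ.succ
    · have : T s t = 0 := if_neg fun h' => h'.1.rt ht
      rw [this, zero_add]
      simp [Q, ht]
    · have : Q t = 0 := if_neg fun h' => ht h'.1
      rw [this, add_zero]
      refine if_congr (hI.rect_iff h hs ht) ?_ rfl
      rw [StateI.opL_eq, one_mul]
      intro k
      rw [mv_of_ne, hI]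
      · exact fun e => hs (congrArg Prod.fst e).symm
      · exact fun e => ht (congrArg Prod.fst e).symm
  rw [Finset.sum_congr rfl fun t _ => h4 t, Finset.sum_add_distrib]
  congr 1
  refine (Fintype.sum_of_injective (alphaThrough H ρ c) (alphaThrough_injective H ρ c) _ _
    (fun t ht => if_neg fun h' => ?_) fun k => ?_).symm
  · obtain ⟨k, hk⟩ := exists_eq_alphaThrough H c h'.1
    exact ht ⟨k, hk.symm⟩
  · rw [← h3]
    exact if_congr ⟨fun h' => ⟨rfl, h'⟩, fun h' => h'.2⟩ rfl rfl

open Classical in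
/-- The differential of a state that contains all lifts of `w` is annihilated by `F^R`. -/
theorem StateI.sum_opR (h : IsStabilization G H ρ c) (hI : StateI H ρ c σ) :
    (∑ s, ∑ t, if H.Rect σ s t then opR H ρ c S o (mv σ s t) * tau S o s t else 0) = 0 := by
  refine Finset.sum_eq_zero fun s _ => Finset.sum_eq_zero fun t _ => ?_
  split_ifs with hr
  swap
  · rfl
  have hs : s.1 ≠ ρ.succ := fun hs => hI.not_rect h hs hr
  have hloc : ∀ k, loc H c (mv σ s t) ρ.castSucc k c = swap s t (alphaThrough H ρ c k) :=
    fun k => by rw [loc_mv, loc, colAt_self, ← hI k, Equiv.symm_apply_apply]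
  by_cases hex : ∃ k, t ≠ alphaThrough H ρ c k
  · obtain ⟨k, hk⟩ := hex
    rw [opR_eq_zero S o k, zero_mul]
    refine locR_eq_zero_of_row S o ?_
    rw [hloc, swap_apply_of_ne_of_ne _ hk.symm]
    · rfl
    · exact fun e => hs (congrArg Prod.fst e).symm
  push Not at hex
  rw [opR_eq_zero S o 0, zero_mul]
  set f := loc H c (mv σ s t) ρ.castSucc (0 : ZMod m) with hf
  have hfc : f c = s := by rw [hf, hloc, ← hex 0, swap_apply_right]
  have hm := hr.noMarking
  rw [hex 0, hI] at hm
  have hp : ∀ v : Curve (n + 1) m, cycIco s.1 ρ.succ v.1 →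
      ¬ Poly H ρ c (alphaThrough H ρ c (0 + 1)) f v := by
    rintro v hv ⟨hvs, j, hj, hjA, hcols, -⟩
    have hjs : (σ s).1 = j := by
      have h1 : mv σ s t (f j) = σ s := by rw [hjA, ← hex (0 + 1), mv_right]
      rw [hf, apply_loc] at h1
      rw [← h1]; rfl
    rw [hjs] at hm
    rcases cycIco_or hj (H.O.symm v.1) with h1 | h1
    · have := (hm _ h1).2
      rw [Equiv.apply_symm_apply] at this
      exact this hv
    · have := (hcols _ h1).2
      rw [Equiv.apply_symm_apply] at this
      exact this (cycIco_left hvs)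
  rw [locR, if_neg, zero_add]
  · refine Finset.sum_eq_zero fun j _ => if_neg fun h' => ?_
    have h1 := h'.2.1
    rw [hfc] at h1
    exact hp _ h1.2 h'.2.2
  · rw [hfc]
    exact hp _ (cycIco_left hs)

end Maps

section Maps

variable {k : ZMod m} {σ y : State (n + 1) m} {s t u : Curve (n + 1) m}
variable (H ρ c) in
/-- The lifts of the right end point of the new horizontal segment are components of `σ`. -/
def StateJ (σ : State (n + 1) m) : Prop := ∀ k, σ (alphaThrough H ρ c (k + 1)) = (c + 1, k)

theorem StateJ.apply (hJ : StateJ H ρ c σ) (k : ZMod m) :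
    σ (alphaThrough H ρ c k) = (c + 1, k - 1) := by
  rw [← hJ, sub_add_cancel]

theorem StateJ.col (hJ : StateJ H ρ c σ) {p : Curve (n + 1) m} (hp : p.1 = ρ.succ) :
    (σ p).1 = c + 1 := by
  obtain ⟨k, rfl⟩ := exists_eq_alphaThrough H c hp
  rw [hJ.apply]

theorem StateJ.row (hJ : StateJ H ρ c σ) {p : Curve (n + 1) m} (hp : (σ p).1 = c + 1) :
    p.1 = ρ.succ := by
  have : σ p = σ (alphaThrough H ρ c ((σ p).2 + 1)) := by rw [hJ]; exact Prod.ext hp rfl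
  rw [σ.injective this]
  rfl

variable (H ρ c) in
/-- The state that arises from `σ` by a thin polygon. -/
structure ThinPolygon (σ y : State (n + 1) m) : Prop where
  start : StateJ H ρ c σ
  final_state : StateI H ρ c y
  lower : ∀ k, y (σ.symm (c, k)) = (c + 1, k)
  other : ∀ p, p.1 ≠ ρ.succ → (σ p).1 ≠ c → y p = σ p

theorem ThinPolygon.cases (hy : ThinPolygon H ρ c σ y) {p : Curve (n + 1) m} (hp : p.1 ≠ ρ.succ) :
    (σ p).1 ≠ c + 1 ∧ (((σ p).1 ≠ c ∧ y p = σ p) ∨ ∃ k, σ p = (c, k) ∧ y p = (c + 1, k)) := by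
  refine ⟨fun e => hp (hy.start.row e), ?_⟩
  by_cases hc : (σ p).1 = c
  · have h1 : σ p = (c, (σ p).2) := Prod.ext hc rfl
    refine Or.inr ⟨(σ p).2, h1, ?_⟩
    rw [← hy.lower, ← h1, Equiv.symm_apply_apply]
  · exact Or.inl ⟨hc, hy.other p hp hc⟩

theorem ThinPolygon.meets_iff (h : IsStabilization G H ρ c) (hy : ThinPolygon H ρ c σ y)
    {p q : Curve (n + 1) m} (hp : p.1 ≠ ρ.succ) (hq : q.1 ≠ ρ.succ) :
    H.Meets q (y p) ↔ H.Meets q (σ p) := by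
  rcases (hy.cases hp).2 with ⟨-, h1⟩ | ⟨k, h1, h2⟩
  · rw [h1]
  · rw [h1, h2]
    exact h.meets_add_one hq

theorem ThinPolygon.val_cases (hy : ThinPolygon H ρ c σ y) {p : Curve (n + 1) m} (hp : p.1 ≠ ρ.succ) :
    ((σ p).1 : ℕ) ≠ (c + 1 : Fin (n + 1)) ∧
      ((((σ p).1 : ℕ) ≠ c ∧ ((y p).1 : ℕ) = (σ p).1) ∨
        (((σ p).1 : ℕ) = c ∧ ((y p).1 : ℕ) = (c + 1 : Fin (n + 1)))) := by
  have h1 := hy.cases hp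
  rw [fin_ne_iff, fin_ne_iff] at h1
  refine ⟨h1.1, h1.2.imp (fun h2 => ⟨h2.1, by rw [h2.2]⟩) ?_⟩
  rintro ⟨k, h2, h3⟩
  rw [h2, h3]
  exact ⟨rfl, rfl⟩

theorem ThinPolygon.rect_iff (h : IsStabilization G H ρ c) (hy : ThinPolygon H ρ c σ y)
    (hs : s.1 ≠ ρ.succ) (ht : t.1 ≠ ρ.succ) : H.Rect σ s t ↔ GRect H ρ c y s t ∧
      ¬ (cycIoo s.1 t.1 ρ.succ ∧ (σ s).1 = c) := by
  have hc1 := val_add_one_cases ρ c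
  have hc2 := val_sub_one_cases ρ c
  have vs := hy.val_cases hs
  have vt := hy.val_cases ht
  constructor
  · intro hr
    have hcol := hr.col
    refine ⟨⟨hs, ht, hr.row, ?_, (hy.meets_iff h ht hs).2 hr.ms, (hy.meets_iff h hs ht).2 hr.mt,
      fun j hjc hj => hr.noMarking j ?_, fun p hps hp hq hm => hr.clear p hp ?_
        ((hy.meets_iff h hs hps).1 hm)⟩, fun ⟨h1, h2⟩ => ?_⟩
    · omega
    · rw [fin_ne_iff] at hjc
      grind
    · have vp := hy.val_cases hps
      grind
    · have h3 := (hr.noMarking c (by rw [h2]; exact cycIco_left (h2 ▸ hr.col))).2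
      rw [h.O_new] at h3
      exact h3 h1.2
  · rintro ⟨hr, hn⟩
    have hcol := hr.col
    have hX : cycIoo s.1 t.1 ρ.succ → (cycIco (σ s).1 (σ t).1 c ∨ cycIco (σ s).1 (σ t).1 (c + 1)) →
        False := by
      intro h1 h2
      have hne : (σ s).1 ≠ c := fun e => hn ⟨h1, e⟩
      have hadd : c + 1 ≠ c := add_one_ne ρ c
      have hsub : c - 1 ≠ c := by omega
      rw [cycIco_iff, cycIco_iff] at h2
      rcases h.adjacent with h' | h'
      · refine (hr.noMarking _ hadd ?_).1 (by rw [h']; exact h1.2)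
        grind
      · refine (hr.noMarking _ hsub ?_).1 (by rw [h']; exact h1.2)
        grind
    refine ⟨hr.row, ?_, (hy.meets_iff h ht hs).1 hr.ms, (hy.meets_iff h hs ht).1 hr.mt,
      fun j hj => ?_, fun p hp hq hm => ?_⟩
    · omega
    · by_cases hjc : j = c
      · subst hjc
        have h1 : ¬ cycIoo s.1 t.1 ρ.succ := fun h' => hX h' (Or.inl hj)
        rw [h.O_new, h.X_new]
        have hv := val_rows ρ
        grind
      · refine hr.noMarking j hjc ?_
        grind
    · by_cases hps : p.1 = ρ.succ
      · rw [hps] at hp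
        rw [hy.start.col hps] at hq
        exact hX hp (Or.inr hq.2)
      · refine hr.clear p hps hp ?_ ((hy.meets_iff h hs hps).2 hm)
        have vp := hy.val_cases hps
        grind

theorem ThinPolygon.not_rect (h : IsStabilization G H ρ c) (hy : ThinPolygon H ρ c σ y)
    (ht : t.1 = ρ.succ) : ¬ H.Rect σ s t := fun hr => by
  have hc1 := val_add_one_cases ρ c
  have h2 := hr.col
  have h3 := hr.row
  have h1 := hr.noMarking c (by
    rw [hy.start.col ht] at h2 ⊢
    grind)
  rw [h.X_new, ht] at h1
  rw [ht] at h3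
  refine h1.1 ?_
  have hv := val_rows ρ
  grind

theorem StateJ.col_ne (h : IsStabilization G H ρ c) (hJ : StateJ H ρ c σ)
    (hr : H.Rect σ (alphaThrough H ρ c (k + 1)) u) :
    (σ u).1 ≠ c ∧ (σ u).1 ≠ c + 1 ∧ H.X (c - 1) = ρ.succ := by
  have hc1 := val_add_one_cases ρ c
  have hc2 := val_sub_one_cases ρ c
  have hcol := hr.col
  have hm := hr.noMarking
  rw [hJ] at hcol hm
  have hrow : cycIco ρ.succ u.1 ρ.succ := cycIco_left hr.row
  have hX : H.X (c - 1) = ρ.succ := h.adjacent.resolve_left fun e =>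
    (hm (c + 1) (cycIco_left hcol)).1 (by rw [e]; exact hrow)
  refine ⟨fun e => ?_, hcol.symm, hX⟩
  refine (hm (c - 1) ?_).1 (by rw [hX]; exact hrow)
  rw [e, cycIco_iff]
  dsimp only
  omega

/-- A rectangle of the small grid that is not a rectangle of the large one corresponds to a
rectangle followed by a polygon. -/
theorem ThinPolygon.gRect_iff (h : IsStabilization G H ρ c) (hσ : H.IsGen σ)
    (hy : ThinPolygon H ρ c σ y) :
    (GRect H ρ c y (σ.symm (c, k)) u ∧ cycIoo (σ.symm (c, k)).1 u.1 ρ.succ) ↔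
      H.Rect σ (alphaThrough H ρ c (k + 1)) u ∧
        Poly H ρ c (alphaThrough H ρ c (k + 1))
          (loc H c (mv σ (alphaThrough H ρ c (k + 1)) u) ρ.castSucc k) (σ.symm (c, k)) := by
  set A := alphaThrough H ρ c (k + 1) with hA
  set r := σ.symm (c, k) with hr
  set f := loc H c (mv σ A u) ρ.castSucc k with hf
  have hAr : A.1 = ρ.succ := rfl
  have hσA : σ A = (c + 1, k) := hy.start k
  have hσr : σ r = (c, k) := by simp [hr]
  have hyr : y r = (c + 1, k) := hy.lower k
  have hc1 := val_add_one_cases ρ c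
  have hv := val_rows ρ
  have hcc := add_one_ne ρ c
  have hrr : r.1 ≠ ρ.succ := fun e => hcc (by have h' := hy.start.col e; rw [hσr] at h'; exact h'.symm)
  have hmr : H.Meets r (c, k) := hσr ▸ hσ r
  have hmr1 : H.Meets r (c + 1, k) := (h.meets_add_one hrr).2 hmr
  have hmA : H.Meets A (c + 1, k) := hσA ▸ hσ A
  have hfc1 : f (c + 1) = u := by
    rw [hf, loc_mv, loc, h.colAt_add_one (castSucc_ne_succ ρ), ← hσA, Equiv.symm_apply_apply,
      swap_apply_left]
  have key : ∀ j, H.NoMarking r.1 u.1 (c + 1) j → cycIoo r.1 u.1 ρ.succ →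
      ∀ p, cycIcc r.1 u.1 p.1 → cycIcc (c + 1) j (σ p).1 →
        (H.Meets p (c + 1, k) ↔ σ p = colAt H c ρ.castSucc k (σ p).1) ∧
          H.Meets r (colAt H c ρ.castSucc k (σ p).1) := by
    intro j hm hsut p hp hq
    have he : cycIcc r.1 u.1 ρ.castSucc := by grind
    have hBc := meets_colAt (H := H) (c := c) (e := ρ.castSucc) (k := k) (c + 1)
    rw [h.colAt_add_one (castSucc_ne_succ ρ)] at hBc
    have hB : ∀ i, cycIcc (c + 1) j i → H.Meets r (colAt H c ρ.castSucc k i) := fun i hi =>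
      hm.transport he (cycIcc_left _ _) (cycIcc_left _ _) hi hBc (meets_colAt i) hmr1
    refine ⟨⟨fun hpu => ?_, fun e => ?_⟩, hB _ hq⟩
    · refine (hσ p).right_unique (q' := colAt H c ρ.castSucc k (σ p).1) ?_ rfl
      exact hm.transport (p := r) (q' := colAt H c ρ.castSucc k (σ p).1) (cycIcc_left _ _) hp
        (cycIcc_left _ _) hq hmr1 (hB _ hq) hpu
    · have h1 : H.Meets p (colAt H c ρ.castSucc k (σ p).1) := by rw [← e]; exact hσ p
      exact hm.transport (p := r) (q := colAt H c ρ.castSucc k (σ p).1) (cycIcc_left _ _) hp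
        hq (cycIcc_left _ _) (hB _ hq) hmr1 h1
  constructor
  · rintro ⟨hg, hsut⟩
    have hus := hg.rt
    have vu := hy.val_cases hus
    have huc : (σ u).1 ≠ c := fun e => by
      have h1 := hg.col
      rw [hyr] at h1
      rw [Fin.ext_iff] at e
      dsimp only at h1
      omega
    have huc1 : (σ u).1 ≠ c + 1 := fun e => hus (hy.start.row e)
    have hyu : y u = σ u := hy.other u hus huc
    have hcol : ∀ j, cycIco (c + 1) (σ u).1 j → j ≠ c := by
      intro j hj
      grind
    have hm : H.NoMarking r.1 u.1 (c + 1) (σ u).1 := fun j hj =>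
      hg.noMarking j (hcol j hj) (by rw [hyr, hyu]; exact hj)
    have hmu : H.Meets u (c + 1, k) := hyr ▸ hg.mt
    have hru : H.Meets r (σ u) := hyu ▸ hg.ms
    have hclear : ∀ p, p.1 ≠ ρ.succ → cycIoo r.1 u.1 p.1 → cycIoo (c + 1) (σ u).1 (σ p).1 →
        ¬ H.Meets p (c + 1, k) := by
      intro p hps hp hq
      have := hg.clear p hps hp
      rw [hyr, hyu, hy.other p hps (hcol _ hq.2)] at this
      exact this hq
    refine ⟨⟨hus.symm, by rw [hσA]; exact huc1.symm, ?_, by rw [hσA]; exact hmu, ?_, ?_⟩, hrr,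
      (σ u).1, huc, ?_, fun i hi => ?_, fun i hi hi' => ?_⟩
    · exact hm.transport (p := r) (cycIcc_left _ _) hsut.icc (cycIcc_left _ _) (cycIcc_right _ _)
        hmr1 hru hmA
    · rw [hσA]
      exact hm.mono (fun i hi => (cycIco_split hsut.2 i).2 (Or.inr hi)) fun j hj => hj
    · intro p hp hq
      rw [hσA] at hq ⊢
      refine hclear p hp.1 ?_ hq
      have h1 := hp
      have h2 := hsut
      rw [cycIoo_iff] at h1 h2 ⊢
      rw [hAr] at h1
      omega
    · rw [hf, loc_mv, swap_apply_eq_iff, swap_apply_left, loc,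
        ← ((key _ hm hsut u (cycIcc_right _ _) (cycIcc_right _ _)).1).1 hmu, Equiv.symm_apply_apply]
    · have h1 : i ≠ c → cycIco (c + 1) (σ u).1 i := by
        intro hic
        have := (σ u).1.2
        have := i.2
        rw [cycIco_iff] at hi ⊢
        omega
      refine ⟨fun hic h' => (hm i (h1 hic)).1 ((cycIco_split hsut.2 _).2 (Or.inl h')), fun h' => ?_⟩
      by_cases hic : i = c
      · rw [hic, h.O_new] at h'
        exact not_cycIco_right _ _ h'
      · exact (hm i (h1 hic)).2 ((cycIco_split hsut.2 _).2 (Or.inl h'))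
    · by_cases hic : i = c + 1
      · rw [hic, hfc1] at hi'
        have h1 := hsut
        rw [cycIoo_iff] at h1 hi'
        omega
      · have hi2 : cycIoo (c + 1) (σ u).1 i := by
          have := (σ u).1.2
          have := i.2
          rw [← ne_eq] at hic
          rw [cycIoo_iff] at hi ⊢
          omega
        have hp : σ (σ.symm (colAt H c ρ.castSucc k i)) = colAt H c ρ.castSucc k i := by simp
        have hne2 : σ.symm (colAt H c ρ.castSucc k i) ≠ u := fun e => by
          rw [← e, hp] at hi2
          exact not_cycIco_right _ _ hi2.2
        have hne1 : σ.symm (colAt H c ρ.castSucc k i) ≠ A := fun e => by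
          have := hσA.symm.trans ((congrArg σ e).symm.trans hp)
          exact hic (congrArg Prod.fst this).symm
        rw [hf, loc_mv, loc, swap_apply_of_ne_of_ne hne1 hne2] at hi'
        have h2 : cycIoo r.1 u.1 (σ.symm (colAt H c ρ.castSucc k i)).1 :=
          ⟨hi'.1, (cycIco_split hsut.2 _).2 (Or.inl hi'.2)⟩
        refine hclear _ (fun e => ?_) h2 (by rw [hp]; exact hi2)
          ((key _ hm hsut _ h2.icc (by rw [hp]; exact hi2.icc)).1.2 (by rw [hp]; rfl))
        rw [e] at hi'
        exact not_cycIco_right _ _ hi'.2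
  · rintro ⟨hrec, -, j, hjc, hjA, hcols, hcl⟩
    obtain ⟨huc, huc1, -⟩ := hy.start.col_ne h hrec
    have hσu : σ u = colAt H c ρ.castSucc k j := by
      have h4 : mv σ A u (f j) = σ u := by rw [hjA, mv_left]
      rw [hf, apply_loc] at h4
      exact h4.symm
    obtain rfl : j = (σ u).1 := by rw [hσu]; rfl
    have hus : u.1 ≠ ρ.succ := hrec.row.symm
    have hmu : H.Meets u (c + 1, k) := hσA ▸ hrec.mt
    have hyu : y u = σ u := hy.other u hus huc
    have hur : u.1 ≠ r.1 := fun e => huc (by rw [hmu.left_unique hmr1 e, hσr])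
    have hsut : cycIoo r.1 u.1 ρ.succ := by
      have h1 := hcl (c + 1) (by
        have := (σ u).1.2
        grind)
      rw [hfc1] at h1
      grind
    have hcol : ∀ j, cycIco (c + 1) (σ u).1 j → j ≠ c ∧ cycIco c (σ u).1 j := by
      intro j hj
      grind
    have hm2 := hrec.noMarking
    rw [hσA] at hm2
    have hm : H.NoMarking r.1 u.1 (c + 1) (σ u).1 := by
      intro j hj
      have h1 := hcols j (hcol j hj).2
      have h2 := hm2 j hj
      rw [cycIco_split hsut.2, cycIco_split hsut.2]
      exact ⟨fun h' => h'.elim (h1.1 (hcol j hj).1) h2.1, fun h' => h'.elim h1.2 h2.2⟩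
    refine ⟨⟨hrr, hus, hur.symm, ?_, ?_, ?_, ?_, ?_⟩, hsut⟩
    · rw [hyr, hyu]; exact huc1.symm
    · rw [hyu]
      have := (key _ hm hsut u (cycIcc_right _ _) (cycIcc_right _ _)).2
      rwa [← hσu] at this
    · rw [hyr]; exact hmu
    · intro j _ hj
      rw [hyr, hyu] at hj
      exact hm j hj
    · intro p hps hp hq hmp
      rw [hyr, hyu] at hq
      rw [hyr] at hmp
      have hpc : (σ p).1 ≠ c := fun e => by
        have vp := hy.val_cases hps
        have h1 := hq.1
        rw [Fin.ext_iff] at e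
        dsimp only at h1
        omega
      rw [hy.other p hps hpc] at hq
      rcases (cycIco_split hsut.2 _).1 hp.2 with h2 | h2
      · refine hcl (σ p).1 ⟨hpc, (hcol _ hq.2).2⟩ ?_
        have h1 := (key _ hm hsut p hp.icc hq.icc).1.1 hmp
        have h3 : f (σ p).1 = p := by
          rw [hf, loc_mv, loc, ← h1, Equiv.symm_apply_apply, swap_apply_of_ne_of_ne]
          · exact fun e => hps (by rw [e]; rfl)
          · rintro rfl
            exact not_cycIco_right _ _ hq.2
        rw [h3]
        exact ⟨hp.1, h2⟩
      · exact hrec.clear p ⟨hps, h2⟩ (by rw [hσA]; exact hq) (by rw [hσA]; exact hmp)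

end Maps

section Maps

variable {k : ZMod m} {σ y : State (n + 1) m} {s t u : Curve (n + 1) m}
theorem StateJ.symm_row_ne (hJ : StateJ H ρ c σ) (hcc : c + 1 ≠ c) (k : ZMod m) :
    (σ.symm (c, k)).1 ≠ ρ.succ := fun e => by
  have h' := hJ.col e
  rw [Equiv.apply_symm_apply] at h'
  exact hcc h'.symm

theorem StateJ.loc_add_one (h : IsStabilization G H ρ c) (hJ : StateJ H ρ c σ)
    {e : Fin (n + 1)} (he : e ≠ ρ.succ) (k : ZMod m) :
    loc H c σ e k (c + 1) = alphaThrough H ρ c (k + 1) := by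
  rw [loc, h.colAt_add_one he, ← hJ, Equiv.symm_apply_apply]

theorem StateJ.mv_state (hJ : StateJ H ρ c σ) (hs : s.1 ≠ ρ.succ) (ht : t.1 ≠ ρ.succ) :
    StateJ H ρ c (mv σ s t) := fun k => by
  rw [mv_of_ne, hJ]
  · exact fun e => hs (congrArg Prod.fst e).symm
  · exact fun e => ht (congrArg Prod.fst e).symm

variable [NeZero m]

theorem StateJ.opR_eq (h : IsStabilization G H ρ c) (hJ : StateJ H ρ c σ) :
    opR H ρ c S o σ = polyOp S o (fun k => σ.symm (c, k)) (alphaThrough H ρ c) := by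
  rw [opR, prodR, sheetProd_one, one_mul]
  intro k
  refine locR_thin S o h ?_ (hJ.loc_add_one h (castSucc_ne_succ ρ) k) rfl
  rw [loc, colAt_self]
  exact hJ.symm_row_ne (add_one_ne ρ c) k

theorem StateJ.opL_zero (h : IsStabilization G H ρ c) (hJ : StateJ H ρ c σ) :
    opL H ρ c S o σ = 0 := by
  refine opL_eq_zero S o 0 (locL_eq_zero_of_row S o ?_ ?_)
  · rw [loc, colAt_self]
    exact fun e => hJ.symm_row_ne (add_one_ne ρ c) 0 (congrArg Prod.fst e)
  · rw [hJ.loc_add_one h (succ_add_one_ne_succ ρ)]; rfl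

open Classical in
theorem ThinPolygon.sum_opL (h : IsStabilization G H ρ c) (hy : ThinPolygon H ρ c σ y) :
    (∑ s, ∑ t, if H.Rect σ s t then opL H ρ c S o (mv σ s t) * tau S o s t else 0) = 0 := by
  have hJ := hy.start
  refine Finset.sum_eq_zero fun s _ => Finset.sum_eq_zero fun u _ => ?_
  split_ifs with hr
  swap
  · rfl
  have hu : u.1 ≠ ρ.succ := fun e => hy.not_rect h e hr
  by_cases hs : s.1 ≠ ρ.succ
  · rw [(hJ.mv_state hs hu).opL_zero S o h, zero_mul]
  push Not at hs
  obtain ⟨k, hk⟩ := exists_eq_alphaThrough H c hs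
  obtain ⟨k, rfl⟩ : ∃ k', k = k' + 1 := ⟨k - 1, by ring⟩
  subst hk
  obtain ⟨huc, huc1, hX⟩ := hJ.col_ne h hr
  have hcc := add_one_ne ρ c
  have hrk : (mv σ (alphaThrough H ρ c (k + 1)) u).symm (c, k) = σ.symm (c, k) := by
    rw [mv_symm_apply, swap_apply_of_ne_of_ne]
    · exact fun e => hJ.symm_row_ne hcc k (congrArg Prod.fst e)
    · rintro e
      rw [← e] at huc
      exact huc (by simp)
  rw [opL_eq_zero S o k, zero_mul]
  set f := loc H c (mv σ (alphaThrough H ρ c (k + 1)) u) (ρ.succ + 1) k with hf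
  have hfc : f c = σ.symm (c, k) := by rw [hf, loc, colAt_self, hrk]
  have hfc1 : f (c + 1) = u := by
    rw [hf, loc_mv, hJ.loc_add_one h (succ_add_one_ne_succ ρ), swap_apply_left]
  rw [locL, if_neg, zero_add]
  · refine Finset.sum_eq_zero fun j _ => if_neg fun ⟨hx, hj⟩ => ?_
    have hm2 := hx.noMarking
    rw [hj, hfc1] at hm2
    have hm1 := hr.noMarking
    rw [hJ] at hm1
    have hj2 : mv σ (alphaThrough H ρ c (k + 1)) u (f j) = colAt H c (ρ.succ + 1) k j := by
      rw [hf, apply_loc]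
    rw [hj] at hj2
    have hjc : j ≠ c := by
      rintro rfl
      rw [hfc] at hj
      exact hJ.symm_row_ne hcc k (congrArg Prod.fst hj)
    have hrow : cycIco ρ.succ u.1 ρ.succ := cycIco_left hu.symm
    refine (hm2 (c - 1) ?_).1 (by rw [hX]; exact hrow)
    have hc1 := val_add_one_cases ρ c
    have hc2 := val_sub_one_cases ρ c
    grind
  · rw [hfc]
    exact fun e => hJ.symm_row_ne hcc k (congrArg Prod.fst e)

open Classical in
theorem StateJ.opR_mv (h : IsStabilization G H ρ c) (hJ : StateJ H ρ c σ)
    (hr : H.Rect σ (alphaThrough H ρ c (k + 1)) u) :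
    opR H ρ c S o (mv σ (alphaThrough H ρ c (k + 1)) u) =
      (if Poly H ρ c (alphaThrough H ρ c (k + 1))
          (loc H c (mv σ (alphaThrough H ρ c (k + 1)) u) ρ.castSucc k) (σ.symm (c, k)) then
        1 else 0) * polyOp S o (fun k => σ.symm (c, k)) (alphaThrough H ρ c) := by
  obtain ⟨huc, huc1, hX⟩ := hJ.col_ne h hr
  have hcc := add_one_ne ρ c
  have hu : u.1 ≠ ρ.succ := hr.row.symm
  have hrk : ∀ i, (mv σ (alphaThrough H ρ c (k + 1)) u).symm (c, i) = σ.symm (c, i) := by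
    intro i
    rw [mv_symm_apply, swap_apply_of_ne_of_ne]
    · exact fun e => hJ.symm_row_ne hcc i (congrArg Prod.fst e)
    · rintro e
      rw [← e] at huc
      exact huc (by simp)
  set A := alphaThrough H ρ c (k + 1) with hA
  set f := loc H c (mv σ A u) ρ.castSucc k with hf
  have hfc : f c = σ.symm (c, k) := by rw [hf, loc, colAt_self, hrk]
  have hfc1 : f (c + 1) = u := by
    rw [hf, loc_mv, hJ.loc_add_one h (castSucc_ne_succ ρ), swap_apply_left]
  have h1 : ∀ k', k' ≠ k → locR H ρ c S o (alphaThrough H ρ c (k' + 1))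
      (loc H c (mv σ A u) ρ.castSucc k') = 1 := by
    intro k' hk
    refine locR_thin S o h ?_ ?_ rfl
    · rw [loc, colAt_self, hrk]
      exact hJ.symm_row_ne hcc k'
    · rw [loc_mv, hJ.loc_add_one h (castSucc_ne_succ ρ), swap_apply_of_ne_of_ne]
      · exact fun e => hk (add_right_cancel (alphaThrough_injective H ρ c e))
      · exact fun e => hu (congrArg Prod.fst e).symm
  have h2 : prodR H ρ c S o (mv σ A u) = locR H ρ c S o A f := by
    rw [prodR, sheetProd_eq_mul _ k, sheetProd_one, one_mul]
    rotate_left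
    · exact fun k' hk => locR_commute S o fun i j e => hk (loc_inj.1 e).1.symm
    intro k'
    by_cases hk : k' = k
    · rw [hk, Function.update_self]
    · rw [Function.update_of_ne hk, h1 k' hk]
  rw [opR, h2, locR, hfc, Finset.sum_eq_zero, add_zero]
  · congr 2
    exact funext hrk
  · refine fun j _ => if_neg fun ⟨hx, hj, _⟩ => ?_
    have hm2 := hx.noMarking
    have hp := hx.punctured
    have hjc : j ≠ c := by
      rintro rfl
      exact hx.obtuse.1 rfl
    rw [hfc1] at hm2
    rw [hfc, hfc1] at hp
    refine (hm2 (c - 1) ?_).1 ?_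
    · have hc1 := val_add_one_cases ρ c
      have hc2 := val_sub_one_cases ρ c
      grind
    · rw [hX]
      grind

open Classical in
/-- On the states in which the polygon is thin, the map `F^R` anticommutes with the differentials. -/
theorem ThinPolygon.sum_opR (h : IsStabilization G H ρ c) (hσ : H.IsGen σ) (hy : ThinPolygon H ρ c σ y) :
    (∑ s, ∑ t, if H.Rect σ s t then opR H ρ c S o (mv σ s t) * tau S o s t else 0) =
      -(gOp H ρ c S o y * opR H ρ c S o σ) := by
  have hJ := hy.start
  have hcc := add_one_ne ρ c
  rw [hJ.opR_eq S o h]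
  set W := polyOp S o (fun k => σ.symm (c, k)) (alphaThrough H ρ c) with hW
  have hrinj := symm_col_injective (c := c) σ
  have hAinj := alphaThrough_injective H ρ c (m := m)
  have hrA : ∀ i j, σ.symm (c, i) ≠ alphaThrough H ρ c j := fun i j e =>
    hJ.symm_row_ne hcc i (congrArg Prod.fst e)
  let T (s t : Curve (n + 1) m) : Operator (n + 1) m :=
    if GRect H ρ c y s t ∧ ¬ (cycIoo s.1 t.1 ρ.succ ∧ (σ s).1 = c) then tau S o s t else 0
  let V : Curve (n + 1) m → Curve (n + 1) m → Operator (n + 1) m := fun s t =>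
    if GRect H ρ c y s t ∧ (cycIoo s.1 t.1 ρ.succ ∧ (σ s).1 = c) then tau S o s t else 0
  let V' : ZMod m → Curve (n + 1) m → Operator (n + 1) m := fun k t =>
    if GRect H ρ c y (σ.symm (c, k)) t ∧ cycIoo (σ.symm (c, k)).1 t.1 ρ.succ then
      tau S o (σ.symm (c, k)) t else 0
  let L : Curve (n + 1) m → Curve (n + 1) m → Operator (n + 1) m := fun s t =>
    if H.Rect σ s t then opR H ρ c S o (mv σ s t) * tau S o s t else 0
  have h1 : gOp H ρ c S o y = (∑ s, ∑ t, T s t) + ∑ k, ∑ t, V' k t := by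
    have h2 : ∑ k, ∑ t, V' k t = ∑ s, ∑ t, V s t := by
      refine Fintype.sum_of_injective (fun k => σ.symm (c, k)) hrinj
        (fun k => ∑ t, V' k t) (fun s => ∑ t, V s t)
        (fun s hs => Finset.sum_eq_zero fun t _ => if_neg fun h' => hs ?_)
        fun k => Finset.sum_congr rfl fun t _ => if_congr ?_ rfl rfl
      · refine ⟨(σ s).2, ?_⟩
        change σ.symm (c, (σ s).2) = s
        rw [← h'.2.2]
        simp
      · simp
    rw [h2, gOp, ← Finset.sum_add_distrib]
    refine Finset.sum_congr rfl fun s _ => ?_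
    rw [← Finset.sum_add_distrib]
    refine Finset.sum_congr rfl fun t _ => ?_
    by_cases h1 : GRect H ρ c y s t <;>
      by_cases h2 : (cycIoo s.1 t.1 ρ.succ ∧ (σ s).1 = c) <;> simp [T, V, h1, h2]
  have h3 : ∀ s t, s.1 ≠ ρ.succ → L s t = -(T s t * W) := by
    intro s t hs
    by_cases ht : t.1 = ρ.succ
    · have e1 : L s t = 0 := if_neg (hy.not_rect h ht)
      have e2 : T s t = 0 := if_neg fun h' => h'.1.rt ht
      rw [e1, e2, zero_mul, neg_zero]
    by_cases hr : H.Rect σ s t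
    · have e1 : L s t = opR H ρ c S o (mv σ s t) * tau S o s t := if_pos hr
      have e2 : T s t = tau S o s t := if_pos ((hy.rect_iff h hs ht).1 hr)
      have e3 : (swap s t ∘ alphaThrough H ρ c) = alphaThrough H ρ c (m := m) :=
        funext fun i => swap_apply_of_ne_of_ne (fun e' => hs (congrArg Prod.fst e').symm)
          (fun e' => ht (congrArg Prod.fst e').symm)
      rw [e1, e2, (hJ.mv_state hs ht).opR_eq S o h,
        polyOp_conj S o (symm_col_injective _) hAinj _ hr.ne, e3]
      · congr 3
        funext i
        simp [mv_symm_apply]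
      · exact fun i j e => (hJ.mv_state hs ht).symm_row_ne hcc i (congrArg Prod.fst e)
    · have e1 : L s t = 0 := if_neg hr
      have e2 : T s t = 0 := if_neg fun h' => hr ((hy.rect_iff h hs ht).2 h')
      rw [e1, e2, zero_mul, neg_zero]
  have h4 : ∀ k t, L (alphaThrough H ρ c (k + 1)) t = -(V' k t * W) := by
    intro k t
    have hiff := hy.gRect_iff h hσ (k := k) (u := t)
    by_cases hr : H.Rect σ (alphaThrough H ρ c (k + 1)) t
    · have e1 : L (alphaThrough H ρ c (k + 1)) t = _ := if_pos hr
      rw [e1, hJ.opR_mv S o h hr]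
      by_cases hp : Poly H ρ c (alphaThrough H ρ c (k + 1))
          (loc H c (mv σ (alphaThrough H ρ c (k + 1)) t) ρ.castSucc k) (σ.symm (c, k))
      · have e2 : V' k t = tau S o (σ.symm (c, k)) t := if_pos (hiff.2 ⟨hr, hp⟩)
        rw [if_pos hp, one_mul, e2, tau_symm S o hr.ne.symm, mul_neg,
          polyOp_mul_tau S o hrinj hAinj hrA (t := t) _ _ k]
        · intro i e'
          refine (hJ.col_ne h hr).1 ?_
          rw [e', Equiv.apply_symm_apply]
        · exact fun i e' => hr.row (congrArg Prod.fst e').symm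
      · have e2 : V' k t = 0 := if_neg fun h' => hp (hiff.1 h').2
        rw [if_neg hp, e2, zero_mul, zero_mul]
        exact neg_zero.symm
    · have e1 : L (alphaThrough H ρ c (k + 1)) t = 0 := if_neg hr
      have e2 : V' k t = 0 := if_neg fun h' => hr (hiff.1 h').1
      rw [e1, e2, zero_mul, neg_zero]
  let Q : Curve (n + 1) m → Operator (n + 1) m := fun s =>
    if s.1 = ρ.succ then ∑ t, L s t else 0
  have h5 : ∀ s, ∑ t, L s t = -((∑ t, T s t) * W) + Q s := by
    intro s
    by_cases hs : s.1 = ρ.succ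
    · have e1 : Q s = ∑ t, L s t := if_pos hs
      have e2 : ∀ t, T s t = 0 := fun t => if_neg fun h' => h'.1.rs hs
      rw [e1, Finset.sum_eq_zero fun t _ => e2 t, zero_mul, neg_zero, zero_add]
    · have e1 : Q s = 0 := if_neg hs
      rw [e1, add_zero, Finset.sum_congr rfl fun t _ => h3 s t hs, Finset.sum_neg_distrib,
        Finset.sum_mul]
  have h6 : ∑ s, Q s = -((∑ k, ∑ t, V' k t) * W) := by
    rw [Finset.sum_mul, ← Finset.sum_neg_distrib]
    refine (Fintype.sum_of_injective (fun k => alphaThrough H ρ c (k + 1))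
      (fun i j e => add_right_cancel (hAinj e)) (fun k => -((∑ t, V' k t) * W)) Q (fun s hs => if_neg fun h' => hs ?_)
      fun k => ?_).symm
    · obtain ⟨k, hk⟩ := exists_eq_alphaThrough H c h'
      exact ⟨k - 1, by simp [hk]⟩
    · have e1 : Q (alphaThrough H ρ c (k + 1)) = _ := if_pos rfl
      rw [e1, Finset.sum_congr rfl fun t _ => h4 k t, Finset.sum_neg_distrib, Finset.sum_mul]
  change (∑ s, ∑ t, L s t) = _
  rw [Finset.sum_congr rfl fun s _ => h5 s, Finset.sum_add_distrib, h6, h1, add_mul, neg_add,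
    Finset.sum_neg_distrib, Finset.sum_mul Finset.univ (fun s => ∑ t, T s t)]

end Maps

/-! ### The two-chains of rectangles, hexagons and polygons -/

section Domains

theorem shift_add_cross (ρ : Fin n) (i j : Fin (n + 1)) :
    H.shift i (j - 1) + H.cross i (j - 1) = H.shift i j := by
  classical
  have h := Grid.shift_sub_shift (D := H) i (j - 1) j
  have h1 : ∀ k, cycIco (j - 1) j k ↔ k = j - 1 := fun k => by
    have := cycIco_add_one ρ (c := j - 1) (j := k)
    rwa [sub_add_cancel] at this
  simp only [h1, Finset.sum_ite_eq', Finset.mem_univ, if_true] at h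
  omega

variable (H) in
/-- The sheets of the squares to the right of a lift of `alpha_i` change like the sheets of the points on
this lift. -/
def FlatAt (i₀ i₁ j₀ j₁ : Fin (n + 1)) : Prop :=
  ∀ i j, cycIco i₀ i₁ i → cycIco j₀ j₁ j → H.rowCross i j = H.cross i₀ j

theorem Grid.NoMarking.flatAt {i₀ i₁ j₀ j₁ : Fin (n + 1)} (h : H.NoMarking i₀ i₁ j₀ j₁) :
    FlatAt H i₀ i₁ j₀ j₁ := by
  intro i j hi hj
  obtain ⟨h1, h2⟩ := h j hj
  rw [cycIco_iff] at h1 h2 hi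
  rw [Grid.cross_eq, Grid.rowCross]
  simp only [Fin.lt_def]
  split_ifs <;> omega

theorem IsStabilization.rowCross_new (h : IsStabilization G H ρ c) (i : Fin (n + 1)) :
    H.rowCross i c = 0 := by
  have hv := val_rows ρ
  rw [Grid.rowCross, h.O_new, h.X_new]
  simp only [Fin.lt_def]
  rw [if_neg (by omega), if_neg (by omega)]

open Classical in
theorem squares_corner (ρ : Fin n) {s : Curve (n + 1) m} {i₁ j₀ j₁ : Fin (n + 1)}
    (hf : FlatAt H s.1 i₁ j₀ j₁) (hi : s.1 ≠ i₁) (hj : j₀ ≠ j₁) (i j : Fin (n + 1)) (a : ZMod m) :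
    squares H s i₁ j₀ j₁ i j a - squares H s i₁ j₀ j₁ (i - 1) j a
      - squares H s i₁ j₀ j₁ i (j - 1) (a - (H.rowCross i (j - 1) : ZMod m))
      + squares H s i₁ j₀ j₁ (i - 1) (j - 1) (a - (H.rowCross (i - 1) (j - 1) : ZMod m)) =
    if H.Meets s (j, a) then ((if i = s.1 then 1 else 0) - (if i = i₁ then 1 else 0)) *
      ((if j = j₀ then 1 else 0) - (if j = j₁ then 1 else 0)) else 0 := by
  have key : ∀ i', cycIco s.1 i₁ i' → cycIco j₀ j₁ (j - 1) →
      (H.Meets s (j - 1, a - (H.rowCross i' (j - 1) : ZMod m)) ↔ H.Meets s (j, a)) := by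
    intro i' h1 h2
    have h3 := congrArg (Int.cast : ℤ → ZMod m) (shift_add_cross (H := H) ρ s.1 j)
    push_cast at h3
    simp only [Grid.Meets]
    rw [hf i' _ h1 h2, ← h3]
    constructor
    · intro e; linear_combination e
    · intro e; linear_combination e
  have e1 : ∀ i', squares H s i₁ j₀ j₁ i' (j - 1) (a - (H.rowCross i' (j - 1) : ZMod m)) =
      if cycIco s.1 i₁ i' ∧ cycIco j₀ j₁ (j - 1) ∧ H.Meets s (j, a) then 1 else 0 := by
    intro i'
    refine if_congr (and_congr_right fun h1 => and_congr_right fun h2 => key i' h1 h2) rfl rfl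
  rw [e1, e1]
  simp only [squares]
  by_cases hm : H.Meets s (j, a)
  · have r1 : ∀ {p q x : Fin (n + 1)}, p ≠ q → ((if cycIco p q x then (1 : ℤ) else 0) -
        (if cycIco p q (x - 1) then 1 else 0)) = (if x = p then 1 else 0) - if x = q then 1 else 0 := by
      intro p q x hpq
      have h1 := val_sub_one_cases ρ x
      simp only [cycIco_iff, Fin.ext_iff]
      split_ifs <;> omega
    rw [if_pos hm, ← r1 hi, ← r1 hj]
    simp only [hm, and_true]
    by_cases h1 : cycIco s.1 i₁ i <;> by_cases h2 : cycIco s.1 i₁ (i - 1) <;>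
      by_cases h3 : cycIco j₀ j₁ j <;> by_cases h4 : cycIco j₀ j₁ (j - 1) <;> simp [h1, h2, h3, h4]
  · simp [hm]

open Classical in
/-- The condition on the corners of a two-chain that connects two states. -/
def Connects (H : Grid (n + 1)) (σ σ' : State (n + 1) m)
    (p : Fin (n + 1) → Fin (n + 1) → ZMod m → ℤ) : Prop :=
  ∀ i j a,
    p i j a - p (i - 1) j a - p i (j - 1) (a - (H.rowCross i (j - 1) : ZMod m))
      + p (i - 1) (j - 1) (a - (H.rowCross (i - 1) (j - 1) : ZMod m))
      = (if (σ.symm (j, a)).1 = i then 1 else 0) - (if (σ'.symm (j, a)).1 = i then 1 else 0)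

theorem Connects.add {σ σ' σ'' : State (n + 1) m} {p p' : Fin (n + 1) → Fin (n + 1) → ZMod m → ℤ}
    (h : Connects H σ σ' p) (h' : Connects H σ' σ'' p') : Connects H σ σ'' (p + p') := by
  intro i j a
  have h1 := h i j a
  have h2 := h' i j a
  simp only [Pi.add_apply]
  linarith

theorem Connects.zero {σ : State (n + 1) m} : Connects H σ σ 0 := by
  intro i j a
  simp

theorem connects_squares (ρ : Fin n) {σ : State (n + 1) m} (hσ : H.IsGen σ) {s t : Curve (n + 1) m}
    (hf : FlatAt H s.1 t.1 (σ s).1 (σ t).1) (hrow : s.1 ≠ t.1) (hcol : (σ s).1 ≠ (σ t).1)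
    (hm : H.Meets s (σ t)) :
    Connects H σ (mv σ s t) (squares H s t.1 (σ s).1 (σ t).1) := by
  classical
  have hst : s ≠ t := fun e => hrow (congrArg Prod.fst e)
  intro i j a
  rw [squares_corner ρ hf hrow hcol, mv_symm_apply]
  by_cases h1 : (j, a) = σ s
  · have e : j = (σ s).1 := congrArg Prod.fst h1
    have e' : ¬ j = (σ t).1 := fun e' => hcol (e.symm.trans e')
    rw [h1, if_pos (hσ s), Equiv.symm_apply_apply, swap_apply_left]
    simp [e', ← e, eq_comm]
  by_cases h2 : (j, a) = σ t
  · have e : j = (σ t).1 := congrArg Prod.fst h2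
    have e' : ¬ j = (σ s).1 := fun e' => hcol (e'.symm.trans e)
    rw [h2, if_pos hm, Equiv.symm_apply_apply, swap_apply_right]
    simp [e', ← e, eq_comm]
  · rw [swap_apply_of_ne_of_ne, sub_self]
    · by_cases h3 : H.Meets s (j, a)
      · have e1 : ¬ j = (σ s).1 := fun e => h1 (h3.right_unique (hσ s) e)
        have e2 : ¬ j = (σ t).1 := fun e => h2 (h3.right_unique hm e)
        simp [e1, e2]
      · exact if_neg h3
    · exact fun e => h1 (by rw [← e, Equiv.apply_symm_apply])
    · exact fun e => h2 (by rw [← e, Equiv.apply_symm_apply])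

theorem isPseudoDomain_iff {x y : H.Gen m} {p : TwoChain (n + 1) m} :
    IsPseudoDomain H ρ c x y p ↔
      (∀ j, j ≠ c → ∀ a b, p.1 (H.X j) j a = p.1 (H.X j) j b ∧ p.1 (H.O j) j a = p.1 (H.O j) j b) ∧
      (∀ k, p.1 ρ.succ c k - p.1 ρ.castSucc c k = p.2.1 - p.2.2) ∧ Connects H x.1 y.1 p.1 :=
  ⟨fun h => ⟨h.marked, h.puncture, h.corner⟩, fun h => ⟨h.1, h.2.1, h.2.2⟩⟩

theorem IsPseudoDomain.add {x y z : H.Gen m} {p q : TwoChain (n + 1) m}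
    (hp : IsPseudoDomain H ρ c x y p) (hq : IsPseudoDomain H ρ c y z q) :
    IsPseudoDomain H ρ c x z (p + q) := by
  rw [isPseudoDomain_iff] at *
  refine ⟨fun j hj a b => ⟨?_, ?_⟩, fun k => ?_, hp.2.2.add hq.2.2⟩
  · exact congrArg₂ (· + ·) (hp.1 j hj a b).1 (hq.1 j hj a b).1
  · exact congrArg₂ (· + ·) (hp.1 j hj a b).2 (hq.1 j hj a b).2
  · have h1 := hp.2.1 k
    have h2 := hq.2.1 k
    simp only [Prod.fst_add, Prod.snd_add, Pi.add_apply]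
    linarith

theorem IsPseudoDomain.refl (x : H.Gen m) : IsPseudoDomain H ρ c x x 0 :=
  isPseudoDomain_iff.2 ⟨fun _ _ _ _ => ⟨rfl, rfl⟩, fun _ => rfl, Connects.zero⟩

theorem QFine.add {p q : TwoChain (n + 1) m} (hp : QFine H c p) (hq : QFine H c q) :
    QFine H c (p + q) := by
  refine ⟨fun j hj a => ⟨?_, ?_⟩, ?_⟩
  · exact (congrArg₂ (· + ·) (hp.1 j hj a).1 (hq.1 j hj a).1).trans (add_zero 0)
  · exact (congrArg₂ (· + ·) (hp.1 j hj a).2 (hq.1 j hj a).2).trans (add_zero 0)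
  · exact (congrArg₂ (· + ·) hp.2 hq.2).trans (add_zero 0)

theorem QFine.zero : QFine H c (0 : TwoChain (n + 1) m) := ⟨fun _ _ _ => ⟨rfl, rfl⟩, rfl⟩

theorem squares_eq_zero {s : Curve (n + 1) m} {i₁ j₀ j₁ i j : Fin (n + 1)} {a : ZMod m}
    (h : cycIco j₀ j₁ j → ¬ cycIco s.1 i₁ i) : squares H s i₁ j₀ j₁ i j a = 0 := by
  classical
  exact if_neg fun h' => h h'.2.1 h'.1

/-- The region in which a two-chain is supported contains no marking except possibly `O_1` and `X_1`. -/
def NoOldMarking (H : Grid (n + 1)) (c : Fin (n + 1)) (i₀ i₁ j₀ j₁ : Fin (n + 1)) : Prop :=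
  ∀ j, j ≠ c → cycIco j₀ j₁ j → ¬ cycIco i₀ i₁ (H.X j) ∧ ¬ cycIco i₀ i₁ (H.O j)

theorem Grid.NoMarking.old {i₀ i₁ j₀ j₁ : Fin (n + 1)} (h : H.NoMarking i₀ i₁ j₀ j₁) :
    NoOldMarking H c i₀ i₁ j₀ j₁ := fun j _ hj => h j hj

theorem NoOldMarking.flatAt (h : IsStabilization G H ρ c) {i₀ i₁ j₀ j₁ : Fin (n + 1)}
    (hm : NoOldMarking H c i₀ i₁ j₀ j₁) (hi : i₀ ≠ ρ.succ) : FlatAt H i₀ i₁ j₀ j₁ := by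
  intro i j hi' hj
  by_cases hjc : j = c
  · rw [hjc, h.rowCross_new, h.cross_new, if_neg hi]
  · obtain ⟨h1, h2⟩ := hm j hjc hj
    rw [cycIco_iff] at h1 h2 hi'
    rw [Grid.cross_eq, Grid.rowCross]
    simp only [Fin.lt_def]
    split_ifs <;> omega

theorem NoOldMarking.squares_eq_zero {s : Curve (n + 1) m} {i₁ j₀ j₁ j : Fin (n + 1)}
    (hm : NoOldMarking H c s.1 i₁ j₀ j₁) (hj : j ≠ c) (a : ZMod m) :
    squares H s i₁ j₀ j₁ (H.X j) j a = 0 ∧ squares H s i₁ j₀ j₁ (H.O j) j a = 0 :=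
  ⟨GridCover.squares_eq_zero fun h => (hm j hj h).1, GridCover.squares_eq_zero fun h => (hm j hj h).2⟩

/-- The two-chain of a rectangle. -/
def rectChain (H : Grid (n + 1)) (σ : State (n + 1) m) (s t : Curve (n + 1) m) :
    TwoChain (n + 1) m := (squares H s t.1 (σ s).1 (σ t).1, 0, 0)

theorem rectChain_fine {σ : State (n + 1) m} {s t : Curve (n + 1) m}
    (hm : NoOldMarking H c s.1 t.1 (σ s).1 (σ t).1) : QFine H c (rectChain H σ s t) :=
  ⟨fun _ hj a => hm.squares_eq_zero hj a, rfl⟩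

theorem Grid.Rect.isPseudoDomain (h : IsStabilization G H ρ c) {x y : H.Gen m} {s t : Curve (n + 1) m}
    (hr : H.Rect x.1 s t) (hy : y.1 = mv x.1 s t) :
    IsPseudoDomain H ρ c x y (rectChain H x.1 s t) := by
  rw [isPseudoDomain_iff, hy]
  refine ⟨fun j hj a b => ?_, fun k => ?_,
    connects_squares ρ x.2 hr.noMarking.flatAt hr.row hr.col hr.ms⟩
  · have h1 := fun a => hr.noMarking.old.squares_eq_zero (s := s) hj a
    exact ⟨(h1 a).1.trans (h1 b).1.symm, (h1 a).2.trans (h1 b).2.symm⟩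
  · have h1 : ∀ k, squares H s t.1 (x.1 s).1 (x.1 t).1 ρ.succ c k = 0 := fun k =>
      squares_eq_zero fun h' => by rw [← h.O_new]; exact (hr.noMarking c h').2
    have h2 : ∀ k, squares H s t.1 (x.1 s).1 (x.1 t).1 ρ.castSucc c k = 0 := fun k =>
      squares_eq_zero fun h' => by rw [← h.X_new]; exact (hr.noMarking c h').1
    change squares H s t.1 (x.1 s).1 (x.1 t).1 ρ.succ c k -
      squares H s t.1 (x.1 s).1 (x.1 t).1 ρ.castSucc c k = _
    rw [h1, h2]
    rfl

theorem isPseudoDomain_of_annular (h : IsStabilization G H ρ c) {x y : H.Gen m}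
    {s t : Curve (n + 1) m} (hy : y.1 = mv x.1 s t) (hs : s.1 ≠ ρ.succ) (ht : t.1 ≠ ρ.succ)
    (hrow : s.1 ≠ t.1) (hcol : (x.1 s).1 ≠ (x.1 t).1) (hm : H.Meets s (x.1 t))
    (hmark : NoOldMarking H c s.1 t.1 (x.1 s).1 (x.1 t).1) :
    IsPseudoDomain H ρ c x y (rectChain H x.1 s t) := by
  rw [isPseudoDomain_iff, hy]
  refine ⟨fun j hj a b => ?_, fun k => ?_,
    connects_squares ρ x.2 (hmark.flatAt h hs) hrow hcol hm⟩
  · have h1 := fun a => hmark.squares_eq_zero hj a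
    exact ⟨(h1 a).1.trans (h1 b).1.symm, (h1 a).2.trans (h1 b).2.symm⟩
  · have h1 : squares H s t.1 (x.1 s).1 (x.1 t).1 ρ.succ c k =
        squares H s t.1 (x.1 s).1 (x.1 t).1 ρ.castSucc c k := by
      classical
      refine if_congr (and_congr_left fun _ => ?_) rfl rfl
      have hv := val_rows ρ
      grind
    change squares H s t.1 (x.1 s).1 (x.1 t).1 ρ.succ c k -
      squares H s t.1 (x.1 s).1 (x.1 t).1 ρ.castSucc c k = _
    rw [h1, sub_self]
    rfl

end Domains

section Polygons

section Cycle

variable {N m : ℕ} (S : SignAssignment (Curve N m) (Curve N m)) (o : Orientation N m)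

/-- The state that arises by successive exchanges of the component on `a` with the components on the curves
of a list. -/
def mvStar (a : Curve N m) (L : List (Curve N m)) (σ : State N m) : State N m :=
  L.foldl (fun σ b => mv σ a b) σ

theorem star_vec {a : Curve N m} {L : List (Curve N m)} (ha : a ∉ L) (σ : State N m) :
    ∃ ε : ℤˣ, star S o a L (vec o σ) = (ε : ℤ) • vec o (mvStar a L σ) := by
  induction L generalizing σ with
  | nil => exact ⟨1, by simp [star, mvStar]⟩
  | cons b L ih =>
    rw [List.mem_cons, not_or] at ha
    obtain ⟨ε, hε⟩ := ih ha.2 (mv σ a b)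
    refine ⟨S.sign (formalState o σ) (rectMove o a b) * ε, ?_⟩
    rw [star, Module.End.mul_apply, tau_vec S o σ ha.1, map_smul, hε, smul_smul, Units.val_mul]
    rfl

theorem mvStar_zig {r A : ZMod m → Curve N m} (σ : State N m) (b : ZMod m) (k : ℕ)
    (hn : (zig r A b (k + 1)).Nodup) :
    (∀ i ≤ k, mvStar (r b) (A b :: zig r A (b - 1) k) σ (A (b - (i : ℕ))) = σ (r (b - (i : ℕ)))) ∧
    (∀ i < k, mvStar (r b) (A b :: zig r A (b - 1) k) σ (r (b - 1 - (i : ℕ))) =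
      σ (A (b - (i : ℕ)))) ∧
    mvStar (r b) (A b :: zig r A (b - 1) k) σ (r b) = σ (A (b - (k : ℕ))) ∧
    ∀ p, p ∉ zig r A b (k + 1) → mvStar (r b) (A b :: zig r A (b - 1) k) σ p = σ p := by
  induction k with
  | zero =>
    simp only [zig, mvStar, List.foldl_cons, List.foldl_nil]
    refine ⟨fun i hi => ?_, fun i hi => absurd hi (by omega), by simp, fun p hp => ?_⟩
    · obtain rfl : i = 0 := by omega
      simp
    · simp only [List.mem_cons, List.not_mem_nil, or_false, not_or] at hp
      exact mv_of_ne _ hp.1 hp.2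
  | succ k ih =>
    have e : b - 1 - (k : ZMod m) = b - ((k + 1 : ℕ) : ZMod m) := by push_cast; ring
    have hz : zig r A b (k + 1 + 1) =
        zig r A b (k + 1) ++ [r (b - ((k + 1 : ℕ) : ZMod m)), A (b - ((k + 1 : ℕ) : ZMod m))] :=
      zig_succ r A b (k + 1)
    have hz' : zig r A (b - 1) (k + 1) =
        zig r A (b - 1) k ++ [r (b - ((k + 1 : ℕ) : ZMod m)), A (b - ((k + 1 : ℕ) : ZMod m))] := by
      rw [zig_succ, e]
    set R := r (b - ((k + 1 : ℕ) : ZMod m)) with hR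
    set B := A (b - ((k + 1 : ℕ) : ZMod m)) with hB
    rw [hz] at hn
    obtain ⟨i1, i2, i3, i4⟩ := ih (List.nodup_append.1 hn).1
    set y := mvStar (r b) (A b :: zig r A (b - 1) k) σ with hy
    have hy' : mvStar (r b) (A b :: zig r A (b - 1) (k + 1)) σ = mv (mv y (r b) R) (r b) B := by
      rw [hz', hy, mvStar, mvStar, ← List.cons_append, List.foldl_append]
      rfl
    have hd := (List.nodup_append.1 hn).2.2
    have hRB : R ≠ B := by
      have := (List.nodup_append.1 hn).2.1
      simp at this
      exact this
    have hmem : ∀ i ≤ k, r (b - (i : ZMod m)) ∈ zig r A b (k + 1) ∧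
        A (b - (i : ZMod m)) ∈ zig r A b (k + 1) := by
      intro i hi
      clear * - hi
      induction k generalizing b i with
      | zero =>
        obtain rfl : i = 0 := by omega
        simp [zig]
      | succ k ih =>
        rcases i with _ | i
        · simp [zig]
        · have e : b - ((i + 1 : ℕ) : ZMod m) = b - 1 - (i : ZMod m) := by push_cast; ring
          rw [e, zig]
          exact ⟨List.mem_cons_of_mem _ (List.mem_cons_of_mem _ (ih (b - 1) i (by omega)).1),
            List.mem_cons_of_mem _ (List.mem_cons_of_mem _ (ih (b - 1) i (by omega)).2)⟩
    have hRn : R ∉ zig r A b (k + 1) := fun h => hd R h R (by simp) rfl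
    have hBn : B ∉ zig r A b (k + 1) := fun h => hd B h B (by simp) rfl
    have hrb : r b ∈ zig r A b (k + 1) := by simp [zig]
    have h0 : ∀ p ∈ zig r A b (k + 1), p ≠ r b → mv (mv y (r b) R) (r b) B p = y p := by
      intro p hp hpb
      rw [mv_of_ne _ hpb (fun e => hBn (by rw [← e]; exact hp)),
        mv_of_ne _ hpb (fun e => hRn (by rw [← e]; exact hp))]
    have hrA : ∀ i ≤ k, A (b - (i : ZMod m)) ≠ r b := by
      intro i hi e'
      have h1 := (List.nodup_append.1 hn).1
      clear * - h1 hi e'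
      rw [zig, List.nodup_cons] at h1
      refine h1.1 ?_
      rw [← e']
      rcases i with _ | i
      · simp
      · refine List.mem_cons_of_mem _ ?_
        have e : b - ((i + 1 : ℕ) : ZMod m) = b - 1 - (i : ZMod m) := by push_cast; ring
        rw [e]
        generalize b - 1 = b' at *
        clear * - hi
        induction k generalizing b' i with
        | zero => omega
        | succ k ih =>
          rcases i with _ | i
          · simp [zig]
          · have e : b' - ((i + 1 : ℕ) : ZMod m) = b' - 1 - (i : ZMod m) := by push_cast; ring
            rw [e, zig]
            exact List.mem_cons_of_mem _ (List.mem_cons_of_mem _ (ih i (by omega) (b' - 1)))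
    have hrr : ∀ i < k, r (b - 1 - (i : ZMod m)) ≠ r b := by
      intro i hi e'
      have h1 := (List.nodup_append.1 hn).1
      clear * - h1 hi e'
      rw [zig, List.nodup_cons] at h1
      refine h1.1 ?_
      rw [← e']
      refine List.mem_cons_of_mem _ ?_
      generalize b - 1 = b' at *
      clear * - hi
      induction k generalizing b' i with
      | zero => omega
      | succ k ih =>
        rcases i with _ | i
        · simp [zig]
        · have e : b' - ((i + 1 : ℕ) : ZMod m) = b' - 1 - (i : ZMod m) := by push_cast; ring
          rw [e, zig]
          exact List.mem_cons_of_mem _ (List.mem_cons_of_mem _ (ih i (by omega) (b' - 1)))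
    have hRb : R ≠ r b := fun e' => hRn (e' ▸ hrb)
    have hBb : B ≠ r b := fun e' => hBn (e' ▸ hrb)
    rw [hy', hz]
    refine ⟨fun i hi => ?_, fun i hi => ?_, ?_, fun p hp => ?_⟩
    · rcases Nat.lt_or_ge k i with h | h
      · obtain rfl : i = k + 1 := by omega
        rw [← hB, ← hR, mv_right, mv_left, i4 _ hRn]
      · rw [h0 _ (hmem i h).2 (hrA i h), i1 i h]
    · rcases Nat.lt_or_ge i k with h | h
      · have e' : b - 1 - (i : ZMod m) = b - ((i + 1 : ℕ) : ZMod m) := by push_cast; ring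
        rw [h0 _ (e' ▸ (hmem (i + 1) h).1) (hrr i h), i2 i h]
      · obtain rfl : i = k := by omega
        rw [e, ← hR, mv_of_ne _ hRb hRB, mv_right, i3]
    · rw [mv_left, mv_of_ne _ hBb hRB.symm, i4 _ hBn]
    · simp only [List.mem_append, List.mem_cons, List.not_mem_nil, or_false, not_or] at hp
      have hpb : p ≠ r b := fun e' => hp.1 (e' ▸ hrb)
      rw [mv_of_ne _ hpb hp.2.2, mv_of_ne _ hpb hp.2.1, i4 _ hp.1]

variable [NeZero m]

theorem exists_polyOp_vec {r A : ZMod m → Curve N m} (hr : Function.Injective r)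
    (hA : Function.Injective A) (hrA : ∀ i j, r i ≠ A j) (σ : State N m) :
    ∃ (y : State N m) (ε : ℤˣ), polyOp S o r A (vec o σ) = (ε : ℤ) • vec o y ∧
      (∀ k, y (A k) = σ (r k)) ∧ (∀ k, y (r k) = σ (A (k + 1))) ∧
      ∀ p, (∀ k, p ≠ A k) → (∀ k, p ≠ r k) → y p = σ p := by
  obtain ⟨k, hk⟩ := Nat.exists_eq_succ_of_ne_zero (NeZero.ne m)
  have hz : zig r A 1 m = zig r A 1 (k + 1) := congrArg (zig r A 1) hk
  have hn := nodup_zig hr hA hrA 1 le_rfl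
  rw [hz] at hn
  obtain ⟨i1, i2, i3, i4⟩ := mvStar_zig σ 1 k hn
  obtain ⟨ε, hε⟩ := star_vec S o (L := A 1 :: zig r A (1 - 1) k) (List.nodup_cons.1 hn).1 σ
  have hm : ((k : ZMod m) + 1) = 0 := by
    have : ((k + 1 : ℕ) : ZMod m) = 0 := by rw [← Nat.succ_eq_add_one, ← hk]; simp
    exact_mod_cast this
  have hall : ∀ b j : ZMod m, ∃ i ≤ k, j = b - (i : ZMod m) := by
    intro b j
    refine ⟨(b - j).val, ?_, by simp⟩
    have := ZMod.val_lt (b - j)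
    omega
  refine ⟨_, ε, ?_, fun j => ?_, fun j => ?_, fun p h1 h2 => i4 p fun hp => ?_⟩
  · rw [polyOp, hz]
    exact hε
  · obtain ⟨i, hi, rfl⟩ := hall 1 j
    exact i1 i hi
  · obtain ⟨i, hi, rfl⟩ := hall (1 - 1) j
    rcases hi.lt_or_eq with h | rfl
    · rw [i2 i h]
      congr 2; ring
    · rw [show (1 - 1 - (i : ZMod m)) = 1 by linear_combination -hm, i3]
      congr 2; linear_combination -hm
  · obtain ⟨i, -, h | h⟩ := mem_zig r A hp
    · exact h2 _ h
    · exact h1 _ h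

end Cycle

variable {k : ZMod m} {σ : State (n + 1) m}
/-- The conditions on one part of a polygon, without local coordinates. -/
theorem poly_iff (h : IsStabilization G H ρ c) (hσ : H.IsGen σ) {A : Curve (n + 1) m} :
    Poly H ρ c A (loc H c σ ρ.castSucc k) (σ.symm (c, k)) ↔
      (σ.symm (c, k)).1 ≠ ρ.succ ∧ (σ A).1 ≠ c ∧ H.Meets (σ.symm (c, k)) (σ A) ∧
      (∀ j, cycIco c (σ A).1 j → (j ≠ c → ¬ cycIco (σ.symm (c, k)).1 ρ.succ (H.X j)) ∧
        ¬ cycIco (σ.symm (c, k)).1 ρ.succ (H.O j)) ∧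
      H.Clear σ (σ.symm (c, k)).1 ρ.succ (c, k) (σ A).1 := by
  set r := σ.symm (c, k) with hr
  have hσr : σ r = (c, k) := by simp [hr]
  have hmr : H.Meets r (c, k) := hσr ▸ hσ r
  have hv := val_rows ρ
  have hBc := meets_colAt (H := H) (c := c) (e := ρ.castSucc) (k := k) c
  rw [colAt_self] at hBc
  have key : r.1 ≠ ρ.succ → ∀ j, (∀ i, cycIco c j i → (i ≠ c → ¬ cycIco r.1 ρ.succ (H.X i)) ∧
        ¬ cycIco r.1 ρ.succ (H.O i)) →
      H.NoMarking r.1 ρ.castSucc c j ∧ cycIcc r.1 ρ.castSucc ρ.castSucc ∧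
        ∀ i, cycIcc c j i → H.Meets r (colAt H c ρ.castSucc k i) := by
    intro hrs j hj
    have hm : H.NoMarking r.1 ρ.castSucc c j := by
      intro i hi
      have h1 := hj i hi
      constructor
      · by_cases hic : i = c
        · rw [hic, h.X_new]; exact not_cycIco_right _ _
        · intro h'
          refine h1.1 hic ?_
          grind
      · intro h'
        refine h1.2 ?_
        grind
    exact ⟨hm, cycIcc_right _ _, fun i hi =>
      hm.transport (cycIcc_right _ _) (cycIcc_left _ _) (cycIcc_left _ _) hi hBc (meets_colAt i) hmr⟩
  have hrow : r.1 ≠ ρ.succ → ∀ i, cycIoo r.1 ρ.succ i → cycIcc r.1 ρ.castSucc i := by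
    intro hrs i hi
    grind
  constructor
  · rintro ⟨hrs, j, hjc, hjA, hcols, hcl⟩
    obtain ⟨hm, -, hB⟩ := key hrs j hcols
    have hσA : σ A = colAt H c ρ.castSucc k j := by rw [← hjA, apply_loc]
    obtain rfl : j = (σ A).1 := by rw [hσA]; rfl
    refine ⟨hrs, hjc, by rw [hσA]; exact hB _ (cycIcc_right _ _), hcols, fun p hp hq hmp => ?_⟩
    refine hcl (σ p).1 hq ?_
    have h1 : σ p = colAt H c ρ.castSucc k (σ p).1 := by
      refine (hσ p).right_unique (q' := colAt H c ρ.castSucc k (σ p).1) ?_ rfl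
      exact hm.transport (p := r) (q' := colAt H c ρ.castSucc k (σ p).1) (cycIcc_left _ _)
        (hrow hrs _ hp) (cycIcc_left _ _) hq.icc hmr (hB _ hq.icc) hmp
    rw [← eq_loc h1]
    exact hp
  · rintro ⟨hrs, hAc, hmA, hcols, hcl⟩
    obtain ⟨hm, -, hB⟩ := key hrs _ hcols
    have hσA : σ A = colAt H c ρ.castSucc k (σ A).1 :=
      hmA.right_unique (q' := colAt H c ρ.castSucc k (σ A).1) (hB _ (cycIcc_right _ _)) rfl
    refine ⟨hrs, (σ A).1, hAc, (eq_loc hσA).symm, hcols, fun i hi hi' => ?_⟩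
    have hp : σ (loc H c σ ρ.castSucc k i) = colAt H c ρ.castSucc k i := apply_loc i
    refine hcl _ hi' (by rw [hp]; exact hi) ?_
    have h1 := hσ (loc H c σ ρ.castSucc k i)
    rw [hp] at h1
    exact hm.transport (p := r) (cycIcc_left _ _) (hrow hrs _ hi') hi.icc (cycIcc_left _ _)
      (hB _ hi.icc) hmr h1

theorem isPolygon_iff (h : IsStabilization G H ρ c) {x y : H.Gen m} :
    IsPolygon H ρ c x y ↔
      (∀ k, Poly H ρ c (alphaThrough H ρ c (k + 1)) (loc H c x.1 ρ.castSucc k)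
        (loc H c x.1 ρ.castSucc k c)) ∧
      (∀ k, y.1 (alphaThrough H ρ c k) = x.1 (x.1.symm (c, k))) ∧
      (∀ k, y.1 (x.1.symm (c, k)) = x.1 (alphaThrough H ρ c (k + 1))) ∧
      ∀ p, (∀ k, p ≠ alphaThrough H ρ c k) → (∀ k, p ≠ x.1.symm (c, k)) → y.1 p = x.1 p := by
  have hc : ∀ k, loc H c x.1 ρ.castSucc k c = x.1.symm (c, k) := fun k => by rw [loc, colAt_self]
  simp only [hc, poly_iff h x.2, Equiv.apply_symm_apply]
  constructor
  · intro hp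
    exact ⟨fun k => ⟨hp.row_ne k, hp.col_ne k, hp.meets k, hp.noMarking k, hp.noPoint k⟩,
      hp.upper_left, hp.lower_right, hp.other⟩
  · rintro ⟨h1, h2, h3, h4⟩
    exact ⟨fun k => (h1 k).1, fun k => (h1 k).2.1, fun k => (h1 k).2.2.1, fun k => (h1 k).2.2.2.1,
      fun k => (h1 k).2.2.2.2, h2, h3, h4⟩

theorem IsPolygon.noOldMarking (_h : IsStabilization G H ρ c) {x y : H.Gen m}
    (hp : IsPolygon H ρ c x y) (k : ZMod m) :
    NoOldMarking H c (x.1.symm (c, k)).1 ρ.succ c (x.1 (alphaThrough H ρ c (k + 1))).1 :=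
  fun j hj hj' => ⟨(hp.noMarking k j hj').1 hj, (hp.noMarking k j hj').2⟩

variable [NeZero m]

theorem IsPolygon.isPseudoDomain (h : IsStabilization G H ρ c) {x y : H.Gen m}
    (hp : IsPolygon H ρ c x y) : IsPseudoDomain H ρ c x y (polygonChain H ρ c x) := by
  classical
  have hsum : ∀ i j a, (polygonChain H ρ c x).1 i j a = ∑ k : ZMod m,
      squares H (x.1.symm (c, k)) ρ.succ c (x.1 (alphaThrough H ρ c (k + 1))).1 i j a := by
    intro i j a
    simp [polygonChain, Finset.sum_apply]
  have hmr : ∀ k, H.Meets (x.1.symm (c, k)) (c, k) := fun k => by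
    have := x.2 (x.1.symm (c, k))
    rwa [Equiv.apply_symm_apply] at this
  rw [isPseudoDomain_iff]
  refine ⟨fun j hj a b => ?_, fun k => ?_, fun i j a => ?_⟩
  · have h1 : ∀ a, (polygonChain H ρ c x).1 (H.X j) j a = 0 ∧
        (polygonChain H ρ c x).1 (H.O j) j a = 0 := fun a => by
      rw [hsum, hsum]
      exact ⟨Finset.sum_eq_zero fun k _ => ((hp.noOldMarking h k).squares_eq_zero hj a).1,
        Finset.sum_eq_zero fun k _ => ((hp.noOldMarking h k).squares_eq_zero hj a).2⟩
    exact ⟨(h1 a).1.trans (h1 b).1.symm, (h1 a).2.trans (h1 b).2.symm⟩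
  · rw [hsum, hsum, Finset.sum_eq_zero fun k' _ => squares_eq_zero fun _ => not_cycIco_right _ _,
      Finset.sum_eq_single k]
    · have : squares H (x.1.symm (c, k)) ρ.succ c (x.1 (alphaThrough H ρ c (k + 1))).1 ρ.castSucc c k =
          1 := by
        refine if_pos ⟨?_, cycIco_left (hp.col_ne k).symm, hmr k⟩
        have h1 := hp.row_ne k
        have hv := val_rows ρ
        grind
      rw [this]
      rfl
    · intro k' _ hk
      refine if_neg fun h' => hk ?_
      exact (congrArg Prod.snd ((hmr k').right_unique h'.2.2 rfl))
    · exact fun h' => absurd (Finset.mem_univ _) h'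
  · rw [hsum, hsum, hsum, hsum, ← Finset.sum_sub_distrib, ← Finset.sum_sub_distrib,
      ← Finset.sum_add_distrib, Finset.sum_congr rfl fun k _ => squares_corner ρ
        ((hp.noOldMarking h k).flatAt h (hp.row_ne k)) (hp.row_ne k) (hp.col_ne k).symm i j a]
    by_cases h1 : j = c
    · subst h1
      rw [Finset.sum_eq_single a]
      · rw [if_pos (hmr a), show y.1.symm (j, a) = alphaThrough H ρ j a by
          rw [Equiv.symm_apply_eq, hp.upper_left]]
        have := (hp.col_ne a).symm
        simp only [if_true, if_neg this, sub_zero, mul_one, eq_comm (b := i)]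
        rfl
      · intro k _ hk
        refine if_neg fun h' => hk ?_
        exact congrArg Prod.snd ((hmr k).right_unique h' rfl)
      · exact fun h' => absurd (Finset.mem_univ _) h'
    · by_cases h2 : ∃ k, (j, a) = x.1 (alphaThrough H ρ c (k + 1))
      · obtain ⟨k, hk⟩ := h2
        have hj : j = (x.1 (alphaThrough H ρ c (k + 1))).1 := congrArg Prod.fst hk
        rw [Finset.sum_eq_single k]
        · rw [hk, if_pos (hp.meets k), Equiv.symm_apply_apply, ← hp.lower_right k,
            Equiv.symm_apply_apply, hp.lower_right k, if_neg h1, if_pos hj]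
          simp [alphaThrough, eq_comm]
        · intro k' _ hk'
          by_cases h3 : H.Meets (x.1.symm (c, k')) (j, a)
          · have h4 : ¬ j = (x.1 (alphaThrough H ρ c (k' + 1))).1 := fun e => by
              have h5 := h3.right_unique (hp.meets k') e
              rw [hk] at h5
              exact hk' (add_right_cancel (alphaThrough_injective H ρ c (x.1.injective h5))).symm
            simp [h1, h4]
          · exact if_neg h3
        · exact fun h' => absurd (Finset.mem_univ _) h'
      · push Not at h2
        rw [Finset.sum_eq_zero, show y.1.symm (j, a) = x.1.symm (j, a) by
          rw [Equiv.symm_apply_eq, hp.other, Equiv.apply_symm_apply]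
          · intro k e
            refine h2 (k - 1) ?_
            rw [sub_add_cancel, ← e, Equiv.apply_symm_apply]
          · intro k e
            exact h1 (congrArg Prod.fst (x.1.symm.injective e)), sub_self]
        intro k _
        by_cases h3 : H.Meets (x.1.symm (c, k)) (j, a)
        · have h4 : ¬ j = (x.1 (alphaThrough H ρ c (k + 1))).1 := fun e =>
            h2 k (h3.right_unique (hp.meets k) e)
          simp [h1, h4]
        · exact if_neg h3

/-- A state from which all parts of a polygon start is the start of a polygon. -/
theorem exists_isPolygon (h : IsStabilization G H ρ c) {x : H.Gen m}
    (hp : ∀ k, Poly H ρ c (alphaThrough H ρ c (k + 1)) (loc H c x.1 ρ.castSucc k)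
        (loc H c x.1 ρ.castSucc k c)) :
    ∃ y, IsPolygon H ρ c x y ∧ polyOp S o (fun k => x.1.symm (c, k)) (alphaThrough H ρ c) (vec o x.1) =
      ((polygonSign H ρ c S o x : ℤˣ) : ℤ) • vec o y.1 := by
  have hc : ∀ k, loc H c x.1 ρ.castSucc k c = x.1.symm (c, k) := fun k => by rw [loc, colAt_self]
  have hp' := hp
  simp only [hc, poly_iff h x.2] at hp'
  obtain ⟨y, ε, h1, h2, h3, h4⟩ := exists_polyOp_vec S o (symm_col_injective (c := c) x.1)
    (alphaThrough_injective H ρ c) (fun i j e => (hp' i).1 (congrArg Prod.fst e)) x.1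
  have hy : H.IsGen y := by
    intro p
    by_cases e1 : ∃ k, p = alphaThrough H ρ c k
    · obtain ⟨k, rfl⟩ := e1
      rw [h2, Equiv.apply_symm_apply]
      exact meets_alphaThrough H ρ c k
    · by_cases e2 : ∃ k, p = x.1.symm (c, k)
      · obtain ⟨k, rfl⟩ := e2
        rw [h3]
        exact (hp' k).2.2.1
      · push Not at e1 e2
        rw [h4 p e1 e2]
        exact x.2 p
  refine ⟨H.toGen y hy, (isPolygon_iff h).2 ⟨hp, h2, h3, h4⟩, ?_⟩
  obtain ⟨f, hf⟩ := polyOp_vec (S := S) (o := o) x fun k => (hp' k).1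
  have e : (ε : ℤ) • vec o y = ((polygonSign H ρ c S o x : ℤˣ) : ℤ) • Finsupp.single f 1 :=
    h1.symm.trans hf
  rw [vec, Finsupp.smul_single_one, Finsupp.smul_single_one, Finsupp.single_eq_single_iff] at e
  rw [hf, Grid.toGen_val, vec, (e.resolve_right fun e => ε.ne_zero e.1).1]

end Polygons

/-! ### Chains of punctured hexagons -/

section Hexagons

variable {e : Fin (n + 1)} {k : ZMod m} {σ : State (n + 1) m} {j : Fin (n + 1)}
variable {f : Fin (n + 1) → Curve (n + 1) m} {A A' : Curve (n + 1) m}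

variable (H ρ c) in
theorem isPuncturedRect_iff {x z : H.Gen m} {k : ZMod m} {s t : Curve (n + 1) m} :
    IsPuncturedRect H ρ c x z k s t ↔ x.1 s = (c, k) ∧ x.1 t = (c + 1, k) ∧ z.1 = mv x.1 s t ∧
      cycIoo s.1 t.1 ρ.succ := by
  have hv := val_rows ρ
  refine and_congr_right fun _ => and_congr_right fun _ => and_congr_right fun _ => ?_
  grind

theorem HexAt.ne {f : Fin (n + 1) → Curve (n + 1) m} (hf : HexAt H ρ c f j) : j ≠ c := by
  rintro rfl
  exact hf.obtuse.1 rfl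

theorem HexAt.ne' {f : Fin (n + 1) → Curve (n + 1) m} (hf : HexAt H ρ c f j) : j ≠ c + 1 := by
  rintro rfl
  exact not_cycIco_right _ _ hf.obtuse.2

theorem not_cycIoo_succ (ρ : Fin n) {j c : Fin (n + 1)} : ¬ cycIoo j c (c + 1) := by
  have h1 := val_add_one_cases ρ c
  have := j.2
  grind

variable (c) in
/-- The local coordinates after a punctured hexagon. -/
def hexSwap (f : Fin (n + 1) → Curve (n + 1) m) (j : Fin (n + 1)) : Fin (n + 1) → Curve (n + 1) m :=
  (f ∘ swap c (c + 1)) ∘ swap j c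

theorem HexAt.hexSwap_self (ρ : Fin n) (hf : HexAt H ρ c f j) : hexSwap c f j c = f j := by
  simp [hexSwap, swap_apply_of_ne_of_ne hf.ne hf.ne']

theorem HexAt.hexSwap_add_one (hf : HexAt H ρ c f j) : hexSwap c f j (c + 1) = f c := by
  simp [hexSwap, swap_apply_of_ne_of_ne hf.ne'.symm (add_one_ne ρ c)]

theorem hexSwap_right : hexSwap c f j j = f (c + 1) := by simp [hexSwap]

theorem hexSwap_of_ne {i : Fin (n + 1)} (h1 : i ≠ c) (h2 : i ≠ c + 1) (h3 : i ≠ j) :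
    hexSwap c f j i = f i := by
  simp [hexSwap, swap_apply_of_ne_of_ne h3 h1, swap_apply_of_ne_of_ne h1 h2]

variable (H c) in
/-- The state after a punctured hexagon. -/
def hexState (σ : State (n + 1) m) (e : Fin (n + 1)) (k : ZMod m) (j : Fin (n + 1)) :
    State (n + 1) m :=
  mv (mv σ (loc H c σ e k c) (loc H c σ e k (c + 1))) (loc H c σ e k j) (loc H c σ e k (c + 1))

theorem hexState_eq (hf : HexAt H ρ c (loc H c σ e k) j) :
    hexState H c σ e k j = mv (mv σ (loc H c σ e k c) (loc H c σ e k (c + 1)))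
      (loc H c (mv σ (loc H c σ e k c) (loc H c σ e k (c + 1))) e k j)
      (loc H c (mv σ (loc H c σ e k c) (loc H c σ e k (c + 1))) e k c) := by
  rw [loc_mv_loc, hexState]
  simp [swap_apply_of_ne_of_ne hf.ne hf.ne']

theorem loc_hexState (hf : HexAt H ρ c (loc H c σ e k) j) :
    loc H c (hexState H c σ e k j) e k = hexSwap c (loc H c σ e k) j := by
  rw [hexState_eq hf, loc_mv_loc, loc_mv_loc, hexSwap]

theorem loc_hexState_of_ne {k' : ZMod m} (hk : k' ≠ k) :
    loc H c (hexState H c σ e k j) e k' = loc H c σ e k' := by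
  funext i
  have h1 : ∀ a, loc H c σ e k' i ≠ loc H c σ e k a := fun a h => hk (loc_inj.1 h).1
  rw [hexState, loc_mv, loc_mv, swap_apply_of_ne_of_ne (h1 _) (h1 _),
    swap_apply_of_ne_of_ne (h1 _) (h1 _)]

theorem HexAt.exists_state (h : IsStabilization G H ρ c) {x : H.Gen m} (he : e ≠ ρ.succ)
    (hf : HexAt H ρ c (loc H c x.1 e k) j)
    (hej : cycIcc (loc H c x.1 e k j).1 (loc H c x.1 e k (c + 1)).1 e) :
    ∃ z z' : H.Gen m,
      IsPuncturedRect H ρ c x z k (loc H c x.1 e k c) (loc H c x.1 e k (c + 1)) ∧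
      H.IsRect z z' (loc H c x.1 e k j) (loc H c x.1 e k (c + 1)) ∧
      z'.1 = hexState H c x.1 e k j := by
  set f := loc H c x.1 e k with hfd
  have hc : x.1 (f c) = (c, k) := by rw [hfd, apply_loc, colAt_self]
  have hc1 : x.1 (f (c + 1)) = (c + 1, k) := by rw [hfd, apply_loc, h.colAt_add_one he]
  have m1 : H.Meets (f c) (c + 1, k) := (h.meets_add_one hf.punctured.1.symm).2 (hc ▸ x.2 (f c))
  have m2 : H.Meets (f (c + 1)) (c, k) := (h.meets_add_one hf.row_ne).1 (hc1 ▸ x.2 (f (c + 1)))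
  have hz : H.IsGen (mv x.1 (f c) (f (c + 1))) :=
    Grid.IsGen.mv (D := H) x.2 (by rw [hc1]; exact m1) (by rw [hc]; exact m2)
  have e1 : loc H c (mv x.1 (f c) (f (c + 1))) e k = f ∘ swap c (c + 1) := loc_mv_loc _ _
  have ej : (f ∘ swap c (c + 1)) j = f j := by
    simp [swap_apply_of_ne_of_ne hf.ne hf.ne']
  have ec : (f ∘ swap c (c + 1)) c = f (c + 1) := by simp
  have hr : H.Rect (mv x.1 (f c) (f (c + 1))) (f j) (f (c + 1)) := by
    have := rect_loc_iff (k := k) (c := c) hz (a := j) (b := c) (e := e)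
      (by rw [e1, ej, ec]; exact hej)
    rw [e1, ej, ec] at this
    refine this.2 ⟨fun e' => ?_, hf.ne, hf.noMarking, fun i hi => ?_⟩
    · have := hf.obtuse
      rw [e'] at this
      exact not_cycIco_right _ _ this.2
    · have h1 : i ≠ c := fun e' => not_cycIco_right _ _ (by have := hi.2; rwa [e'] at this)
      have h2 : i ≠ c + 1 := by rintro rfl; exact not_cycIoo_succ ρ hi
      rw [Function.comp, swap_apply_of_ne_of_ne h1 h2]
      exact hf.clear i hi
  exact ⟨H.toGen _ hz, H.toGen _ (hr.isGen hz),
    (isPuncturedRect_iff H ρ c).2 ⟨hc, hc1, rfl, hf.punctured⟩, Grid.isRect_iff.2 ⟨hr, rfl⟩, rfl⟩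

theorem IsPuncturedRect.exists_hexAt (h : IsStabilization G H ρ c) {x z z' : H.Gen m}
    (he : e ≠ ρ.succ) {s t u : Curve (n + 1) m} (hp : IsPuncturedRect H ρ c x z k s t)
    (hr : H.IsRect z z' u t) (ho : cycIoo s.1 t.1 u.1) (hej : cycIcc u.1 t.1 e) :
    ∃ j, s = loc H c x.1 e k c ∧ t = loc H c x.1 e k (c + 1) ∧ u = loc H c x.1 e k j ∧
      HexAt H ρ c (loc H c x.1 e k) j ∧ z'.1 = hexState H c x.1 e k j := by
  obtain ⟨hs, ht, hz, hsu⟩ := (isPuncturedRect_iff H ρ c).1 hp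
  obtain ⟨hr, hz'⟩ := Grid.isRect_iff.1 hr
  obtain rfl : s = loc H c x.1 e k c := eq_loc (by rw [hs, colAt_self])
  obtain rfl : t = loc H c x.1 e k (c + 1) := eq_loc (by rw [ht, h.colAt_add_one he])
  have e1 : loc H c z.1 e k = loc H c x.1 e k ∘ swap c (c + 1) := by rw [hz, loc_mv_loc]
  have ec : loc H c z.1 e k c = loc H c x.1 e k (c + 1) := by rw [e1]; simp
  rw [← ec] at hr hej
  obtain ⟨j, rfl⟩ := hr.exists_loc_left z.2 hej
  have hr' := (rect_loc_iff z.2 hej).1 hr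
  have hj1 : j ≠ c + 1 := by
    rintro rfl
    rw [e1] at ho
    simp only [Function.comp, swap_apply_right] at ho
    exact ho.1 rfl
  have ej : loc H c z.1 e k j = loc H c x.1 e k j := by
    rw [e1, Function.comp, swap_apply_of_ne_of_ne hr'.2.1 hj1]
  rw [ec, ej] at hr'
  refine ⟨j, rfl, rfl, ej, ⟨hsu, by rw [← ej]; exact ho, hr'.2.2.1, fun i hi => ?_⟩, ?_⟩
  · have h1 : i ≠ c := fun e' => not_cycIco_right _ _ (by have := hi.2; rwa [e'] at this)
    have h2 : i ≠ c + 1 := by rintro rfl; exact not_cycIoo_succ ρ hi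
    have := hr'.2.2.2 i hi
    rwa [e1, Function.comp, swap_apply_of_ne_of_ne h1 h2] at this
  · rw [hz', ej, hz, hexState]

theorem HexAt.hexOp_vec {x z : H.Gen m} {f : Fin (n + 1) → Curve (n + 1) m}
    (hf : HexAt H ρ c f j) (hz : z.1 = mv x.1 (f c) (f (c + 1))) :
    hexOp c S o f j (vec o x.1) =
      ((S.sign (H.formal o x) (rectMove o (f c) (f (c + 1))) *
        S.sign (H.formal o z) (rectMove o (f j) (f (c + 1))) : ℤˣ) : ℤ) •
        vec o (mv (mv x.1 (f c) (f (c + 1))) (f j) (f (c + 1))) := by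
  rw [hexOp, Module.End.mul_apply, tau_vec S o _ hf.ne_add_one', map_smul, ← hz,
    tau_vec S o _ hf.ne_add_one, smul_smul, Units.val_mul]
  rfl

theorem IsPuncturedRect.isPseudoDomain (h : IsStabilization G H ρ c) {x z : H.Gen m}
    {s t : Curve (n + 1) m} (hp : IsPuncturedRect H ρ c x z k s t) :
    IsPseudoDomain H ρ c x z (squares H s t.1 c (c + 1), 0, 0) ∧
      QFine H c (squares H s t.1 c (c + 1), 0, 0) := by
  obtain ⟨hs, ht, hz, hsu⟩ := (isPuncturedRect_iff H ρ c).1 hp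
  have hm : NoOldMarking H c s.1 t.1 (x.1 s).1 (x.1 t).1 := by
    rw [hs, ht]
    intro j hj hj'
    exact absurd ((cycIco_add_one ρ).1 hj') hj
  have e1 : rectChain H x.1 s t = (squares H s t.1 c (c + 1), 0, 0) := by rw [rectChain, hs, ht]
  rw [← e1]
  refine ⟨isPseudoDomain_of_annular h hz hsu.1.symm ?_ ?_ ?_ ?_ hm, rectChain_fine hm⟩
  · intro e'
    rw [e'] at hsu
    exact not_cycIco_right _ _ hsu.2
  · intro e'
    rw [e', cycIoo_iff] at hsu
    omega
  · rw [hs, ht]; exact (add_one_ne ρ c).symm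
  · rw [ht]
    exact (h.meets_add_one hsu.1.symm).2 (hs ▸ x.2 s)

theorem HexChain.isPseudoDomain (h : IsStabilization G H ρ c) {P : Curve (n + 1) m → Prop}
    {ks : List (ZMod m)} {x y : H.Gen m} {p : TwoChain (n + 1) m} {μ : ℤˣ}
    (hx : HexChain H ρ c S o P ks x y p μ) : IsPseudoDomain H ρ c x y p ∧ QFine H c p ∧ p.2.2 = 0 := by
  induction hx with
  | nil x => exact ⟨.refl x, .zero, rfl⟩
  | cons x z z' y k s t u ks p μ hp hr ho hu _ ih =>
    obtain ⟨hs, ht, hz, hsu⟩ := (isPuncturedRect_iff H ρ c).1 hp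
    obtain ⟨hr1, hz'⟩ := Grid.isRect_iff.1 hr
    have h1 := hr1.isPseudoDomain h hz'
    have h2 := rectChain_fine (c := c) hr1.noMarking.old
    have hzu : (z.1 u).1 = (x.1 u).1 := by
      rw [hz, mv_of_ne]
      · rintro rfl; exact ho.1 rfl
      · rintro rfl; exact not_cycIco_right _ _ ho.2
    have hzt : (z.1 t).1 = c := by rw [hz, mv_right, hs]
    have h3 := hp.isPseudoDomain h
    have h4 := h3.1.add h1
    have h5 := h3.2.add h2
    rw [rectChain, hzu, hzt] at h4 h5
    exact ⟨h4.add ih.1, h5.add ih.2.1, (zero_add _).trans ih.2.2⟩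

variable (c) in
/-- The two-chain of a punctured hexagon. -/
def hexChain (H : Grid (n + 1)) (f : Fin (n + 1) → Curve (n + 1) m) (j : Fin (n + 1)) :
    TwoChain (n + 1) m :=
  if j = c then 0 else (squares H (f c) (f (c + 1)).1 c (c + 1) + squares H (f j) (f (c + 1)).1 j c, 0, 0)

variable (H ρ c) in
/-- Conditions `V` on the local coordinates which say that the piece of a domain in one sheet with a
punctured hexagon whose obtuse corner lies in a given column is admissible, for chains of hexagons with
corners in `P` that lead to a fixed operator `W`. -/
structure SheetRule (e : Fin (n + 1)) (P : Curve (n + 1) m → Prop)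
    (V : ZMod m → (Fin (n + 1) → Curve (n + 1) m) → Fin (n + 1) → Prop)
    (W : H.Gen m → Operator (n + 1) m) : Prop where
  row_ne : e ≠ ρ.succ
  cases : ∀ {k f j}, V k f j →
    j = c ∨ HexAt H ρ c f j ∧ P (f j) ∧ cycIcc (f j).1 (f (c + 1)).1 e
  range : ∀ {k f j} {s t u : Curve (n + 1) m}, V k f j → P u → cycIoo s.1 t.1 ρ.succ →
    cycIoo s.1 t.1 u.1 → f c = u → f (c + 1) = s → cycIcc u.1 t.1 e
  step : ∀ {x : H.Gen m} {k j i}, HexAt H ρ c (loc H c x.1 e k) j → P (loc H c x.1 e k j) →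
    H.Meets (loc H c x.1 e k j) (c, k) → cycIcc (loc H c x.1 e k j).1 (loc H c x.1 e k (c + 1)).1 e →
    (V k (hexSwap c (loc H c x.1 e k) j) i ↔ i = c ∧ V k (loc H c x.1 e k) j)
  conj : ∀ {x x' : H.Gen m} {φ : ZMod m → Fin (n + 1)} {k}, (∀ k, V k (loc H c x.1 e k) (φ k)) →
    φ k ≠ c → x'.1 = hexState H c x.1 e k (φ k) →
    W x' * hexOp c S o (loc H c x.1 e k) (φ k) = hexOp c S o (loc H c x.1 e k) (φ k) * W x

variable {P : Curve (n + 1) m → Prop}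
  {V : ZMod m → (Fin (n + 1) → Curve (n + 1) m) → Fin (n + 1) → Prop}
  {W : H.Gen m → Operator (n + 1) m}

theorem hexOp_self (hf : f c ≠ f (c + 1)) : hexOp c S o f c = 1 := tau_sq S o hf

theorem SheetRule.exists_hexChain (h : IsStabilization G H ρ c) (hR : SheetRule H ρ c S o e P V W)
    {ks : List (ZMod m)} (hks : ks.Nodup) {x : H.Gen m} {φ : ZMod m → Fin (n + 1)}
    (hφ : ∀ k, V k (loc H c x.1 e k) (φ k)) (hk : ∀ k, k ∈ ks ↔ φ k ≠ c) :
    ∃ (z : H.Gen m) (p : TwoChain (n + 1) m) (μ : ℤˣ), HexChain H ρ c S o P ks x z p μ ∧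
      (∀ k, V k (loc H c z.1 e k) c) ∧ ∀ k, z.1.symm (c, k) = loc H c x.1 e k (φ k) := by
  induction ks generalizing x φ with
  | nil =>
    have h1 : ∀ k, φ k = c := fun k => by simpa using (hk k)
    refine ⟨x, 0, 1, .nil x, fun k => h1 k ▸ hφ k, fun k => by rw [h1, loc, colAt_self]⟩
  | cons k ks ih =>
    rw [List.nodup_cons] at hks
    have hkc : φ k ≠ c := (hk k).1 List.mem_cons_self
    obtain ⟨hf, hu, he⟩ := (hR.cases (hφ k)).resolve_left hkc
    obtain ⟨y, x', hp, hr, hx'⟩ := hf.exists_state h hR.row_ne he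
    have hxu : H.Meets (loc H c x.1 e k (φ k)) (c, k) := by
      have h1 := x'.2 (loc H c x.1 e k (φ k))
      rwa [show x'.1 (loc H c x.1 e k (φ k)) = (c, k) by
        rw [← colAt_self (H := H) (e := e), ← hf.hexSwap_self ρ, ← loc_hexState hf, ← hx',
          apply_loc]] at h1
    have hlk : ∀ k', k' ≠ k → loc H c x'.1 e k' = loc H c x.1 e k' := fun k' hk' => by
      rw [hx', loc_hexState_of_ne hk']
    obtain ⟨z, p, μ, h1, h2, h3⟩ := ih (x := x') (φ := Function.update φ k c) hks.2
      (fun k' => by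
        by_cases hkk : k' = k
        · subst hkk
          rw [hx', loc_hexState hf, Function.update_self]
          exact (hR.step hf hu hxu he).2 ⟨rfl, hφ _⟩
        · rw [Function.update_of_ne hkk, hlk k' hkk]; exact hφ k')
      (fun k' => by
        by_cases hkk : k' = k
        · subst hkk; simp [hks.1]
        · rw [Function.update_of_ne hkk, ← hk, List.mem_cons]; simp [hkk])
    refine ⟨z, _, _, .cons x y x' z k _ _ _ ks p μ hp hr hf.obtuse hu h1, h2, fun k' => ?_⟩
    rw [h3]
    by_cases hkk : k' = k
    · subst hkk
      rw [Function.update_self, hx', loc_hexState hf, hf.hexSwap_self ρ]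
    · rw [Function.update_of_ne hkk, hlk k' hkk]

variable [NeZero m]

theorem SheetRule.prod_step (hR : SheetRule H ρ c S o e P V W) {x x' : H.Gen m}
    {φ : ZMod m → Fin (n + 1)} (hφ : ∀ k, V k (loc H c x.1 e k) (φ k)) (hk : φ k ≠ c)
    (hx' : x'.1 = hexState H c x.1 e k (φ k)) :
    sheetProd (fun k => hexOp c S o (loc H c x.1 e k) (φ k)) =
      sheetProd (fun k' => hexOp c S o (loc H c x'.1 e k') (Function.update φ k c k')) *
        hexOp c S o (loc H c x.1 e k) (φ k) := by
  have hf := ((hR.cases (hφ k)).resolve_left hk).1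
  have hne : ∀ k' : ZMod m, loc H c x.1 e k' c ≠ loc H c x.1 e k' (c + 1) := fun k' e' =>
    (add_one_ne ρ c).symm (loc_injective e')
  rw [sheetProd_eq_mul _ k]
  · congr 2
    funext k'
    by_cases hkk : k' = k
    · subst hkk
      rw [Function.update_self, Function.update_self, hx', loc_hexState hf, hexOp_self]
      rw [hf.hexSwap_self ρ, hf.hexSwap_add_one]
      exact fun e' => hf.ne (loc_injective e')
    · rw [Function.update_of_ne hkk, Function.update_of_ne hkk, hx', loc_hexState_of_ne hkk]
  · intro k' hk'
    rcases hR.cases (hφ k') with h1 | ⟨h1, -⟩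
    · rw [h1, hexOp_self S o (hne k')]
      exact Commute.one_right _
    · exact hexOp_commute S o (fun i j e' => hk' (loc_inj.1 e').1.symm) hf h1

theorem SheetRule.of_hexChain (h : IsStabilization G H ρ c) (hR : SheetRule H ρ c S o e P V W)
    {ks : List (ZMod m)} {x z : H.Gen m} {p : TwoChain (n + 1) m} {μ : ℤˣ}
    (hx : HexChain H ρ c S o P ks x z p μ) (hz : ∀ k, V k (loc H c z.1 e k) c) :
    ∃ φ : ZMod m → Fin (n + 1), (∀ k, V k (loc H c x.1 e k) (φ k)) ∧
      (∀ k, z.1.symm (c, k) = loc H c x.1 e k (φ k)) ∧ (∀ k, k ∈ ks ↔ φ k ≠ c) ∧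
      p = ∑ k, hexChain c H (loc H c x.1 e k) (φ k) ∧
      sheetProd (fun k => hexOp c S o (loc H c x.1 e k) (φ k)) (W x (vec o x.1)) =
        (μ : ℤ) • W z (vec o z.1) := by
  induction hx with
  | nil x =>
    refine ⟨fun _ => c, hz, fun k => by rw [loc, colAt_self], by simp, by simp [hexChain], ?_⟩
    rw [sheetProd_one fun k => hexOp_self S o fun e' => (add_one_ne ρ c).symm (loc_injective e')]
    simp
  | cons x y x' z k s t u ks p μ hp hr ho hu _ ih =>
    obtain ⟨φ, h1, h2, h3, h4, h5⟩ := ih hz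
    obtain ⟨hs, ht, hy, hsu⟩ := (isPuncturedRect_iff H ρ c).1 hp
    obtain ⟨hr', hx'⟩ := Grid.isRect_iff.1 hr
    have us : u ≠ s := fun e' => ho.1 (congrArg Prod.fst e')
    have ut : u ≠ t := fun e' => not_cycIco_right _ _ (e' ▸ ho.2)
    have st : s ≠ t := fun e' => by
      rw [e', cycIoo_iff] at hsu
      omega
    have hxu : x'.1 u = (c, k) := by rw [hx', mv_left, hy, mv_right, hs]
    have hxs : x'.1 s = (c + 1, k) := by rw [hx', mv_of_ne _ us.symm st, hy, mv_left, ht]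
    have he := hR.range (h1 k) hu hsu ho (eq_loc (by rw [hxu, colAt_self])).symm
      (eq_loc (by rw [hxs, h.colAt_add_one hR.row_ne])).symm
    obtain ⟨j, rfl, rfl, rfl, hf, hx'⟩ := hp.exists_hexAt h hR.row_ne hr ho he
    have h6 := h1 k
    rw [hx', loc_hexState hf, hR.step hf hu (hxu ▸ x'.2 _) he] at h6
    obtain ⟨hφk, hV⟩ := h6
    have hlk : ∀ k', k' ≠ k → loc H c x'.1 e k' = loc H c x.1 e k' := fun k' hk' => by
      rw [hx', loc_hexState_of_ne hk']
    have hv : ∀ k', V k' (loc H c x.1 e k') (Function.update φ k j k') := by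
      intro k'
      by_cases hk : k' = k
      · subst hk; rwa [Function.update_self]
      · rw [Function.update_of_ne hk, ← hlk k' hk]; exact h1 k'
    have hjc : Function.update φ k j k ≠ c := by rw [Function.update_self]; exact hf.ne
    have hup : Function.update (Function.update φ k j) k c = φ := by
      rw [Function.update_idem, ← hφk, Function.update_eq_self]
    have hxs' : x'.1 = hexState H c x.1 e k (Function.update φ k j k) := by
      rw [Function.update_self, hx']
    refine ⟨Function.update φ k j, hv, fun k' => ?_, fun k' => ?_, ?_, ?_⟩
    · by_cases hk : k' = k
      · subst hk
        rw [h2, Function.update_self, hφk, hx', loc_hexState hf, hf.hexSwap_self ρ]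
      · rw [h2, Function.update_of_ne hk, hlk k' hk]
    · rw [List.mem_cons, h3]
      by_cases hk : k' = k
      · subst hk; simp [hf.ne]
      · rw [Function.update_of_ne hk]; simp [hk]
    · rw [h4, ← Finset.add_sum_erase _ _ (Finset.mem_univ k),
        ← Finset.add_sum_erase _ _ (Finset.mem_univ k), hφk, Function.update_self,
        hexChain, if_pos rfl, zero_add, hexChain, if_neg hf.ne, apply_loc, colAt_fst]
      congr 1
      refine Finset.sum_congr rfl fun k' hk' => ?_
      have hk := Finset.ne_of_mem_erase hk'
      rw [Function.update_of_ne hk, hlk k' hk]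
    · rw [hR.prod_step S o hv hjc hxs', hup, Module.End.mul_apply, ← Module.End.mul_apply _ (W x),
        ← hR.conj hv hjc hxs', Module.End.mul_apply, Function.update_self, hf.hexOp_vec S o hy,
        map_smul, map_smul, show mv (mv x.1 _ _) _ _ = x'.1 from hx'.symm, h5, smul_smul,
        Units.val_mul _ μ]

end Hexagons

section Rules

variable {f : Fin (n + 1) → Curve (n + 1) m} {A : Curve (n + 1) m} {j : Fin (n + 1)}

variable (H ρ c) in
/-- The admissible pieces of the domains of Type L. -/
def ValidL (k : ZMod m) (f : Fin (n + 1) → Curve (n + 1) m) (j : Fin (n + 1)) : Prop :=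
  f j = alphaThrough H ρ c k ∧ (j = c ∨ HexAt H ρ c f j)

variable (H ρ c) in
/-- The admissible pieces of the domains of Type R. -/
def ValidR (k : ZMod m) (f : Fin (n + 1) → Curve (n + 1) m) (j : Fin (n + 1)) : Prop :=
  Poly H ρ c (alphaThrough H ρ c (k + 1)) f (f j) ∧
    (j = c ∨ HexAt H ρ c f j ∧ cycIoo (f c).1 ρ.succ (f j).1)

theorem hexSwap_injective (hf : Function.Injective f) : Function.Injective (hexSwap c f j) :=
  (hf.comp (Equiv.injective _)).comp (Equiv.injective _)

theorem sheetRuleL : SheetRule H ρ c S o (ρ.succ + 1) (fun u => u.1 = ρ.succ) (ValidL H ρ c)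
    fun _ => 1 := by
  have key : ∀ t : Fin (n + 1), t ≠ ρ.succ → cycIcc ρ.succ t (ρ.succ + 1) := by
    intro t ht
    have h1 := val_add_one_cases ρ ρ.succ
    grind
  refine ⟨succ_add_one_ne_succ ρ, ?_, ?_, ?_, fun _ _ _ => by rw [one_mul, mul_one]⟩
  · rintro k f j ⟨h1, h2⟩
    refine h2.imp_right fun h2 => ⟨h2, congrArg Prod.fst h1, ?_⟩
    rw [show (f j).1 = ρ.succ from congrArg Prod.fst h1]
    exact key _ h2.row_ne
  · intro k f j s t u _ hu hs _ _ _
    rw [hu]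
    refine key _ fun e' => ?_
    rw [e'] at hs
    exact not_cycIco_right _ _ hs.2
  · intro x k j i hf hu hm _
    have h1 := eq_alphaThrough' hu hm
    constructor
    · rintro ⟨h2, -⟩
      refine ⟨hexSwap_injective (c := c) (j := j) (loc_injective (H := H) (c := c) (σ := x.1)
        (e := ρ.succ + 1) (k := k)) ?_, h1, Or.inr hf⟩
      rw [h2, hf.hexSwap_self ρ, h1]
    · rintro ⟨rfl, -⟩
      exact ⟨(hf.hexSwap_self ρ).trans h1, Or.inl rfl⟩

theorem HexAt.poly_hexSwap (hf : HexAt H ρ c f j) (hA : A.1 = ρ.succ)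
    (hj : cycIoo (f c).1 ρ.succ (f j).1) :
    Poly H ρ c A (hexSwap c f j) (f j) ↔ Poly H ρ c A f (f j) := by
  have hs : (f c).1 ≠ ρ.succ := hf.punctured.1.symm
  have hu : (f j).1 ≠ ρ.succ := fun e' => not_cycIco_right _ _ (by have := hj.2; rwa [e'] at this)
  have hne : ∀ {p : Curve (n + 1) m}, p.1 ≠ ρ.succ → p ≠ A := fun h e' => h (by rw [e', hA])
  have hp := hf.punctured
  refine Poly.congr (fun i => ?_) fun i hi => ?_
  · by_cases h1 : i = c
    · rw [h1, hf.hexSwap_self ρ]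
      exact iff_of_false (hne hu) (hne hs)
    · by_cases h2 : i = c + 1
      · rw [h2, hf.hexSwap_add_one]
        exact iff_of_false (hne hs) (hne hf.row_ne)
      · by_cases h3 : i = j
        · rw [h3, hexSwap_right]
          exact iff_of_false (hne hf.row_ne) (hne hu)
        · rw [hexSwap_of_ne h1 h2 h3]
  · by_cases h2 : i = c + 1
    · rw [h2, hf.hexSwap_add_one]
      grind
    · by_cases h3 : i = j
      · rw [h3, hexSwap_right]
        grind
      · rw [hexSwap_of_ne hi h2 h3]

theorem polyOp_hexagon [NeZero m] {r A : ZMod m → Curve (n + 1) m} {s t u : Curve (n + 1) m}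
    (hr : Function.Injective r) (hA : Function.Injective A) (hrA : ∀ i j, r i ≠ A j) (hst : s ≠ t)
    (hut : u ≠ t) (hs : ∀ k, A k ≠ s) (ht : ∀ k, A k ≠ t) (hu : ∀ k, A k ≠ u) :
    polyOp S o (swap u t ∘ swap s t ∘ r) A * (tau S o u t * tau S o s t) =
      tau S o u t * tau S o s t * polyOp S o r A := by
  have e1 : swap s t ∘ A = A := funext fun k => swap_apply_of_ne_of_ne (hs k) (ht k)
  have e2 : swap u t ∘ A = A := funext fun k => swap_apply_of_ne_of_ne (hu k) (ht k)
  have n1 : ∀ i j, (swap s t ∘ r) i ≠ A j := fun i j e => hrA i j <| by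
    rw [← congrFun e1 j, Function.comp, swap_apply_eq_iff] at e
    rw [e, Function.comp, swap_apply_self]
  have n2 : ∀ i j, (swap u t ∘ swap s t ∘ r) i ≠ A j := fun i j e => n1 i j <| by
    rw [← congrFun e2 j, Function.comp, swap_apply_eq_iff] at e
    rw [e, Function.comp, swap_apply_self]
  have s1 : ∀ (a b : Curve (n + 1) m) (r : ZMod m → Curve (n + 1) m),
      swap a b ∘ swap a b ∘ r = r := fun a b r => funext fun k => by simp
  rw [← mul_assoc, polyOp_conj S o ((Equiv.injective _).comp ((Equiv.injective _).comp hr)) hA n2 hut,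
    s1, e2, neg_mul, mul_assoc,
    polyOp_conj S o ((Equiv.injective _).comp hr) hA n1 hst, s1, e1, mul_neg, neg_neg, mul_assoc]

theorem ValidR.row_ne {k : ZMod m} (hv : ValidR H ρ c k f j) : (f c).1 ≠ ρ.succ ∧ (f j).1 ≠ ρ.succ := by
  refine ⟨?_, hv.1.1⟩
  rcases hv.2 with rfl | h1
  · exact hv.1.1
  · exact h1.1.punctured.1.symm

theorem sheetRuleR [NeZero m] : SheetRule H ρ c S o ρ.castSucc (fun u => u.1 ≠ ρ.succ) (ValidR H ρ c)
    fun x => polyOp S o (fun k => x.1.symm (c, k)) (alphaThrough H ρ c) := by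
  have hv := val_rows ρ
  have hcv : (ρ.castSucc : ℕ) = ρ := Fin.val_castSucc ρ
  have hρ := ρ.2
  refine ⟨castSucc_ne_succ ρ, ?_, ?_, ?_, ?_⟩
  · intro k f j hv
    have h3 := hv.row_ne.2
    refine hv.2.imp_right fun ⟨h2, h4⟩ => ⟨h2, h3, ?_⟩
    have hp := h2.punctured
    have := (f j).1.2
    grind
  · intro k f j s t u hv hu hs hsu h1 h2
    by_contra hcon
    have hsu' : cycIoo u.1 ρ.succ s.1 ∧ cycIoo ρ.succ s.1 u.1 := by
      have := u.1.2
      grind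
    rcases hv.2 with rfl | ⟨h3, -⟩
    · refine not_poly_of_blocked (A := alphaThrough H ρ j (k + 1)) rfl ?_ hv.1
      rw [h1, h2]; exact hsu'.1
    · refine h3.not_nPlus ?_
      rw [NPlus, h1, h2]; exact hsu'.2
  · intro x k j i hf hu _ he
    set f := loc H c x.1 ρ.castSucc k
    have hp := hf.punctured
    have ho := hf.obtuse
    have hj : cycIoo (f c).1 ρ.succ (f j).1 := by
      have := (f j).1.2
      grind
    constructor
    · rintro ⟨h1, h2⟩
      rcases h2 with rfl | ⟨h2, h3⟩
      · rw [hf.hexSwap_self ρ, hf.poly_hexSwap rfl hj] at h1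
        exact ⟨rfl, h1, Or.inr ⟨hf, hj⟩⟩
      · exfalso
        have h4 := h2.clear
        rw [hf.hexSwap_add_one] at h4
        rw [hf.hexSwap_self ρ] at h3
        have hij : i ≠ j := by
          rintro rfl
          rw [hexSwap_right] at h3
          grind
        have e1 := hexSwap_of_ne (f := f) h2.ne h2.ne' hij
        rw [e1] at h3 h4
        rcases cycIoo_cases hf.ne hij.symm h2.ne.symm with h5 | h5
        · have h6 : cycIoo i c j := by
            have := i.2
            grind
          refine h4 j h6 ?_
          rw [hexSwap_right]
          grind
        · refine hf.clear i h5 ?_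
          grind
    · rintro ⟨rfl, h1, -⟩
      refine ⟨?_, Or.inl rfl⟩
      rw [hf.hexSwap_self ρ, hf.poly_hexSwap rfl hj]
      exact h1
  · intro x x' φ k hφ hk hx'
    have hf := ((hφ k).2.resolve_left hk).1
    have hne : ∀ {p : Curve (n + 1) m}, p.1 ≠ ρ.succ → ∀ k, alphaThrough H ρ c k ≠ p :=
      fun h k e' => h (congrArg Prod.fst e').symm
    have hr : (fun k' => x'.1.symm (c, k')) =
        swap (loc H c x.1 ρ.castSucc k (φ k)) (loc H c x.1 ρ.castSucc k (c + 1)) ∘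
          swap (loc H c x.1 ρ.castSucc k c) (loc H c x.1 ρ.castSucc k (c + 1)) ∘
          fun k' => x.1.symm (c, k') := by
      funext k'
      rw [hx', hexState, mv_symm_apply, mv_symm_apply]
      rfl
    rw [hr]
    refine polyOp_hexagon S o (symm_col_injective (c := c) x.1) (alphaThrough_injective H ρ c)
      (fun i j e' => ?_) hf.ne_add_one' hf.ne_add_one (hne (hφ k).row_ne.1) (hne hf.row_ne)
      (hne (hφ k).row_ne.2)
    have := (hφ i).row_ne.1
    rw [loc, colAt_self] at this
    exact hne this j e'.symm

end Rules

section Expansion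

/-- Sums of signs over sets of domains that are numbered by admissible data. -/
theorem sum_finsum_units_smul {α ι Y M : Type*} [Fintype ι] [Fintype Y] [AddCommGroup M] (v : Y → M)
    (hv : ∀ {y y' : Y} {μ μ' : ℤˣ}, (μ : ℤ) • v y = (μ' : ℤ) • v y' → y = y' ∧ μ = μ')
    (T : Y → α → ℤˣ → Prop) (good : ι → Prop) [DecidablePred good] (P : ι → α) (V : ι → M) (R : ι → Y → Prop)
    (h1 : ∀ {y p μ}, T y p μ → ∃ i, good i ∧ p = P i ∧ V i = (μ : ℤ) • v y)
    (h2 : ∀ {i}, good i → ∃ y μ, T y (P i) μ ∧ V i = (μ : ℤ) • v y ∧ R i y)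
    (h3 : ∀ {i j y}, R i y → R j y → i = j) :
    ∑ y, (∑ᶠ q ∈ {q : α × ℤˣ | T y q.1 q.2}, (q.2 : ℤ)) • v y =
      ∑ i, if good i then V i else 0 := by
  classical
  have h4 : ∀ {i y} {μ : ℤˣ}, good i → V i = (μ : ℤ) • v y → T y (P i) μ ∧ R i y := by
    intro i y μ hi hV
    obtain ⟨y', μ', h5, h6, h7⟩ := h2 hi
    obtain ⟨rfl, rfl⟩ := hv (hV.symm.trans h6)
    exact ⟨h5, h7⟩
  have key : ∀ y, (∑ᶠ q ∈ {q : α × ℤˣ | T y q.1 q.2}, (q.2 : ℤ)) • v y =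
      ∑ i, if good i ∧ ∃ μ : ℤˣ, V i = (μ : ℤ) • v y then V i else 0 := by
    intro y
    by_cases hy : ∃ i, good i ∧ ∃ μ : ℤˣ, V i = (μ : ℤ) • v y
    · obtain ⟨i, hi, μ, hμ⟩ := hy
      have h5 := h4 hi hμ
      have h6 : {q : α × ℤˣ | T y q.1 q.2} = {(P i, μ)} := by
        refine Set.eq_singleton_iff_unique_mem.2 ⟨h5.1, fun q hq => ?_⟩
        obtain ⟨j, hj, hp, hV⟩ := h1 hq
        obtain rfl := h3 (h4 hj hV).2 h5.2
        exact Prod.ext hp (hv (hV.symm.trans hμ)).2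
      rw [h6, finsum_mem_singleton, Finset.sum_eq_single i, if_pos ⟨hi, μ, hμ⟩, hμ]
      · intro j _ hj
        refine if_neg fun ⟨hj', μ', hμ'⟩ => hj ?_
        exact h3 (h4 hj' hμ').2 h5.2
      · exact fun h => absurd (Finset.mem_univ _) h
    · rw [show {q : α × ℤˣ | T y q.1 q.2} = ∅ from Set.eq_empty_iff_forall_notMem.2 fun q hq => by
        obtain ⟨i, hi, -, hV⟩ := h1 hq
        exact hy ⟨i, hi, _, hV⟩, finsum_mem_empty, zero_smul]
      exact (Finset.sum_eq_zero fun i _ => if_neg fun hi => hy ⟨i, hi⟩).symm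
  rw [Finset.sum_congr rfl fun y _ => key y, Finset.sum_comm]
  refine Finset.sum_congr rfl fun i _ => ?_
  by_cases hi : good i
  · obtain ⟨y, μ, -, hV, -⟩ := h2 hi
    rw [if_pos hi, Finset.sum_eq_single y, if_pos ⟨hi, μ, hV⟩]
    · intro y' _ hy'
      refine if_neg fun ⟨_, μ', hV'⟩ => hy' ?_
      exact (hv (hV'.symm.trans hV)).1
    · exact fun h => absurd (Finset.mem_univ _) h
  · rw [if_neg hi]
    exact Finset.sum_eq_zero fun y _ => if_neg fun h => hi h.1

open Classical in
theorem sheetProd_sum {m : ℕ} [NeZero m] {κ R : Type*} [Fintype κ] [Ring R] (a : ZMod m → κ → R) :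
    sheetProd (fun k => ∑ j, a k j) = ∑ φ : ZMod m → κ, sheetProd fun k => a k (φ k) := by
  have e : ∀ g : ZMod m → R, sheetProd g =
      MultilinearMap.mkPiAlgebraFin ℤ m R fun i => g (ZMod.finEquiv m i) := fun g => by
    rw [MultilinearMap.mkPiAlgebraFin_apply, List.ofFn_eq_map, sheetProd, sheetList, List.map_map]
    rfl
  rw [e, MultilinearMap.map_sum]
  refine Fintype.sum_equiv (Equiv.arrowCongr (ZMod.finEquiv m).toEquiv (Equiv.refl κ)) _ _ fun φ => ?_
  rw [e]
  congr 1
  funext i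
  simp [Equiv.arrowCongr]

open Classical in
theorem sheetProd_ite {m : ℕ} [NeZero m] {R : Type*} [MonoidWithZero R] (p : ZMod m → Prop)
    (a : ZMod m → R) :
    sheetProd (fun k => if p k then a k else 0) = if ∀ k, p k then sheetProd a else 0 := by
  by_cases h : ∀ k, p k
  · rw [if_pos h]
    exact congrArg sheetProd (funext fun k => if_pos (h k))
  · rw [if_neg h]
    push Not at h
    obtain ⟨k, hk⟩ := h
    exact sheetProd_eq_zero k (if_neg hk)

theorem ite_zero_apply {M : Type*} [AddCommGroup M] (p : Prop) [Decidable p] (T : Module.End ℤ M)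
    (v : M) : (if p then T else 0) v = if p then T v else 0 := by
  split_ifs <;> rfl

variable {f : Fin (n + 1) → Curve (n + 1) m} {k : ZMod m} {x y z : H.Gen m}

open Classical in
theorem locL_eq_sum (hf : f c ≠ f (c + 1)) :
    locL H ρ c S o (alphaThrough H ρ c k) f =
      ∑ j, if ValidL H ρ c k f j then hexOp c S o f j else 0 := by
  rw [locL, ← Fintype.sum_ite_eq' c fun _ => if f c = alphaThrough H ρ c k then
    (1 : Operator (n + 1) m) else 0, ← Finset.sum_add_distrib]
  refine Finset.sum_congr rfl fun j _ => ?_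
  by_cases hj : j = c
  · subst hj
    have h1 : ¬ HexAt H ρ j f j := fun h => h.ne rfl
    simp [ValidL, h1, hexOp_self S o hf]
  · simp [ValidL, hj, and_comm]

open Classical in
theorem locR_eq_sum (hf : f c ≠ f (c + 1)) :
    locR H ρ c S o (alphaThrough H ρ c (k + 1)) f =
      ∑ j, if ValidR H ρ c k f j then hexOp c S o f j else 0 := by
  rw [locR, ← Fintype.sum_ite_eq' c fun _ => if Poly H ρ c (alphaThrough H ρ c (k + 1)) f (f c) then
    (1 : Operator (n + 1) m) else 0, ← Finset.sum_add_distrib]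
  refine Finset.sum_congr rfl fun j _ => ?_
  by_cases hj : j = c
  · subst hj
    have h1 : ¬ HexAt H ρ j f j := fun h => h.ne rfl
    simp [ValidR, h1, hexOp_self S o hf]
  · simp [ValidR, hj, and_comm, and_assoc]

theorem stateI_iff_allI : StateI H ρ c y.1 ↔ AllI H ρ c y := by
  constructor
  · intro h a
    have := congrArg Prod.fst (h (a + (H.shift ρ.succ c : ZMod m)))
    rwa [alphaThrough, add_sub_cancel_right] at this
  · exact fun h k => (y.2 _).right_unique (q' := (c, k)) (meets_alphaThrough H ρ c k) (h _)

theorem vec_smul_inj {y y' : H.Gen m} {μ μ' : ℤˣ}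
    (h : (μ : ℤ) • vec o y.1 = (μ' : ℤ) • vec o y'.1) : y = y' ∧ μ = μ' := by
  rw [vec, vec, Finsupp.smul_single_one, Finsupp.smul_single_one, Finsupp.single_eq_single_iff] at h
  have h := h.resolve_right fun e => μ.ne_zero e.1
  exact ⟨Subtype.ext (vec_injective o (by rw [vec, vec, h.1])), Units.ext h.2⟩

theorem HexChain.row_eq {P : Curve (n + 1) m → Prop} (hP : ∀ u, P u → u.1 ≠ ρ.succ)
    {ks : List (ZMod m)} {p : TwoChain (n + 1) m} {μ : ℤˣ}
    (hx : HexChain H ρ c S o P ks x y p μ) {q : Curve (n + 1) m} (hq : q.1 = ρ.succ) :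
    y.1 q = x.1 q := by
  induction hx with
  | nil x => rfl
  | cons x z z' y k s t u ks p μ hp hr ho hu _ ih =>
    obtain ⟨hs, ht, hz, hsu⟩ := (isPuncturedRect_iff H ρ c).1 hp
    have hqs : q ≠ s := fun e' => hsu.1 (by rw [← e', hq])
    have hqt : q ≠ t := fun e' => not_cycIco_right _ _ (by have := hsu.2; rwa [← e', hq] at this)
    have hqu : q ≠ u := fun e' => hP u hu (by rw [← e', hq])
    rw [ih, (Grid.isRect_iff.1 hr).2, mv_of_ne _ hqu hqt, hz, mv_of_ne _ hqs hqt]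

theorem IsPolygon.unique {y' : H.Gen m} (h1 : IsPolygon H ρ c x y) (h2 : IsPolygon H ρ c x y') :
    y = y' := by
  refine Subtype.ext (Equiv.ext fun p => ?_)
  by_cases e1 : ∃ k, p = alphaThrough H ρ c k
  · obtain ⟨k, rfl⟩ := e1
    rw [h1.upper_left, h2.upper_left]
  · by_cases e2 : ∃ k, p = x.1.symm (c, k)
    · obtain ⟨k, rfl⟩ := e2
      rw [h1.lower_right, h2.lower_right]
    · push Not at e1 e2
      rw [h1.other p e1 e2, h2.other p e1 e2]

variable [NeZero m]

theorem evLift_sum (h : IsStabilization G H ρ c) (a : H.Gen m → ℤ) (ha : ∀ y, ¬ AllI H ρ c y → a y = 0) :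
    evLift h o (∑ g, Finsupp.single g (a (h.lift g))) = ∑ y, a y • vec o y.1 := by
  rw [map_sum]
  refine Fintype.sum_of_injective h.lift (lift_injective h) _ _ (fun y hy => ?_) fun g =>
    evLift_single h o g _
  rw [ha y fun hI => hy (exists_lift h hI), zero_smul]

theorem exists_nodup_list (φ : ZMod m → Fin (n + 1)) :
    ∃ ks : List (ZMod m), ks.Nodup ∧ ∀ k, k ∈ ks ↔ φ k ≠ c :=
  ⟨(Finset.univ.filter fun k => φ k ≠ c).toList, Finset.nodup_toList _, fun k => by simp⟩

theorem sum_coeffL (h : IsStabilization G H ρ c) (x : H.Gen m) :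
    ∑ y, coeffL H ρ c S o x y • vec o y.1 = opL H ρ c S o x.1 (vec o x.1) := by
  classical
  have e1 : opL H ρ c S o x.1 = ∑ φ : ZMod m → Fin (n + 1),
      if ∀ k, ValidL H ρ c k (loc H c x.1 (ρ.succ + 1) k) (φ k) then
        sheetProd fun k => hexOp c S o (loc H c x.1 (ρ.succ + 1) k) (φ k) else 0 := by
    rw [opL, funext fun k => locL_eq_sum S o (k := k) fun e' => (add_one_ne ρ c).symm
      (loc_injective e'), sheetProd_sum]
    exact Finset.sum_congr rfl fun φ _ => sheetProd_ite _ _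
  rw [e1, LinearMap.sum_apply, Finset.sum_congr rfl fun φ _ => ite_zero_apply _ _ _]
  unfold coeffL
  have hR := sheetRuleL (H := H) (ρ := ρ) (c := c) S o
  refine sum_finsum_units_smul (fun y : H.Gen m => vec o y.1) (vec_smul_inj o)
    (fun y => TypeL H ρ c S o x y)
    (fun φ => ∀ k, ValidL H ρ c k (loc H c x.1 (ρ.succ + 1) k) (φ k))
    (fun φ : ZMod m → Fin (n + 1) => ∑ k, hexChain c H (loc H c x.1 (ρ.succ + 1) k) (φ k)) _
    (fun (φ : ZMod m → Fin (n + 1)) _ => ∀ k, ValidL H ρ c k (loc H c x.1 (ρ.succ + 1) k) (φ k)) ?_ ?_ ?_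
  · rintro y p μ ⟨-, hy, ks, -, -, hc⟩
    obtain ⟨φ, h1, h2, h3, h4, h5⟩ := hR.of_hexChain S o h hc fun k => by
      refine ⟨?_, Or.inl rfl⟩
      rw [loc, colAt_self, Equiv.symm_apply_eq, stateI_iff_allI.2 hy]
    exact ⟨φ, h1, h4, h5⟩
  · intro φ hφ
    obtain ⟨ks, hks, hk⟩ := exists_nodup_list (c := c) φ
    obtain ⟨z, p, μ, h1, h2, h3⟩ := hR.exists_hexChain S o h hks hφ hk
    obtain ⟨φ', k1, k2, k3, k4, k5⟩ := hR.of_hexChain S o h h1 h2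
    obtain rfl : φ = φ' := funext fun k => loc_injective ((h3 k).symm.trans (k2 k))
    refine ⟨z, μ, ?_, k5, hφ⟩
    rw [← k4]
    refine ⟨(h1.isPseudoDomain S o h).1, stateI_iff_allI.1 fun k => ?_, ks, hks, fun k => ?_, h1⟩
    · rw [← Equiv.eq_symm_apply, h3, (hφ k).1]
    · rw [hk, not_iff_not]
      constructor
      · intro e'
        have := (hφ k).1
        rw [e', loc, colAt_self] at this
        exact congrArg Prod.fst this
      · intro e'
        have h5 := x.2 (x.1.symm (c, k))
        rw [Equiv.apply_symm_apply] at h5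
        refine loc_injective (H := H) (c := c) (σ := x.1) (e := ρ.succ + 1) (k := k) ?_
        rw [(hφ k).1, loc, colAt_self]
        exact (eq_alphaThrough' e' h5).symm
  · exact fun {φ φ' _} h1 h2 => funext fun k => loc_injective ((h1 k).1.trans (h2 k).1.symm)

theorem IsPolygon.qFine (h : IsStabilization G H ρ c) (hp : IsPolygon H ρ c x y) :
    QFine H c (polygonChain H ρ c x) := by
  refine ⟨fun j hj a => ?_, rfl⟩
  simp only [polygonChain, Finset.sum_apply]
  exact ⟨Finset.sum_eq_zero fun k _ => ((hp.noOldMarking h k).squares_eq_zero hj a).1,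
    Finset.sum_eq_zero fun k _ => ((hp.noOldMarking h k).squares_eq_zero hj a).2⟩

theorem sum_coeffR (h : IsStabilization G H ρ c) (x : H.Gen m) :
    ∑ y, coeffR H ρ c S o x y • vec o y.1 = opR H ρ c S o x.1 (vec o x.1) := by
  classical
  have e1 : prodR H ρ c S o x.1 = ∑ φ : ZMod m → Fin (n + 1),
      if ∀ k, ValidR H ρ c k (loc H c x.1 ρ.castSucc k) (φ k) then
        sheetProd fun k => hexOp c S o (loc H c x.1 ρ.castSucc k) (φ k) else 0 := by
    rw [prodR, funext fun k => locR_eq_sum S o (k := k) fun e' => (add_one_ne ρ c).symm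
      (loc_injective e'), sheetProd_sum]
    exact Finset.sum_congr rfl fun φ _ => sheetProd_ite _ _
  rw [opR, e1, Module.End.mul_apply, LinearMap.sum_apply, Finset.sum_congr rfl fun φ _ => ite_zero_apply _ _ _]
  unfold coeffR
  have hR := sheetRuleR (H := H) (ρ := ρ) (c := c) S o
  have hpoly : ∀ {z y : H.Gen m}, IsPolygon H ρ c z y →
      (∀ k, ValidR H ρ c k (loc H c z.1 ρ.castSucc k) c) ∧
      polyOp S o (fun k => z.1.symm (c, k)) (alphaThrough H ρ c) (vec o z.1) =
        ((polygonSign H ρ c S o z : ℤˣ) : ℤ) • vec o y.1 := fun {z y} hp => by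
    have h1 := ((isPolygon_iff h).1 hp).1
    obtain ⟨y', h2, h3⟩ := exists_isPolygon S o h h1
    rw [hp.unique h2]
    exact ⟨fun k => ⟨h1 k, Or.inl rfl⟩, h3⟩
  have hchain : ∀ {φ : ZMod m → Fin (n + 1)} {ks : List (ZMod m)} {z : H.Gen m}
      {p : TwoChain (n + 1) m} {μ : ℤˣ},
      HexChain H ρ c S o (fun u => u.1 ≠ ρ.succ) ks x z p μ →
      (∀ k, z.1.symm (c, k) = loc H c x.1 ρ.castSucc k (φ k)) →
      polygonChain H ρ c z = (∑ k : ZMod m, squares H (loc H c x.1 ρ.castSucc k (φ k)) ρ.succ c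
        (x.1 (alphaThrough H ρ c (k + 1))).1, 0, 1) := fun hc hz => by
    rw [polygonChain]
    congr 1
    refine Finset.sum_congr rfl fun k _ => ?_
    rw [hz, hc.row_eq S o (fun _ h => h) (q := alphaThrough H ρ c (k + 1)) rfl]
  refine sum_finsum_units_smul (fun y : H.Gen m => vec o y.1) (vec_smul_inj o)
    (fun y => TypeR H ρ c S o x y)
    (fun φ => ∀ k, ValidR H ρ c k (loc H c x.1 ρ.castSucc k) (φ k))
    (fun φ : ZMod m → Fin (n + 1) => ∑ k, hexChain c H (loc H c x.1 ρ.castSucc k) (φ k) +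
      (∑ k : ZMod m, squares H (loc H c x.1 ρ.castSucc k (φ k)) ρ.succ c
        (x.1 (alphaThrough H ρ c (k + 1))).1, 0, 1)) _
    (fun (φ : ZMod m → Fin (n + 1)) y => ∀ k, y.1 (loc H c x.1 ρ.castSucc k (φ k)) = x.1 (alphaThrough H ρ c (k + 1))) ?_ ?_ ?_
  · rintro y p μ ⟨-, hy, ks, z, p', μ', hc, hp, rfl, rfl⟩
    obtain ⟨h0, h0'⟩ := hpoly hp
    obtain ⟨φ, h1, h2, h3, h4, h5⟩ := hR.of_hexChain S o h hc h0
    refine ⟨φ, h1, by rw [h4, hchain hc h2], ?_⟩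
    rw [h5, h0', smul_smul, Units.val_mul]
  · intro φ hφ
    obtain ⟨ks, hks, hk⟩ := exists_nodup_list (c := c) φ
    obtain ⟨z, p, μ, h1, h2, h3⟩ := hR.exists_hexChain S o h hks hφ hk
    obtain ⟨φ', k1, k2, k3, k4, k5⟩ := hR.of_hexChain S o h h1 h2
    obtain rfl : φ = φ' := funext fun k => loc_injective ((h3 k).symm.trans (k2 k))
    obtain ⟨y, hp, hs⟩ := exists_isPolygon S o h fun k => (h2 k).1
    refine ⟨y, μ * polygonSign H ρ c S o z, ?_, ?_, fun k => ?_⟩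
    · rw [← k4, ← hchain h1 h3]
      exact ⟨(h1.isPseudoDomain S o h).1.add (hp.isPseudoDomain h),
        stateI_iff_allI.1 hp.upper_left, ks, z, p, μ, h1, hp, rfl, rfl⟩
    · rw [k5, hs, smul_smul, Units.val_mul]
    · rw [← h3, hp.lower_right, h1.row_eq S o (fun _ h => h) (q := alphaThrough H ρ c (k + 1)) rfl]
  · intro φ φ' y h1 h2
    exact funext fun k => loc_injective (y.1.injective ((h1 k).trans (h2 k).symm))

theorem evLift_stabMap_fst (h : IsStabilization G H ρ c) (x : H.Gen m) :
    evLift h o (h.stabMap S o (Finsupp.single x 1)).1 = opR H ρ c S o x.1 (vec o x.1) := by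
  rw [IsStabilization.stabMap, Finsupp.linearCombination_single, one_smul, ← sum_coeffR S o h]
  refine evLift_sum o h (coeffR H ρ c S o x) fun y hy => ?_
  rw [coeffR, show {q : TwoChain (n + 1) m × ℤˣ | TypeR H ρ c S o x y q.1 q.2} = ∅ from
    Set.eq_empty_iff_forall_notMem.2 fun q hq => hy hq.2.1, finsum_mem_empty]

theorem evLift_stabMap_snd (h : IsStabilization G H ρ c) (x : H.Gen m) :
    evLift h o (h.stabMap S o (Finsupp.single x 1)).2 = opL H ρ c S o x.1 (vec o x.1) := by
  rw [IsStabilization.stabMap, Finsupp.linearCombination_single, one_smul, ← sum_coeffL S o h]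
  refine evLift_sum o h (coeffL H ρ c S o x) fun y hy => ?_
  rw [coeffL, show {q : TwoChain (n + 1) m × ℤˣ | TypeL H ρ c S o x y q.1 q.2} = ∅ from
    Set.eq_empty_iff_forall_notMem.2 fun q hq => hy hq.2.1, finsum_mem_empty]

end Expansion

/-! ### The gradings -/

section Gradings

section Count

variable {N m : ℕ} {D : Grid N}

theorem Grid.pairCount_map {A B : Type*} [Fintype A] [Fintype B] (f : A → ℚ × ℚ) (g : B → ℚ × ℚ) :
    Grid.pairCount (Finset.univ.val.map f) (Finset.univ.val.map g) = ∑ a, ∑ b,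
      if 0 < ((g b).1 - (f a).1) * ((g b).2 - (f a).2) then 1 else 0 := by
  have e : (Finset.univ.val.map f) ×ˢ (Finset.univ.val.map g) =
      (Finset.univ : Finset (A × B)).val.map (Prod.map f g) := by
    rw [← Finset.univ_product_univ, Finset.product_val]
    simp only [SProd.sprod, Multiset.product, Multiset.map_bind, Multiset.bind_map, Multiset.map_map]
    rfl
  rw [pairCount, e, Multiset.filter_map, Multiset.card_map, ← Finset.filter_val, Finset.card_val,
    Finset.card_filter, Fintype.sum_prod_type]
  push_cast
  rfl

/-- The side of a circle on which a square lies. -/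
def side (i r : Fin N) : ℤ := if i ≤ r then 1 else -1

theorem ite_side (a j i r : Fin N) :
    (if 0 < ((((j : ℕ) : ℚ) + 1 / 2) - ((a : ℕ) : ℚ)) * ((((r : ℕ) : ℚ) + 1 / 2) - ((i : ℕ) : ℚ)) then
      (1 : ℚ) else 0) = (1 + (side a j * side i r : ℤ)) / 2 := by
  have key : ∀ a j : Fin N, (a ≤ j ∧ 0 < (((j : ℕ) : ℚ) + 1 / 2) - ((a : ℕ) : ℚ)) ∨
      (¬ a ≤ j ∧ (((j : ℕ) : ℚ) + 1 / 2) - ((a : ℕ) : ℚ) < 0) := by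
    intro a j
    by_cases h : a ≤ j
    · have : ((a : ℕ) : ℚ) ≤ ((j : ℕ) : ℚ) := by exact_mod_cast h
      exact Or.inl ⟨h, by linarith⟩
    · have : ((j : ℕ) : ℚ) + 1 ≤ ((a : ℕ) : ℚ) := by exact_mod_cast not_le.1 h
      exact Or.inr ⟨h, by linarith⟩
  rcases key a j with ⟨h1, h2⟩ | ⟨h1, h2⟩ <;> rcases key i r with ⟨h3, h4⟩ | ⟨h3, h4⟩ <;>
    simp only [side, h1, h3, if_true, if_false]
  · rw [if_pos (mul_pos h2 h4)]; norm_num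
  · rw [if_neg (mul_neg_of_pos_of_neg h2 h4).not_gt]; norm_num
  · rw [if_neg (mul_neg_of_neg_of_pos h2 h4).not_gt]; norm_num
  · rw [if_pos (mul_pos_of_neg_of_neg h2 h4)]; norm_num

/-- The contribution of an intersection point to the Alexander grading. -/
def Grid.weight (D : Grid N) (i a : Fin N) : ℤ := ∑ j, side a j * (side i (D.X j) - side i (D.O j))

open Classical in
/-- The number of pairs of markings one of which is above and to the right of the other. -/
def markCount (M : Fin N → Fin N) : ℚ :=
  ∑ j, ∑ k, if (j < k ∧ M j < M k) ∨ (k < j ∧ M k < M j) then 1 else 0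

theorem Grid.alexander_eq [NeZero m] (x : D.Gen m) :
    D.alexander x = 1 / 2 * ((∑ q, D.weight q.1 (x.1 q).1 : ℤ) / (2 * m) -
      1 / 2 * (markCount D.X - markCount D.O)) - ((N : ℚ) - 1) / 2 := by
  classical
  have h1 : pairCount D.pointsX D.pointsO = pairCount D.pointsO D.pointsX := by
    rw [pointsX, pointsO, pairCount_map, pairCount_map, Finset.sum_comm]
    refine Finset.sum_congr rfl fun j _ => Finset.sum_congr rfl fun k _ => if_congr ?_ rfl rfl
    rw [← neg_mul_neg, neg_sub, neg_sub]
  have h2 : ∀ M : Fin N → Fin N,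
      pairCount ((Finset.univ : Finset (Fin N)).val.map fun j : Fin N =>
        (((j : ℕ) : ℚ) + 1 / 2, ((M j : ℕ) : ℚ) + 1 / 2))
      ((Finset.univ : Finset (Fin N)).val.map fun j : Fin N =>
        (((j : ℕ) : ℚ) + 1 / 2, ((M j : ℕ) : ℚ) + 1 / 2)) = markCount M := by
    intro M
    rw [pairCount_map, markCount]
    refine Finset.sum_congr rfl fun j _ => Finset.sum_congr rfl fun k _ => if_congr ?_ rfl rfl
    simp only [mul_pos_iff, add_sub_add_right_eq_sub, sub_pos, sub_neg, Nat.cast_lt, Fin.val_fin_lt]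
  have h3 : ∀ M : Fin N → Fin N, pairCount (D.points x)
      ((Finset.univ : Finset (Fin N)).val.map fun j : Fin N =>
        (((j : ℕ) : ℚ) + 1 / 2, ((M j : ℕ) : ℚ) + 1 / 2)) =
      ∑ q : Curve N m, ∑ j, (1 + ((side (x.1 q).1 j * side q.1 (M j) : ℤ) : ℚ)) / 2 := by
    intro M
    rw [points, pairCount_map]
    exact Finset.sum_congr rfl fun q _ => Finset.sum_congr rfl fun j _ => ite_side _ _ _ _
  rw [alexander, h1, pointsX, pointsO, h2 D.X, h2 D.O, h3 D.X, h3 D.O, ← Finset.sum_sub_distrib]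
  have h4 : ∀ q : Curve N m, ((∑ j, (1 + ((side (x.1 q).1 j * side q.1 (D.X j) : ℤ) : ℚ)) / 2) -
      ∑ j, (1 + ((side (x.1 q).1 j * side q.1 (D.O j) : ℤ) : ℚ)) / 2) =
      (D.weight q.1 (x.1 q).1 : ℤ) / 2 := by
    intro q
    rw [← Finset.sum_sub_distrib, weight, Int.cast_sum, Finset.sum_div]
    refine Finset.sum_congr rfl fun j _ => ?_
    push_cast
    ring
  rw [Finset.sum_congr rfl fun q _ => h4 q, ← Finset.sum_div, Int.cast_sum, div_div]
  ring

end Count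

theorem val_predAbove (ρ : Fin n) (k : Fin (n + 1)) :
    ((k : ℕ) ≤ ρ ∧ (ρ.predAbove k : ℕ) = k) ∨ ((ρ : ℕ) < k ∧ (ρ.predAbove k : ℕ) + 1 = k) := by
  unfold Fin.predAbove
  split_ifs with h
  · rw [Fin.lt_def, Fin.val_castSucc] at h
    exact Or.inr ⟨h, by rw [Fin.val_pred]; omega⟩
  · rw [Fin.lt_def, Fin.val_castSucc] at h
    exact Or.inl ⟨by omega, by rw [Fin.coe_castPred]⟩

theorem side_sub_side (ρ : Fin n) (i r : Fin (n + 1)) : side i r - side (i + 1) r =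
    2 * ((if i = r then 1 else 0) - if i = Fin.last n then 1 else 0) := by
  have h1 := val_add_one_cases ρ i
  simp only [side, Fin.le_def, Fin.ext_iff, Fin.val_last]
  split_ifs <;> omega

theorem sum_marked (M : Equiv.Perm (Fin (n + 1))) (i : Fin (n + 1)) :
    ∑ j, (if i = M j then (1 : ℤ) else 0) = 1 := by
  rw [Finset.sum_eq_single (M.symm i)]
  · simp
  · intro j _ hj
    exact if_neg fun e => hj (by rw [e, Equiv.symm_apply_apply])
  · exact fun h => absurd (Finset.mem_univ _) h

theorem weight_difference (ρ : Fin n) (H : Grid (n + 1)) (i a : Fin (n + 1)) :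
    H.weight i a - H.weight (i + 1) a - H.weight i (a + 1) + H.weight (i + 1) (a + 1) =
      4 * ((if i = H.X a then 1 else 0) - if i = H.O a then 1 else 0) := by
  have h1 : ∀ j, side a j * (side i (H.X j) - side i (H.O j)) -
      side a j * (side (i + 1) (H.X j) - side (i + 1) (H.O j)) -
      side (a + 1) j * (side i (H.X j) - side i (H.O j)) +
      side (a + 1) j * (side (i + 1) (H.X j) - side (i + 1) (H.O j)) =
      4 * ((if a = j then (if i = H.X j then 1 else 0) - (if i = H.O j then 1 else 0) else 0) -
        (if a = Fin.last n then 1 else 0) *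
          ((if i = H.X j then 1 else 0) - if i = H.O j then 1 else 0)) := by
    intro j
    have e1 := side_sub_side ρ a j
    have e2 := side_sub_side ρ i (H.X j)
    have e3 := side_sub_side ρ i (H.O j)
    have e4 : ∀ z : ℤ, (if a = j then z else 0) = (if a = j then 1 else 0) * z := by
      intro z; split_ifs <;> ring
    rw [e4]
    linear_combination (side i (H.X j) - side i (H.O j) - side (i + 1) (H.X j) +
      side (i + 1) (H.O j)) * e1 + 2 * ((if a = j then 1 else 0) - if a = Fin.last n then 1 else 0) *
      (e2 - e3)
  simp only [Grid.weight]
  rw [← Finset.sum_sub_distrib, ← Finset.sum_sub_distrib, ← Finset.sum_add_distrib,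
    Finset.sum_congr rfl fun j _ => h1 j, ← Finset.mul_sum, Finset.sum_sub_distrib,
    Finset.sum_ite_eq Finset.univ a, if_pos (Finset.mem_univ _), ← Finset.mul_sum,
    Finset.sum_sub_distrib, sum_marked, sum_marked]
  ring

variable [NeZero m] {x y : H.Gen m} {p : TwoChain (n + 1) m}

theorem IsPseudoDomain.sum_mul (hp : IsPseudoDomain H ρ c x y p) (g : Fin (n + 1) → Fin (n + 1) → ℤ) :
    ∑ i, ∑ j, (g i j - g (i + 1) j - g i (j + 1) + g (i + 1) (j + 1)) * ∑ a, p.1 i j a =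
      ∑ q, g q.1 (x.1 q).1 - ∑ q, g q.1 (y.1 q).1 := by
  classical
  set P : Fin (n + 1) → Fin (n + 1) → ℤ := fun i j => ∑ a, p.1 i j a with hP
  have hs : ∀ (i j : Fin (n + 1)) (b : ZMod m), ∑ a, p.1 i j (a - b) = P i j := fun i j b =>
    (Equiv.subRight b).sum_comp (p.1 i j)
  have h1 : ∀ i j, P i j - P (i - 1) j - P i (j - 1) + P (i - 1) (j - 1) =
      ∑ a, pointCount H x i j a - ∑ a, pointCount H y i j a := by
    intro i j
    have h0 := Finset.sum_congr (rfl : (Finset.univ : Finset (ZMod m)) = _) fun a _ => hp.corner i j a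
    simp only [Finset.sum_add_distrib, Finset.sum_sub_distrib, hs] at h0
    exact h0
  have h2 : ∀ z : H.Gen m, ∑ q, g q.1 (z.1 q).1 = ∑ i, ∑ j, g i j * ∑ a, pointCount H z i j a := by
    intro z
    rw [← Equiv.sum_comp z.1.symm, Fintype.sum_prod_type,
      Finset.sum_comm (f := fun i j => g i j * ∑ a, pointCount H z i j a)]
    refine Finset.sum_congr rfl fun j _ => ?_
    simp_rw [Finset.mul_sum]
    rw [Finset.sum_comm]
    exact Finset.sum_congr rfl fun a _ => by simp [pointCount]
  have r1 : ∀ f : Fin (n + 1) → ℤ, ∑ i, f (i + 1) = ∑ i, f i := fun f =>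
    Equiv.sum_comp (Equiv.addRight (1 : Fin (n + 1))) f
  have h3 : ∀ i j, g i j * P i j - g i j * P (i - 1) j - g i j * P i (j - 1) +
      g i j * P (i - 1) (j - 1) =
      g i j * ∑ a, pointCount H x i j a - g i j * ∑ a, pointCount H y i j a := by
    intro i j
    linear_combination g i j * h1 i j
  rw [h2, h2, ← Finset.sum_sub_distrib]
  simp_rw [← Finset.sum_sub_distrib, ← h3, Finset.sum_add_distrib, Finset.sum_sub_distrib]
  rw [← r1 fun i => ∑ j, g i j * P (i - 1) j, ← r1 fun i => ∑ j, g i j * P (i - 1) (j - 1)]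
  simp_rw [fun i => (r1 fun j => g i j * P i (j - 1)).symm,
    fun i => (r1 fun j => g (i + 1) j * P (i + 1 - 1) (j - 1)).symm, add_sub_cancel_right]
  simp_rw [← Finset.sum_sub_distrib, ← Finset.sum_add_distrib]
  exact Finset.sum_congr rfl fun i _ => Finset.sum_congr rfl fun j _ => by ring

theorem IsPseudoDomain.alexander_sub (h : IsStabilization G H ρ c) (hp : IsPseudoDomain H ρ c x y p)
    (hq : QFine H c p) : H.alexander x - H.alexander y = p.2.2 := by
  have h0 : ∀ a : Fin (n + 1), ∑ i, 4 * ((if i = H.X a then 1 else 0) - if i = H.O a then 1 else 0) *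
      ∑ b, p.1 i a b = if a = c then 4 * m * p.2.2 else 0 := by
    intro a
    have e : ∀ i, 4 * ((if i = H.X a then (1 : ℤ) else 0) - if i = H.O a then 1 else 0) *
        ∑ b, p.1 i a b = 4 * ((if i = H.X a then ∑ b, p.1 i a b else 0) -
          if i = H.O a then ∑ b, p.1 i a b else 0) := by
      intro i; split_ifs <;> ring
    rw [Finset.sum_congr rfl fun i _ => e i, ← Finset.mul_sum, Finset.sum_sub_distrib,
      Finset.sum_ite_eq', Finset.sum_ite_eq', if_pos (Finset.mem_univ _), if_pos (Finset.mem_univ _),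
      ← Finset.sum_sub_distrib]
    by_cases ha : a = c
    · rw [if_pos ha, ha, h.X_new, h.O_new, Finset.sum_congr rfl fun k _ =>
        show p.1 ρ.castSucc c k - p.1 ρ.succ c k = p.2.2 by
          have := hp.puncture k
          rw [hq.2] at this
          linarith]
      simp [mul_assoc]
    · rw [if_neg ha, Finset.sum_eq_zero fun b _ => by rw [(hq.1 a ha b).1, (hq.1 a ha b).2, sub_zero]]
      rfl
  have h1 := hp.sum_mul H.weight
  simp_rw [weight_difference ρ] at h1
  rw [Finset.sum_comm, Finset.sum_congr rfl fun a _ => h0 a, Finset.sum_ite_eq',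
    if_pos (Finset.mem_univ _)] at h1
  have h2 := congrArg (Int.cast : ℤ → ℚ) h1
  push_cast at h2
  rw [Grid.alexander_eq, Grid.alexander_eq]
  have hm : (m : ℚ) ≠ 0 := by exact_mod_cast NeZero.ne m
  push_cast
  field_simp
  linarith

/-! ### The Alexander gradings of the two diagrams -/

theorem IsStabilization.alexander_lift (h : IsStabilization G H ρ c) (g : G.Gen m) :
    G.alexander g = H.alexander (h.lift g) + 1 := by
  classical
  have hv := val_rows ρ
  have hX : ∀ j, H.X (c.succAbove j) ≠ ρ.castSucc := fun j e =>
    Fin.succAbove_ne c j (H.X.injective (e.trans h.X_new.symm))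
  have hO : ∀ j, H.O (c.succAbove j) ≠ ρ.succ := fun j e =>
    Fin.succAbove_ne c j (H.O.injective (e.trans h.O_new.symm))
  have hside : ∀ a j : Fin n, side (c.succAbove a) (c.succAbove j) = side a j := fun a j =>
    if_congr Fin.succAbove_le_succAbove_iff rfl rfl
  have hside' : ∀ (i : Fin n) (k : Fin (n + 1)), side (ρ.succ.succAbove i) k = side i (ρ.predAbove k) :=
    fun i k => if_congr (le_predAbove ρ i k).symm rfl rfl
  have hw : ∀ i a, H.weight (ρ.succ.succAbove i) (c.succAbove a) = G.weight i a := by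
    intro i a
    have h1 := Fin.succAbove_ne ρ.succ i
    have h0 : side (ρ.succ.succAbove i) ρ.castSucc = side (ρ.succ.succAbove i) ρ.succ := by
      refine if_congr ?_ rfl rfl
      rw [Fin.le_def, Fin.le_def]
      omega
    rw [Grid.weight, Fin.sum_univ_succAbove _ c, h.X_new, h.O_new, h0, sub_self, mul_zero, zero_add]
    exact Finset.sum_congr rfl fun j _ => by rw [hside, hside', hside', h.X_old, h.O_old]
  set E : ℤ := ∑ j, side c (c.succAbove j) *
    (side ρ.succ (H.X (c.succAbove j)) - side ρ.succ (H.O (c.succAbove j))) with hE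
  have hn : H.weight ρ.succ c = -2 + E := by
    rw [Grid.weight, Fin.sum_univ_succAbove _ c, h.X_new, h.O_new, ← hE]
    have h1 : ¬ ρ.succ ≤ ρ.castSucc := by rw [Fin.le_def]; omega
    simp [side, h1]
  have hsum : ∑ q, H.weight q.1 ((h.lift g).1 q).1 = ∑ q, G.weight q.1 (g.1 q).1 + m * (-2 + E) := by
    rw [Fintype.sum_prod_type, Fin.sum_univ_succAbove _ ρ.succ, add_comm, Fintype.sum_prod_type]
    congr 1
    · refine Finset.sum_congr rfl fun i _ => Finset.sum_congr rfl fun a _ => ?_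
      have e := congrArg Prod.fst (lift_curveUp h g (i, a))
      rw [curveUp, curveUp] at e
      rw [e, hw]
    · rw [Finset.sum_congr rfl fun a _ => show H.weight ρ.succ ((h.lift g).1 (ρ.succ, a)).1 = -2 + E by
        rw [lift_new, hn]]
      simp [ZMod.card]
  have hmark : ∀ (M : Fin (n + 1) → Fin (n + 1)) (M' : Fin n → Fin n)
      (_ : ∀ j, M' j = ρ.predAbove (M (c.succAbove j)))
      (_ : (M c = ρ.castSucc ∧ ∀ j, M (c.succAbove j) ≠ ρ.castSucc) ∨
        (M c = ρ.succ ∧ ∀ j, M (c.succAbove j) ≠ ρ.succ)),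
      markCount M = markCount M' +
        ∑ j, ((1 + (side c (c.succAbove j) * side ρ.succ (M (c.succAbove j)) : ℤ) : ℚ)) := by
    intro M M' hM hc
    have hp := val_predAbove ρ
    have e1 : ∀ j, (if (c < c.succAbove j ∧ M c < M (c.succAbove j)) ∨
        (c.succAbove j < c ∧ M (c.succAbove j) < M c) then (1 : ℚ) else 0) =
        (1 + (side c (c.succAbove j) * side ρ.succ (M (c.succAbove j)) : ℤ)) / 2 := by
      intro j
      have h1 := Fin.succAbove_ne c j
      have h2 : (M c = ρ.castSucc ∧ M (c.succAbove j) ≠ ρ.castSucc) ∨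
        (M c = ρ.succ ∧ M (c.succAbove j) ≠ ρ.succ) := hc.imp (And.imp_right fun h => h j)
          (And.imp_right fun h => h j)
      simp only [Fin.ext_iff, ne_eq] at h1 h2
      have h3 : (M c < M (c.succAbove j) ↔ ρ.succ ≤ M (c.succAbove j)) ∧
        (M (c.succAbove j) < M c ↔ ¬ ρ.succ ≤ M (c.succAbove j)) := by
        simp only [Fin.lt_def, Fin.le_def]; omega
      have h4 : (c < c.succAbove j ↔ c ≤ c.succAbove j) ∧ (c.succAbove j < c ↔ ¬ c ≤ c.succAbove j) := by
        simp only [Fin.lt_def, Fin.le_def]; omega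
      simp only [h3.1, h3.2, h4.1, h4.2, side]
      by_cases h5 : c ≤ c.succAbove j <;> by_cases h6 : ρ.succ ≤ M (c.succAbove j) <;>
        simp [h5, h6]
    have e2 : ∀ j k, (M (c.succAbove j) < M (c.succAbove k) ↔ M' j < M' k) := by
      intro j k
      have h1 : (M (c.succAbove j) ≠ ρ.castSucc ∧ M (c.succAbove k) ≠ ρ.castSucc) ∨
          (M (c.succAbove j) ≠ ρ.succ ∧ M (c.succAbove k) ≠ ρ.succ) :=
        hc.imp (fun h => ⟨h.2 j, h.2 k⟩) fun h => ⟨h.2 j, h.2 k⟩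
      have h2 := hp (M (c.succAbove j))
      have h3 := hp (M (c.succAbove k))
      rw [hM, hM]
      simp only [Fin.ext_iff, ne_eq, Fin.lt_def] at *
      omega
    rw [markCount, Fin.sum_univ_succAbove _ c, Fin.sum_univ_succAbove _ c,
      Finset.sum_congr rfl fun j _ => Fin.sum_univ_succAbove _ c, Finset.sum_add_distrib]
    simp only [lt_irrefl, false_and, or_self, if_false, zero_add, Fin.succAbove_lt_succAbove_iff, e2, e1]
    rw [Finset.sum_congr rfl fun j _ => (if_congr or_comm rfl rfl).trans (e1 j), markCount, ← add_assoc,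
      ← Finset.sum_add_distrib, add_comm]
    congr 1
    exact Finset.sum_congr rfl fun j _ => by ring
  rw [Grid.alexander_eq, Grid.alexander_eq, hsum, hmark H.X G.X h.X_old (Or.inl ⟨h.X_new, hX⟩),
    hmark H.O G.O h.O_old (Or.inr ⟨h.O_new, hO⟩)]
  have hE' : (E : ℚ) = (∑ j, (1 + (side c (c.succAbove j) * side ρ.succ (H.X (c.succAbove j)) : ℤ) : ℚ)) -
      ∑ j, (1 + (side c (c.succAbove j) * side ρ.succ (H.O (c.succAbove j)) : ℤ) : ℚ) := by
    rw [← Finset.sum_sub_distrib, hE]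
    push_cast
    exact Finset.sum_congr rfl fun j _ => by ring
  have hm : (m : ℚ) ≠ 0 := by exact_mod_cast NeZero.ne m
  push_cast at hE' ⊢
  field_simp
  rw [hE']
  ring

end Gradings

/-! ### The filtration -/

section Filtration

theorem sum_lt_add_one (ρ : Fin n) (f : Fin (n + 1) → ℤ) (hf : ∑ k, f k = 0) (i : Fin (n + 1)) :
    (∑ k, if k < i + 1 then f k else 0) - (∑ k, if k < i then f k else 0) = f i := by
  have h1 : ∀ k, (if k < i + 1 then f k else 0) - (if k < i then f k else 0) =
      (if k = i then f k else 0) - if i = Fin.last n then f k else 0 := by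
    intro k
    have h2 := val_add_one_cases ρ i
    have e : ((if k < i + 1 then (1 : ℤ) else 0) - if k < i then 1 else 0) =
        (if k = i then 1 else 0) - if i = Fin.last n then 1 else 0 := by
      simp only [Fin.lt_def, Fin.ext_iff, Fin.val_last]
      split_ifs <;> omega
    have e' : ∀ p : Prop, ∀ _ : Decidable p, (if p then f k else 0) = (if p then 1 else 0) * f k :=
      fun p _ => by split_ifs <;> ring
    rw [e', e', e', e', ← sub_mul, ← sub_mul, e]
  rw [← Finset.sum_sub_distrib, Finset.sum_congr rfl fun k _ => h1 k, Finset.sum_sub_distrib,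
    Finset.sum_ite_eq' Finset.univ i f, if_pos (Finset.mem_univ _)]
  by_cases h2 : i = Fin.last n
  · simp [h2, hf]
  · simp [h2]

theorem exists_difference (ρ : Fin n) (l : Fin (n + 1) → Fin (n + 1) → ℤ) (h1 : ∀ i, ∑ j, l i j = 0)
    (h2 : ∀ j, ∑ i, l i j = 0) : ∃ g : Fin (n + 1) → Fin (n + 1) → ℤ,
      ∀ i j, g i j - g (i + 1) j - g i (j + 1) + g (i + 1) (j + 1) = l i j := by
  refine ⟨fun i j => ∑ k, if k < i then ∑ r, (if r < j then l k r else 0) else 0, fun i j => ?_⟩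
  have h3 : ∀ i', (∑ k, if k < i' then ∑ r, (if r < j + 1 then l k r else 0) else 0) -
      (∑ k, if k < i' then ∑ r, (if r < j then l k r else 0) else 0) =
      ∑ k, if k < i' then l k j else 0 := by
    intro i'
    rw [← Finset.sum_sub_distrib]
    refine Finset.sum_congr rfl fun k _ => ?_
    rw [← sum_lt_add_one ρ (l k) (h1 k) j]
    split_ifs <;> simp
  have h4 := sum_lt_add_one ρ (fun k => l k j) (h2 j) i
  simp only at h4 ⊢
  linear_combination h4 + h3 (i + 1) - h3 i

/-- The two-chain has no negative multiplicities. -/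
def Nonneg (p : TwoChain (n + 1) m) : Prop := ∀ i j a, 0 ≤ p.1 i j a

theorem Nonneg.add {p p' : TwoChain (n + 1) m} (h : Nonneg p) (h' : Nonneg p') : Nonneg (p + p') :=
  fun i j a => add_nonneg (h i j a) (h' i j a)

theorem squares_nonneg (s : Curve (n + 1) m) (i₁ j₀ j₁ i j : Fin (n + 1)) (a : ZMod m) :
    0 ≤ squares H s i₁ j₀ j₁ i j a := by
  unfold squares
  split_ifs <;> norm_num

variable {x y : H.Gen m}

theorem HexChain.nonneg {P : Curve (n + 1) m → Prop} {ks : List (ZMod m)} {p : TwoChain (n + 1) m}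
    {μ : ℤˣ} (hx : HexChain H ρ c S o P ks x y p μ) : Nonneg p := by
  induction hx with
  | nil x => exact fun _ _ _ => le_rfl
  | cons x z z' y k s t u ks p μ hp hr ho hu _ ih =>
    exact Nonneg.add (fun i j a => add_nonneg (squares_nonneg _ _ _ _ _ _ _)
      (squares_nonneg _ _ _ _ _ _ _)) ih

/-- The gradings of two generators differ by non-negative contributions to the filtration and by `d` in
the Alexander grading. -/
def Drops (H : Grid (n + 1)) (ρ : Fin n) (c : Fin (n + 1)) (x y : H.Gen m) (d : ℤ) : Prop :=
  ∃ p : TwoChain (n + 1) m, IsPseudoDomain H ρ c x y p ∧ QFine H c p ∧ Nonneg p ∧ p.2.2 = d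

theorem TypeL.drops (h : IsStabilization G H ρ c) {p : TwoChain (n + 1) m} {μ : ℤˣ}
    (hp : TypeL H ρ c S o x y p μ) : Drops H ρ c x y 0 := by
  obtain ⟨h1, -, ks, -, -, hc⟩ := hp
  exact ⟨p, h1, (hc.isPseudoDomain S o h).2.1, hc.nonneg, (hc.isPseudoDomain S o h).2.2⟩

theorem coeffL_drops (h : IsStabilization G H ρ c) (hc : coeffL H ρ c S o x y ≠ 0) :
    Drops H ρ c x y 0 := by
  obtain ⟨q, hq, -⟩ := exists_ne_zero_of_finsum_mem_ne_zero hc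
  exact TypeL.drops S o h hq

variable [NeZero m]

theorem qCount_nonneg {p : TwoChain (n + 1) m} (hp : Nonneg p) : 0 ≤ qCount ρ c p :=
  Finset.sum_nonneg fun _ _ => Finset.sum_nonneg fun _ _ => Finset.sum_nonneg fun _ _ => hp _ _ _

theorem Drops.alexander (h : IsStabilization G H ρ c) {d : ℤ} (hd : Drops H ρ c x y d) :
    H.alexander x = H.alexander y + d := by
  obtain ⟨p, h1, h2, -, h4⟩ := hd
  have := h1.alexander_sub h h2
  rw [h4] at this
  linarith

theorem Drops.le {d : ℤ} (hd : Drops H ρ c x y d) {Q : H.Gen m → ℤ} (hQ : IsQFunction H ρ c Q) :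
    Q y ≤ Q x := by
  obtain ⟨p, h1, h2, h3, -⟩ := hd
  have := hQ x y p h1 h2
  have := qCount_nonneg (ρ := ρ) (c := c) h3
  linarith

theorem TypeR.drops (h : IsStabilization G H ρ c) {p : TwoChain (n + 1) m} {μ : ℤˣ}
    (hp : TypeR H ρ c S o x y p μ) : Drops H ρ c x y 1 := by
  obtain ⟨h1, -, ks, z, p', μ', hc, hp, rfl, -⟩ := hp
  obtain ⟨-, h2, h3⟩ := hc.isPseudoDomain S o h
  refine ⟨_, h1, h2.add (hp.qFine h), hc.nonneg.add fun i j a => ?_, ?_⟩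
  · simp only [polygonChain, Finset.sum_apply]
    exact Finset.sum_nonneg fun k _ => squares_nonneg _ _ _ _ _ _ _
  · rw [Prod.snd_add, Prod.snd_add, h3]; rfl

theorem coeffR_drops (h : IsStabilization G H ρ c) (hc : coeffR H ρ c S o x y ≠ 0) :
    Drops H ρ c x y 1 := by
  obtain ⟨q, hq, -⟩ := exists_ne_zero_of_finsum_mem_ne_zero hc
  exact TypeR.drops S o h hq

theorem Grid.exists_isRect_of_coeff_ne_zero {N : ℕ} {D : Grid N}
    (S : SignAssignment (Curve N m) (Curve N m)) (o : Orientation N m) {x y : D.Gen m}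
    (hc : D.coeff S o x y ≠ 0) : ∃ s t, D.IsRect x y s t := by
  obtain ⟨s, -, hs⟩ := Finset.exists_ne_zero_of_sum_ne_zero hc
  obtain ⟨t, -, ht⟩ := Finset.exists_ne_zero_of_sum_ne_zero hs
  exact ⟨s, t, by_contra fun hn => ht (if_neg hn)⟩

theorem coeff_drops (h : IsStabilization G H ρ c) (hc : H.coeff S o x y ≠ 0) : Drops H ρ c x y 0 := by
  obtain ⟨s, t, hr⟩ := Grid.exists_isRect_of_coeff_ne_zero S o hc
  obtain ⟨hr, hy⟩ := Grid.isRect_iff.1 hr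
  exact ⟨_, hr.isPseudoDomain h hy, rectChain_fine hr.noMarking.old,
    fun i j a => squares_nonneg _ _ _ _ _ _ _, rfl⟩

theorem coeff_drops_lift (h : IsStabilization G H ρ c) {S : SignAssignment (Curve n m) (Curve n m)}
    {o : Orientation n m} {g g' : G.Gen m} (hc : G.coeff S o g g' ≠ 0) :
    Drops H ρ c (h.lift g) (h.lift g') 0 := by
  obtain ⟨s, t, hr⟩ := Grid.exists_isRect_of_coeff_ne_zero S o hc
  obtain ⟨hr, hy⟩ := (isRect_lift_iff h).1 hr
  exact ⟨_, isPseudoDomain_of_annular h hy hr.rs hr.rt hr.row hr.col hr.ms hr.noMarking,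
    rectChain_fine hr.noMarking, fun i j a => squares_nonneg _ _ _ _ _ _ _, rfl⟩

theorem Grid.Rect.eq_of_level (h : IsStabilization G H ρ c) {Q : H.Gen m → ℤ}
    (hQ : IsQFunction H ρ c Q) {s t : Curve (n + 1) m} (hr : H.Rect x.1 s t) (hy : y.1 = mv x.1 s t) :
    Q x = Q y ↔ (∀ i, cycIco s.1 t.1 i → i = ρ.succ) ∨ ∀ j, cycIco (x.1 s).1 (x.1 t).1 j → j = c := by
  classical
  rw [← sub_eq_zero, hQ x y _ (hr.isPseudoDomain h hy) (rectChain_fine hr.noMarking.old)]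
  have h0 : ∀ i j a, 0 ≤ (rectChain H x.1 s t).1 i j a := fun i j a => squares_nonneg _ _ _ _ _ _ _
  rw [qCount, Finset.sum_eq_zero_iff_of_nonneg fun _ _ => Finset.sum_nonneg fun _ _ =>
    Finset.sum_nonneg fun _ _ => h0 _ _ _]
  constructor
  · intro h1
    by_contra! hcon
    obtain ⟨⟨i, hi, his⟩, j, hj, hjc⟩ := hcon
    have h2 := (Finset.sum_eq_zero_iff_of_nonneg fun _ _ => Finset.sum_nonneg fun _ _ => h0 _ _ _).1
      (h1 i (by simp [his])) j (by simp [hjc])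
    have h3 := (Finset.sum_eq_zero_iff_of_nonneg fun _ _ => h0 _ _ _).1 h2
      (s.2 + (H.shift s.1 j : ZMod m)) (Finset.mem_univ _)
    have h4 : (rectChain H x.1 s t).1 i j (s.2 + (H.shift s.1 j : ZMod m)) = 1 :=
      if_pos ⟨hi, hj, rfl⟩
    omega
  · intro h1 i hi
    refine Finset.sum_eq_zero fun j hj => Finset.sum_eq_zero fun a _ => if_neg ?_
    rintro ⟨h2, h3, -⟩
    rcases h1 with h1 | h1
    · exact (Finset.mem_filter.1 hi).2 (h1 i h2)
    · exact (Finset.mem_filter.1 hj).2 (h1 j h3)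

/-- The filtration exists. -/
theorem exists_isQFunction (h : IsStabilization G H ρ c) : ∃ Q : H.Gen m → ℤ, IsQFunction H ρ c Q := by
  set l : Fin (n + 1) → Fin (n + 1) → ℤ := fun i j =>
    if j = c then 0 else (if i = ρ.succ then 0 else 1) - n * (if i = H.O j then 1 else 0) with hl
  have hcard : ∀ k : Fin (n + 1), ∑ i : Fin (n + 1), (if i = k then (0 : ℤ) else 1) = n := by
    intro k
    rw [Fin.sum_univ_succAbove _ k]
    simp [Fin.succAbove_ne]
  have h1 : ∀ i, ∑ j, l i j = 0 := by
    intro i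
    rw [Fin.sum_univ_succAbove _ c]
    have e : ∑ j : Fin n, (if i = H.O (c.succAbove j) then (1 : ℤ) else 0) =
        1 - if i = ρ.succ then 1 else 0 := by
      have := sum_marked H.O i
      rw [Fin.sum_univ_succAbove _ c, h.O_new] at this
      linarith
    simp only [hl, if_true, Fin.succAbove_ne, if_false, zero_add, Finset.sum_sub_distrib,
      ← Finset.mul_sum, e]
    split_ifs <;> simp
  have h2 : ∀ j, ∑ i, l i j = 0 := by
    intro j
    by_cases hj : j = c
    · simp [hl, hj]
    · simp only [hl, if_neg hj, Finset.sum_sub_distrib, hcard, ← Finset.mul_sum, Finset.sum_ite_eq',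
        Finset.mem_univ, if_true, mul_one, sub_self]
  obtain ⟨g, hg⟩ := exists_difference ρ l h1 h2
  refine ⟨fun x => ∑ q, g q.1 (x.1 q).1, fun x y p hp hf => ?_⟩
  rw [← hp.sum_mul g, qCount, Finset.sum_filter]
  refine Finset.sum_congr rfl fun i _ => ?_
  rw [show (if i ≠ ρ.succ then ∑ j ∈ Finset.univ.filter (· ≠ c), ∑ a, p.1 i j a else 0) =
    ∑ j, if i ≠ ρ.succ ∧ j ≠ c then ∑ a, p.1 i j a else 0 by
      by_cases hi : i = ρ.succ <;> simp [hi, Finset.sum_filter]]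
  refine Finset.sum_congr rfl fun j _ => ?_
  rw [hg]
  simp only [hl]
  by_cases hj : j = c
  · simp [hj]
  · by_cases hi : i = H.O j
    · have h0 : ∑ a, p.1 i j a = 0 := Finset.sum_eq_zero fun a _ => by
        rw [hi]; exact (hf.1 j hj a).2
      simp [h0]
    · simp [hi, hj]

end Filtration

/-! ### Pairs of generators that differ by a thin rectangle at the new column -/

section Pairing

variable (ρ c) in
/-- The components on the two sides of the new column in the sheet `k` do not lie on the new row. -/
def Free (σ : State (n + 1) m) (k : ZMod m) : Prop :=
  (σ.symm (c, k)).1 ≠ ρ.succ ∧ (σ.symm (c + 1, k)).1 ≠ ρ.succ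

variable (ρ c) in
/-- A sheet that is free, if there is one. -/
def mark (σ : State (n + 1) m) : ZMod m := Classical.epsilon (Free ρ c σ)

variable (ρ c) in
/-- There is a thin rectangle at the marked sheet. -/
def IsPos (σ : State (n + 1) m) : Prop :=
  Free ρ c σ (mark ρ c σ) ∧
    cycIoo ρ.succ (σ.symm (c + 1, mark ρ c σ)).1 (σ.symm (c, mark ρ c σ)).1

variable (ρ c) in
/-- There is a thin rectangle into the state at the marked sheet. -/
def IsNeg (σ : State (n + 1) m) : Prop :=
  Free ρ c σ (mark ρ c σ) ∧
    ¬ cycIoo ρ.succ (σ.symm (c + 1, mark ρ c σ)).1 (σ.symm (c, mark ρ c σ)).1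

variable (c) in
/-- The components on the two sides of the new column in the sheet `k` are exchanged. -/
def exchange (k : ZMod m) (σ : State (n + 1) m) : State (n + 1) m :=
  σ.trans (swap (c, k) (c + 1, k))

variable (ρ c) in
/-- The other end of the thin rectangle at the marked sheet. -/
def thinSwap (σ : State (n + 1) m) : State (n + 1) m := exchange c (mark ρ c σ) σ

variable {σ : State (n + 1) m}

theorem free_mark {k : ZMod m} (hk : Free ρ c σ k) : Free ρ c σ (mark ρ c σ) :=
  Classical.epsilon_spec (p := Free ρ c σ) ⟨k, hk⟩

theorem exchange_symm (k : ZMod m) (q : Curve (n + 1) m) :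
    (exchange c k σ).symm q = σ.symm (swap (c, k) (c + 1, k) q) := by
  simp [exchange]

theorem exchange_exchange (k : ZMod m) : exchange c k (exchange c k σ) = σ := by
  ext1 p
  simp [exchange]

theorem exchange_eq_mv (k : ZMod m) :
    exchange c k σ = mv σ (σ.symm (c, k)) (σ.symm (c + 1, k)) := by
  refine Equiv.symm_bijective.injective (Equiv.ext fun q => ?_)
  rw [exchange_symm, mv_symm_apply]
  exact Function.Injective.map_swap σ.symm.injective _ _ _

theorem free_exchange {k : ZMod m} (hk : Free ρ c σ k) : Free ρ c (exchange c k σ) = Free ρ c σ := by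
  funext k'
  have hc := add_one_ne ρ c
  by_cases h : k' = k
  · subst h
    simp only [Free, exchange_symm, swap_apply_left, swap_apply_right]
    exact propext and_comm
  · have h1 : ∀ i j : Fin (n + 1), (i, k') ≠ (j, k) := fun i j e => h (congrArg Prod.snd e)
    simp only [Free, exchange_symm, swap_apply_of_ne_of_ne (h1 _ _) (h1 _ _)]

theorem mark_exchange {k : ZMod m} (hk : Free ρ c σ k) :
    mark ρ c (exchange c k σ) = mark ρ c σ := by
  rw [mark, free_exchange hk, mark]

theorem thinSwap_thinSwap (hk : Free ρ c σ (mark ρ c σ)) : thinSwap ρ c (thinSwap ρ c σ) = σ := by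
  rw [thinSwap, thinSwap, mark_exchange hk, exchange_exchange]

theorem isPos_exchange {k : ZMod m} (hk : Free ρ c σ k) (hne : k ≠ mark ρ c σ) :
    IsPos ρ c (exchange c k σ) ↔ IsPos ρ c σ := by
  have h1 : ∀ i j : Fin (n + 1), (i, mark ρ c σ) ≠ (j, k) := fun i j e => hne (congrArg Prod.snd e).symm
  simp only [IsPos, mark_exchange hk, free_exchange hk, exchange_symm,
    swap_apply_of_ne_of_ne (h1 _ _) (h1 _ _)]

theorem row_ne_of_free (h : IsStabilization G H ρ c) (hσ : H.IsGen σ) {k : ZMod m}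
    (hk : Free ρ c σ k) : (σ.symm (c, k)).1 ≠ (σ.symm (c + 1, k)).1 := by
  intro e
  have h1 := hσ (σ.symm (c, k))
  have h2 := hσ (σ.symm (c + 1, k))
  rw [Equiv.apply_symm_apply] at h1 h2
  have h3 := Grid.Meets.left_unique (D := H) h1 ((h.meets_add_one hk.2).1 h2) e
  exact add_one_ne ρ c (congrArg Prod.fst (σ.symm.injective h3)).symm

theorem isGen_exchange (h : IsStabilization G H ρ c) (hσ : H.IsGen σ) {k : ZMod m}
    (hk : Free ρ c σ k) : H.IsGen (exchange c k σ) := by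
  have h1 := hσ (σ.symm (c, k))
  have h2 := hσ (σ.symm (c + 1, k))
  rw [Equiv.apply_symm_apply] at h1 h2
  rw [exchange_eq_mv]
  refine hσ.mv ?_ ?_ <;> rw [Equiv.apply_symm_apply]
  · exact (h.meets_add_one hk.1).2 h1
  · exact (h.meets_add_one hk.2).1 h2

theorem isNeg_thinSwap (hσ : IsPos ρ c σ) : IsNeg ρ c (thinSwap ρ c σ) := by
  obtain ⟨h1, h2⟩ := hσ
  rw [IsNeg, thinSwap, mark_exchange h1, free_exchange h1]
  refine ⟨h1, ?_⟩
  rw [exchange_symm, exchange_symm, swap_apply_left, swap_apply_right]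
  grind

theorem isPos_thinSwap (h : IsStabilization G H ρ c) (hg : H.IsGen σ) (hσ : IsNeg ρ c σ) :
    IsPos ρ c (thinSwap ρ c σ) := by
  obtain ⟨h1, h2⟩ := hσ
  rw [IsPos, thinSwap, mark_exchange h1, free_exchange h1]
  refine ⟨h1, ?_⟩
  rw [exchange_symm, exchange_symm, swap_apply_left, swap_apply_right]
  have h3 := row_ne_of_free h hg h1
  obtain ⟨h4, h5⟩ := h1
  grind

theorem stateI_or_stateJ [NeZero m] (h : IsStabilization G H ρ c) (hσ : H.IsGen σ) (h1 : ¬ IsPos ρ c σ)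
    (h2 : ¬ IsNeg ρ c σ) : StateI H ρ c σ ∨ StateJ H ρ c σ := by
  have h3 : ∀ k, σ (alphaThrough H ρ c k) = (c, k) ∨ σ (alphaThrough H ρ c (k + 1)) = (c + 1, k) := by
    intro k
    have h4 : ¬ Free ρ c σ k := fun hk => by
      have := free_mark hk
      by_cases h5 : cycIoo ρ.succ (σ.symm (c + 1, mark ρ c σ)).1 (σ.symm (c, mark ρ c σ)).1
      · exact h1 ⟨this, h5⟩
      · exact h2 ⟨this, h5⟩
    have h5 := hσ (σ.symm (c, k))
    have h6 := hσ (σ.symm (c + 1, k))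
    rw [Equiv.apply_symm_apply] at h5 h6
    rw [Free, not_and_or, not_not, not_not] at h4
    rcases h4 with h4 | h4
    · left
      rw [← eq_alphaThrough' h4 h5, Equiv.apply_symm_apply]
    · right
      rw [← eq_alphaThrough h h4 h6, Equiv.apply_symm_apply]
  by_cases h4 : ∃ k, σ (alphaThrough H ρ c k) = (c, k)
  · left
    obtain ⟨k, hk⟩ := h4
    have h5 : ∀ j : ℕ, σ (alphaThrough H ρ c (k - j)) = (c, k - j) := by
      intro j
      induction j with
      | zero => simpa using hk
      | succ j ih =>
        refine (h3 (k - (j + 1 : ℕ))).resolve_right fun h6 => ?_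
        have e : k - ((j + 1 : ℕ) : ZMod m) + 1 = k - j := by push_cast; ring
        rw [e, ih] at h6
        exact add_one_ne ρ c (congrArg Prod.fst h6).symm
    intro k'
    have := h5 (k - k').val
    rwa [ZMod.natCast_val, ZMod.cast_id', id, sub_sub_cancel] at this
  · right
    push Not at h4
    exact fun k => (h3 k).resolve_left (h4 k)

theorem StateI.not_free (hI : StateI H ρ c σ) (k : ZMod m) : ¬ Free ρ c σ k := fun hk =>
  hk.1 (by rw [← hI k, Equiv.symm_apply_apply]; rfl)

theorem StateJ.not_free (hJ : StateJ H ρ c σ) (k : ZMod m) : ¬ Free ρ c σ k := fun hk =>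
  hk.2 (by rw [← hJ k, Equiv.symm_apply_apply]; rfl)

theorem StateI.not_stateJ (hI : StateI H ρ c σ) : ¬ StateJ H ρ c σ := fun hJ =>
  add_one_ne ρ c (congrArg Prod.fst ((hJ 0).symm.trans (hI _)))

/-! ### Triangularity of the boundary operator -/

variable {x y : H.Gen m} {s t : Curve (n + 1) m}

theorem IsPos.rect (h : IsStabilization G H ρ c) (hx : IsPos ρ c x.1) :
    H.Rect x.1 (x.1.symm (c, mark ρ c x.1)) (x.1.symm (c + 1, mark ρ c x.1)) := by
  have := NPlus.rect (σ := x.1) (e := ρ.castSucc) (k := mark ρ c x.1) h x.2 (castSucc_ne_succ ρ)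
  rw [NPlus, loc, loc, colAt_self, h.colAt_add_one (castSucc_ne_succ ρ)] at this
  exact this hx.2

theorem Grid.Rect.eq_exchange (h : IsStabilization G H ρ c) (hr : H.Rect x.1 s t)
    (hc : ∀ j, cycIco (x.1 s).1 (x.1 t).1 j → j = c) :
    ∃ k, Free ρ c x.1 k ∧ mv x.1 s t = exchange c k x.1 := by
  have h1 := hr.row
  have h2 := hr.col
  have hs : (x.1 s).1 = c := hc _ (by grind)
  have ht : (x.1 t).1 = c + 1 := by
    by_contra ht
    refine add_one_ne ρ c (hc _ ?_)
    have := val_add_one_cases ρ c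
    have := (x.1 t).1.2
    grind
  have h3 := hr.noMarking c (by rw [cycIco_iff]; rw [fin_ne_iff, ← hs] at *; omega)
  rw [h.X_new, h.O_new] at h3
  have hs' : s.1 ≠ ρ.succ := fun e => h3.2 (by rw [cycIco_iff]; have := congrArg Fin.val e; omega)
  have ht' : t.1 ≠ ρ.succ := fun e => h3.1 (by
    have := congrArg Fin.val e
    have := Fin.val_succ ρ
    have := Fin.val_castSucc ρ
    have := s.1.2
    grind)
  obtain ⟨k, hk⟩ : ∃ k, x.1 s = (c, k) := ⟨_, Prod.ext hs rfl⟩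
  have hm : H.Meets s (c + 1, k) := (h.meets_add_one hs').2 (hk ▸ x.2 s)
  have hk' : x.1 t = (c + 1, k) := Grid.Meets.right_unique (D := H) (q' := (c + 1, k)) hr.ms hm ht
  have e1 : x.1.symm (c, k) = s := by rw [← hk, Equiv.symm_apply_apply]
  have e2 : x.1.symm (c + 1, k) = t := by rw [← hk', Equiv.symm_apply_apply]
  exact ⟨k, ⟨by rwa [e1], by rwa [e2]⟩, by rw [exchange_eq_mv, e1, e2]⟩

variable [NeZero m]

variable (H ρ c) in
/-- The distances of the components on the new row from the new column. -/
def spread (σ : State (n + 1) m) : ℤ :=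
  ∑ k, (((σ (alphaThrough H ρ c k)).1 - (c + 1) : Fin (n + 1)) : ℕ)

theorem spread_exchange {k : ZMod m} (hk : Free ρ c σ k) :
    spread H ρ c (exchange c k σ) = spread H ρ c σ := by
  refine Finset.sum_congr rfl fun a _ => ?_
  rw [exchange_eq_mv, mv_of_ne]
  · exact fun e => hk.1 (congrArg Prod.fst e).symm
  · exact fun e => hk.2 (congrArg Prod.fst e).symm

theorem Grid.Rect.spread_lt (h : IsStabilization G H ρ c) (hr : H.Rect x.1 s t)
    (hc : ∀ i, cycIco s.1 t.1 i → i = ρ.succ) : spread H ρ c x.1 < spread H ρ c (mv x.1 s t) := by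
  have h1 := hr.row
  have h2 := hr.col
  have hs : s.1 = ρ.succ := hc _ (by grind)
  have ht : t.1 ≠ ρ.succ := hs ▸ h1.symm
  have h3 : ¬ cycIco (x.1 s).1 (x.1 t).1 c := fun hj => (hr.noMarking c hj).2 (by
    rw [h.O_new, ← hs, cycIco_iff]; omega)
  have hlt : (((x.1 s).1 - (c + 1) : Fin (n + 1)) : ℕ) < ((x.1 t).1 - (c + 1) : Fin (n + 1)) := by
    change cycIco _ _ _
    have := val_add_one_cases ρ c
    have := (x.1 t).1.2
    have := (x.1 s).1.2
    grind
  obtain ⟨a, rfl⟩ := exists_eq_alphaThrough H c hs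
  refine Finset.sum_lt_sum (fun k _ => ?_) ⟨a, Finset.mem_univ _, ?_⟩
  · by_cases hk : k = a
    · subst hk
      rw [mv_left]
      exact_mod_cast hlt.le
    · rw [mv_of_ne]
      · exact fun e => hk (alphaThrough_injective H ρ c e)
      · exact fun e => ht (congrArg Prod.fst e).symm
  · rw [mv_left]
    exact_mod_cast hlt

variable {Q : H.Gen m → ℤ}

theorem level_eq_of_thinSwap (h : IsStabilization G H ρ c) (hQ : IsQFunction H ρ c Q)
    (hx : IsPos ρ c x.1) (hy : y.1 = thinSwap ρ c x.1) : Q x = Q y := by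
  rw [thinSwap, exchange_eq_mv] at hy
  refine ((hx.rect h).eq_of_level h hQ hy).2 (Or.inr fun j hj => ?_)
  simp only [Equiv.apply_symm_apply] at hj
  have := val_add_one_cases ρ c
  have := j.2
  grind

/-- Apart from the thin rectangle at the marked sheet, the boundary of a generator with this rectangle
leads out of the set of these generators only if the filtration decreases or the spread increases. -/
theorem triangular (h : IsStabilization G H ρ c) (hQ : IsQFunction H ρ c Q)
    (S : SignAssignment (Curve (n + 1) m) (Curve (n + 1) m)) (o : Orientation (n + 1) m)
    (hx : IsPos ρ c x.1) (hy : IsNeg ρ c y.1) (hc : H.coeff S o x y ≠ 0) :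
    y.1 = thinSwap ρ c x.1 ∨ Q y < Q x ∨ (Q y = Q x ∧ spread H ρ c x.1 < spread H ρ c y.1) := by
  have hle := (coeff_drops S o h hc).le hQ
  obtain ⟨s, t, hr⟩ := Grid.exists_isRect_of_coeff_ne_zero S o hc
  obtain ⟨hr, hy'⟩ := Grid.isRect_iff.1 hr
  rcases hle.lt_or_eq with hlt | heq
  · exact Or.inr (Or.inl hlt)
  rcases (hr.eq_of_level h hQ hy').1 heq.symm with h1 | h1
  · exact Or.inr (Or.inr ⟨heq, hy' ▸ hr.spread_lt h h1⟩)
  · left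
    obtain ⟨k, hk, he⟩ := hr.eq_exchange h h1
    rw [hy', he]
    by_cases hm : k = mark ρ c x.1
    · rw [hm]; rfl
    · exact absurd ((isPos_exchange hk hm).2 hx).2 (by rw [← he, ← hy']; exact hy.2)

theorem coeff_thinSwap (h : IsStabilization G H ρ c)
    (S : SignAssignment (Curve (n + 1) m) (Curve (n + 1) m)) (o : Orientation (n + 1) m)
    (hx : IsPos ρ c x.1) (hy : y.1 = thinSwap ρ c x.1) : ∃ ε : ℤˣ, H.coeff S o x y = ε := by
  set r := x.1.symm (c, mark ρ c x.1) with hr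
  set t := x.1.symm (c + 1, mark ρ c x.1) with ht
  have hR : H.Rect x.1 r t := hx.rect h
  rw [thinSwap, exchange_eq_mv, ← hr, ← ht] at hy
  have hxr : x.1 r = (c, mark ρ c x.1) := by simp [hr]
  have hxt : x.1 t = (c + 1, mark ρ c x.1) := by simp [ht]
  have hrt : r ≠ t := fun e => hR.row (congrArg Prod.fst e)
  have hn : ¬ H.Rect x.1 t r := by
    intro hR'
    obtain ⟨j, hj⟩ := H.O.surjective t.1
    refine (hR'.noMarking j ?_).2 ?_
    · rw [hxr, hxt]
      have hjc : j ≠ c := by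
        rintro rfl
        exact hx.1.2 (hj.symm.trans h.O_new)
      have := val_add_one_cases ρ c
      have := j.2
      rw [cycIco_iff]
      simp only
      omega
    · have := hR.row
      rw [hj, cycIco_iff]
      omega
  have hu : ∀ u v, H.IsRect x y u v → u = r ∧ v = t := by
    intro u v huv
    obtain ⟨h1, h2⟩ := Grid.isRect_iff.1 huv
    have h3 : mv x.1 u v r = x.1 t := by rw [← h2, hy, mv_left]
    have h4 : r = u ∨ r = v := by
      by_contra! h4
      rw [mv_of_ne _ h4.1 h4.2] at h3
      exact hrt (x.1.injective h3)
    rcases h4 with rfl | rfl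
    · rw [mv_left] at h3
      exact ⟨rfl, x.1.injective h3⟩
    · rw [mv_right] at h3
      obtain rfl := x.1.injective h3
      exact absurd h1 hn
  refine ⟨S.sign (H.formal o x) (rectMove o r t), ?_⟩
  rw [Grid.coeff, Finset.sum_eq_single r, Finset.sum_eq_single t]
  · exact if_pos (Grid.isRect_iff.2 ⟨hR, hy⟩)
  · exact fun v _ hv => if_neg fun h1 => hv (hu _ _ h1).2
  · simp
  · exact fun u _ hur => Finset.sum_eq_zero fun v _ => if_neg fun h1 => hur (hu _ _ h1).1
  · simp

end Pairing

/-! ### Quasi-isomorphisms and cancellation -/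

section Cancellation

variable {M M' : Type} [AddCommGroup M] [AddCommGroup M'] {d : M →ₗ[ℤ] M} {d' : M' →ₗ[ℤ] M'}
  {F : M →ₗ[ℤ] M'}

theorem homology_mk_eq_zero_iff {v : LinearMap.ker d} :
    (Submodule.Quotient.mk v : Homology d) = 0 ↔ ∃ u, d u = v := by
  rw [Submodule.Quotient.mk_eq_zero]
  rfl

/-- The pairs of elements of `P` whose boundaries are in `P` as well represent all homology classes. -/
structure Cancels (d : M →ₗ[ℤ] M) (F : M →ₗ[ℤ] M') (P : Submodule ℤ M) : Prop where
  surj : ∀ v c', ∃ x ∈ P, v - d x ∈ P ∧ F x = c'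
  inj : ∀ x ∈ P, d x ∈ P → F x = 0 → x = 0

variable {P : Submodule ℤ M}

theorem Cancels.chainMap (hP : Cancels d F P) (hd : d ∘ₗ d = 0)
    (h : ∀ x ∈ P, d' (F x) = F (d x)) : d' ∘ₗ F = F ∘ₗ d := by
  refine LinearMap.ext fun v => ?_
  obtain ⟨x, hx, hv, hF⟩ := hP.surj v 0
  have h1 := h _ hv
  have h2 := h x hx
  have h3 : d (d x) = 0 := LinearMap.congr_fun hd x
  rw [hF, map_zero] at h2
  rw [map_sub, map_sub, map_sub, ← h2, map_zero, sub_zero, h3, sub_zero] at h1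
  exact h1

theorem Cancels.exists_cycle (hP : Cancels d F P) (hd : d ∘ₗ d = 0) (hF : d' ∘ₗ F = F ∘ₗ d) {c' : M'}
    (hc : d' c' = 0) : ∃ v, d v = 0 ∧ F v = c' := by
  obtain ⟨x, hx, hv, rfl⟩ := hP.surj 0 c'
  rw [zero_sub, neg_mem_iff] at hv
  have h3 : d (d x) = 0 := LinearMap.congr_fun hd x
  have h4 : d' (F x) = F (d x) := LinearMap.congr_fun hF x
  exact ⟨x, hP.inj _ hv (h3 ▸ P.zero_mem) (h4 ▸ hc), rfl⟩

theorem Cancels.exists_bounding (hP : Cancels d F P) (hd : d ∘ₗ d = 0) (hF : d' ∘ₗ F = F ∘ₗ d) {v : M}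
    (hv : d v = 0) {c' : M'} (hc : d' c' = F v) : ∃ w, d w = v := by
  obtain ⟨x, hx, hvx, rfl⟩ := hP.surj v c'
  have h3 : d (d x) = 0 := LinearMap.congr_fun hd x
  have h4 : d' (F x) = F (d x) := LinearMap.congr_fun hF x
  refine ⟨x, (sub_eq_zero.1 (hP.inj _ hvx ?_ ?_)).symm⟩
  · rw [map_sub, hv, h3, sub_zero]
    exact P.zero_mem
  · rw [map_sub, ← h4, hc, sub_self]

theorem Cancels.isQuasiIso (hP : Cancels d F P) (hd : d ∘ₗ d = 0) (hF : d' ∘ₗ F = F ∘ₗ d) :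
    IsQuasiIso d d' F := by
  refine ⟨hF, (injective_iff_map_eq_zero _).2 fun a ha => ?_, fun b => ?_⟩
  · obtain ⟨⟨v, hv⟩, rfl⟩ := Submodule.Quotient.mk_surjective _ a
    obtain ⟨u, hu⟩ := homology_mk_eq_zero_iff.1 ha
    exact homology_mk_eq_zero_iff.2 (hP.exists_bounding hd hF hv hu)
  · obtain ⟨⟨w, hw⟩, rfl⟩ := Submodule.Quotient.mk_surjective _ b
    obtain ⟨v, hv, rfl⟩ := hP.exists_cycle hd hF hw
    exact ⟨Submodule.Quotient.mk ⟨v, hv⟩, rfl⟩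

variable {Fil : ℤ → Submodule ℤ M} {Fil' : ℤ → Submodule ℤ M'}

theorem isQuasiIso_grMap (hd : d ∘ₗ d = 0) (hF : d' ∘ₗ F = F ∘ₗ d)
    (hs : ∀ k, ∀ v ∈ Fil k, ∀ c' ∈ Fil' k, ∃ x ∈ P, x ∈ Fil k ∧ v - d x ∈ P ∧ F x = c')
    (hi : ∀ x ∈ P, d x ∈ P → F x = 0 → x = 0) (fH : IsFiltered Fil Fil d) (f' : IsFiltered Fil' Fil' d')
    (fF : IsFiltered Fil Fil' F) (k : ℤ) :
    IsQuasiIso (grMap fH k) (grMap f' k) (grMap fF k) := by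
  have hc : Cancels (grMap fH k) (grMap fF k)
      ((P.submoduleOf (Fil k)).map (Submodule.mkQ ((Fil (k - 1)).submoduleOf (Fil k)))) := by
    constructor
    · intro v c'
      obtain ⟨⟨v, hv⟩, rfl⟩ := Submodule.Quotient.mk_surjective _ v
      obtain ⟨⟨c', hc⟩, rfl⟩ := Submodule.Quotient.mk_surjective _ c'
      obtain ⟨x, hx, hxk, h1, rfl⟩ := hs k v hv c' hc
      exact ⟨Submodule.Quotient.mk ⟨x, hxk⟩, ⟨⟨x, hxk⟩, hx, rfl⟩,
        ⟨⟨v, hv⟩ - ⟨d x, fH k x hxk⟩, h1, rfl⟩, rfl⟩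
    · rintro _ ⟨⟨x, hxk⟩, hx, rfl⟩ ⟨⟨p, hpk⟩, hp, h1⟩ h2
      have h3 : p - d x ∈ Fil (k - 1) :=
        (Submodule.Quotient.eq ((Fil (k - 1)).submoduleOf (Fil k)) (x := ⟨p, hpk⟩) (y := ⟨d x, fH k x hxk⟩)).1 h1
      change (Submodule.Quotient.mk (⟨F x, fF k x hxk⟩ : Fil' k) : Gr Fil' k) = 0 at h2
      rw [Submodule.Quotient.mk_eq_zero] at h2
      have h4 : F x ∈ Fil' (k - 1) := h2
      obtain ⟨x', hx', hxk', h5, h6⟩ := hs (k - 1) _ (neg_mem h3) _ h4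
      have h7 : x - x' = 0 := by
        refine hi _ (P.sub_mem hx hx') ?_ ?_
        · have : d (x - x') = p + (-(p - d x) - d x') := by rw [map_sub]; abel
          rw [this]
          exact P.add_mem hp h5
        · rw [map_sub, h6, sub_self]
      rw [sub_eq_zero] at h7
      exact (Submodule.Quotient.mk_eq_zero _).2 (show x ∈ Fil (k - 1) from h7 ▸ hxk')
  refine hc.isQuasiIso (LinearMap.ext fun v => ?_) (LinearMap.ext fun v => ?_)
  · obtain ⟨⟨v, hv⟩, rfl⟩ := Submodule.Quotient.mk_surjective _ v
    have : d (d v) = 0 := LinearMap.congr_fun hd v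
    exact (Submodule.Quotient.mk_eq_zero _).2 (show d (d v) ∈ Fil (k - 1) from this ▸ Submodule.zero_mem _)
  · obtain ⟨⟨v, hv⟩, rfl⟩ := Submodule.Quotient.mk_surjective _ v
    exact congrArg Submodule.Quotient.mk (Subtype.ext (LinearMap.congr_fun hF v))

end Cancellation

/-! ### The homology of a shifted sum -/

section Splitting

variable {M N : Type} [AddCommGroup M] [AddCommGroup N] {d : M →ₗ[ℤ] M} {dN : N →ₗ[ℤ] N}

/-- The map in homology that is induced by a map that commutes with the differentials up to a sign. -/
def inducedMap (f : M →ₗ[ℤ] N) (ε : ℤˣ) (hf : ∀ v, dN (f v) = (ε : ℤ) • f (d v)) :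
    Homology d →ₗ[ℤ] Homology dN :=
  Submodule.mapQ _ _
    (f.restrict (p := LinearMap.ker d) (q := LinearMap.ker dN) fun v hv => by
      rw [LinearMap.mem_ker] at *
      rw [hf, hv, map_zero, smul_zero]) <| by
    rintro ⟨v, hv⟩ ⟨w, hw⟩
    change d w = v at hw
    refine ⟨(ε : ℤ) • f w, ?_⟩
    change dN _ = f v
    rw [map_smul, hf, hw, smul_smul, ← Units.val_mul, ← sq, Int.units_sq, Units.val_one, one_smul]

theorem exists_splitting {P : Submodule ℤ M} {F : M →ₗ[ℤ] N × N} (hP : Cancels d F P) (hd : d ∘ₗ d = 0)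
    (hF : (-dN).prodMap dN ∘ₗ F = F ∘ₗ d) :
    ∃ Φ : Homology d ≃ₗ[ℤ] Homology dN ⊗[ℤ] (ℤ × ℤ), ∀ (V : Submodule ℤ M) (W W' : Submodule ℤ N),
      (∀ v ∈ V, (F v).1 ∈ W ∧ (F v).2 ∈ W') →
      (∀ v, d v = 0 → (F v).1 ∈ W → (F v).2 ∈ W' → ∃ v' ∈ V, d v' = 0 ∧ F v' = F v) →
      (homologyPart d V).map Φ.toLinearMap =
        (homologyPart dN W).map ((TensorProduct.mk ℤ (Homology dN) (ℤ × ℤ)).flip (1, 0)) ⊔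
          (homologyPart dN W').map ((TensorProduct.mk ℤ (Homology dN) (ℤ × ℤ)).flip (0, 1)) := by
  have h1 : ∀ v, dN (F v).1 = ((-1 : ℤˣ) : ℤ) • (F (d v)).1 := fun v => by
    have := congrArg Prod.fst (LinearMap.congr_fun hF v)
    simp only [LinearMap.comp_apply, LinearMap.prodMap_apply, LinearMap.neg_apply] at this
    simp [← this]
  have h2 : ∀ v, dN (F v).2 = ((1 : ℤˣ) : ℤ) • (F (d v)).2 := fun v => by
    have := congrArg Prod.snd (LinearMap.congr_fun hF v)
    simp only [LinearMap.comp_apply, LinearMap.prodMap_apply] at this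
    simp [← this]
  let Φ₀ : Homology d →ₗ[ℤ] Homology dN × Homology dN :=
    (inducedMap (LinearMap.fst ℤ N N ∘ₗ F) (-1) h1).prod (inducedMap (LinearMap.snd ℤ N N ∘ₗ F) 1 h2)
  have hbij : Function.Bijective Φ₀ := by
    refine ⟨(injective_iff_map_eq_zero _).2 fun a ha => ?_, fun b => ?_⟩
    · obtain ⟨⟨v, hv⟩, rfl⟩ := Submodule.Quotient.mk_surjective _ a
      obtain ⟨u, hu⟩ := homology_mk_eq_zero_iff.1 (congrArg Prod.fst ha)
      obtain ⟨u', hu'⟩ := homology_mk_eq_zero_iff.1 (congrArg Prod.snd ha)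
      refine homology_mk_eq_zero_iff.2 (hP.exists_bounding hd hF hv (c' := (-u, u')) ?_)
      refine Prod.ext ?_ hu'
      simpa using hu
    · obtain ⟨b, b'⟩ := b
      obtain ⟨⟨w, hw⟩, rfl⟩ := Submodule.Quotient.mk_surjective _ b
      obtain ⟨⟨w', hw'⟩, rfl⟩ := Submodule.Quotient.mk_surjective _ b'
      rw [LinearMap.mem_ker] at hw hw'
      obtain ⟨v, hv, hFv⟩ := hP.exists_cycle hd hF (c' := (w, w')) (by simp [hw, hw'])
      refine ⟨Submodule.Quotient.mk ⟨v, hv⟩, Prod.ext ?_ ?_⟩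
      · exact congrArg Submodule.Quotient.mk (Subtype.ext (congrArg Prod.fst hFv))
      · exact congrArg Submodule.Quotient.mk (Subtype.ext (congrArg Prod.snd hFv))
  let T : Homology dN ⊗[ℤ] (ℤ × ℤ) ≃ₗ[ℤ] Homology dN × Homology dN :=
    TensorProduct.prodRight ℤ ℤ (Homology dN) ℤ ℤ ≪≫ₗ
      (TensorProduct.rid ℤ (Homology dN)).prodCongr (TensorProduct.rid ℤ (Homology dN))
  have hT : T.symm.toLinearMap = ((TensorProduct.mk ℤ (Homology dN) (ℤ × ℤ)).flip (1, 0)).coprod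
      ((TensorProduct.mk ℤ (Homology dN) (ℤ × ℤ)).flip (0, 1)) := by
    refine LinearMap.ext fun z => ?_
    rw [LinearEquiv.coe_coe, LinearEquiv.symm_apply_eq]
    change z = T (z.1 ⊗ₜ[ℤ] ((1 : ℤ), (0 : ℤ)) + z.2 ⊗ₜ[ℤ] ((0 : ℤ), (1 : ℤ)))
    rw [map_add]
    change z = ((1 : ℤ) • z.1, (0 : ℤ) • z.1) + ((0 : ℤ) • z.2, (1 : ℤ) • z.2)
    simp
  refine ⟨LinearEquiv.ofBijective Φ₀ hbij ≪≫ₗ T.symm, fun V W W' hV hW => ?_⟩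
  have hΦ : (homologyPart d V).map Φ₀ = (homologyPart dN W).prod (homologyPart dN W') := by
    ext ⟨b, b'⟩
    constructor
    · rintro ⟨_, ⟨v, hv, rfl⟩, hb⟩
      rw [← hb]
      exact ⟨⟨⟨_, _⟩, (hV _ hv).1, rfl⟩, ⟨⟨_, _⟩, (hV _ hv).2, rfl⟩⟩
    · rintro ⟨⟨⟨w, hw⟩, hwW, rfl⟩, ⟨w', hw'⟩, hwW', rfl⟩
      rw [LinearMap.mem_ker] at hw hw'
      obtain ⟨v, hv, hFv⟩ := hP.exists_cycle hd hF (c' := (w, w')) (by simp [hw, hw'])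
      obtain ⟨v', hv', hdv, hFv'⟩ := hW v hv (by rw [hFv]; exact hwW) (by rw [hFv]; exact hwW')
      rw [hFv] at hFv'
      refine ⟨Submodule.Quotient.mk ⟨v', hdv⟩, ⟨⟨v', hdv⟩, hv', rfl⟩, Prod.ext ?_ ?_⟩
      · exact congrArg Submodule.Quotient.mk (Subtype.ext (congrArg Prod.fst hFv'))
      · exact congrArg Submodule.Quotient.mk (Subtype.ext (congrArg Prod.snd hFv'))
  have hcomp : (LinearEquiv.ofBijective Φ₀ hbij ≪≫ₗ T.symm).toLinearMap = T.symm.toLinearMap ∘ₗ Φ₀ := rfl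
  rw [hcomp, Submodule.map_comp, hΦ, hT]
  exact LinearMap.map_coprod_prod _ _ _ _

end Splitting

section Slide

variable (m c) in
/-- The passage from the left to the right side of the new column, one sheet lower on the left. -/
def slide : Curve (n + 1) m ≃ Curve (n + 1) m :=
  Equiv.prodShear (swap c (c + 1)) fun j => if j = c then Equiv.subRight 1 else Equiv.refl _

theorem slide_left (k : ZMod m) : slide m c (c, k) = (c + 1, k - 1) := by simp [slide]

theorem slide_right (ρ : Fin n) (k : ZMod m) : slide m c (c + 1, k) = (c, k) := by
  simp [slide, add_one_ne ρ c]

theorem slide_of_ne {q : Curve (n + 1) m} (h1 : q.1 ≠ c) (h2 : q.1 ≠ c + 1) : slide m c q = q := by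
  simp [slide, h1, swap_apply_of_ne_of_ne h1 h2]

theorem eq_of_cycIco_add_one (ρ : Fin n) {j : Fin (n + 1)} (hj : cycIco c (c + 1) j) : j = c := by
  have := val_add_one_cases ρ c
  have := j.2
  grind

theorem stateI_lift [NeZero m] (h : IsStabilization G H ρ c) (g : G.Gen m) :
    StateI H ρ c (h.lift g).1 := stateI_iff_allI.2 (allI_lift h g)

theorem isGen_slide [NeZero m] (h : IsStabilization G H ρ c) (g : G.Gen m) :
    H.IsGen ((h.lift g).1.trans (slide m c)) := by
  intro p
  have hI := stateI_lift h g
  have hp := (h.lift g).2 p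
  rw [Equiv.trans_apply]
  by_cases h1 : ((h.lift g).1 p).1 = c
  · obtain ⟨k, rfl⟩ := exists_eq_alphaThrough H c (hI.row h1)
    rw [hI, slide_left]
    have := h.meets_alphaThrough_add_one (k - 1)
    rwa [sub_add_cancel] at this
  · by_cases h2 : ((h.lift g).1 p).1 = c + 1
    · obtain ⟨k, hk⟩ : ∃ k, (h.lift g).1 p = (c + 1, k) := ⟨_, Prod.ext h2 rfl⟩
      rw [hk] at hp ⊢
      rw [slide_right ρ]
      refine (h.meets_add_one fun e => h1 (hI.col e)).1 hp
    · rwa [slide_of_ne h1 h2]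

/-- The generator from which a thin polygon leads to the completion of `g`. -/
def IsStabilization.thinLift [NeZero m] (h : IsStabilization G H ρ c) (g : G.Gen m) : H.Gen m :=
  H.toGen ((h.lift g).1.trans (slide m c)) (isGen_slide h g)

variable [NeZero m]

theorem thinLift_apply (h : IsStabilization G H ρ c) (g : G.Gen m) (p : Curve (n + 1) m) :
    (h.thinLift g).1 p = slide m c ((h.lift g).1 p) := rfl

theorem thinLift_injective (h : IsStabilization G H ρ c) :
    Function.Injective (h.thinLift (m := m)) := fun g g' e => by
  refine lift_injective h (Subtype.ext (Equiv.ext fun p => (slide m c).injective ?_))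
  rw [← thinLift_apply, e, thinLift_apply]

theorem thinPolygon_thinLift (h : IsStabilization G H ρ c) (g : G.Gen m) :
    ThinPolygon H ρ c (h.thinLift g).1 (h.lift g).1 := by
  have hI := stateI_lift h g
  refine ⟨fun k => ?_, hI, fun k => ?_, fun p h1 h2 => ?_⟩
  · rw [thinLift_apply, hI, slide_left, add_sub_cancel_right]
  · refine (slide m c).injective ?_
    rw [← thinLift_apply, Equiv.apply_symm_apply, slide_right ρ]
  · rw [thinLift_apply] at h2 ⊢
    refine (slide_of_ne (fun e => h1 (hI.row e)) fun e => h2 ?_).symm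
    rw [show (h.lift g).1 p = (c + 1, ((h.lift g).1 p).2) from Prod.ext e rfl, slide_right ρ]

theorem exists_thinLift (h : IsStabilization G H ρ c) {x : H.Gen m} (hJ : StateJ H ρ c x.1) :
    ∃ g, h.thinLift g = x := by
  have h1 : ∀ k, (slide m c).symm (c + 1, k) = (c, k + 1) := fun k => by
    rw [Equiv.symm_apply_eq, slide_left, add_sub_cancel_right]
  have h2 : ∀ k, (slide m c).symm (c, k) = (c + 1, k) := fun k => by
    rw [Equiv.symm_apply_eq, slide_right ρ]
  have hy : H.IsGen (x.1.trans (slide m c).symm) := by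
    intro p
    have hp := x.2 p
    rw [Equiv.trans_apply]
    by_cases h3 : p.1 = ρ.succ
    · obtain ⟨k, rfl⟩ := exists_eq_alphaThrough H c h3
      obtain ⟨k, rfl⟩ : ∃ k', k = k' + 1 := ⟨k - 1, by ring⟩
      rw [hJ, h1]
      exact meets_alphaThrough H ρ c _
    · by_cases h4 : (x.1 p).1 = c
      · obtain ⟨k, hk⟩ : ∃ k, x.1 p = (c, k) := ⟨_, Prod.ext h4 rfl⟩
        rw [hk] at hp ⊢
        rw [h2]
        exact (h.meets_add_one h3).2 hp
      · have : (slide m c).symm (x.1 p) = x.1 p := by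
          rw [Equiv.symm_apply_eq, slide_of_ne h4 fun e => h3 (hJ.row e)]
        rwa [this]
  have hI : StateI H ρ c (H.toGen _ hy).1 := fun k => by
    obtain ⟨k, rfl⟩ : ∃ k', k = k' + 1 := ⟨k - 1, by ring⟩
    rw [Grid.toGen_val, Equiv.trans_apply, hJ, h1]
  obtain ⟨g, hg⟩ := exists_lift h (stateI_iff_allI.1 hI)
  refine ⟨g, Subtype.ext (Equiv.ext fun p => ?_)⟩
  rw [thinLift_apply, hg, Grid.toGen_val, Equiv.trans_apply, Equiv.apply_symm_apply]

theorem poly_thinLift (h : IsStabilization G H ρ c) (g : G.Gen m) (k : ZMod m) :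
    Poly H ρ c (alphaThrough H ρ c (k + 1)) (loc H c (h.thinLift g).1 ρ.castSucc k)
      ((h.thinLift g).1.symm (c, k)) := by
  have hJ := (thinPolygon_thinLift h g).start
  have hk := hJ.symm_row_ne (add_one_ne ρ c) k
  have hm := (h.thinLift g).2 ((h.thinLift g).1.symm (c, k))
  rw [Equiv.apply_symm_apply] at hm
  refine (poly_iff h (h.thinLift g).2).2 ⟨hk, ?_, ?_, ?_, ?_⟩ <;> rw [hJ k]
  · exact add_one_ne ρ c
  · exact (h.meets_add_one hk).2 hm
  · intro j hj
    obtain rfl := eq_of_cycIco_add_one ρ hj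
    refine ⟨fun hn => absurd rfl hn, ?_⟩
    rw [h.O_new, cycIco_iff]
    omega
  · exact fun p _ hp => absurd (eq_of_cycIco_add_one ρ hp.2) hp.1

theorem isPolygon_thinLift (h : IsStabilization G H ρ c) (g : G.Gen m) :
    IsPolygon H ρ c (h.thinLift g) (h.lift g) := by
  have hy := thinPolygon_thinLift h g
  refine (isPolygon_iff h).2 ⟨fun k => ?_, fun k => ?_, fun k => ?_, fun p h1 h2 => ?_⟩
  · have := poly_thinLift h g k
    rwa [loc, colAt_self]
  · rw [hy.final_state, Equiv.apply_symm_apply]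
  · rw [hy.lower, hy.start]
  · refine hy.other p (fun e => ?_) fun e => ?_
    · obtain ⟨k, hk⟩ := exists_eq_alphaThrough H c e
      exact h1 k hk
    · refine h2 ((h.thinLift g).1 p).2 (((h.thinLift g).1.eq_symm_apply).2 (Prod.ext e rfl))

theorem level_thinLift (h : IsStabilization G H ρ c) {Q : H.Gen m → ℤ} (hQ : IsQFunction H ρ c Q)
    (g : G.Gen m) : Q (h.thinLift g) = Q (h.lift g) := by
  have hp := isPolygon_thinLift h g
  rw [← sub_eq_zero, hQ _ _ _ (hp.isPseudoDomain h) (hp.qFine h)]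
  refine Finset.sum_eq_zero fun i _ => Finset.sum_eq_zero fun j hj => Finset.sum_eq_zero fun a _ => ?_
  simp only [polygonChain, Finset.sum_apply]
  refine Finset.sum_eq_zero fun k _ => if_neg ?_
  rintro ⟨-, h1, -⟩
  rw [(thinPolygon_thinLift h g).start] at h1
  exact (Finset.mem_filter.1 hj).2 (eq_of_cycIco_add_one ρ h1)

theorem opR_thinLift (h : IsStabilization G H ρ c) (g : G.Gen m) : ∃ ε : ℤˣ,
    opR H ρ c S o (h.thinLift g).1 (vec o (h.thinLift g).1) = (ε : ℤ) • vec o (h.lift g).1 := by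
  have hJ := (thinPolygon_thinLift h g).start
  obtain ⟨y, hy, he⟩ := exists_isPolygon S o h (x := h.thinLift g) fun k => by
    have := poly_thinLift h g k
    rwa [loc, colAt_self]
  refine ⟨polygonSign H ρ c S o (h.thinLift g), ?_⟩
  rw [hJ.opR_eq S o h, he, hy.unique (isPolygon_thinLift h g)]

theorem stabMap_thinLift (h : IsStabilization G H ρ c) (g : G.Gen m) : ∃ ε : ℤˣ,
    h.stabMap S o (Finsupp.single (h.thinLift g) 1) = (Finsupp.single g (ε : ℤ), 0) := by
  obtain ⟨ε, hε⟩ := opR_thinLift S o h g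
  refine ⟨ε, Prod.ext (evLift_injective h o ?_) (evLift_injective h o ?_)⟩
  · rw [evLift_stabMap_fst, hε, evLift_single]
  · rw [evLift_stabMap_snd, (thinPolygon_thinLift h g).start.opL_zero S o h]
    simp

theorem opR_lift (h : IsStabilization G H ρ c) (g : G.Gen m) : opR H ρ c S o (h.lift g).1 = 0 := by
  refine opR_eq_zero S o 0 (locR_eq_zero_of_row S o ?_)
  rw [loc, colAt_self, ← stateI_lift h g 0, Equiv.symm_apply_apply]
  rfl

theorem stabMap_lift (h : IsStabilization G H ρ c) (g : G.Gen m) :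
    h.stabMap S o (Finsupp.single (h.lift g) 1) = (0, Finsupp.single g 1) := by
  refine Prod.ext (evLift_injective h o ?_) (evLift_injective h o ?_)
  · rw [evLift_stabMap_fst, opR_lift]
    simp
  · rw [evLift_stabMap_snd, (stateI_lift h g).opL_eq S o, evLift_single]
    simp

theorem IsPos.stabMap_eq_zero (h : IsStabilization G H ρ c) {x : H.Gen m} (hx : IsPos ρ c x.1) :
    h.stabMap S o (Finsupp.single x 1) = 0 := by
  refine Prod.ext (evLift_injective h o ?_) (evLift_injective h o ?_)
  · rw [evLift_stabMap_fst, opR_eq_zero S o (mark ρ c x.1) (locR_eq_zero_of_nPlus S o rfl ?_)]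
    · simp
    · rw [NPlus, loc, loc, colAt_self, h.colAt_add_one (castSucc_ne_succ ρ)]
      exact hx.2
  · rw [evLift_stabMap_snd, opL_eq_zero S o (mark ρ c x.1) (locL_eq_zero_of_nPlus S o rfl ?_)]
    · simp
    · rw [NPlus, loc, loc, colAt_self, h.colAt_add_one (succ_add_one_ne_succ ρ)]
      exact hx.2

/-! ### The stabilization map is a chain map on the span of the remaining generators -/

theorem evLift_stabMap_boundary_fst (h : IsStabilization G H ρ c) (x : H.Gen m) :
    evLift h o (h.stabMap S o (H.boundary S o (Finsupp.single x 1))).1 =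
      H.ev o (opR H ρ c S o) (H.boundary S o (Finsupp.single x 1)) := by
  have : evLift h o ∘ₗ LinearMap.fst ℤ _ _ ∘ₗ h.stabMap S o = H.ev o (opR H ρ c S o) := by
    refine Finsupp.lhom_ext' fun x => LinearMap.ext_ring ?_
    simp [evLift_stabMap_fst, Grid.ev]
  exact LinearMap.congr_fun this _

theorem evLift_stabMap_boundary_snd (h : IsStabilization G H ρ c) (x : H.Gen m) :
    evLift h o (h.stabMap S o (H.boundary S o (Finsupp.single x 1))).2 =
      H.ev o (opL H ρ c S o) (H.boundary S o (Finsupp.single x 1)) := by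
  have : evLift h o ∘ₗ LinearMap.snd ℤ _ _ ∘ₗ h.stabMap S o = H.ev o (opL H ρ c S o) := by
    refine Finsupp.lhom_ext' fun x => LinearMap.ext_ring ?_
    simp [evLift_stabMap_snd, Grid.ev]
  exact LinearMap.congr_fun this _

theorem IsPos.stabMap_boundary (h : IsStabilization G H ρ c) {x : H.Gen m} (hx : IsPos ρ c x.1) :
    h.stabMap S o (H.boundary S o (Finsupp.single x 1)) = 0 := by
  refine Prod.ext (evLift_injective h o ?_) (evLift_injective h o ?_)
  · rw [evLift_stabMap_boundary_fst, Grid.ev_boundary,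
      sum_opR_of_nPlus S o (k := mark ρ c x.1) h x.2]
    · simp
    · rw [NPlus, loc, loc, colAt_self, h.colAt_add_one (castSucc_ne_succ ρ)]
      exact hx.2
  · rw [evLift_stabMap_boundary_snd, Grid.ev_boundary,
      sum_opL_of_nPlus S o (k := mark ρ c x.1) h x.2]
    · simp
    · rw [NPlus, loc, loc, colAt_self, h.colAt_add_one (succ_add_one_ne_succ ρ)]
      exact hx.2

theorem stabMap_boundary_lift (h : IsStabilization G H ρ c) (g : G.Gen m) :
    h.stabMap S o (H.boundary S o (Finsupp.single (h.lift g) 1)) =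
      (0, G.boundary (signG H ρ c S o) (orientationG ρ c o) (Finsupp.single g 1)) := by
  have hI := stateI_lift h g
  refine Prod.ext (evLift_injective h o ?_) (evLift_injective h o ?_)
  · rw [evLift_stabMap_boundary_fst, Grid.ev_boundary, hI.sum_opR S o h]
    simp
  · rw [evLift_stabMap_boundary_snd, Grid.ev_boundary, hI.sum_opL S o h (h.lift g).2]
    exact (evLift_boundary h S o g).symm

theorem stabMap_boundary_thinLift (h : IsStabilization G H ρ c) (g : G.Gen m) {ε : ℤˣ}
    (hε : h.stabMap S o (Finsupp.single (h.thinLift g) 1) = (Finsupp.single g (ε : ℤ), 0)) :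
    h.stabMap S o (H.boundary S o (Finsupp.single (h.thinLift g) 1)) =
      (-G.boundary (signG H ρ c S o) (orientationG ρ c o) (Finsupp.single g (ε : ℤ)), 0) := by
  have hy := thinPolygon_thinLift h g
  have h1 := evLift_stabMap_fst S o h (h.thinLift g)
  rw [hε, evLift_single] at h1
  have h2 : Finsupp.single g (ε : ℤ) = (ε : ℤ) • Finsupp.single g (1 : ℤ) := by simp
  refine Prod.ext (evLift_injective h o ?_) (evLift_injective h o ?_)
  · rw [evLift_stabMap_boundary_fst, Grid.ev_boundary, hy.sum_opR S o h (h.thinLift g).2,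
      LinearMap.neg_apply, Module.End.mul_apply, ← h1, map_smul]
    simp only [map_neg, h2, map_smul, evLift_boundary h S o g]
  · rw [evLift_stabMap_boundary_snd, Grid.ev_boundary, hy.sum_opL S o h]
    simp

end Slide

section Elimination

variable (m H ρ c) in
/-- The chains without components at the ends of thin rectangles. -/
def remaining : Submodule ℤ (H.Chain m) := Finsupp.supported ℤ ℤ {x | ¬ IsNeg ρ c x.1}

variable {x y : H.Gen m}

theorem single_mem_remaining {a : ℤ} (hx : ¬ IsNeg ρ c x.1) :
    Finsupp.single x a ∈ remaining m H ρ c := Finsupp.single_mem_supported ℤ a hx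

theorem IsPos.not_isNeg {σ : State (n + 1) m} (hσ : IsPos ρ c σ) : ¬ IsNeg ρ c σ := fun h => h.2 hσ.2

theorem eq_on_remaining {M : Type} [AddCommGroup M] {f g : H.Chain m →ₗ[ℤ] M}
    (hfg : ∀ x : H.Gen m, ¬ IsNeg ρ c x.1 → f (Finsupp.single x 1) = g (Finsupp.single x 1))
    {v : H.Chain m} (hv : v ∈ remaining m H ρ c) : f v = g v := by
  rw [remaining, Finsupp.supported_eq_span_single] at hv
  have : Submodule.span ℤ ((fun x => Finsupp.single x (1 : ℤ)) '' {x : H.Gen m | ¬ IsNeg ρ c x.1}) ≤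
      LinearMap.eqLocus f g := by
    rw [Submodule.span_le]
    rintro _ ⟨x, hx, rfl⟩
    exact hfg x hx
  exact this hv

theorem exists_thinSwap_eq (h : IsStabilization G H ρ c) (hy : IsNeg ρ c y.1) :
    ∃ x : H.Gen m, IsPos ρ c x.1 ∧ y.1 = thinSwap ρ c x.1 :=
  ⟨H.toGen (thinSwap ρ c y.1) (isGen_exchange h y.2 hy.1), isPos_thinSwap h y.2 hy,
    (thinSwap_thinSwap hy.1).symm⟩

theorem levelLE_mono {N : ℕ} {D : Grid N} {Q : D.Gen m → ℤ} {k k' : ℤ} (hk : k ≤ k') :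
    levelLE D Q k ≤ levelLE D Q k' :=
  Finsupp.supported_mono fun _ hx => le_trans hx hk

variable [NeZero m]

theorem not_isNeg_lift (h : IsStabilization G H ρ c) (g : G.Gen m) : ¬ IsNeg ρ c (h.lift g).1 :=
  fun hn => (stateI_lift h g).not_free _ hn.1

theorem not_isNeg_thinLift (h : IsStabilization G H ρ c) (g : G.Gen m) :
    ¬ IsNeg ρ c (h.thinLift g).1 :=
  fun hn => (thinPolygon_thinLift h g).start.not_free _ hn.1

theorem isPos_or_lift_or_thinLift (h : IsStabilization G H ρ c) (hx : ¬ IsNeg ρ c x.1) :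
    IsPos ρ c x.1 ∨ (∃ g, h.lift g = x) ∨ ∃ g, h.thinLift g = x := by
  by_cases hp : IsPos ρ c x.1
  · exact Or.inl hp
  · rcases stateI_or_stateJ h x.2 hp hx with h1 | h1
    · exact Or.inr (Or.inl (exists_lift h (stateI_iff_allI.1 h1)))
    · exact Or.inr (Or.inr (exists_thinLift h h1))

theorem stabMap_comm (h : IsStabilization G H ρ c) {v : H.Chain m} (hv : v ∈ remaining m H ρ c) :
    (-G.boundary (signG H ρ c S o) (orientationG ρ c o)).prodMap
      (G.boundary (signG H ρ c S o) (orientationG ρ c o)) (h.stabMap S o v) =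
      h.stabMap S o (H.boundary S o v) := by
  refine eq_on_remaining (f := (-G.boundary (signG H ρ c S o) (orientationG ρ c o)).prodMap
      (G.boundary (signG H ρ c S o) (orientationG ρ c o)) ∘ₗ h.stabMap S o)
    (g := h.stabMap S o ∘ₗ H.boundary S o) (fun x hx => ?_) hv
  rw [LinearMap.comp_apply, LinearMap.comp_apply]
  rcases isPos_or_lift_or_thinLift h hx with hx | ⟨g, rfl⟩ | ⟨g, rfl⟩
  · rw [hx.stabMap_eq_zero S o h, hx.stabMap_boundary S o h, map_zero]
  · rw [stabMap_lift, stabMap_boundary_lift]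
    simp
  · obtain ⟨ε, hε⟩ := stabMap_thinLift S o h g
    rw [stabMap_boundary_thinLift S o h g hε, hε]
    simp

variable {Q : H.Gen m → ℤ}

variable (ρ c Q) in
/-- The order in which generators are eliminated. -/
def rank (x : H.Gen m) : ℤ ×ₗ ℤ := toLex (Q x, -spread H ρ c x.1)

theorem rank_lt_iff : rank ρ c Q x < rank ρ c Q y ↔
    Q x < Q y ∨ Q x = Q y ∧ spread H ρ c y.1 < spread H ρ c x.1 := by
  rw [rank, rank, Prod.Lex.toLex_lt_toLex, neg_lt_neg_iff]

theorem rank_thinSwap (h : IsStabilization G H ρ c) (hQ : IsQFunction H ρ c Q) (hx : IsPos ρ c x.1)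
    (hy : y.1 = thinSwap ρ c x.1) : rank ρ c Q y = rank ρ c Q x := by
  rw [rank, rank, level_eq_of_thinSwap h hQ hx hy, hy, thinSwap, spread_exchange hx.1]

theorem rank_lt_of_coeff (h : IsStabilization G H ρ c) (hQ : IsQFunction H ρ c Q)
    (hx : IsPos ρ c x.1) (hy : IsNeg ρ c y.1) (hc : H.coeff S o x y ≠ 0)
    (hne : y.1 ≠ thinSwap ρ c x.1) : rank ρ c Q y < rank ρ c Q x :=
  rank_lt_iff.2 ((triangular h hQ S o hx hy hc).resolve_left hne)

/-- Every generator is, up to a boundary, a remaining chain. -/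
theorem exists_reduction_single (h : IsStabilization G H ρ c) (hQ : IsQFunction H ρ c Q)
    (y : H.Gen m) : ∃ x ∈ remaining m H ρ c, x ∈ levelLE H Q (Q y) ∧
      Finsupp.single y 1 - H.boundary S o x ∈ remaining m H ρ c ∧ h.stabMap S o x = 0 := by
  classical
  have wf : WellFounded fun x y : H.Gen m => rank ρ c Q x < rank ρ c Q y :=
    haveI : IsTrans (H.Gen m) fun x y => rank ρ c Q x < rank ρ c Q y := ⟨fun _ _ _ => lt_trans⟩
    haveI : Std.Irrefl fun x y : H.Gen m => rank ρ c Q x < rank ρ c Q y := ⟨fun _ => lt_irrefl _⟩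
    Finite.wellFounded_of_trans_of_irrefl _
  induction y using wf.induction with
  | _ y ih =>
  by_cases hy : IsNeg ρ c y.1
  swap
  · exact ⟨0, Submodule.zero_mem _, Submodule.zero_mem _, by simpa using single_mem_remaining hy, map_zero _⟩
  obtain ⟨x, hx, hxy⟩ := exists_thinSwap_eq h hy
  obtain ⟨ε, hε⟩ := coeff_thinSwap h S o hx hxy
  have hle : Q x = Q y := level_eq_of_thinSwap h hQ hx hxy
  have hz : ∀ z : H.Gen m, ∃ u ∈ remaining m H ρ c, u ∈ levelLE H Q (Q y) ∧
      Finsupp.single z (if z = y then 0 else H.coeff S o x z) - H.boundary S o u ∈ remaining m H ρ c ∧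
        h.stabMap S o u = 0 := by
    intro z
    by_cases hzc : (if z = y then 0 else H.coeff S o x z) = 0
    · exact ⟨0, Submodule.zero_mem _, Submodule.zero_mem _, by simp [hzc], map_zero _⟩
    have hzy : z ≠ y := fun e => hzc (if_pos e)
    rw [if_neg hzy] at hzc ⊢
    by_cases hn : IsNeg ρ c z.1
    · obtain ⟨u, h1, h2, h3, h4⟩ := ih z (by
        rw [rank_thinSwap h hQ hx hxy]
        exact rank_lt_of_coeff S o h hQ hx hn hzc fun e => hzy (Subtype.ext (e.trans hxy.symm)))
      have hzQ : Q z ≤ Q y := hle ▸ (coeff_drops S o h hzc).le hQ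
      refine ⟨H.coeff S o x z • u, Submodule.smul_mem _ _ h1,
        Submodule.smul_mem _ _ (levelLE_mono hzQ h2), ?_, by rw [map_smul, h4, smul_zero]⟩
      have : Finsupp.single z (H.coeff S o x z) - H.boundary S o (H.coeff S o x z • u) =
          H.coeff S o x z • (Finsupp.single z 1 - H.boundary S o u) := by
        rw [map_smul, smul_sub, Finsupp.smul_single, smul_eq_mul, mul_one]
      rw [this]
      exact Submodule.smul_mem _ _ h3
    · exact ⟨0, Submodule.zero_mem _, Submodule.zero_mem _,
        by simpa using single_mem_remaining hn, map_zero _⟩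
  choose u h1 h2 h3 h4 using hz
  refine ⟨(ε : ℤ) • (Finsupp.single x 1 - ∑ z, u z),
    Submodule.smul_mem _ _ (Submodule.sub_mem _ (single_mem_remaining hx.not_isNeg)
      (Submodule.sum_mem _ fun z _ => h1 z)),
    Submodule.smul_mem _ _ (Submodule.sub_mem _ (Finsupp.single_mem_supported ℤ 1 hle.le)
      (Submodule.sum_mem _ fun z _ => h2 z)), ?_, ?_⟩
  · have h5 : H.boundary S o (Finsupp.single x 1) = (ε : ℤ) • Finsupp.single y 1 +
        ∑ z, Finsupp.single z (if z = y then 0 else H.coeff S o x z) := by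
      rw [Grid.boundary_single, ← Finset.add_sum_erase _ _ (Finset.mem_univ y), hε,
        ← Finset.add_sum_erase (Finset.univ : Finset (H.Gen m)) (fun z => Finsupp.single z
          (if z = y then 0 else H.coeff S o x z)) (Finset.mem_univ y)]
      simp only [if_true, Finsupp.single_zero, zero_add, Finsupp.smul_single, smul_eq_mul, mul_one]
      congr 1
      exact Finset.sum_congr rfl fun z hz => by rw [if_neg (Finset.ne_of_mem_erase hz)]
    have h6 : (ε : ℤ) * ε = 1 := by rw [← Units.val_mul, ← sq, Int.units_sq, Units.val_one]
    have h7 : Finsupp.single y 1 - H.boundary S o ((ε : ℤ) • (Finsupp.single x 1 - ∑ z, u z)) =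
        (-ε : ℤ) • ∑ z, (Finsupp.single z (if z = y then 0 else H.coeff S o x z) -
          H.boundary S o (u z)) := by
      rw [map_smul, map_sub, h5, map_sum, Finset.sum_sub_distrib, smul_sub, smul_add, smul_smul, h6,
        one_smul, neg_smul, smul_sub]
      abel
    rw [h7]
    exact Submodule.smul_mem _ _ (Submodule.sum_mem _ fun z _ => h3 z)
  · rw [map_smul, map_sub, hx.stabMap_eq_zero S o h, map_sum, Finset.sum_eq_zero fun z _ => h4 z,
      sub_zero, smul_zero]

theorem exists_section (h : IsStabilization G H ρ c) (hQ : IsQFunction H ρ c Q) {k : ℤ}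
    {c' : G.Chain m × G.Chain m}
    (hc : c' ∈ (levelLE G (Q ∘ h.lift) k).prod (levelLE G (Q ∘ h.lift) k)) :
    ∃ x ∈ remaining m H ρ c, x ∈ levelLE H Q k ∧ h.stabMap S o x = c' := by
  choose ε hε using stabMap_thinLift S o h
  refine ⟨∑ g, ((ε g * c'.1 g : ℤ) • Finsupp.single (h.thinLift g) 1 +
    c'.2 g • Finsupp.single (h.lift g) 1), Submodule.sum_mem _ fun g _ => Submodule.add_mem _
      (Submodule.smul_mem _ _ (single_mem_remaining (not_isNeg_thinLift h g)))
      (Submodule.smul_mem _ _ (single_mem_remaining (not_isNeg_lift h g))),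
    Submodule.sum_mem _ fun g _ => Submodule.add_mem _ ?_ ?_, ?_⟩
  · by_cases hg : c'.1 g = 0
    · simp [hg]
    · exact Submodule.smul_mem _ _ (Finsupp.single_mem_supported ℤ 1 ((level_thinLift h hQ g).trans_le
        (hc.1 (Finsupp.mem_support_iff.2 hg))))
  · by_cases hg : c'.2 g = 0
    · simp [hg]
    · exact Submodule.smul_mem _ _ (Finsupp.single_mem_supported ℤ 1
        (hc.2 (Finsupp.mem_support_iff.2 hg)))
  · have h6 : ∀ g, (ε g * c'.1 g : ℤ) * ε g = c'.1 g := fun g => by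
      have : ((ε g : ℤˣ) : ℤ) * ε g = 1 := by rw [← Units.val_mul, ← sq, Int.units_sq, Units.val_one]
      linear_combination c'.1 g * this
    have h7 : ∀ g, h.stabMap S o ((ε g * c'.1 g : ℤ) • Finsupp.single (h.thinLift g) 1 +
        c'.2 g • Finsupp.single (h.lift g) 1) =
        (Finsupp.single g (c'.1 g), Finsupp.single g (c'.2 g)) := fun g => by
      rw [map_add, map_smul, map_smul, hε, stabMap_lift]
      simp [h6]
    rw [map_sum, Finset.sum_congr rfl fun g _ => h7 g]
    refine Prod.ext ?_ ?_
    · rw [Prod.fst_sum]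
      exact Finsupp.univ_sum_single _
    · rw [Prod.snd_sum]
      exact Finsupp.univ_sum_single _

theorem exists_reduction (h : IsStabilization G H ρ c) (hQ : IsQFunction H ρ c Q) (k : ℤ)
    (v : H.Chain m) (hv : v ∈ levelLE H Q k) (c' : G.Chain m × G.Chain m)
    (hc : c' ∈ (levelLE G (Q ∘ h.lift) k).prod (levelLE G (Q ∘ h.lift) k))
    (hd : ∀ w ∈ levelLE H Q k, H.boundary S o w ∈ levelLE H Q k) :
    ∃ x ∈ remaining m H ρ c, x ∈ levelLE H Q k ∧ v - H.boundary S o x ∈ remaining m H ρ c ∧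
      h.stabMap S o x = c' := by
  obtain ⟨x, hx, hxk, hF⟩ := exists_section S o h hQ hc
  choose u h1 h2 h3 h4 using exists_reduction_single S o h hQ
  have hw : v - H.boundary S o x ∈ levelLE H Q k := Submodule.sub_mem _ hv (hd x hxk)
  set w := v - H.boundary S o x with hwdef
  refine ⟨x + ∑ y, w y • u y, Submodule.add_mem _ hx (Submodule.sum_mem _ fun y _ =>
    Submodule.smul_mem _ _ (h1 y)), Submodule.add_mem _ hxk (Submodule.sum_mem _ fun y _ => ?_), ?_, ?_⟩
  · by_cases hy : w y = 0
    · simp [hy]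
    · exact Submodule.smul_mem _ _ (levelLE_mono (hw (Finsupp.mem_support_iff.2 hy)) (h2 y))
  · have : v - H.boundary S o (x + ∑ y, w y • u y) =
        ∑ y, w y • (Finsupp.single y 1 - H.boundary S o (u y)) := by
      rw [map_add, ← sub_sub, ← hwdef, map_sum]
      conv_lhs => rw [← Finsupp.univ_sum_single w]
      rw [← Finset.sum_sub_distrib]
      refine Finset.sum_congr rfl fun y _ => ?_
      rw [map_smul, smul_sub, Finsupp.smul_single, smul_eq_mul, mul_one, Finsupp.univ_sum_single]
    rw [this]
    exact Submodule.sum_mem _ fun y _ => Submodule.smul_mem _ _ (h3 y)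
  · rw [map_add, hF, map_sum, Finset.sum_eq_zero fun y _ => by rw [map_smul, h4, smul_zero], add_zero]

theorem boundary_apply (v : H.Chain m) (y : H.Gen m) :
    H.boundary S o v y = ∑ x, v x * H.coeff S o x y := by
  conv_lhs => rw [← Finsupp.univ_sum_single v]
  rw [map_sum, Finsupp.finsetSum_apply]
  refine Finset.sum_congr rfl fun x _ => ?_
  have : Finsupp.single x (v x) = v x • Finsupp.single x (1 : ℤ) := by simp
  rw [this, map_smul, Grid.boundary_single, Finsupp.smul_apply, Finsupp.finsetSum_apply,
    Finset.sum_eq_single y]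
  · simp
  · exact fun z _ hz => Finsupp.single_eq_of_ne hz.symm
  · simp

theorem eq_zero_of_stabMap (h : IsStabilization G H ρ c) (hQ : IsQFunction H ρ c Q) (v : H.Chain m)
    (hv : v ∈ remaining m H ρ c) (hdv : H.boundary S o v ∈ remaining m H ρ c)
    (hF : h.stabMap S o v = 0) : v = 0 := by
  classical
  choose ε hε using stabMap_thinLift S o h
  have hI : ∀ g, v (h.lift g) = 0 := fun g => by
    have := eq_on_remaining (f := Finsupp.lapply g ∘ₗ LinearMap.snd ℤ _ _ ∘ₗ h.stabMap S o)
      (g := Finsupp.lapply (h.lift g)) (fun x hx => ?_) hv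
    · simpa [hF] using this.symm
    · simp only [LinearMap.comp_apply, Finsupp.lapply_apply, LinearMap.snd_apply]
      rcases isPos_or_lift_or_thinLift h hx with hx | ⟨g', rfl⟩ | ⟨g', rfl⟩
      · rw [hx.stabMap_eq_zero S o h, Finsupp.single_eq_of_ne]
        · rfl
        · exact fun e => (stateI_lift h g).not_free _ (e ▸ hx.1)
      · rw [stabMap_lift, Finsupp.single_apply, Finsupp.single_apply, (lift_injective h).eq_iff]
      · rw [hε, Finsupp.single_eq_of_ne]
        · rfl
        · exact fun e => (stateI_lift h g).not_stateJ (e ▸ (thinPolygon_thinLift h g').start)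
  have hJ : ∀ g, v (h.thinLift g) = 0 := fun g => by
    have := eq_on_remaining (f := Finsupp.lapply g ∘ₗ LinearMap.fst ℤ _ _ ∘ₗ h.stabMap S o)
      (g := (ε g : ℤ) • Finsupp.lapply (h.thinLift g)) (fun x hx => ?_) hv
    · simpa [hF] using this.symm
    · simp only [LinearMap.comp_apply, Finsupp.lapply_apply, LinearMap.fst_apply, LinearMap.smul_apply]
      rcases isPos_or_lift_or_thinLift h hx with hx | ⟨g', rfl⟩ | ⟨g', rfl⟩
      · rw [hx.stabMap_eq_zero S o h, Finsupp.single_eq_of_ne]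
        · simp
        · exact fun e => (thinPolygon_thinLift h g).start.not_free _ (e ▸ hx.1)
      · rw [stabMap_lift, Finsupp.single_eq_of_ne]
        · simp
        · exact fun e => (stateI_lift h g').not_stateJ (e ▸ (thinPolygon_thinLift h g).start)
      · rw [hε, Finsupp.single_apply, Finsupp.single_apply, (thinLift_injective h).eq_iff]
        split_ifs with e
        · rw [e]; simp
        · simp
  by_contra hne
  obtain ⟨x, hx, hmax⟩ := Finset.exists_max_image v.support (rank ρ c Q)
    (Finsupp.support_nonempty_iff.2 hne)
  have hpos : ∀ z ∈ v.support, IsPos ρ c z.1 := fun z hz => by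
    rcases isPos_or_lift_or_thinLift h (hv hz) with h1 | ⟨g, rfl⟩ | ⟨g, rfl⟩
    · exact h1
    · exact absurd (hI g) (Finsupp.mem_support_iff.1 hz)
    · exact absurd (hJ g) (Finsupp.mem_support_iff.1 hz)
  have hxp := hpos x hx
  set y := H.toGen (thinSwap ρ c x.1) (isGen_exchange h x.2 hxp.1) with hy
  have hyx : y.1 = thinSwap ρ c x.1 := rfl
  have hyn : IsNeg ρ c y.1 := isNeg_thinSwap hxp
  obtain ⟨δ, hδ⟩ := coeff_thinSwap h S o hxp hyx
  have h0 : H.boundary S o v y = 0 := by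
    by_contra h1
    exact hdv (Finsupp.mem_support_iff.2 h1) hyn
  rw [boundary_apply, Finset.sum_eq_single x, hδ] at h0
  · exact (mul_ne_zero (Finsupp.mem_support_iff.1 hx) δ.ne_zero) h0
  · intro z _ hzx
    by_contra h1
    have hz : z ∈ v.support := Finsupp.mem_support_iff.2 (left_ne_zero_of_mul h1)
    have h2 := rank_lt_of_coeff S o h hQ (hpos z hz) hyn (right_ne_zero_of_mul h1) fun e => hzx (by
      have h3 := congrArg (thinSwap ρ c) (hyx.symm.trans e)
      rw [thinSwap_thinSwap hxp.1, thinSwap_thinSwap (hpos z hz).1] at h3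
      exact Subtype.ext h3.symm)
    rw [rank_thinSwap h hQ hxp hyx] at h2
    exact h2.not_ge (hmax z hz)
  · simp

end Elimination

section Gradings

theorem map_mem_of_supported {X M : Type} [AddCommGroup M] {s : Set X} {V : Submodule ℤ M}
    {f : (X →₀ ℤ) →ₗ[ℤ] M} (hf : ∀ x ∈ s, f (Finsupp.single x 1) ∈ V) {v : X →₀ ℤ}
    (hv : v ∈ Finsupp.supported ℤ ℤ s) : f v ∈ V := by
  rw [Finsupp.supported_eq_span_single] at hv
  have : Submodule.span ℤ ((fun x => Finsupp.single x (1 : ℤ)) '' s) ≤ V.comap f := by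
    rw [Submodule.span_le]
    rintro _ ⟨x, hx, rfl⟩
    exact hf x hx
  exact this hv

theorem sum_single_mem_supported {X : Type} [Fintype X] {s : Set X} {f : X → ℤ}
    (hf : ∀ y, f y ≠ 0 → y ∈ s) : ∑ y, Finsupp.single y (f y) ∈ Finsupp.supported ℤ ℤ s :=
  Submodule.sum_mem _ fun y _ => by
    by_cases hy : f y = 0
    · simp [hy]
    · exact Finsupp.single_mem_supported ℤ _ (hf y hy)

/-- A map that takes the part of grading `a` to the part of grading `b`, and the other generators to
other parts, commutes with the projections. -/
theorem map_filter {X Y : Type} (f : (X →₀ ℤ) →ₗ[ℤ] Y →₀ ℤ) (p : X → Prop) (q : Y → Prop)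
    [DecidablePred p] [DecidablePred q]
    (h1 : ∀ x, p x → f (Finsupp.single x 1) ∈ Finsupp.supported ℤ ℤ {y | q y})
    (h2 : ∀ x, ¬ p x → f (Finsupp.single x 1) ∈ Finsupp.supported ℤ ℤ {y | ¬ q y}) (v : X →₀ ℤ) :
    f (v.filter p) = (f v).filter q := by
  induction v using Finsupp.induction_linear with
  | zero => rw [Finsupp.filter_zero, map_zero, Finsupp.filter_zero]
  | add v w hv hw => rw [Finsupp.filter_add, map_add, map_add, Finsupp.filter_add, hv, hw]
  | single x a =>
    have e : Finsupp.single x a = a • Finsupp.single x (1 : ℤ) := by simp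
    rw [e, Finsupp.filter_smul, map_smul, map_smul, Finsupp.filter_smul]
    congr 1
    by_cases hx : p x
    · rw [Finsupp.filter_single_of_pos _ hx, (Finsupp.filter_eq_self_iff _ _).2]
      exact fun y hy => h1 x hx (Finsupp.mem_support_iff.2 hy)
    · rw [Finsupp.filter_single_of_neg _ hx, map_zero, (Finsupp.filter_eq_zero_iff _ _).2]
      exact fun y hy => by_contra fun h0 => h2 x hx (Finsupp.mem_support_iff.2 h0) hy

variable [NeZero m]
theorem boundary_single_mem (h : IsStabilization G H ρ c) {s : Set (H.Gen m)} {x : H.Gen m}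
    (hs : ∀ y, Drops H ρ c x y 0 → y ∈ s) :
    H.boundary S o (Finsupp.single x 1) ∈ Finsupp.supported ℤ ℤ s := by
  rw [Grid.boundary_single]
  exact sum_single_mem_supported fun y hy => hs y (coeff_drops S o h hy)

theorem boundary_single_mem_of_lift (h : IsStabilization G H ρ c)
    {S : SignAssignment (Curve n m) (Curve n m)} {o : Orientation n m} {s : Set (G.Gen m)} {g : G.Gen m}
    (hs : ∀ g', Drops H ρ c (h.lift g) (h.lift g') 0 → g' ∈ s) :
    G.boundary S o (Finsupp.single g 1) ∈ Finsupp.supported ℤ ℤ s := by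
  rw [Grid.boundary_single]
  exact sum_single_mem_supported fun y hy => hs y (coeff_drops_lift h hy)

theorem stabMap_single_mem (h : IsStabilization G H ρ c) {s s' : Set (G.Gen m)} {x : H.Gen m}
    (hs : ∀ g, Drops H ρ c x (h.lift g) 1 → g ∈ s) (hs' : ∀ g, Drops H ρ c x (h.lift g) 0 → g ∈ s') :
    (h.stabMap S o (Finsupp.single x 1)).1 ∈ Finsupp.supported ℤ ℤ s ∧
      (h.stabMap S o (Finsupp.single x 1)).2 ∈ Finsupp.supported ℤ ℤ s' := by
  rw [IsStabilization.stabMap, Finsupp.linearCombination_single, one_smul]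
  exact ⟨sum_single_mem_supported fun g hg => hs g (coeffR_drops S o h hg),
    sum_single_mem_supported fun g hg => hs' g (coeffL_drops S o h hg)⟩

theorem Drops.alexander_lift (h : IsStabilization G H ρ c) {x : H.Gen m} {g : G.Gen m} {d : ℤ}
    (hd : Drops H ρ c x (h.lift g) d) : G.alexander g = H.alexander x + 1 - d := by
  rw [hd.alexander h, h.alexander_lift]
  ring

theorem Drops.alexander_lift_lift (h : IsStabilization G H ρ c) {g g' : G.Gen m}
    (hd : Drops H ρ c (h.lift g) (h.lift g') 0) : G.alexander g' = G.alexander g := by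
  rw [hd.alexander_lift h, h.alexander_lift g]
  simp

theorem boundary_mem_degreePart (h : IsStabilization G H ρ c) (a : ℚ) (v : H.Chain m)
    (hv : v ∈ degreePart H a) : H.boundary S o v ∈ degreePart H a :=
  map_mem_of_supported (fun x (hx : H.alexander x = a) => boundary_single_mem S o h fun y hy => by
    have := hy.alexander h
    simp only [Int.cast_zero, add_zero] at this
    exact this.symm.trans hx) hv

theorem boundary_mem_degreePart_of_lift (h : IsStabilization G H ρ c)
    {S : SignAssignment (Curve n m) (Curve n m)} {o : Orientation n m} (a : ℚ) (v : G.Chain m)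
    (hv : v ∈ degreePart G a) : G.boundary S o v ∈ degreePart G a :=
  map_mem_of_supported (fun _ hx => boundary_single_mem_of_lift h fun _ hy =>
    (hy.alexander_lift_lift h).trans hx) hv

theorem stabMap_mem_degreePart (h : IsStabilization G H ρ c) (a : ℚ) (v : H.Chain m)
    (hv : v ∈ degreePart H a) :
    (h.stabMap S o v).1 ∈ degreePart G a ∧ (h.stabMap S o v).2 ∈ degreePart G (a + 1) :=
  map_mem_of_supported (V := (degreePart G a).prod (degreePart G (a + 1)))
    (fun x (hx : H.alexander x = a) => stabMap_single_mem S o h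
      (fun g hg => show G.alexander g = a by rw [hg.alexander_lift h, hx]; simp)
      fun g hg => show G.alexander g = a + 1 by rw [hg.alexander_lift h, hx]; simp) hv

theorem exists_homogeneous_cycle (h : IsStabilization G H ρ c) (a : ℚ) (v : H.Chain m)
    (hv : H.boundary S o v = 0) (h1 : (h.stabMap S o v).1 ∈ degreePart G a)
    (h2 : (h.stabMap S o v).2 ∈ degreePart G (a + 1)) :
    ∃ v' ∈ degreePart H a, H.boundary S o v' = 0 ∧ h.stabMap S o v' = h.stabMap S o v := by
  classical
  refine ⟨v.filter fun x => H.alexander x = a, fun x hx => ?_, ?_, Prod.ext ?_ ?_⟩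
  · rw [Finset.mem_coe, Finsupp.support_filter, Finset.mem_filter] at hx
    exact hx.2
  · rw [map_filter (H.boundary S o) _ fun x => H.alexander x = a, hv, Finsupp.filter_zero]
    · exact fun x hx => boundary_mem_degreePart S o h a _ (Finsupp.single_mem_supported ℤ _ hx)
    · exact fun x hx => boundary_single_mem S o h fun y hy hya => hx (by rw [hy.alexander h, hya]; simp)
  · have := map_filter (LinearMap.fst ℤ _ _ ∘ₗ h.stabMap S o) (fun x => H.alexander x = a)
      (fun g => G.alexander g = a) (fun x hx => (stabMap_mem_degreePart S o h a _
        (Finsupp.single_mem_supported ℤ _ hx)).1) (fun x hx => (stabMap_single_mem S o h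
          (s := {g | ¬ G.alexander g = a}) (s' := Set.univ) (fun g hg (hga : _ = a) => hx (by
            rw [hg.alexander_lift h] at hga
            simpa using hga)) fun _ _ => trivial).1) v
    refine this.trans ((Finsupp.filter_eq_self_iff _ _).2 fun g hg => ?_)
    exact h1 (Finsupp.mem_support_iff.2 hg)
  · have := map_filter (LinearMap.snd ℤ _ _ ∘ₗ h.stabMap S o) (fun x => H.alexander x = a)
      (fun g => G.alexander g = a + 1) (fun x hx => (stabMap_mem_degreePart S o h a _
        (Finsupp.single_mem_supported ℤ _ hx)).2) (fun x hx => (stabMap_single_mem S o h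
          (s := Set.univ) (s' := {g | ¬ G.alexander g = a + 1}) (fun _ _ => trivial)
          fun g hg (hga : _ = a + 1) => hx (by
            rw [hg.alexander_lift h] at hga
            simpa using hga)).2) v
    refine this.trans ((Finsupp.filter_eq_self_iff _ _).2 fun g hg => ?_)
    exact h2 (Finsupp.mem_support_iff.2 hg)

variable {Q : H.Gen m → ℤ}

theorem boundary_mem_levelLE (h : IsStabilization G H ρ c) (hQ : IsQFunction H ρ c Q) :
    IsFiltered (levelLE H Q) (levelLE H Q) (H.boundary S o) := fun _ _ hv =>
  map_mem_of_supported (fun _ hx => boundary_single_mem S o h fun _ hy => (hy.le hQ).trans hx) hv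

theorem boundary_mem_levelLE_of_lift (h : IsStabilization G H ρ c) (hQ : IsQFunction H ρ c Q)
    {S : SignAssignment (Curve n m) (Curve n m)} {o : Orientation n m} (k : ℤ) (v : G.Chain m)
    (hv : v ∈ levelLE G (Q ∘ h.lift) k) : G.boundary S o v ∈ levelLE G (Q ∘ h.lift) k :=
  map_mem_of_supported (fun _ hx => boundary_single_mem_of_lift h fun _ hy => (hy.le hQ).trans hx) hv

theorem stabMap_mem_levelLE (h : IsStabilization G H ρ c) (hQ : IsQFunction H ρ c Q) :
    IsFiltered (levelLE H Q) (fun k => (levelLE G (Q ∘ h.lift) k).prod (levelLE G (Q ∘ h.lift) k))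
      (h.stabMap S o) := fun k _ hv =>
  map_mem_of_supported (V := (levelLE G (Q ∘ h.lift) k).prod (levelLE G (Q ∘ h.lift) k))
    (fun _ hx => stabMap_single_mem S o h (fun _ hg => (hg.le hQ).trans hx)
      fun _ hg => (hg.le hQ).trans hx) hv

theorem stabMap_cancels (h : IsStabilization G H ρ c) :
    Cancels (H.boundary S o) (h.stabMap S o) (remaining m H ρ c) := by
  obtain ⟨Q, hQ⟩ := exists_isQFunction (m := m) h
  refine ⟨fun v c' => ?_, eq_zero_of_stabMap S o h hQ⟩
  obtain ⟨k, hk⟩ := (Set.finite_range Q).bddAbove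
  have hk' : ∀ x, Q x ≤ k := fun x => hk ⟨x, rfl⟩
  obtain ⟨x, h1, -, h2⟩ := exists_reduction S o h hQ k v (fun x _ => hk' x) c'
    ⟨fun g _ => hk' _, fun g _ => hk' _⟩ (boundary_mem_levelLE S o h hQ k)
  exact ⟨x, h1, h2⟩

end Gradings

end GridCover

end

theorem mainTheorem4 {n m : ℕ} [NeZero m] (G : GridCover.Grid n) (H : GridCover.Grid (n + 1))
    (ρ : Fin n) (c : Fin (n + 1)) (h : GridCover.IsStabilization G H ρ c)
    (S : GridCover.SignAssignment (GridCover.Curve (n + 1) m) (GridCover.Curve (n + 1) m))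
    (o : GridCover.Orientation (n + 1) m)
    (dH : H.Chain m →ₗ[ℤ] H.Chain m) (hdH : dH = H.boundary S o)
    (dG : G.Chain m →ₗ[ℤ] G.Chain m)
    (hdG : dG = G.boundary (GridCover.signG H ρ c S o) (GridCover.orientationG ρ c o))
    (d' : G.Chain m × G.Chain m →ₗ[ℤ] G.Chain m × G.Chain m) (hd' : d' = (-dG).prodMap dG)
    (F : H.Chain m →ₗ[ℤ] G.Chain m × G.Chain m) (hF : F = h.stabMap S o) :
    -- the boundary operators are differentials and preserve the Alexander grading
    (dH ∘ₗ dH = 0 ∧ dG ∘ₗ dG = 0 ∧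
      (∀ a, ∀ v ∈ GridCover.degreePart H a, dH v ∈ GridCover.degreePart H a) ∧
      (∀ a, ∀ v ∈ GridCover.degreePart G a, dG v ∈ GridCover.degreePart G a)) ∧
    -- `F` is a chain map, homogeneous for the Alexander gradings
    (d' ∘ₗ F = F ∘ₗ dH ∧
      ∀ a, ∀ v ∈ GridCover.degreePart H a,
        (F v).1 ∈ GridCover.degreePart G a ∧ (F v).2 ∈ GridCover.degreePart G (a + 1)) ∧
    -- the filtration exists; `F` is filtered and a quasi-isomorphism of associated graded complexes
    (∃ Q : H.Gen m → ℤ, GridCover.IsQFunction H ρ c Q) ∧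
    (∀ Q : H.Gen m → ℤ, GridCover.IsQFunction H ρ c Q →
      ∀ (Fil : ℤ → Submodule ℤ (H.Chain m)) (Fil' : ℤ → Submodule ℤ (G.Chain m × G.Chain m)),
        Fil = GridCover.levelLE H Q →
        (Fil' = fun k => (GridCover.levelLE G (Q ∘ h.lift) k).prod
          (GridCover.levelLE G (Q ∘ h.lift) k)) →
        ∃ (fH : GridCover.IsFiltered Fil Fil dH) (f' : GridCover.IsFiltered Fil' Fil' d')
          (fF : GridCover.IsFiltered Fil Fil' F),
          ∀ k, GridCover.IsQuasiIso (GridCover.grMap fH k) (GridCover.grMap f' k)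
            (GridCover.grMap fF k)) ∧
    -- `F` is a quasi-isomorphism
    GridCover.IsQuasiIso dH d' F ∧
    -- the homology of the stabilized diagram, as a graded group
    (∃ Φ : GridCover.Homology dH ≃ₗ[ℤ] GridCover.Homology dG ⊗[ℤ] (ℤ × ℤ),
      ∀ a : ℚ,
        (GridCover.homologyPart dH (GridCover.degreePart H a)).map Φ.toLinearMap =
          (GridCover.homologyPart dG (GridCover.degreePart G a)).map
              ((TensorProduct.mk ℤ (GridCover.Homology dG) (ℤ × ℤ)).flip (1, 0)) ⊔
            (GridCover.homologyPart dG (GridCover.degreePart G (a + 1))).map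
              ((TensorProduct.mk ℤ (GridCover.Homology dG) (ℤ × ℤ)).flip (0, 1))) := by
  subst hdH hdG hd' hF
  have hd := GridCover.Grid.boundary_comp_boundary (D := H) S o
  have hdG := GridCover.Grid.boundary_comp_boundary (D := G) (GridCover.signG H ρ c S o)
    (GridCover.orientationG ρ c o)
  have hC := GridCover.stabMap_cancels S o h
  have hF := hC.chainMap hd fun x hx => GridCover.stabMap_comm S o h hx
  refine ⟨⟨hd, hdG, GridCover.boundary_mem_degreePart S o h,
    GridCover.boundary_mem_degreePart_of_lift h⟩, ⟨hF, GridCover.stabMap_mem_degreePart S o h⟩,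
    GridCover.exists_isQFunction h, ?_, hC.isQuasiIso hd hF, ?_⟩
  · rintro Q hQ _ _ rfl rfl
    exact ⟨GridCover.boundary_mem_levelLE S o h hQ, fun k v hv =>
      ⟨neg_mem (GridCover.boundary_mem_levelLE_of_lift h hQ k _ hv.1),
        GridCover.boundary_mem_levelLE_of_lift h hQ k _ hv.2⟩,
      GridCover.stabMap_mem_levelLE S o h hQ,
      GridCover.isQuasiIso_grMap hd hF (fun k v hv c' hc => GridCover.exists_reduction S o h hQ k v hv c' hc
        (GridCover.boundary_mem_levelLE S o h hQ k)) (GridCover.eq_zero_of_stabMap S o h hQ) _ _ _⟩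
  · obtain ⟨Φ, hΦ⟩ := GridCover.exists_splitting hC hd hF
    exact ⟨Φ, fun a => hΦ _ _ _ (GridCover.stabMap_mem_degreePart S o h a)
      (GridCover.exists_homogeneous_cycle S o h a)⟩
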